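/- Fix $w\in\mathbb Z$. \textbf{Tuples.} Consider tuples $(H^\infty,H^\infty_{\mathbb R},M,F^\bullet,S,w)$ where $H^\infty$ is a finite dimensional complex vector space with real structure $H^\infty_{\mathbb R}$, $M$ is an automorphism of $H^\infty_{\mathbb R}$ with decomposition $M=M_sM_u$ into commuting semisimple and unipotent parts, $N=\log M_u$; $F^\bullet$ is a finite exhaustive decreasing filtration of $H^\infty$ with $M_sF^p\subset F^p$ and $NF^p\subset F^{p-1}$; and $S$ is a nondegenerate $M$-invariant bilinear form on $H^\infty$, real on $H^\infty_{\mathbb R}$, $(-1)^{w-1}$-symmetric on $H^\infty_{\arg\ne0}$ and $(-1)^w$-symmetric on $H^\infty_{\arg=0}$. Here $H^\infty_\lambda$ is the generalized $\lambda$-eigenspace of $M$ and $H^\infty_{\arg=0}$, $H^\infty_{\arg\neq 0}$ are the sums of the $H^\infty_\lambda$ with $\arg\lambda=0$, resp. $\arg\lambda\ne0$. Let $G$ be the automorphism of $H^\infty$ given on $H^\infty_{e^{-2\pi i\alpha}}$, $\Re\alpha\in(0,1]$, by $\Gamma(\alpha\,\mathrm{Id}-\frac{N}{2\pi i})=\sum_k\frac1{k!}\Gamma^{(k)}(\alpha)(\frac{-N}{2\pi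 i})^k$, and $\widetilde F^\bullet=G^{-1}F^\bullet$. The tuple \emph{induces PMHS} if $(H^\infty_{\arg\ne0},H^\infty_{\mathbb R,\arg\neq0},-N,\widetilde F^\bullet,S)$ and $(H^\infty_{\arg=0},H^\infty_{\mathbb R,\arg=0},-N,\widetilde F^\bullet,S)$ are polarized mixed Hodge structures of weights $w-1$ and $w$. (A PMHS of weight $w'$ is a tuple $(H,H_{\mathbb R},N',F^\bullet,S)$ with $S$ nondegenerate, real, $(-1)^{w'}$-symmetric, $N'$ real, nilpotent, an infinitesimal isometry of $S$, with $N'F^p\subset F^{p-1}$ and $S(F^p,F^{w'+1-p})=0$, such that, for the weight filtration $W_\bullet$ of $N'$ centered at $w'$, $F^\bullet$ induces a pure Hodge structure of weight $k$ on each $Gr^W_k$, and $i^{p-(w'+l-p)}S(a,N'^l\overline a)>0$ for each nonzero class $a$ in $F^p\cap\overline{F^{w'+l-p}}$ of the primitive part $\ker(N'^{l+1}:Gr^W_{w'+l}\to Gr^W_{w'-l-2})$, $l\ge0$.) \textbf{Twistors.} Let $\sigma(z)=-1/\overline z$ on $\mathbb P^1$. Consider tuples $(\widehat H,H'_{\mathbb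 R},\widehat W_\bullet,\widehat N,\widehat S,\nabla)$ where $\widehat H$ is a holomorphic vector bundle on $\mathbb P^1$, $\nabla$ is a meromorphic connection on it with poles at most at $0,\infty$, of order at most two, $H'_{\mathbb R}$ is a flat real subbundle of $\widehat H|_{\mathbb C^*}$ with $H'_{\mathbb R}\otimes\mathbb C=\widehat H|_{\mathbb C^*}$, and $\widehat S:\widehat H_z\times\widehat H_{\sigma(z)}\to\mathbb C$ is a flat, nondegenerate, sesquilinear, hermitian-symmetric pairing, holomorphic as a morphism $\mathcal O(\widehat H)\otimes\sigma^*\mathcal O(\widehat H)\to\mathcal O_{\mathbb P^1}$, with $\widehat S(a,b)\in i^w\mathbb R$ for $a\in(H'_{\mathbb R})_z$, $b\in(H'_{\mathbb R})_{\sigma(z)}$, $z\in\mathbb C^*$. Let $H^\infty$ be the space of multivalued flat sections $A(\zeta)$ ($z=e^{2\pi i\zeta}$) on $\mathbb C^*$, $H^\infty_{\mathbb R}$ the space of the real ones, $M$ the monodromy, $(MA)(\zeta)=A(\zeta+1)$, and $N=\log M_u$. For $A\in H^\infty_{e^{-2\pi i\alpha}}$ let $es(A,\alpha)=e^{(2\pi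 i\alpha-N)\zeta}A(\zeta)$. Such a tuple is an \emph{integrable polarized mixed twistor structure (PMTS) with flat real structure on $\mathbb C^*$, generated by elementary sections} if: \begin{itemize} \item $\widehat W_\bullet$ and $\widehat N$ are induced by the monodromy: on $\mathbb C^*$, $\widehat W_k$ is the flat subbundle defined by the weight filtration of $N$ on $H^\infty$ centered at $0$, and $\widehat N$ is the flat endomorphism defined by $N$; \item $(\widehat H,\widehat W_\bullet)$ is a mixed twistor, i.e. $\widehat W_\bullet$ is a filtration by holomorphic subbundles with each $Gr_k^{\widehat W}\widehat H$ isomorphic to a sum of copies of $\mathcal O_{\mathbb P^1}(k)$, and $\widehat N$ is a morphism $\widehat H\to\widehat H\otimes\mathcal O_{\mathbb P^1}(2)$ (i.e. it has at most simple poles at $0$ and $\infty$) mapping $\widehat W_k$ to $\widehat W_{k-2}\otimes\mathcal O_{\mathbb P^1}(2)$; \item $\widehat S$ is a polarization: $\widehat S(\widehat W_k,\sigma^*\widehat W_l)=0$ for $k+l<0$; $\widehat S(\widehat N\cdot,\cdot)+\widehat S(\cdot,\sigma^*\widehat N\,\cdot)=0$; and for $k\ge0$ and $\widehat P_k=\ker(\widehat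 N^{k+1}:Gr_k^{\widehat W}\to Gr_{-k-2}^{\widehat W}\otimes\mathcal O_{\mathbb P^1}(2k+2))$, one has $i^{-k}\widehat S(\widehat N^ka(z),a(\sigma(z)))>0$ on $\mathbb C^*$ for all nonzero global sections $a$ of $\widehat P_k\otimes\mathcal O_{\mathbb P^1}(-k)$, i.e. sections $a$ of $\widehat P_k$ over $\mathbb C$ such that $z^ka$ extends holomorphically to $\infty$; \item there is a finite exhaustive decreasing filtration $F^\bullet$ of $H^\infty$ with $M_sF^p\subset F^p$, $NF^p\subset F^{p-1}$ such that, with $\Re\alpha\in(0,1]$ throughout, $\mathcal O(\widehat H)$ is generated near $0$ by the sections $es(A,\alpha+w-1-p)$, $A\in F^pH^\infty_{e^{-2\pi i\alpha}}$, and near $\infty$ by the sections $es(A,q+\alpha-[\Re\alpha])$, $A\in\overline F^qH^\infty_{e^{-2\pi i\alpha}}$. \end{itemize} \textbf{Lemma.} There is a one to one correspondence between isomorphism classes of tuples $(H^\infty,H^\infty_{\mathbb R},M,F^\bullet,S,w)$ inducing PMHS and isomorphism classes of integrable PMTS $(\widehat H,H'_{\mathbb R},\widehat W_\bullet,\widehat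 N,\widehat S,\nabla)$ with flat real structure on $\mathbb C^*$ generated by elementary sections. A tuple and a twistor correspond to each other iff $(H^\infty,H^\infty_{\mathbb R},M)$ can be identified with the multivalued flat sections of the twistor, with their real structure and monodromy, in such a way that $\mathcal O(\widehat H)$ is generated at $0$ and $\infty$ by the elementary sections belonging to $F^\bullet$ as above, and $S$ and $\widehat S$ are related as follows: with $L(A,B)=(-1)^w\,\widehat S\big(A(\zeta),\overline B(\overline\zeta+\tfrac12)\big)$ (independent of $\zeta$), $$S(a,b)=-(2\pi i)^wL\Big(a,\tfrac1{M-\mathrm{Id}}b\Big)\ \text{ for } b\in H^\infty_{\arg\ne0},$$ $$S(a,b)=(2\pi i)^wL\Big(a,\tfrac{\log\lambda\,\mathrm{Id}+N}{M-\mathrm{Id}}\,b\Big)\ \text{ for } b\in H^\infty_\lambda,\ \arg\lambda=0,$$ where the quotient means $\big(\sum_{k\ge1}\frac1{k!}N^{k-1}\big)^{-1}$ if $\lambda=1$. Moreover, for every tuple inducing PMHS, and for every integrable PMTS as above, all eigenvalues of $M$, resp. of the monodromy, have absolute value one. -/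

import Mathlib

open Filter Topology

universe u v

noncomputable section

namespace PMTS

/-! ## Linear algebra of an automorphism with nilpotent logarithm -/

section LinearAlgebra

variable {V : Type u} [AddCommGroup V] [Module ℂ V]

/-- The value `∑ₖ cₖ Nᵏ` of a power series at a nilpotent endomorphism `N` of a finite
dimensional space (all powers beyond the dimension vanish). -/
def nilSeries (c : ℕ → ℂ) (N : Module.End ℂ V) : Module.End ℂ V :=
  ∑ k ∈ Finset.range (Module.finrank ℂ V + 1), c k • N ^ k

/-- `exp (t N)` for nilpotent `N`. -/
def nilExp (t : ℂ) (N : Module.End ℂ V) : Module.End ℂ V :=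
  nilSeries (fun k => t ^ k / (k.factorial : ℂ)) N

/-- `M = Ms * Mu` with `Ms` semisimple, `Mu = exp N` unipotent and `Ms`, `N` commuting. -/
def IsJordan (M Ms N : Module.End ℂ V) : Prop :=
  Ms.IsSemisimple ∧ IsNilpotent N ∧ Commute Ms N ∧ M = Ms * nilExp 1 N

/-- The semisimple part `M_s` of an automorphism of a finite dimensional space. -/
def semisimplePart (M : Module.End ℂ V) : Module.End ℂ V :=
  Classical.epsilon fun Ms => ∃ N, IsJordan M Ms N

/-- The nilpotent part `N = log M_u` of an automorphism of a finite dimensional space. -/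
def nilpotentPart (M : Module.End ℂ V) : Module.End ℂ V :=
  Classical.epsilon fun N => ∃ Ms, IsJordan M Ms N

/-- `e^{-2πiα}`. -/
def eig (α : ℂ) : ℂ := Complex.exp (-(2 * Real.pi * Complex.I * α))

/-- The generalized eigenspace `H_μ` of `M`. -/
def genEig (M : Module.End ℂ V) (μ : ℂ) : Submodule ℂ V := M.maxGenEigenspace μ

/-- `H_{arg = 0}`, the sum of the generalized eigenspaces with `arg μ = 0`. -/
def argZero (M : Module.End ℂ V) : Submodule ℂ V :=
  ⨆ μ ∈ {μ : ℂ | Complex.arg μ = 0}, genEig M μ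

/-- `H_{arg ≠ 0}`, the sum of the generalized eigenspaces with `arg μ ≠ 0`. -/
def argNeZero (M : Module.End ℂ V) : Submodule ℂ V :=
  ⨆ μ ∈ {μ : ℂ | Complex.arg μ ≠ 0}, genEig M μ

/-- `Re α ∈ (0,1]`. -/
def InStrip (α : ℂ) : Prop := 0 < α.re ∧ α.re ≤ 1

/-- The endomorphism
`G^{(α)} = ∑ₖ Γ^{(k)}(α)/k! (-N/(2πi))ᵏ = Γ(α Id - N/(2πi))`; it is used on `H_{e^{-2πiα}}`. -/
def gammaEnd (M : Module.End ℂ V) (α : ℂ) : Module.End ℂ V :=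
  nilSeries (fun k => iteratedDeriv k Complex.Gamma α / (k.factorial : ℂ)
    * (-1 / (2 * Real.pi * Complex.I)) ^ k) (nilpotentPart M)

/-- The twisted filtration `F̃ᵖ = G⁻¹ Fᵖ`, where `G` is the automorphism which is `G^{(α)}` on
`H_{e^{-2πiα}}` for `Re α ∈ (0,1]`. It is written as the sum over `α` of the parts of `G⁻¹ Fᵖ` in
`H_{e^{-2πiα}}`, which is all of `G⁻¹ Fᵖ` since `F` is invariant under the semisimple part. -/
def twistFil (M : Module.End ℂ V) (F : ℤ → Submodule ℂ V) (p : ℤ) : Submodule ℂ V :=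
  ⨆ α ∈ {α : ℂ | InStrip α}, genEig M (eig α) ⊓ (F p).comap (gammaEnd M α)

/-- A decreasing filtration of a finite dimensional space, which is everything for `p ≪ 0` and
zero for `p ≫ 0`. -/
def IsDecFiltration (F : ℤ → Submodule ℂ V) : Prop :=
  Antitone F ∧ (∃ p, F p = ⊤) ∧ ∃ p, F p = ⊥

/-- The conjugate filtration. -/
def conjFil (conj : V →ₛₗ[starRingEnd ℂ] V) (F : ℤ → Submodule ℂ V) (p : ℤ) : Submodule ℂ V :=
  (F p).comap conj

/-- `W` is the weight filtration of the nilpotent endomorphism `N`, centered at `c`: the (unique)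
finite exhaustive increasing filtration with `N W_l ⊆ W_{l-2}` such that
`Nˡ : Gr_{c+l} → Gr_{c-l}` is an isomorphism for `l ≥ 0`. -/
structure IsWeightFiltration (N : Module.End ℂ V) (c : ℤ) (W : ℤ → Submodule ℂ V) : Prop where
  mono : Monotone W
  exists_bot : ∃ l, W l = ⊥
  exists_top : ∃ l, W l = ⊤
  map_le : ∀ l, (W l).map N ≤ W (l - 2)
  inj : ∀ l : ℕ, ∀ a ∈ W (c + l), (N ^ l) a ∈ W (c - l - 1) → a ∈ W (c + l - 1)
  surj : ∀ l : ℕ, ∀ b ∈ W (c - l), ∃ a ∈ W (c + l), b - (N ^ l) a ∈ W (c - l - 1)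

/-- The preimage in `W_k` of the filtration step `Fᵖ Gr_k = (Fᵖ ∩ W_k + W_{k-1}) / W_{k-1}`. -/
def grFil (W F : ℤ → Submodule ℂ V) (k p : ℤ) : Submodule ℂ V :=
  (F p ⊓ W k) ⊔ W (k - 1)

/-- `(V, V_ℝ, S, N, F)` is a polarized mixed Hodge structure of weight `w`. The real structure
is given by the complex conjugation `conj`. -/
structure IsPMHS (w : ℤ) (conj : V →ₛₗ[starRingEnd ℂ] V) (S : LinearMap.BilinForm ℂ V)
    (N : Module.End ℂ V) (F : ℤ → Submodule ℂ V) : Prop where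
  finite : FiniteDimensional ℂ V
  conj_conj : ∀ a, conj (conj a) = a
  S_nondeg : S.Nondegenerate
  S_symm : ∀ a b, S a b = (-1) ^ w * S b a
  S_real : ∀ a b, S (conj a) (conj b) = starRingEnd ℂ (S a b)
  N_nilp : IsNilpotent N
  N_real : ∀ a, N (conj a) = conj (N a)
  N_isometry : ∀ a b, S (N a) b + S a (N b) = 0
  F_fil : IsDecFiltration F
  N_F : ∀ p, (F p).map N ≤ F (p - 1)
  S_F : ∀ p, ∀ a ∈ F p, ∀ b ∈ F (w + 1 - p), S a b = 0
  /-- For the weight filtration `W` of `N` centered at `w`: `F` induces on `Gr_k` a pure Hodge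
  structure of weight `k`, that is `Fᵖ Gr_k ⊕ conj F^{k+1-p} Gr_k = Gr_k`; and the forms
  `S_l(a,b) = S(a, Nˡ b)` polarize the primitive parts
  `P_{w+l} = ker (N^{l+1} : Gr_{w+l} → Gr_{w-l-2})`. -/
  weight : ∃ W : ℤ → Submodule ℂ V, IsWeightFiltration N w W ∧
    (∀ k p, grFil W F k p ⊔ grFil W (conjFil conj F) k (k + 1 - p) = W k ∧
      grFil W F k p ⊓ grFil W (conjFil conj F) k (k + 1 - p) = W (k - 1)) ∧
    ∀ (l : ℕ) (p : ℤ) (a : V), a ∈ W (w + l) → a ∉ W (w + l - 1) →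
      (N ^ (l + 1)) a ∈ W (w - l - 3) →
      a ∈ grFil W F (w + l) p → a ∈ grFil W (conjFil conj F) (w + l) (w + l - p) →
      ∃ r : ℝ, 0 < r ∧ Complex.I ^ (p - (w + l - p)) * S a ((N ^ l) (conj a)) = r

/-- The subspace `U` is stable under `conj` and `N`, and all data restricted to `U` form a
polarized mixed Hodge structure of weight `w`. -/
def IsPMHSOn (w : ℤ) (conj : V →ₛₗ[starRingEnd ℂ] V) (S : LinearMap.BilinForm ℂ V)
    (N : Module.End ℂ V) (F : ℤ → Submodule ℂ V) (U : Submodule ℂ V) : Prop :=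
  ∃ (c : U →ₛₗ[starRingEnd ℂ] U) (n : Module.End ℂ U),
    (∀ x, (c x : V) = conj x) ∧ (∀ x, (n x : V) = N x) ∧
    IsPMHS w c (S.restrict U) n (fun p => (F p).comap U.subtype)

/-- `F` is a finite exhaustive decreasing filtration, invariant under the semisimple part of `M`,
with `N Fᵖ ⊆ F^{p-1}` for the nilpotent part `N` of `M`. -/
def IsMonodromyFiltration (M : Module.End ℂ V) (F : ℤ → Submodule ℂ V) : Prop :=
  IsDecFiltration F ∧ (∀ p, (F p).map (semisimplePart M) ≤ F p) ∧
    ∀ p, (F p).map (nilpotentPart M) ≤ F (p - 1)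

end LinearAlgebra

/-! ## Tuples `(H^∞, H^∞_ℝ, M, F, S, w)` -/

/-- A tuple `(H^∞, H^∞_ℝ, M, F^•, S, w)`: a finite dimensional complex vector space `V` with a real
structure (the fixed space of `conj`), an automorphism `M` of the real structure, a filtration
`F` and a pairing `S`. -/
structure HodgeTuple (w : ℤ) where
  V : Type u
  [acg : AddCommGroup V]
  [mod : Module ℂ V]
  finite : FiniteDimensional ℂ V
  conj : V →ₛₗ[starRingEnd ℂ] V
  conj_conj : ∀ a, conj (conj a) = a
  M : Module.End ℂ V
  M_bij : Function.Bijective M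
  M_real : ∀ a, M (conj a) = conj (M a)
  F : ℤ → Submodule ℂ V
  F_fil : IsMonodromyFiltration M F
  S : LinearMap.BilinForm ℂ V
  S_nondeg : S.Nondegenerate
  S_M : ∀ a b, S (M a) (M b) = S a b
  S_symm_argNeZero : ∀ a ∈ argNeZero M, ∀ b ∈ argNeZero M, S a b = (-1) ^ (w - 1) * S b a
  S_symm_argZero : ∀ a ∈ argZero M, ∀ b ∈ argZero M, S a b = (-1) ^ w * S b a
  S_real : ∀ a b, S (conj a) (conj b) = starRingEnd ℂ (S a b)

attribute [instance] HodgeTuple.acg HodgeTuple.mod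

namespace HodgeTuple

variable {w : ℤ}

/-- `(-N, F̃, S)` gives polarized mixed Hodge structures of weights `w - 1` and `w` on
`H_{arg ≠ 0}` and `H_{arg = 0}`. -/
def InducesPMHS (D : HodgeTuple.{u} w) : Prop :=
  IsPMHSOn (w - 1) D.conj D.S (-nilpotentPart D.M) (twistFil D.M D.F) (argNeZero D.M) ∧
  IsPMHSOn w D.conj D.S (-nilpotentPart D.M) (twistFil D.M D.F) (argZero D.M)

/-- Isomorphisms of tuples. -/
structure Iso (D D' : HodgeTuple.{u} w) where
  e : D.V ≃ₗ[ℂ] D'.V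
  conj : ∀ a, e (D.conj a) = D'.conj (e a)
  M : ∀ a, e (D.M a) = D'.M (e a)
  F : ∀ p a, e a ∈ D'.F p ↔ a ∈ D.F p
  S : ∀ a b, D'.S (e a) (e b) = D.S a b

def Iso.refl (D : HodgeTuple.{u} w) : Iso D D where
  e := LinearEquiv.refl ℂ D.V
  conj _ := rfl
  M _ := rfl
  F _ _ := Iff.rfl
  S _ _ := rfl

def Iso.symm {D D' : HodgeTuple.{u} w} (f : Iso D D') : Iso D' D where
  e := f.e.symm
  conj a := by apply f.e.injective; simp [f.conj]
  M a := by apply f.e.injective; simp [f.M]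
  F p a := by rw [← f.F]; simp
  S a b := by rw [← f.S]; simp

def Iso.trans {D D' D'' : HodgeTuple.{u} w} (f : Iso D D') (g : Iso D' D'') : Iso D D'' where
  e := f.e.trans g.e
  conj a := by simp [f.conj, g.conj]
  M a := by simp [f.M, g.M]
  F p a := by simp [f.F, g.F]
  S a b := by simp [f.S, g.S]

end HodgeTuple

/-- Tuples inducing polarized mixed Hodge structures. -/
def PMHSTuple (w : ℤ) : Type (u + 1) := {D : HodgeTuple.{u} w // D.InducesPMHS}

/-- Two tuples are equivalent iff they are isomorphic. -/
def pmhsSetoid (w : ℤ) : Setoid (PMHSTuple.{u} w) where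
  r D D' := Nonempty (HodgeTuple.Iso D.1 D'.1)
  iseqv :=
    { refl := fun D => ⟨HodgeTuple.Iso.refl D.1⟩
      symm := fun ⟨f⟩ => ⟨f.symm⟩
      trans := fun ⟨f⟩ ⟨g⟩ => ⟨f.trans g⟩ }

/-! ## The Riemann sphere -/

/-- The Riemann sphere `ℙ¹ = ℂ ∪ {∞}`. -/
abbrev P1 : Type := OnePoint ℂ

/-- The point of `ℙ¹` with coordinate `z⁻¹ = w`. -/
def atInf (w : ℂ) : P1 := if w = 0 then OnePoint.infty else ((w⁻¹ : ℂ) : P1)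

/-- The coordinate function `z` on `ℂ ⊆ ℙ¹` (with an irrelevant value at `∞`). -/
def zc (x : P1) : ℂ := x.elim 0 id

/-- `ℂ^* ⊆ ℙ¹`. -/
def Cstar : Set P1 := {x | x ≠ OnePoint.infty ∧ x ≠ ((0 : ℂ) : P1)}

/-- The function `f` is holomorphic in a neighbourhood of the point `x` of `ℙ¹`. -/
def HolFun (f : P1 → ℂ) (x : P1) : Prop :=
  (∀ z : ℂ, x = (z : P1) → AnalyticAt ℂ (fun u : ℂ => f (u : P1)) z) ∧
  (x = OnePoint.infty → AnalyticAt ℂ (fun u : ℂ => f (atInf u)) 0)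

/-- The antipodal map `σ(z) = -1 / conj z`. -/
def sig (x : P1) : P1 := x.elim ((0 : ℂ) : P1) fun z => atInf (-(starRingEnd ℂ z))

/-- The universal covering `ζ ↦ e^{2πiζ}` of `ℂ^*`. -/
def expP (ζ : ℂ) : P1 := ((Complex.exp (2 * Real.pi * Complex.I * ζ) : ℂ) : P1)

theorem expP_mem (ζ : ℂ) : expP ζ ∈ Cstar := by
  refine ⟨OnePoint.coe_ne_infty _, ?_⟩
  intro h
  exact Complex.exp_ne_zero _ (OnePoint.coe_injective h)

theorem expP_add_one (ζ : ℂ) : expP (ζ + 1) = expP ζ := by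
  unfold expP
  rw [mul_add, mul_one, Complex.exp_periodic]

theorem sig_expP (ζ : ℂ) : sig (expP ζ) = expP (starRingEnd ℂ ζ + 1 / 2) := by
  have h : (-(starRingEnd ℂ (Complex.exp (2 * Real.pi * Complex.I * ζ)))) ≠ 0 := by
    simp
  have hpi : Complex.exp (2 * Real.pi * Complex.I * (1 / 2)) = -1 := by
    rw [show (2 * Real.pi * Complex.I * (1 / 2) : ℂ) = Real.pi * Complex.I by ring,
      Complex.exp_pi_mul_I]
  show atInf _ = _
  unfold atInf expP
  rw [if_neg h, mul_add, Complex.exp_add, hpi, ← Complex.exp_conj, inv_neg, ← Complex.exp_neg]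
  congr 1
  rw [mul_neg_one]
  congr 2
  simp only [map_mul, Complex.conj_I, Complex.conj_ofReal, map_ofNat]
  ring

/-! ## Holomorphic vector bundles on the Riemann sphere -/

/-- A family of complex vector spaces over `ℙ¹` together with a notion of holomorphic section near a
point, i.e. with a presheaf of sections described by its germs. -/
structure HolFam where
  Fib : P1 → Type u
  [acg : ∀ x, AddCommGroup (Fib x)]
  [mod : ∀ x, Module ℂ (Fib x)]
  HolAt : (∀ x, Fib x) → P1 → Prop

attribute [instance] HolFam.acg HolFam.mod

namespace HolFam

/-- `e` is a holomorphic frame over `U`: a section is holomorphic near a point of `U` iff its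
coefficients with respect to the bases `e x` are. -/
def IsFrameOn (E : HolFam.{u}) {r : ℕ} (U : Set P1)
    (e : ∀ x, Module.Basis (Fin r) ℂ (E.Fib x)) : Prop :=
  ∀ s : ∀ x, E.Fib x, ∀ x ∈ U, E.HolAt s x ↔ ∀ i, HolFun (fun y => (e y).repr (s y) i) x

/-- `E` is a holomorphic vector bundle of rank `r` on `ℙ¹`. -/
def IsBundle (E : HolFam.{u}) (r : ℕ) : Prop :=
  ∀ x : P1, ∃ U : Set P1, IsOpen U ∧ x ∈ U ∧
    ∃ e : ∀ y, Module.Basis (Fin r) ℂ (E.Fib y), E.IsFrameOn U e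

/-- The section `s`, considered on a punctured neighbourhood of `x`, extends to a holomorphic
section near `x`. -/
def ExtHolAt (E : HolFam.{u}) (s : ∀ x, E.Fib x) (x : P1) : Prop :=
  ∃ t, E.HolAt t x ∧ ∀ᶠ y in 𝓝[≠] x, t y = s y

/-- Isomorphisms. -/
structure Iso (E : HolFam.{u}) (E' : HolFam.{v}) where
  e : ∀ x, E.Fib x ≃ₗ[ℂ] E'.Fib x
  hol : ∀ s x, E'.HolAt (fun y => e y (s y)) x ↔ E.HolAt s x

/-- The bundle `𝒪(k)^r`, trivialized over `ℂ` and over `ℙ¹ ∖ {0}`, with transition function `z^k`: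
the fibre at `z ∈ ℂ` is described by the first trivialization, the fibre at `∞` by the second, and
`f` in the first one is `z^{-k} f` in the second one. -/
def O (k : ℤ) (r : ℕ) : HolFam.{0} where
  Fib _ := Fin r → ℂ
  HolAt s x :=
    (∀ z : ℂ, x = (z : P1) → ∀ i, AnalyticAt ℂ (fun u : ℂ => s (u : P1) i) z) ∧
    (x = OnePoint.infty → ∀ i, AnalyticAt ℂ
      (fun u : ℂ => if u = 0 then s OnePoint.infty i else u ^ k * s (atInf u) i) 0)

/-- A twistor is pure of weight `k` iff it is isomorphic to a sum of copies of `𝒪(k)`. -/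
def IsPure (E : HolFam.{u}) (k : ℤ) : Prop := ∃ r : ℕ, Nonempty (Iso E (O k r))

/-- A family of subspaces is a holomorphic subbundle: locally it is spanned by a part of a
holomorphic frame. -/
def IsSubbundle (E : HolFam.{u}) (W : ∀ x, Submodule ℂ (E.Fib x)) : Prop :=
  ∀ x : P1, ∃ U : Set P1, IsOpen U ∧ x ∈ U ∧
    ∃ (r : ℕ) (e : ∀ y, Module.Basis (Fin r) ℂ (E.Fib y)) (J : Set (Fin r)), E.IsFrameOn U e ∧
      ∀ y ∈ U, W y = Submodule.span ℂ (e y '' J)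

/-- The quotient `Gr_k = W_k / W_{k-1}`; a section is holomorphic iff it lifts locally to a
holomorphic section of `W_k`. -/
def Gr (E : HolFam.{u}) (W : ℤ → ∀ x, Submodule ℂ (E.Fib x)) (k : ℤ) : HolFam.{u} where
  Fib x := (W k x) ⧸ (W (k - 1) x).comap (W k x).subtype
  HolAt s x := ∃ t : ∀ y, W k y, E.HolAt (fun y => (t y : E.Fib y)) x ∧
    ∀ᶠ y in 𝓝 x, Submodule.Quotient.mk (t y) = s y

/-- A mixed twistor: an increasing filtration by subbundles such that `Gr_k` is pure of
weight `k`. -/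
structure IsMixed (E : HolFam.{u}) (W : ℤ → ∀ x, Submodule ℂ (E.Fib x)) : Prop where
  mono : Monotone W
  exists_bot : ∃ k, ∀ x, W k x = ⊥
  exists_top : ∃ k, ∀ x, W k x = ⊤
  subbundle : ∀ k, E.IsSubbundle (W k)
  pure : ∀ k, (E.Gr W k).IsPure k

/-- The identification of fibres over equal points. -/
def fibCast (E : HolFam.{u}) {x y : P1} (h : x = y) : E.Fib x ≃ₗ[ℂ] E.Fib y := by
  subst h
  exact LinearEquiv.refl ℂ _

end HolFam

/-- A meromorphic connection on `E`, holomorphic on `ℂ^*` with poles of order at most two at `0`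
and `∞`. It is given by the operator `D = ∇_{z∂_z}` on sections over open subsets of `ℂ^*`.
(The Leibniz rule, applied to functions which are constant near a point, shows that the germ of
`D s` at a point only depends on the germ of `s`.) -/
structure IsMerConnection (E : HolFam.{u}) (D : (∀ x, E.Fib x) → ∀ x, E.Fib x) : Prop where
  hol : ∀ s, ∀ x ∈ Cstar, E.HolAt s x → E.HolAt (D s) x
  add : ∀ s t, ∀ x ∈ Cstar, E.HolAt s x → E.HolAt t x → D (s + t) x = D s x + D t x
  leibniz : ∀ (f : P1 → ℂ) s, ∀ z : ℂ, z ≠ 0 → HolFun f (z : P1) → E.HolAt s (z : P1) →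
    D (fun y => f y • s y) (z : P1) =
      f (z : P1) • D s (z : P1) + (z * deriv (fun u : ℂ => f (u : P1)) z) • s (z : P1)
  /-- `z² ∇_{∂_z}` preserves holomorphic sections near `0`. -/
  pole_zero : ∀ s, E.HolAt s ((0 : ℂ) : P1) →
    E.ExtHolAt (fun y => zc y • D s y) ((0 : ℂ) : P1)
  /-- For `u = z⁻¹`, `u² ∇_{∂_u} = - z⁻¹ ∇_{z∂_z}` preserves holomorphic sections near `∞`. -/
  pole_inf : ∀ s, E.HolAt s OnePoint.infty →
    E.ExtHolAt (fun y => (zc y)⁻¹ • D s y) OnePoint.infty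

/-- `s` is a holomorphic flat section near the point `x` of `ℂ^*`. -/
def FlatAt (E : HolFam.{u}) (D : (∀ x, E.Fib x) → ∀ x, E.Fib x) (s : ∀ x, E.Fib x) (x : P1) :
    Prop :=
  E.HolAt s x ∧ ∀ᶠ y in 𝓝 x, D s y = 0

/-! ## Integrable twistors with real structure and pairing -/

/-- A tuple `(Ĥ, H'_ℝ, Ŵ, N̂, Ŝ, ∇)`: a holomorphic vector bundle `Ĥ` on `ℙ¹` with a meromorphic
connection `∇` with poles of order at most two at `0` and `∞`, a flat real subbundle over `ℂ^*`, a
non-degenerate hermitian-symmetric flat pairing `Ŝ : Ĥ ⊗ σ^* Ĥ → 𝒪`, a family of subspaces `Ŵ_k`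
of the fibres and an endomorphism `N̂` of the bundle over `ℂ^*`. -/
structure Twistor where
  E : HolFam.{u}
  rank : ℕ
  bundle : E.IsBundle rank
  nabla : (∀ x, E.Fib x) → ∀ x, E.Fib x
  conn : IsMerConnection E nabla
  /-- Complex conjugation with respect to the real subbundle (only relevant over `ℂ^*`). -/
  conj : ∀ x, E.Fib x →ₛₗ[starRingEnd ℂ] E.Fib x
  conj_conj : ∀ x ∈ Cstar, ∀ v, conj x (conj x v) = v
  conj_flat : ∀ s, ∀ x ∈ Cstar, FlatAt E nabla s x → FlatAt E nabla (fun y => conj y (s y)) x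
  What : ℤ → ∀ x, Submodule ℂ (E.Fib x)
  /-- `N̂` over `ℂ^*` (the values over `0` and `∞` are irrelevant). -/
  Nhat : ∀ x, Module.End ℂ (E.Fib x)
  /-- The value `Ŝ(a, b)` for `a ∈ Ĥ_x`, `b ∈ Ĥ_{σ(x)}`, antilinear in `b`. -/
  Shat : ∀ x, E.Fib x →ₗ[ℂ] E.Fib (sig x) →ₛₗ[starRingEnd ℂ] ℂ
  Shat_hol : ∀ a b x, E.HolAt a x → E.HolAt b (sig x) →
    HolFun (fun y => Shat y (a y) (b (sig y))) x
  Shat_nondeg_left : ∀ x a, (∀ b, Shat x a b = 0) → a = 0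
  Shat_nondeg_right : ∀ x b, (∀ a, Shat x a b = 0) → b = 0
  Shat_symm : ∀ (a b : ∀ x, E.Fib x) (x : P1),
    Shat x (a x) (b (sig x)) = starRingEnd ℂ (Shat (sig x) (b (sig x)) (a (sig (sig x))))
  Shat_flat : ∀ a b, ∀ x ∈ Cstar, FlatAt E nabla a x → FlatAt E nabla b (sig x) →
    ∀ᶠ y in 𝓝 x, Shat y (a y) (b (sig y)) = Shat x (a x) (b (sig x))

namespace HolFam

theorem holFun_const (c : ℂ) (x : P1) : HolFun (fun _ => c) x :=
  ⟨fun _ _ => analyticAt_const, fun _ => analyticAt_const⟩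

theorem HolFun.add {f g : P1 → ℂ} {x : P1} (hf : HolFun f x) (hg : HolFun g x) :
    HolFun (fun y => f y + g y) x :=
  ⟨fun z hz => (hf.1 z hz).add (hg.1 z hz), fun h => (hf.2 h).add (hg.2 h)⟩

theorem HolFun.const_mul {f : P1 → ℂ} {x : P1} (c : ℂ) (hf : HolFun f x) :
    HolFun (fun y => c * f y) x :=
  ⟨fun z hz => analyticAt_const.mul (hf.1 z hz), fun h => analyticAt_const.mul (hf.2 h)⟩

theorem IsBundle.holAt_add {E : HolFam.{u}} {r : ℕ} (hE : E.IsBundle r) {s t : ∀ x, E.Fib x}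
    {x : P1} (hs : E.HolAt s x) (ht : E.HolAt t x) : E.HolAt (s + t) x := by
  obtain ⟨U, -, hx, e, he⟩ := hE x
  rw [he _ x hx] at *
  intro i
  simpa using HolFun.add (hs i) (ht i)

theorem IsBundle.holAt_smul {E : HolFam.{u}} {r : ℕ} (hE : E.IsBundle r) {s : ∀ x, E.Fib x}
    {x : P1} (c : ℂ) (hs : E.HolAt s x) : E.HolAt (c • s) x := by
  obtain ⟨U, -, hx, e, he⟩ := hE x
  rw [he _ x hx] at *
  intro i
  simpa using HolFun.const_mul c (hs i)

theorem IsBundle.holAt_zero {E : HolFam.{u}} {r : ℕ} (hE : E.IsBundle r) (x : P1) :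
    E.HolAt 0 x := by
  obtain ⟨U, -, hx, e, he⟩ := hE x
  rw [he _ x hx]
  intro i
  simpa using holFun_const 0 x

/-- Holomorphy at a point is an open condition. -/
theorem HolFun.eventually {f : P1 → ℂ} {z : ℂ} (hf : HolFun f (z : P1)) :
    ∀ᶠ y in 𝓝 (z : P1), y ∈ Cstar → HolFun f y := by
  have h := (hf.1 z rfl).eventually_analyticAt
  rw [OnePoint.nhds_coe_eq, Filter.eventually_map]
  filter_upwards [h] with u hu _
  refine ⟨fun z' hz' => ?_, fun h => absurd h (OnePoint.coe_ne_infty _)⟩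
  rw [← OnePoint.coe_injective hz']
  exact hu

theorem IsBundle.holAt_eventually {E : HolFam.{u}} {r : ℕ} (hE : E.IsBundle r)
    {s : ∀ x, E.Fib x} {x : P1} (hx : x ∈ Cstar) (hs : E.HolAt s x) :
    ∀ᶠ y in 𝓝 x, y ∈ Cstar ∧ E.HolAt s y := by
  obtain ⟨U, hU, hxU, e, he⟩ := hE x
  obtain ⟨z, rfl⟩ := OnePoint.ne_infty_iff_exists.1 hx.1
  have hC : IsOpen Cstar :=
    (isOpen_compl_singleton (x := (OnePoint.infty : P1))).inter
      (isOpen_compl_singleton (x := ((0 : ℂ) : P1)))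
  have h1 : ∀ i, ∀ᶠ y in 𝓝 (z : P1), y ∈ Cstar → HolFun (fun y => (e y).repr (s y) i) y :=
    fun i => HolFun.eventually ((he _ _ hxU).1 hs i)
  filter_upwards [hU.mem_nhds hxU, hC.mem_nhds hx, Filter.eventually_all.2 h1] with y h2 h3 h4
  exact ⟨h3, (he _ _ h2).2 fun i => h4 i h3⟩

end HolFam

theorem FlatAt.add {E : HolFam.{u}} {r : ℕ} (hE : E.IsBundle r)
    {D : (∀ x, E.Fib x) → ∀ x, E.Fib x} (hD : IsMerConnection E D) {s t : ∀ x, E.Fib x} {x : P1}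
    (hx : x ∈ Cstar) (hs : FlatAt E D s x) (ht : FlatAt E D t x) : FlatAt E D (s + t) x := by
  refine ⟨hE.holAt_add hs.1 ht.1, ?_⟩
  filter_upwards [hE.holAt_eventually hx hs.1, hE.holAt_eventually hx ht.1, hs.2, ht.2]
    with y h1 h2 h3 h4
  rw [hD.add s t y h1.1 h1.2 h2.2, h3, h4, add_zero]

theorem FlatAt.smul {E : HolFam.{u}} {r : ℕ} (hE : E.IsBundle r)
    {D : (∀ x, E.Fib x) → ∀ x, E.Fib x} (hD : IsMerConnection E D) {s : ∀ x, E.Fib x} {x : P1}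
    (hx : x ∈ Cstar) (c : ℂ) (hs : FlatAt E D s x) : FlatAt E D (c • s) x := by
  refine ⟨hE.holAt_smul c hs.1, ?_⟩
  filter_upwards [hE.holAt_eventually hx hs.1, hs.2] with y h1 h2
  obtain ⟨z, rfl⟩ := OnePoint.ne_infty_iff_exists.1 h1.1.1
  have hz : z ≠ 0 := fun h => h1.1.2 (by rw [h])
  have := hD.leibniz (fun _ => c) s z hz (HolFam.holFun_const c _) h1.2
  rw [h2, smul_zero, deriv_const, mul_zero, zero_smul, add_zero] at this
  exact this

theorem FlatAt.zero {E : HolFam.{u}} {r : ℕ} (hE : E.IsBundle r)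
    {D : (∀ x, E.Fib x) → ∀ x, E.Fib x} (hD : IsMerConnection E D) {x : P1}
    (hx : x ∈ Cstar) : FlatAt E D 0 x := by
  refine ⟨hE.holAt_zero x, ?_⟩
  filter_upwards [hE.holAt_eventually hx (hE.holAt_zero x)] with y h1
  have := hD.add 0 0 y h1.1 h1.2 h1.2
  simpa using this

namespace Twistor

/-- `H^∞`: the space of multivalued flat sections of `Ĥ` over `ℂ^*`, i.e. of functions
`ζ ↦ A(ζ) ∈ Ĥ_{e^{2πiζ}}` which locally come from flat sections. -/
def Hinf (T : Twistor.{u}) : Submodule ℂ (∀ ζ : ℂ, T.E.Fib (expP ζ)) where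
  carrier := {A | ∀ ζ₀, ∃ s, FlatAt T.E T.nabla s (expP ζ₀) ∧ ∀ᶠ ζ in 𝓝 ζ₀, A ζ = s (expP ζ)}
  add_mem' := by
    intro A B hA hB ζ₀
    obtain ⟨s, hs, hs'⟩ := hA ζ₀
    obtain ⟨t, ht, ht'⟩ := hB ζ₀
    refine ⟨s + t, FlatAt.add T.bundle T.conn (expP_mem _) hs ht, ?_⟩
    filter_upwards [hs', ht'] with ζ h1 h2
    simp [h1, h2]
  zero_mem' := by
    intro ζ₀
    exact ⟨0, FlatAt.zero T.bundle T.conn (expP_mem _), Filter.Eventually.of_forall fun _ => rfl⟩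
  smul_mem' := by
    intro c A hA ζ₀
    obtain ⟨s, hs, hs'⟩ := hA ζ₀
    refine ⟨c • s, FlatAt.smul T.bundle T.conn (expP_mem _) c hs, ?_⟩
    filter_upwards [hs'] with ζ h1
    simp [h1]

/-- Evaluation of multivalued flat sections at `ζ`. -/
def ev (T : Twistor.{u}) (ζ : ℂ) : T.Hinf →ₗ[ℂ] T.E.Fib (expP ζ) :=
  (LinearMap.proj ζ).comp T.Hinf.subtype

/-- Complex conjugation on `H^∞`; its fixed space is `H^∞_ℝ`. -/
def conjInf (T : Twistor.{u}) : T.Hinf →ₛₗ[starRingEnd ℂ] T.Hinf where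
  toFun A := ⟨fun ζ => T.conj (expP ζ) (A.1 ζ), by
    intro ζ₀
    obtain ⟨s, hs, hs'⟩ := A.2 ζ₀
    refine ⟨_, T.conj_flat s _ (expP_mem _) hs, ?_⟩
    filter_upwards [hs'] with ζ h1
    rw [h1]⟩
  map_add' A B := by
    ext ζ
    simp
  map_smul' c A := by
    ext ζ
    simp

theorem fibCast_section (E : HolFam.{u}) (s : ∀ x, E.Fib x) {x y : P1} (h : x = y) :
    E.fibCast h (s x) = s y := by
  subst h
  rfl

theorem flatAt_congr {E : HolFam.{u}} {D : (∀ x, E.Fib x) → ∀ x, E.Fib x} {s : ∀ x, E.Fib x}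
    {x y : P1} (h : x = y) (hs : FlatAt E D s x) : FlatAt E D s y := h ▸ hs

/-- The monodromy `(M A)(ζ) = A(ζ + 1)` on `H^∞`. -/
def mono (T : Twistor.{u}) : Module.End ℂ T.Hinf where
  toFun A := ⟨fun ζ => T.E.fibCast (expP_add_one ζ) (A.1 (ζ + 1)), by
    intro ζ₀
    obtain ⟨s, hs, hs'⟩ := A.2 (ζ₀ + 1)
    refine ⟨s, flatAt_congr (expP_add_one ζ₀) hs, ?_⟩
    have hc : Filter.Tendsto (fun ζ : ℂ => ζ + 1) (𝓝 ζ₀) (𝓝 (ζ₀ + 1)) :=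
      (continuous_id.add continuous_const).tendsto ζ₀
    filter_upwards [hc.eventually hs'] with ζ h1
    rw [h1, fibCast_section]⟩
  map_add' A B := by
    ext ζ
    simp
  map_smul' c A := by
    ext ζ
    simp

/-- The nilpotent part `N = log M_u` of the monodromy. -/
def N (T : Twistor.{u}) : Module.End ℂ T.Hinf := nilpotentPart T.mono

/-- `s = es(A, α)` on `ℂ^*`: the section `z ↦ e^{(2πiα - N)ζ} A(ζ)`, `z = e^{2πiζ}`
(single valued if `A ∈ H^∞_{e^{-2πiα}}`). -/
def IsElementary (T : Twistor.{u}) (A : T.Hinf) (α : ℂ) (s : ∀ x, T.E.Fib x) : Prop :=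
  ∀ ζ : ℂ, s (expP ζ) =
    Complex.exp (2 * Real.pi * Complex.I * α * ζ) • T.ev ζ (nilExp (-ζ) T.N A)

/-- Near the point `x ∈ {0, ∞}`, the bundle is generated over `𝒪` by the elementary sections
`es(A, α + n)`, where `Re α ∈ (0,1]` and `A` is in the part in `H^∞_{e^{-2πiα}}` of the subspaces
`Φ n α` of `H^∞`. -/
def GeneratedAt (T : Twistor.{u}) (x : P1) (Φ : ℤ → ℂ → Submodule ℂ T.Hinf) : Prop :=
  ∀ s : ∀ y, T.E.Fib y, T.E.ExtHolAt s x ↔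
    ∃ (m : ℕ) (n : Fin m → ℤ) (α : Fin m → ℂ) (A : Fin m → T.Hinf)
      (es : Fin m → ∀ y, T.E.Fib y) (f : Fin m → P1 → ℂ),
      (∀ i, InStrip (α i) ∧ A i ∈ genEig T.mono (eig (α i)) ∧ A i ∈ Φ (n i) (α i) ∧
        T.IsElementary (A i) (α i + n i) (es i) ∧ HolFun (f i) x) ∧
      ∀ᶠ y in 𝓝[≠] x, s y = ∑ i, f i y • es i y

/-- The bundle is generated by the elementary sections belonging to the filtration `F` on `H^∞`:
near `0` by the `es(A, α + w - 1 - p)` with `A ∈ Fᵖ H^∞_{e^{-2πiα}}`, and near `∞` by the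
`es(A, q + α - [Re α])` with `A ∈ conj F^q H^∞_{e^{-2πiα}}`, always with `Re α ∈ (0,1]`. -/
def GeneratedBy (T : Twistor.{u}) (w : ℤ) (F : ℤ → Submodule ℂ T.Hinf) : Prop :=
  T.GeneratedAt ((0 : ℂ) : P1) (fun n _ => F (w - 1 - n)) ∧
  T.GeneratedAt OnePoint.infty (fun n α => conjFil T.conjInf F (n + ⌊α.re⌋))

/-- The twistor is generated by elementary sections. -/
def IsGenByElementary (T : Twistor.{u}) (w : ℤ) : Prop :=
  ∃ F : ℤ → Submodule ℂ T.Hinf, IsMonodromyFiltration T.mono F ∧ T.GeneratedBy w F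

/-- `Ŝ` takes values in `i^w ℝ` on the real subbundle, i.e. so does the pairing
`P(a, b) = (-1)^w Ŝ(a, τ_real b)` between opposite fibres. -/
def IsReal (T : Twistor.{u}) (w : ℤ) : Prop :=
  ∀ x ∈ Cstar, ∀ a b, T.conj x a = a → T.conj (sig x) b = b →
    ∃ r : ℝ, T.Shat x a b = Complex.I ^ w * r

/-- `Ŵ` and `N̂` are induced by the monodromy of `∇`: over `ℂ^*` the subbundle `Ŵ_k` is the flat
subbundle given by the weight filtration of `N` centered at zero, and `N̂` is the flat endomorphism
given by `N`. -/
def IsInduced (T : Twistor.{u}) : Prop :=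
  (∃ W : ℤ → Submodule ℂ T.Hinf, IsWeightFiltration T.N 0 W ∧
    ∀ k ζ, T.What k (expP ζ) = (W k).map (T.ev ζ)) ∧
  ∀ ζ A, T.Nhat (expP ζ) (T.ev ζ A) = T.ev ζ (T.N A)

/-- `(Ĥ, Ŵ)` is a mixed twistor and `N̂` is a morphism `Ĥ → Ĥ ⊗ 𝒪(2)` which maps `Ŵ_k` to
`Ŵ_{k-2} ⊗ 𝒪(2)`. Here `𝒪(2) = 𝒪(0 + ∞)`, i.e. `N̂` may have simple poles at `0` and `∞`. -/
structure IsMixedTwistor (T : Twistor.{u}) : Prop where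
  mixed : T.E.IsMixed T.What
  N_hol : ∀ s, ∀ x ∈ Cstar, T.E.HolAt s x → T.E.HolAt (fun y => T.Nhat y (s y)) x
  N_zero : ∀ s, T.E.HolAt s ((0 : ℂ) : P1) →
    T.E.ExtHolAt (fun y => zc y • T.Nhat y (s y)) ((0 : ℂ) : P1)
  N_inf : ∀ s, T.E.HolAt s OnePoint.infty →
    T.E.ExtHolAt (fun y => (zc y)⁻¹ • T.Nhat y (s y)) OnePoint.infty
  N_W : ∀ k, ∀ x ∈ Cstar, (T.What k x).map (T.Nhat x) ≤ T.What (k - 2) x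

/-- The class in `Gr_k` of a (pointwise) section of `Ŵ_k`. -/
def grClass (T : Twistor.{u}) (k : ℤ) (a : ∀ x, T.What k x) :
    ∀ x, (T.E.Gr T.What k).Fib x :=
  fun x => Submodule.Quotient.mk (a x)

/-- The class of `a` is a global section of `P̂_k ⊗ 𝒪(-k)`, where
`P̂_k = ker (N̂^{k+1} : Gr_k → Gr_{-k-2} ⊗ 𝒪(2k+2))` is the primitive part: it is a section of
`P̂_k` over `ℂ` such that its product with `z^k` is holomorphic at `∞`. -/
def IsPrimitiveSection (T : Twistor.{u}) (k : ℕ) (a : ∀ x, T.What k x) : Prop :=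
  (∀ x ∈ Cstar, ((T.Nhat x) ^ (k + 1)) (a x : T.E.Fib x) ∈ T.What (-(k : ℤ) - 3) x) ∧
  (∀ z : ℂ, (T.E.Gr T.What k).HolAt (T.grClass k a) (z : P1)) ∧
  (T.E.Gr T.What k).ExtHolAt (fun x => (zc x) ^ k • T.grClass k a x) OnePoint.infty

/-- `Ŝ` is a polarization of the mixed twistor: it is a morphism of mixed twistors, `N̂` is an
infinitesimal isometry, and for all `k ≥ 0` the form `i^{-k} Ŝ(N̂^k -, -)` is positive definite on
the global sections of `P̂_k ⊗ 𝒪(-k)`. -/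
structure IsPolarized (T : Twistor.{u}) : Prop where
  weight : ∀ k l : ℤ, k + l < 0 → ∀ x, ∀ a ∈ T.What k x, ∀ b ∈ T.What l (sig x),
    T.Shat x a b = 0
  isometry : ∀ x ∈ Cstar, ∀ a b, T.Shat x (T.Nhat x a) b + T.Shat x a (T.Nhat (sig x) b) = 0
  pos : ∀ (k : ℕ) (a : ∀ x, T.What k x), T.IsPrimitiveSection k a →
    (∃ z : ℂ, T.grClass k a (z : P1) ≠ 0) → ∀ x ∈ Cstar,
    ∃ r : ℝ, 0 < r ∧ Complex.I ^ (-(k : ℤ)) *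
      T.Shat x (((T.Nhat x) ^ k) (a x : T.E.Fib x)) (a (sig x) : T.E.Fib (sig x)) = r

/-- Integrable polarized mixed twistor structures of weight zero with flat real structure over
`ℂ^*`, with `Ŵ` and `N̂` induced by the monodromy, generated by elementary sections. -/
structure IsPMTS (T : Twistor.{u}) (w : ℤ) : Prop where
  real : T.IsReal w
  induced : T.IsInduced
  mixed : T.IsMixedTwistor
  polarized : T.IsPolarized
  elementary : T.IsGenByElementary w

/-- Isomorphisms of twistors with all additional data. -/
structure Iso (T T' : Twistor.{u}) where
  e : ∀ x, T.E.Fib x ≃ₗ[ℂ] T'.E.Fib x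
  hol : ∀ s x, T'.E.HolAt (fun y => e y (s y)) x ↔ T.E.HolAt s x
  nabla : ∀ s, ∀ x ∈ Cstar, T.E.HolAt s x →
    T'.nabla (fun y => e y (s y)) x = e x (T.nabla s x)
  conj : ∀ x ∈ Cstar, ∀ v, e x (T.conj x v) = T'.conj x (e x v)
  What : ∀ k x v, e x v ∈ T'.What k x ↔ v ∈ T.What k x
  Nhat : ∀ x ∈ Cstar, ∀ v, e x (T.Nhat x v) = T'.Nhat x (e x v)
  Shat : ∀ x a b, T'.Shat x (e x a) (e (sig x) b) = T.Shat x a b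

def Iso.refl (T : Twistor.{u}) : Iso T T where
  e _ := LinearEquiv.refl ℂ _
  hol _ _ := Iff.rfl
  nabla _ _ _ _ := rfl
  conj _ _ _ := rfl
  What _ _ _ := Iff.rfl
  Nhat _ _ _ := rfl
  Shat _ _ _ := rfl

def Iso.symm {T T' : Twistor.{u}} (f : Iso T T') : Iso T' T where
  e x := (f.e x).symm
  hol s x := by rw [← f.hol]; simp
  nabla s x hx hs := by
    have h : T.E.HolAt (fun y => (f.e y).symm (s y)) x := by rw [← f.hol]; simpa using hs
    have h2 := f.nabla _ x hx h
    simp only [LinearEquiv.apply_symm_apply] at h2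
    rw [h2]; simp
  conj x hx v := by apply (f.e x).injective; simp [f.conj x hx]
  What k x v := by rw [← f.What]; simp
  Nhat x hx v := by apply (f.e x).injective; simp [f.Nhat x hx]
  Shat x a b := by rw [← f.Shat]; simp

def Iso.trans {T T' T'' : Twistor.{u}} (f : Iso T T') (g : Iso T' T'') : Iso T T'' where
  e x := (f.e x).trans (g.e x)
  hol s x := by
    rw [← f.hol, ← g.hol]; rfl
  nabla s x hx hs := by
    have h := g.nabla (fun y => f.e y (s y)) x hx ((f.hol s x).2 hs)
    rw [f.nabla s x hx hs] at h
    exact h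
  conj x hx v := by simp [f.conj x hx, g.conj x hx]
  What k x v := by simp [f.What, g.What]
  Nhat x hx v := by simp [f.Nhat x hx, g.Nhat x hx]
  Shat x a b := by simp [f.Shat, g.Shat]

/-- The pairing `L(A, B) = P(A(ζ), B(ζ + 1/2))` on `H^∞`, where `P` is the flat pairing between
opposite fibres with `Ŝ(a, b) = (-1)^w P(a, τ_real b)`. For `b = B(ζ + 1/2)` in the fibre over `-z`,
the vector `τ_real b` in the fibre over `-1 / conj z = σ(z)` is the parallel transport
of the conjugate of `b` along the ray through `-z`, i.e. the value of the conjugate of `B` at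
`conj ζ + 1/2`. (The value does not depend on `ζ`.) -/
def seifert (T : Twistor.{u}) (w : ℤ) (ζ : ℂ) (A B : T.Hinf) : ℂ :=
  (-1) ^ w * T.Shat (expP ζ) (T.ev ζ A)
    (T.E.fibCast (sig_expP ζ).symm (T.ev (starRingEnd ℂ ζ + 1 / 2) (T.conjInf B)))

/-- The bilinear form `S` on `H^∞` belongs to the pairing `L`:
`S(a, b) = -(2πi)^w L(a, (M - Id)⁻¹ b)` on `H^∞_{arg ≠ 0}`, and
`S(a, b) = (2πi)^w L(a, (log μ Id + N)/(M - Id) b)` for `b ∈ H^∞_μ` with `arg μ = 0`, where for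
`μ = 1` the quotient `N/(M - Id)` means `(∑_{k ≥ 1} N^{k-1}/k!)⁻¹`. Denominators are cleared. -/
structure IsTopPolarization (T : Twistor.{u}) (w : ℤ) (S : T.Hinf → T.Hinf → ℂ) : Prop where
  argNeZero : ∀ (ζ : ℂ) (a b : T.Hinf), b ∈ argNeZero T.mono →
    S a (T.mono b - b) = -(2 * Real.pi * Complex.I) ^ w * T.seifert w ζ a b
  argZero : ∀ (ζ μ : ℂ) (a b : T.Hinf), Complex.arg μ = 0 → μ ≠ 1 → b ∈ genEig T.mono μ →
    S a (T.mono b - b) =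
      (2 * Real.pi * Complex.I) ^ w * T.seifert w ζ a (Complex.log μ • b + T.N b)
  one : ∀ (ζ : ℂ) (a b : T.Hinf), b ∈ genEig T.mono 1 →
    S a (nilSeries (fun k => 1 / ((k + 1).factorial : ℂ)) T.N b) =
      (2 * Real.pi * Complex.I) ^ w * T.seifert w ζ a b

end Twistor

/-- Integrable polarized mixed twistor structures generated by elementary sections. -/
def PMTSTwistor (w : ℤ) : Type (u + 1) := {T : Twistor.{u} // T.IsPMTS w}

/-- Two such twistor structures are equivalent iff they are isomorphic. -/
def pmtsSetoid (w : ℤ) : Setoid (PMTSTwistor.{u} w) where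
  r T T' := Nonempty (Twistor.Iso T.1 T'.1)
  iseqv :=
    { refl := fun T => ⟨Twistor.Iso.refl T.1⟩
      symm := fun ⟨f⟩ => ⟨f.symm⟩
      trans := fun ⟨f⟩ ⟨g⟩ => ⟨f.trans g⟩ }

/-- The twistor `T` is the one constructed from the tuple `D`: after an identification `φ` of `D.V`
with the space `H^∞` of multivalued flat sections of `T`, compatible with the real structures and
the monodromies, the bundle is generated at `0` and `∞` by the elementary sections belonging to
`F` and to its conjugate, and `Ŝ` comes from the pairing `S`. -/
def Corresponds {w : ℤ} (D : HodgeTuple.{u} w) (T : Twistor.{u}) : Prop :=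
  ∃ φ : D.V ≃ₗ[ℂ] T.Hinf,
    (∀ a, φ (D.conj a) = T.conjInf (φ a)) ∧
    (∀ a, φ (D.M a) = T.mono (φ a)) ∧
    T.GeneratedBy w (fun p => (D.F p).comap φ.symm.toLinearMap) ∧
    T.IsTopPolarization w (fun a b => D.S (φ.symm a) (φ.symm b))

end PMTS

end

/-!
Both sides of the correspondence are compared with the same linear algebra data on `V = H^∞`.

Let `B = α - N/(2πi)` on `H_{e^{-2πiα}}`, `Re α ∈ (0,1]`, so that `M = e^{-2πiB}`. Over `ℂ^*`, a bundle
with connection is trivialized by identifying `A ∈ V` with the section `e^{2πiBζ}A(ζ)`, which is the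
elementary section `es(A, α)` if `A ∈ H_{e^{-2πiα}}`. Then `∇_{z∂_z}` becomes `z∂_z + B`, weight filtration
and `N` become constant, generation by elementary sections means that the germs of the bundle at `0`
and `∞` are the lattices `∑ zⁿ 𝒪 F^{w-1-n}` and `∑ zⁿ 𝒪 Fbⁿ`, where `Fb` is the conjugate filtration, shifted
on `H_{arg = 0}`, and `Ŝ` becomes the constant hermitian form `h(a, b) = S(a, ψ conj b)` with
`ψ = κ_n/(Γ(B) Γ(n-B))`, `n = 1 + ⌊Re α⌋`, by the reflection formula (`IsModel`, `Corresponds.exists_isModel`).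

On `Gr^W`, `N` vanishes and `Γ(B)` is a scalar on `H_{e^{-2πiα}}`. So the twist by `G` does not change the
filtrations on `Gr^W`, but it turns orthogonality with respect to `S` into orthogonality of `F` and `Fb`
with respect to `h`. Hence a tuple induces polarized mixed Hodge structures iff `F` and `Fb` are opposite
on `Gr^W` and orthogonal for `h`, and `h` polarizes (`IsData`, `HodgeTuple.inducesPMHS_iff`).

These are the conditions on the twistor: a bundle on `ℙ¹` given by two filtrations is pure of weight
`k` iff they are opposite. By Liouville's theorem, purity implies oppositeness (`IsModel.isData`).
Conversely, opposite filtrations have adapted bases with equal classes in `Gr^W`, which are used as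
frames on `ℂ` and `ℙ¹ ∖ {0}` (`IsOpposite.exists_bases`, `AdaptedFrame`, `AdaptedFrame.isPMTS`).

Two twistors belonging to a tuple are isomorphic over `ℂ^*` with equal germs at `0` and `∞`
(`IsModel.nonempty_iso`); a twistor determines `F` and `S` (`Corresponds.nonempty_iso`). The eigenvalues
have absolute value one, since a primitive Hodge vector in `H_{e^{-2πiα}}` pairs nontrivially with
itself, while this space is orthogonal to itself for non-real `α` (`IsData.norm_eq_one`).
-/

noncomputable section

namespace PMTS

open Complex (I exp Gamma log conj_conj conj_I conj_ofReal exp_add exp_neg sin two_pi_I_ne_zero Gamma_ne_zero_of_re_pos)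
open Module Function
open Polynomial (aeval)
open PowerSeries (X C trunc constantCoeff coeff_mk coeff_C coeff_trunc)
open Submodule (smul_mem mem_map_of_mem span span_mono subtype_apply)
open Finset (sum_congr mul_sum sum_add_distrib sum_sub_distrib sum_eq_zero sum_eq_single sum_insert mem_insert_of_mem mem_insert_self univ mem_univ smul_sum sum_mul induction_on)
open OnePoint (coe_ne_infty ne_infty_iff_exists)
open scoped OnePoint
open LinearMap (BilinForm eqLocus)
open LinearEquiv (apply_symm_apply trans_apply coe_coe symm_apply_apply ofBijective)
local notation "ϖ" => 2 * Real.pi * Complex.I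
local notation "Cj" => starRingEnd ℂ
local notation "ssPart" => semisimplePart
local notation "nPart" => nilpotentPart
local notation "An" => AnalyticAt ℂ
local notation "Fil(" V ")" => ℤ → Submodule ℂ V
local notation "qmk" => Submodule.Quotient.mk
local notation "𝟘" => ((0 : ℂ) : P1)

/-! ### Power series in nilpotent endomorphisms -/

section

variable {V : Type u} [AddCommGroup V] [Module ℂ V]

lemma aeval_eq_of_coeff_eq {N : End ℂ V} {m : ℕ} (hN : N ^ m = 0)
    {p q : Polynomial ℂ} (h : ∀ d < m, p.coeff d = q.coeff d) :
    aeval N p = aeval N q := by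
  have hd : Polynomial.X ^ m ∣ p - q := by
    rw [Polynomial.X_pow_dvd_iff]
    intro d hd
    simp [h d hd]
  obtain ⟨r, hr⟩ := hd
  have := congrArg (aeval N) hr
  rwa [map_sub, map_mul, map_pow, Polynomial.aeval_X, hN, zero_mul, sub_eq_zero] at this

/-- Evaluation of formal power series at an endomorphism with `N ^ m = 0`. -/
def evalNil (N : End ℂ V) (m : ℕ) (hN : N ^ m = 0) :
    PowerSeries ℂ →ₐ[ℂ] End ℂ V :=
  AlgHom.ofLinearMap
    { toFun := fun f => aeval N (trunc m f)
      map_add' := by intro f g; simp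
      map_smul' := by intro c f; simp }
    (by
      have : aeval N (trunc m (1 : PowerSeries ℂ)) =
          aeval N (1 : Polynomial ℂ) := by
        apply aeval_eq_of_coeff_eq hN
        intro d hd
        simp [coeff_trunc, hd, PowerSeries.coeff_one, Polynomial.coeff_one]
      simpa using this)
    (by
      intro f g
      change aeval N (trunc m (f * g)) =
        aeval N (trunc m f) * aeval N (trunc m g)
      rw [← map_mul]
      apply aeval_eq_of_coeff_eq hN
      intro d hd
      rw [coeff_trunc, if_pos hd,
        PowerSeries.coeff_mul_eq_coeff_trunc_mul_trunc f g hd, ← Polynomial.coe_mul,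
        Polynomial.coeff_coe])

lemma evalNil_apply {N : End ℂ V} {m : ℕ} (hN : N ^ m = 0) (f : PowerSeries ℂ) :
    evalNil N m hN f = ∑ k ∈ Finset.range m, PowerSeries.coeff k f • N ^ k := by
  change aeval N (trunc m f) = _
  rw [Polynomial.aeval_def, PowerSeries.eval₂_trunc_eq_sum_range]
  simp [Algebra.smul_def]

lemma evalNil_X {N : End ℂ V} {m : ℕ} (hN : N ^ m = 0) :
    evalNil N m hN X = N := by
  have : aeval N (trunc m (X : PowerSeries ℂ)) =
      aeval N (Polynomial.X : Polynomial ℂ) := by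
    apply aeval_eq_of_coeff_eq hN
    intro d hd
    simp [coeff_trunc, hd, PowerSeries.coeff_X, Polynomial.coeff_X, eq_comm]
  rwa [Polynomial.aeval_X] at this

lemma pow_finrank [FiniteDimensional ℂ V] {N : End ℂ V} (hN : IsNilpotent N) :
    N ^ (finrank ℂ V + 1) = 0 := by
  have h := (LinearMap.charpoly_eq_X_pow_iff N).2
  have h1 : N.charpoly = Polynomial.X ^ finrank ℂ V := by
    rw [LinearMap.charpoly_eq_X_pow_iff]
    obtain ⟨n, hn⟩ := hN
    exact fun m => ⟨n, by rw [hn]; rfl⟩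
  have h2 := LinearMap.aeval_self_charpoly N
  rw [h1, map_pow, Polynomial.aeval_X] at h2
  rw [pow_succ, h2, zero_mul]

lemma nilSeries_eq [FiniteDimensional ℂ V] {N : End ℂ V} (hN : IsNilpotent N)
    (c : ℕ → ℂ) : nilSeries c N = evalNil N _ (pow_finrank hN) (PowerSeries.mk c) := by
  rw [evalNil_apply]; simp [nilSeries]

lemma evalNil_X_pow_mul {N : End ℂ V} {m : ℕ} (hN : N ^ m = 0) (f : PowerSeries ℂ) :
    evalNil N m hN (X ^ m * f) = 0 := by
  simp [map_pow, evalNil_X, hN]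

/-- Evaluation at a nilpotent endomorphism is compatible with substitution of power series. -/
lemma evalNil_subst {N N' : End ℂ V} {m : ℕ} (hN : N ^ m = 0) (hN' : N' ^ m = 0)
    {f g : PowerSeries ℂ} (hg : constantCoeff g = 0)
    (h : evalNil N m hN g = N') :
    evalNil N m hN (f.subst g) = evalNil N' m hN' f := by
  have hs : PowerSeries.HasSubst g := PowerSeries.HasSubst.of_constantCoeff_zero' hg
  obtain ⟨f', hf'⟩ : ∃ f' : PowerSeries ℂ, f = (trunc m f : PowerSeries ℂ) +
      X ^ m * f' := by
    have : X ^ m ∣ f - (trunc m f : PowerSeries ℂ) := by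
      rw [PowerSeries.X_pow_dvd_iff]
      intro d hd
      simp [coeff_trunc, hd]
    obtain ⟨r, hr⟩ := this
    exact ⟨r, by rw [← hr]; ring⟩
  have h1 : evalNil N m hN (f.subst g) =
      evalNil N m hN ((trunc m f : PowerSeries ℂ).subst g) := by
    conv_lhs => rw [hf']
    rw [PowerSeries.subst_add hs, PowerSeries.subst_mul hs, PowerSeries.subst_pow hs,
      PowerSeries.subst_X hs, map_add, map_mul, map_pow, h, hN', zero_mul, add_zero]
  rw [h1, PowerSeries.subst_coe hs, ← Polynomial.aeval_algHom_apply, h]; rfl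

lemma nilExp_one_eq [FiniteDimensional ℂ V] {N : End ℂ V} (hN : IsNilpotent N) :
    nilExp 1 N = evalNil N _ (pow_finrank hN) (PowerSeries.exp ℂ) := by
  unfold nilExp
  rw [nilSeries_eq hN]
  congr 1
  ext k
  simp [PowerSeries.coeff_exp]

lemma constantCoeff_subst_of_zero {f g : PowerSeries ℂ} (hg : constantCoeff g = 0) :
    constantCoeff (f.subst g) = constantCoeff f := by
  have hs : PowerSeries.HasSubst g := PowerSeries.HasSubst.of_constantCoeff_zero' hg
  obtain ⟨r, hr⟩ : X ∣ f - C (constantCoeff f) := by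
    rw [PowerSeries.X_dvd_iff]; simp
  rw [sub_eq_iff_eq_add] at hr
  conv_lhs => rw [hr, PowerSeries.subst_add hs, PowerSeries.subst_mul hs, PowerSeries.subst_X hs]
  have : (C (constantCoeff f)).subst g = C (constantCoeff f) := by
    have h := PowerSeries.subst_coe hs (Polynomial.C (constantCoeff f))
    simpa using h
  rw [this]; simp [hg]

lemma one_add_X_mul_deriv_log : (1 + X) * PowerSeries.derivative ℂ (PowerSeries.log ℂ) = 1 := by
  rw [PowerSeries.deriv_log]
  ext n
  rw [add_mul, one_mul, map_add, coeff_mk]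
  cases n with
  | zero => simp
  | succ n =>
    rw [PowerSeries.coeff_succ_X_mul, coeff_mk, PowerSeries.coeff_one]; simp [pow_succ]

lemma exp_subst_log : (PowerSeries.exp ℂ).subst (PowerSeries.log ℂ) = 1 + X := by
  set f := (PowerSeries.exp ℂ).subst (PowerSeries.log ℂ) with hf
  set l := PowerSeries.derivative ℂ (PowerSeries.log ℂ) with hl
  have h1 : (1 + X) * l = 1 := one_add_X_mul_deriv_log
  have h2 : PowerSeries.derivative ℂ f = f * l := by
    rw [hf, PowerSeries.derivative_subst PowerSeries.HasSubst.log, PowerSeries.derivative_exp]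
  have h3 : l * l + PowerSeries.derivative ℂ l = 0 := by
    have h := congrArg (PowerSeries.derivative ℂ) h1
    rw [Derivation.leibniz, map_add, PowerSeries.derivative_X, smul_eq_mul, smul_eq_mul] at h
    simp only [Derivation.map_one_eq_zero, zero_add, mul_one] at h
    linear_combination l * h - PowerSeries.derivative ℂ l * h1
  have h4 : f * l = 1 := by
    apply PowerSeries.derivative.ext
    · rw [Derivation.leibniz, h2, smul_eq_mul, smul_eq_mul, Derivation.map_one_eq_zero]
      linear_combination f * h3
    · rw [map_mul, hf, constantCoeff_subst_of_zero (by simp), hl, PowerSeries.deriv_log]; simp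
  linear_combination (1 + X) * h4 - f * h1

lemma log_subst_exp : (PowerSeries.log ℂ).subst (PowerSeries.exp ℂ - 1) = X := by
  have hs : PowerSeries.HasSubst (PowerSeries.exp ℂ - 1) := PowerSeries.HasSubst.exp_sub_one
  apply PowerSeries.derivative.ext
  · have h := congrArg (fun f => f.subst (PowerSeries.exp ℂ - 1)) one_add_X_mul_deriv_log
    simp only [PowerSeries.subst_mul hs, PowerSeries.subst_add hs, PowerSeries.subst_X hs] at h
    have h1 : (1 : PowerSeries ℂ).subst (PowerSeries.exp ℂ - 1) = 1 := by
      rw [← PowerSeries.coe_substAlgHom hs, map_one]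
    rw [h1, add_sub_cancel] at h
    rw [PowerSeries.derivative_subst hs, map_sub, PowerSeries.derivative_exp,
      Derivation.map_one_eq_zero, sub_zero, PowerSeries.derivative_X, mul_comm]
    exact h
  · rw [constantCoeff_subst_of_zero (by simp)]; simp

lemma evalNil_of_constantCoeff_nilpotent {N : End ℂ V} {m : ℕ} (hN : N ^ m = 0)
    {f : PowerSeries ℂ} (hf : constantCoeff f = 0) : (evalNil N m hN f) ^ m = 0 := by
  obtain ⟨g, rfl⟩ := PowerSeries.X_dvd_iff.2 hf
  rw [← map_pow, mul_pow, evalNil_X_pow_mul]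

lemma exists_nilExp_eq [FiniteDimensional ℂ V] {n : End ℂ V} (hn : IsNilpotent n) :
    ∃ f : PowerSeries ℂ, ∃ N, N = evalNil n _ (pow_finrank hn) f ∧ IsNilpotent N ∧
      nilExp 1 N = 1 + n := by
  have h0 := evalNil_of_constantCoeff_nilpotent (pow_finrank hn) (f := PowerSeries.log ℂ)
    (by simp)
  refine ⟨PowerSeries.log ℂ, _, rfl, ⟨_, h0⟩, ?_⟩
  rw [nilExp_one_eq ⟨_, h0⟩,
    ← evalNil_subst (pow_finrank hn) _ (by simp) rfl, exp_subst_log, map_add, map_one,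
    evalNil_X]

lemma nilExp_sub_one_pow [FiniteDimensional ℂ V] {N : End ℂ V} (hN : IsNilpotent N) :
    (nilExp 1 N - 1) ^ (finrank ℂ V + 1) = 0 := by
  rw [nilExp_one_eq hN, ← map_one (evalNil N _ (pow_finrank hN)), ← map_sub]
  exact evalNil_of_constantCoeff_nilpotent _ (by simp)

lemma evalNil_log_nilExp [FiniteDimensional ℂ V] {N : End ℂ V} (hN : IsNilpotent N) :
    evalNil (nilExp 1 N - 1) _ (nilExp_sub_one_pow hN) (PowerSeries.log ℂ) = N := by
  rw [← evalNil_subst (g := PowerSeries.exp ℂ - 1) (pow_finrank hN) (nilExp_sub_one_pow hN)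
    (by simp) (by rw [map_sub, map_one, nilExp_one_eq hN]), log_subst_exp, evalNil_X]

lemma nilExp_injective [FiniteDimensional ℂ V] {N N' : End ℂ V} (hN : IsNilpotent N)
    (hN' : IsNilpotent N') (h : nilExp 1 N = nilExp 1 N') : N = N' := by
  rw [← evalNil_log_nilExp hN, ← evalNil_log_nilExp hN']
  simp only [h]

lemma nilSeries_commute {N A : End ℂ V} (h : Commute A N) (c : ℕ → ℂ) :
    Commute A (nilSeries c N) := by
  unfold nilSeries
  exact Commute.sum_right _ _ _ fun k _ => (h.pow_right k).smul_right _

section Jordan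

variable [FiniteDimensional ℂ V]

lemma isNilpotent_nilExp_sub_one {N : End ℂ V} (hN : IsNilpotent N) :
    IsNilpotent (nilExp 1 N - 1) := by
  exact ⟨_, nilExp_sub_one_pow hN⟩

lemma exists_isJordan {M : End ℂ V} (hM : Bijective M) : ∃ Ms N, IsJordan M Ms N := by
  obtain ⟨n, hn, s, hs, hnil, hss, h⟩ := M.exists_isNilpotent_isSemisimple
  have hns : Commute n s := by
    have h1 : Commute M s := Algebra.commute_of_mem_adjoin_self hs
    have h2 : n = M - s := by rw [h]; abel
    rw [h2]; exact h1.sub_left (Commute.refl s)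
  have hMu : IsUnit M := (End.isUnit_iff M).2 hM
  have hnM : Commute n M := by rw [h]; exact (Commute.refl n).add_right hns
  have hsu : IsUnit s := by
    have : s = M + -n := by rw [h]; abel
    rw [this]
    exact hnil.neg.isUnit_add_left_of_commute hMu hnM.neg_left
  obtain ⟨t, rfl⟩ := hsu
  have hnt : Commute n (↑t⁻¹ : End ℂ V) := hns.units_inv_right
  have hnil' : IsNilpotent ((↑t⁻¹ : End ℂ V) * n) := hnt.symm.isNilpotent_mul_left hnil
  obtain ⟨f, N, hN, hNn, hexp⟩ := exists_nilExp_eq hnil'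
  refine ⟨t, N, hss, hNn, ?_, ?_⟩
  · have hf : N = nilSeries (fun k => PowerSeries.coeff k f) ((↑t⁻¹ : End ℂ V) * n) := by
      rw [nilSeries_eq hnil', hN]
      congr 1
      ext k
      simp
    rw [hf]
    apply nilSeries_commute
    exact (Commute.units_inv_right (Commute.refl (t : End ℂ V))).mul_right hns.symm
  · simp [hexp, mul_add, h, add_comm]

lemma IsJordan.bijective {M Ms N : End ℂ V} (hM : Bijective M)
    (h : IsJordan M Ms N) : IsUnit Ms := by
  rw [End.isUnit_iff]
  have hs : Surjective Ms := fun x => by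
    obtain ⟨y, rfl⟩ := hM.2 x
    exact ⟨nilExp 1 N y, by rw [h.2.2.2]; rfl⟩
  exact ⟨LinearMap.injective_iff_surjective.2 hs, hs⟩

lemma IsJordan.unique {M Ms N Ms' N' : End ℂ V} (hM : Bijective M)
    (h : IsJordan M Ms N) (h' : IsJordan M Ms' N') : Ms = Ms' ∧ N = N' := by
  have key : ∀ {Ms N : End ℂ V}, IsJordan M Ms N →
      IsNilpotent (Ms * (nilExp 1 N - 1)) ∧ Commute (Ms * (nilExp 1 N - 1)) Ms ∧
        M = Ms * (nilExp 1 N - 1) + Ms := by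
    intro Ms N h
    have hc : Commute Ms (nilExp 1 N - 1) :=
      (nilSeries_commute h.2.2.1 _).sub_right (Commute.one_right _)
    refine ⟨hc.isNilpotent_mul_left (isNilpotent_nilExp_sub_one h.2.1),
      ((Commute.refl Ms).mul_right hc).symm, ?_⟩
    rw [mul_sub, mul_one, sub_add_cancel]; exact h.2.2.2
  obtain ⟨h1, h2, h3⟩ := key h
  obtain ⟨h1', h2', h3'⟩ := key h'
  have h4 := (End.isNilpotent_isSemisimple_unique h1 h.1 h1' h'.1 h2 h2' (h3.symm.trans h3')).2
  subst h4
  refine ⟨rfl, nilExp_injective h.2.1 h'.2.1 ?_⟩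
  exact (h.bijective hM).mul_left_cancel (h.2.2.2.symm.trans h'.2.2.2)

lemma isJordan_parts {M : End ℂ V} (hM : Bijective M) :
    IsJordan M (ssPart M) (nPart M) := by
  obtain ⟨Ms, N, h⟩ := exists_isJordan hM
  obtain ⟨N', h1⟩ : ∃ N', IsJordan M (ssPart M) N' :=
    Classical.epsilon_spec (p := fun Ms => ∃ N, IsJordan M Ms N) ⟨Ms, N, h⟩
  obtain ⟨Ms', h2⟩ : ∃ Ms', IsJordan M Ms' (nPart M) :=
    Classical.epsilon_spec (p := fun N => ∃ Ms, IsJordan M Ms N) ⟨N, Ms, h⟩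
  have := h1.unique hM h2
  rwa [← this.2]

lemma isNilpotent_nPart {M : End ℂ V} (hM : Bijective M) :
    IsNilpotent (nPart M) := (isJordan_parts hM).2.1

lemma commute_parts {M : End ℂ V} (hM : Bijective M) :
    Commute (ssPart M) (nPart M) := (isJordan_parts hM).2.2.1

lemma mem_genEig_iff {M : End ℂ V} (hM : Bijective M) {μ : ℂ} {x : V} :
    x ∈ genEig M μ ↔ ssPart M x = μ • x := by
  obtain ⟨h1, h2, h3, h4⟩ := isJordan_parts hM
  set Ms := ssPart M
  set N := nPart M
  have hc : Commute Ms (nilExp 1 N - 1) := (nilSeries_commute h3 _).sub_right (Commute.one_right _)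
  have hE : M - Ms = Ms * (nilExp 1 N - 1) := by rw [mul_sub, mul_one, ← h4]
  have hnil : IsNilpotent (M - Ms) := by
    rw [hE]; exact hc.isNilpotent_mul_left (isNilpotent_nilExp_sub_one h2)
  have hcom : Commute M Ms := by
    rw [h4]; exact ((Commute.refl Ms).mul_right (nilSeries_commute h3 _)).symm
  constructor
  · exact fun hx => End.apply_eq_of_mem_of_comm_of_isFinitelySemisimple_of_isNil
      hx hcom h1.isFinitelySemisimple hnil
  · intro hx
    obtain ⟨m, hm⟩ := hnil
    rw [genEig, End.mem_maxGenEigenspace]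
    refine ⟨m, ?_⟩
    have key : ∀ k, ((M - μ • (1 : End ℂ V)) ^ k) x = ((M - Ms) ^ k) x := fun k => by
      induction k with
      | zero => rfl
      | succ k ih =>
        rw [pow_succ', pow_succ', End.mul_apply, End.mul_apply, ih]
        have : Ms (((M - Ms) ^ k) x) = μ • ((M - Ms) ^ k) x := by
          have h5 : Commute Ms ((M - Ms) ^ k) := ((hcom.symm).sub_right (Commute.refl Ms)).pow_right k
          rw [← End.mul_apply, h5.eq, End.mul_apply, hx, map_smul]
        simp [this]
    rw [key, hm]; rfl

end Jordan

/-! ### The strip -/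

lemma exists_strip {μ : ℂ} (hμ : μ ≠ 0) : ∃ α, InStrip α ∧ eig α = μ := by
  set a : ℂ := -(log μ) / ϖ with ha
  have h2 : (ϖ : ℂ) ≠ 0 := two_pi_I_ne_zero
  refine ⟨a - ((⌈a.re⌉ - 1 : ℤ) : ℂ), ⟨?_, ?_⟩, ?_⟩
  · simp only [Complex.sub_re, Complex.intCast_re]
    push_cast
    linarith [Int.ceil_lt_add_one a.re]
  · simp only [Complex.sub_re, Complex.intCast_re]
    push_cast
    linarith [Int.le_ceil a.re]
  · unfold eig
    rw [mul_sub, neg_sub, Complex.exp_sub, ha, mul_div_cancel₀ _ h2, exp_neg,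
      Complex.exp_log hμ, mul_comm (ϖ : ℂ),
      Complex.exp_int_mul_two_pi_mul_I]
    simp

lemma eig_eq_iff {α β : ℂ} : eig α = eig β ↔ ∃ n : ℤ, α = β + n := by
  unfold eig
  rw [Complex.exp_eq_exp_iff_exists_int]
  have h2 : (ϖ : ℂ) ≠ 0 := two_pi_I_ne_zero
  constructor
  · rintro ⟨n, hn⟩
    refine ⟨-n, ?_⟩
    apply mul_left_cancel₀ h2
    push_cast
    linear_combination -hn
  · rintro ⟨n, rfl⟩; exact ⟨-n, by push_cast; ring⟩

lemma eig_injOn {α β : ℂ} (hα : InStrip α) (hβ : InStrip β) (h : eig α = eig β) : α = β := by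
  obtain ⟨n, rfl⟩ := eig_eq_iff.1 h
  have h1 := hα.1
  have h2 := hα.2
  simp only [Complex.add_re, Complex.intCast_re] at h1 h2
  have h3 : (n : ℝ) < 1 := by linarith [hβ.1]
  have h4 : (-1 : ℝ) < n := by linarith [hβ.2]
  have h5 : n = 0 := by
    have h3' : n < 1 := by exact_mod_cast h3
    have h4' : -1 < n := by exact_mod_cast h4
    omega
  simp [h5]

/-- The logarithm `α` with `Re α ∈ (0,1]` and `e^{-2πiα} = μ`. -/
def stripRep (μ : ℂ) : ℂ := Classical.epsilon fun α => InStrip α ∧ eig α = μ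

lemma stripRep_eig {α : ℂ} (hα : InStrip α) : stripRep (eig α) = α := by
  have h : InStrip (stripRep (eig α)) ∧ eig (stripRep (eig α)) = eig α :=
    Classical.epsilon_spec (p := fun β => InStrip β ∧ eig β = eig α) ⟨α, hα, rfl⟩
  exact eig_injOn h.1 hα h.2

lemma stripRep_spec {μ : ℂ} (hμ : μ ≠ 0) : InStrip (stripRep μ) ∧ eig (stripRep μ) = μ :=
  Classical.epsilon_spec (p := fun β => InStrip β ∧ eig β = μ) (exists_strip hμ)

/-! ### Functions of the semisimple part -/

section Spectral

variable [FiniteDimensional ℂ V]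

/-- The operator which is `f α` on `H_{e^{-2πiα}}`, `Re α ∈ (0,1]`; it is written as a polynomial in
the semisimple part of `M`. -/
def ssOp (M : End ℂ V) (f : ℂ → ℂ) : End ℂ V :=
  aeval (ssPart M)
    (Lagrange.interpolate (ssPart M).finite_hasEigenvalue.toFinset id
      fun μ => f (stripRep μ))

lemma ssOp_apply {M : End ℂ V} (hM : Bijective M) (f : ℂ → ℂ) {α : ℂ}
    (hα : InStrip α) {x : V} (hx : x ∈ genEig M (eig α)) : ssOp M f x = f α • x := by
  rw [mem_genEig_iff hM] at hx
  rcases eq_or_ne x 0 with rfl | hne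
  · simp
  have hev : (ssPart M).HasEigenvalue (eig α) :=
    End.hasEigenvalue_of_hasEigenvector ⟨End.mem_eigenspace_iff.2 hx, hne⟩
  unfold ssOp
  rw [End.aeval_apply_of_mem_apply_eq_smul hx]
  have := Lagrange.eval_interpolate_at_node (F := ℂ) (ι := ℂ) (v := id) (fun μ => f (stripRep μ))
    (s := (ssPart M).finite_hasEigenvalue.toFinset) Function.injective_id.injOn
    (i := eig α) (by simpa using hev)
  rw [id] at this
  rw [this, stripRep_eig hα]

lemma genEig_zero {M : End ℂ V} (hM : Bijective M) : genEig M 0 = ⊥ := by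
  rw [eq_bot_iff]
  intro x hx
  rw [mem_genEig_iff hM, zero_smul] at hx
  exact ((End.isUnit_iff _).1 ((isJordan_parts hM).bijective hM)).1 (by rw [hx, map_zero])

@[elab_as_elim]
lemma strip_ind {M : End ℂ V} (hM : Bijective M) {P : V → Prop}
    (hl : P 0 ∧ ∀ x y, P x → P y → P (x + y))
    (h : ∀ α, InStrip α → ∀ x ∈ genEig M (eig α), P x) (x : V) : P x := by
  have hx : x ∈ ⨆ μ, M.maxGenEigenspace μ := by rw [End.iSup_maxGenEigenspace_eq_top]; trivial
  induction hx using Submodule.iSup_induction' with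
  | mem μ x hx =>
    rcases eq_or_ne μ 0 with rfl | hμ
    · have : x ∈ genEig M 0 := hx
      rw [genEig_zero hM, Submodule.mem_bot] at this
      rw [this]; exact hl.1
    · obtain ⟨α, hα, rfl⟩ := exists_strip hμ
      exact h α hα x hx
  | zero => exact hl.1
  | add x y _ _ hx hy => exact hl.2 x y hx hy

/-- The projection to `H_{e^{-2πiα}}`. -/
def eigProj (M : End ℂ V) (α : ℂ) : End ℂ V := ssOp M fun β => if β = α then 1 else 0

lemma ssOp_mem {M : End ℂ V} {X : Submodule ℂ V} (hX : X.map (ssPart M) ≤ X)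
    (f : ℂ → ℂ) {x : V} (hx : x ∈ X) : ssOp M f x ∈ X := by
  have hX' : ∀ y ∈ X, ssPart M y ∈ X := fun y hy => hX ⟨y, hy, rfl⟩
  obtain ⟨p, hp⟩ : ∃ p, ssOp M f = aeval (ssPart M) p := ⟨_, rfl⟩
  rw [hp]
  clear hp
  induction p using Polynomial.induction_on' with
  | add p q hp hq => rw [map_add]; exact X.add_mem hp hq
  | monomial n a =>
    rw [Polynomial.aeval_monomial, End.mul_apply, algebraMap_end_apply]
    apply X.smul_mem
    induction n with
    | zero => simpa using hx
    | succ n ih => rw [pow_succ', End.mul_apply]; exact hX' _ ih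

lemma eigProj_mem {M : End ℂ V} (hM : Bijective M) {α : ℂ}
    (hα : InStrip α) (x : V) : eigProj M α x ∈ genEig M (eig α) := by
  refine strip_ind hM (by simp +contextual [add_mem]) (fun β hβ x hx => ?_) x
  unfold eigProj
  rw [ssOp_apply hM _ hβ hx]
  split_ifs with h
  · subst h; simpa using hx
  · simp

lemma eigProj_apply {M : End ℂ V} (hM : Bijective M) {α : ℂ}
    (hα : InStrip α) {x : V} (hx : x ∈ genEig M (eig α)) : eigProj M α x = x := by
  unfold eigProj
  rw [ssOp_apply hM _ hα hx]; simp

lemma sum_eigProj {M : End ℂ V} (hM : Bijective M) (x : V) :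
    ∑ μ ∈ (ssPart M).finite_hasEigenvalue.toFinset, eigProj M (stripRep μ) x = x := by
  refine strip_ind hM (by simp +contextual [sum_add_distrib]) (fun α hα x hx => ?_) x
  rcases eq_or_ne x 0 with rfl | hne
  · simp
  have hev : (ssPart M).HasEigenvalue (eig α) :=
    End.hasEigenvalue_of_hasEigenvector ⟨End.mem_eigenspace_iff.2 ((mem_genEig_iff hM).1 hx), hne⟩
  rw [Finset.sum_eq_single_of_mem (eig α) (by simpa using hev)]
  · rw [stripRep_eig hα, eigProj_apply hM hα hx]
  · intro μ hμ hne
    unfold eigProj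
    rw [ssOp_apply hM _ hα hx, if_neg, zero_smul]
    rintro rfl
    apply hne
    have hμ0 : μ ≠ 0 := by
      rintro rfl
      have h1 : (ssPart M).HasEigenvalue 0 := by simpa using hμ
      obtain ⟨y, hy⟩ := h1.exists_hasEigenvector
      have h2 : y ∈ genEig M 0 := (mem_genEig_iff hM).2 (End.mem_eigenspace_iff.1 hy.1)
      rw [genEig_zero hM] at h2; exact hy.2 h2
    exact ((stripRep_spec hμ0).2).symm

lemma inStrip_stripRep {M : End ℂ V} (hM : Bijective M) {μ : ℂ}
    (hμ : (ssPart M).HasEigenvalue μ) : InStrip (stripRep μ) := by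
  apply (stripRep_spec _).1
  rintro rfl
  obtain ⟨y, hy⟩ := hμ.exists_hasEigenvector
  have h2 : y ∈ genEig M 0 := (mem_genEig_iff hM).2 (End.mem_eigenspace_iff.1 hy.1)
  rw [genEig_zero hM] at h2; exact hy.2 h2

/-- A subspace which is stable under the semisimple part is graded by the generalized
eigenspaces. -/
lemma stable_induction {M : End ℂ V} (hM : Bijective M) {X : Submodule ℂ V}
    (hX : X.map (ssPart M) ≤ X) {P : V → Prop}
    (h : ∀ α, InStrip α → ∀ x ∈ genEig M (eig α), x ∈ X → P x) (h0 : P 0)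
    (hadd : ∀ x y, P x → P y → P (x + y)) {x : V} (hx : x ∈ X) : P x := by
  rw [← sum_eigProj hM x]
  apply Finset.sum_induction _ P hadd h0
  intro μ hμ
  have hs := inStrip_stripRep hM (by simpa using hμ)
  exact h _ hs _ (eigProj_mem hM hs x) (ssOp_mem hX _ hx)

lemma end_ext_strip {M : End ℂ V} (hM : Bijective M) {f g : End ℂ V}
    (h : ∀ α, InStrip α → ∀ x ∈ genEig M (eig α), f x = g x) : f = g := by
  ext x
  refine strip_ind hM (by simp +contextual) (fun α hα x hx => ?_) x
  exact h α hα x hx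

lemma genEig_stable {M A : End ℂ V} (hM : Bijective M)
    (hA : Commute (ssPart M) A) {μ : ℂ} {x : V} (hx : x ∈ genEig M μ) :
    A x ∈ genEig M μ := by
  rw [mem_genEig_iff hM] at hx ⊢
  rw [← End.mul_apply, hA.eq, End.mul_apply, hx, map_smul]

lemma nPart_mem {M : End ℂ V} (hM : Bijective M) {μ : ℂ} {x : V}
    (hx : x ∈ genEig M μ) : nPart M x ∈ genEig M μ :=
  genEig_stable hM (commute_parts hM) hx

lemma nPart_pow_mem {M : End ℂ V} (hM : Bijective M) {μ : ℂ}
    {x : V} (hx : x ∈ genEig M μ) (k : ℕ) : (nPart M ^ k) x ∈ genEig M μ :=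
  genEig_stable hM ((commute_parts hM).pow_right k) hx

lemma apply_genEig {M : End ℂ V} (hM : Bijective M) {μ : ℂ} {x : V}
    (hx : x ∈ genEig M μ) : M x = μ • nilExp 1 (nPart M) x := by
  conv_lhs => rw [(isJordan_parts hM).2.2.2, End.mul_apply]
  exact (mem_genEig_iff hM).1 (genEig_stable hM (nilSeries_commute (commute_parts hM) _) hx)

end Spectral

/-! ### Holomorphic functions of `α - N/(2πi)` -/

/-- The coefficients of the power series `x ↦ f (α - x/(2πi))`. -/
def tay (f : ℂ → ℂ) (α : ℂ) (k : ℕ) : ℂ := iteratedDeriv k f α / (k.factorial : ℂ) * (-1 / ϖ) ^ k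

lemma tay_congr {f g : ℂ → ℂ} {α : ℂ} (h : f =ᶠ[𝓝 α] g) : tay f α = tay g α := by
  funext k
  rw [tay, tay, h.iteratedDeriv_eq]

lemma tay_mul {f g : ℂ → ℂ} {α : ℂ} (hf : An f α) (hg : An g α) :
    PowerSeries.mk (tay (fun x => f x * g x) α) =
      PowerSeries.mk (tay f α) * PowerSeries.mk (tay g α) := by
  ext n
  rw [PowerSeries.coeff_mul, coeff_mk, Finset.Nat.sum_antidiagonal_eq_sum_range_succ_mk]
  simp only [coeff_mk]
  rw [tay, iteratedDeriv_fun_mul hf.contDiffAt hg.contDiffAt, Finset.sum_div, sum_mul]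
  refine sum_congr rfl fun i hi => ?_
  have hi' : i ≤ n := Nat.lt_succ_iff.1 (Finset.mem_range.1 hi)
  rw [tay, tay, Nat.cast_choose ℂ hi']
  have h1 : (n.factorial : ℂ) ≠ 0 := by exact_mod_cast n.factorial_ne_zero
  have h2 : (i.factorial : ℂ) ≠ 0 := by exact_mod_cast i.factorial_ne_zero
  have h3 : ((n - i).factorial : ℂ) ≠ 0 := by exact_mod_cast (n - i).factorial_ne_zero
  conv_lhs => rw [show n = i + (n - i) by omega, pow_add, show i + (n - i) = n by omega]
  field_simp

lemma tay_const (c α : ℂ) : PowerSeries.mk (tay (fun _ => c) α) = C c := by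
  ext n
  rw [coeff_mk, tay, iteratedDeriv_const, coeff_C]
  split_ifs with h
  · subst h; simp
  · simp

lemma tay_id (α : ℂ) (k : ℕ) : tay (fun x => x) α k =
    if k = 0 then α else if k = 1 then -1 / ϖ else 0 := by
  rw [tay, iteratedDeriv_fun_id]
  rcases k with _ | _ | k <;> simp

lemma tay_exp (ζ α : ℂ) (k : ℕ) : tay (fun x => exp (ϖ * x * ζ)) α k
    = exp (ϖ * α * ζ) * ((-ζ) ^ k / (k.factorial : ℂ)) := by
  have h2 : (ϖ : ℂ) ≠ 0 := two_pi_I_ne_zero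
  have : (fun x => exp (ϖ * x * ζ)) = fun x => exp ((ϖ * ζ) * x) := by funext x; congr 1; ring
  rw [this, tay, iteratedDeriv_cexp_const_mul]
  beta_reduce
  have h3 : (-ζ) ^ k = (ϖ * ζ) ^ k * (-1 / ϖ) ^ k := by rw [← mul_pow]; congr 1; field_simp
  rw [h3, show (ϖ * ζ) * α = ϖ * α * ζ by ring]; ring

/-- The value `f (α - N/(2πi))` for a function `f` which is holomorphic near `α`. -/
def locEnd (M : End ℂ V) (f : ℂ → ℂ) (α : ℂ) : End ℂ V := nilSeries (tay f α) (nPart M)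

lemma locEnd_congr (M : End ℂ V) {f g : ℂ → ℂ} {α : ℂ} (h : f =ᶠ[𝓝 α] g) :
    locEnd M f α = locEnd M g α := by
  rw [locEnd, locEnd, tay_congr h]

lemma locEnd_commute {M A : End ℂ V} (hA : Commute A (nPart M)) (f : ℂ → ℂ)
    (α : ℂ) : Commute A (locEnd M f α) := nilSeries_commute hA _

lemma locEnd_mem {M : End ℂ V} {X : Submodule ℂ V}
    (hX : ∀ x ∈ X, nPart M x ∈ X) (f : ℂ → ℂ) (α : ℂ) {x : V} (hx : x ∈ X) :
    locEnd M f α x ∈ X := by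
  unfold locEnd nilSeries
  rw [LinearMap.sum_apply]
  refine X.sum_mem fun k hk => ?_
  clear hk
  rw [LinearMap.smul_apply]
  apply X.smul_mem
  induction k with
  | zero => simpa using hx
  | succ n ih => rw [pow_succ', End.mul_apply]; exact hX _ ih

lemma locEnd_exp (M : End ℂ V) (ζ α : ℂ) : locEnd M (fun x => exp (ϖ * x * ζ)) α =
      exp (ϖ * α * ζ) • nilExp (-ζ) (nPart M) := by
  unfold locEnd nilExp nilSeries; simp [smul_sum, tay_exp, smul_smul]

section

variable [FiniteDimensional ℂ V] {M : End ℂ V} (hM : Bijective M)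
include hM

lemma locEnd_mul {f g : ℂ → ℂ} {α : ℂ} (hf : An f α) (hg : An g α) :
    locEnd M f α * locEnd M g α = locEnd M (fun x => f x * g x) α := by
  unfold locEnd
  simp [nilSeries_eq (isNilpotent_nPart hM), tay_mul hf hg]

lemma locEnd_const (c α : ℂ) : locEnd M (fun _ => c) α = c • (1 : End ℂ V) := by
  unfold locEnd
  rw [nilSeries_eq (isNilpotent_nPart hM), tay_const]
  have : (C c : PowerSeries ℂ) = algebraMap ℂ (PowerSeries ℂ) c := rfl
  rw [this, AlgHom.commutes, Algebra.algebraMap_eq_smul_one]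

lemma locEnd_id (α : ℂ) : locEnd M (fun x => x) α =
    α • (1 : End ℂ V) - (1 / ϖ) • nPart M := by
  have h : PowerSeries.mk (tay (fun x => x) α) = C α - C (1 / ϖ) * X := by
    ext k
    rw [coeff_mk, tay_id]
    rcases k with _ | _ | k
    · simp
    · simp [coeff_C, neg_div]
    · simp
  unfold locEnd
  rw [nilSeries_eq (isNilpotent_nPart hM), h, map_sub, map_mul, evalNil_X]
  have h1 : ∀ c : ℂ, (C c : PowerSeries ℂ) = algebraMap ℂ (PowerSeries ℂ) c := fun _ => rfl
  simp [h1, AlgHom.commutes, Algebra.algebraMap_eq_smul_one]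

lemma locEnd_mem_genEig (f : ℂ → ℂ) (α : ℂ) {μ : ℂ} {x : V} (hx : x ∈ genEig M μ) :
    locEnd M f α x ∈ genEig M μ :=
  locEnd_mem (fun _ hy => nPart_mem hM hy) f α hx

end

/-- The operator given by `f_α (α - N/(2πi))` on `H_{e^{-2πiα}}` for `Re α ∈ (0,1]`. -/
def fc [FiniteDimensional ℂ V] (M : End ℂ V) (f : ℂ → ℂ → ℂ) : End ℂ V :=
  ∑ k ∈ Finset.range (finrank ℂ V + 1), ssOp M (fun α => tay (f α) α k) * nPart M ^ k

section

variable [FiniteDimensional ℂ V] {M : End ℂ V} (hM : Bijective M)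

include hM in
lemma fc_apply (f : ℂ → ℂ → ℂ) {α : ℂ} (hα : InStrip α) {x : V} (hx : x ∈ genEig M (eig α)) :
    fc M f x = locEnd M (f α) α x := by
  unfold fc locEnd nilSeries
  rw [LinearMap.sum_apply, LinearMap.sum_apply]
  refine sum_congr rfl fun k _ => ?_
  simp [ssOp_apply hM _ hα (nPart_pow_mem hM hx k)]

lemma fc_mem {X : Submodule ℂ V} (hX : X.map (ssPart M) ≤ X)
    (hN : ∀ x ∈ X, nPart M x ∈ X) (f : ℂ → ℂ → ℂ) {x : V} (hx : x ∈ X) : fc M f x ∈ X := by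
  unfold fc
  rw [LinearMap.sum_apply]
  refine X.sum_mem fun k hk => ?_
  clear hk
  rw [End.mul_apply]
  apply ssOp_mem hX
  induction k with
  | zero => simpa using hx
  | succ n ih => rw [pow_succ', End.mul_apply]; exact hN _ ih

include hM

lemma fc_mem_genEig (f : ℂ → ℂ → ℂ) {α : ℂ} (hα : InStrip α) {x : V}
    (hx : x ∈ genEig M (eig α)) : fc M f x ∈ genEig M (eig α) := by
  rw [fc_apply hM f hα hx]; exact locEnd_mem_genEig hM _ _ hx

lemma fc_mul {f g : ℂ → ℂ → ℂ} (hf : ∀ α, InStrip α → An (f α) α)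
    (hg : ∀ α, InStrip α → An (g α) α) :
    fc M f * fc M g = fc M fun α x => f α x * g α x := by
  apply end_ext_strip hM
  intro α hα x hx
  rw [End.mul_apply, fc_apply hM g hα hx, fc_apply hM _ hα (locEnd_mem_genEig hM _ _ hx),
    fc_apply hM _ hα hx, ← End.mul_apply, locEnd_mul hM (hf α hα) (hg α hα)]

lemma fc_congr {f g : ℂ → ℂ → ℂ} (h : ∀ α, InStrip α → f α =ᶠ[𝓝 α] g α) : fc M f = fc M g := by
  apply end_ext_strip hM
  intro α hα x hx
  simp [fc_apply hM _ hα hx, locEnd_congr M (h α hα)]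

lemma fc_one : fc M (fun _ _ => 1) = 1 := by
  apply end_ext_strip hM
  intro α hα x hx
  simp [fc_apply hM _ hα hx, locEnd_const hM]

lemma fc_comm {f g : ℂ → ℂ → ℂ} (hf : ∀ α, InStrip α → An (f α) α)
    (hg : ∀ α, InStrip α → An (g α) α) : Commute (fc M f) (fc M g) := by
  rw [Commute, SemiconjBy, fc_mul hM hf hg, fc_mul hM hg hf]
  exact fc_congr hM fun α _ => Eventually.of_forall fun x => mul_comm _ _

lemma fc_commute_nPart (f : ℂ → ℂ → ℂ) : Commute (fc M f) (nPart M) := by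
  apply end_ext_strip hM
  intro α hα x hx
  rw [End.mul_apply, End.mul_apply, fc_apply hM _ hα hx,
    fc_apply hM _ hα (nPart_mem hM hx), ← End.mul_apply,
    ← End.mul_apply, (locEnd_commute (Commute.refl _) _ _).eq]

lemma fc_exp_neg_one : fc M (fun _ x => Complex.exp (2 * Real.pi * Complex.I * x * (-1))) = M := by
  apply end_ext_strip hM
  intro α hα x hx
  rw [fc_apply hM _ hα hx, locEnd_exp M, apply_genEig hM hx, neg_neg, LinearMap.smul_apply, eig]
  congr 2
  ring

lemma fc_commute_self {f : ℂ → ℂ → ℂ} (hf : ∀ α, InStrip α → An (f α) α) :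
    Commute (fc M f) M := by
  have := fc_comm hM hf (g := fun _ x => exp (ϖ * x * (-1))) fun α _ => by fun_prop
  rwa [fc_exp_neg_one hM] at this

end

/-! ### The logarithm and its exponential -/

section

variable [FiniteDimensional ℂ V] {M : End ℂ V} (hM : Bijective M)

/-- The logarithm `B` with `M = exp (-2πi B)`, equal to `α - N/(2πi)` on `H_{e^{-2πiα}}`. -/
def logB (M : End ℂ V) : End ℂ V := fc M fun _ x => x

/-- `exp (2πi ζ B)`. -/
def expB (M : End ℂ V) (ζ : ℂ) : End ℂ V := fc M fun _ x => exp (ϖ * x * ζ)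

include hM

lemma expB_apply (ζ : ℂ) {α : ℂ} (hα : InStrip α) {x : V} (hx : x ∈ genEig M (eig α)) :
    expB M ζ x = exp (ϖ * α * ζ) • nilExp (-ζ) (nPart M) x := by
  unfold expB
  rw [fc_apply hM _ hα hx, locEnd_exp M]; rfl

lemma logB_apply {α : ℂ} (hα : InStrip α) {x : V} (hx : x ∈ genEig M (eig α)) :
    logB M x = α • x - (1 / ϖ) • nPart M x := by
  unfold logB
  rw [fc_apply hM _ hα hx, locEnd_id hM]; rfl

lemma expB_add (s t : ℂ) : expB M (s + t) = expB M s * expB M t := by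
  unfold expB
  rw [fc_mul hM (fun α _ => by fun_prop) (fun α _ => by fun_prop)]
  congr 1
  funext _ x
  rw [← exp_add]
  congr 1; ring

lemma expB_zero : expB M 0 = 1 := by
  unfold expB
  rw [← fc_one hM]
  congr 1
  funext _ x
  simp

lemma expB_neg_one : expB M (-1) = M := fc_exp_neg_one hM

lemma expB_neg_mul (s : ℂ) : expB M (-s) * expB M s = 1 := by
  rw [← expB_add hM, neg_add_cancel, expB_zero hM]

lemma expB_mul_neg (s : ℂ) : expB M s * expB M (-s) = 1 := by
  rw [← expB_add hM, add_neg_cancel, expB_zero hM]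

lemma expB_neg_apply (s : ℂ) (x : V) : expB M (-s) (expB M s x) = x := by
  rw [← End.mul_apply, expB_neg_mul hM]; rfl

lemma expB_apply_neg (s : ℂ) (x : V) : expB M s (expB M (-s) x) = x := by
  rw [← End.mul_apply, expB_mul_neg hM]; rfl

lemma expB_add_apply (s t : ℂ) (x : V) : expB M (s + t) x = expB M s (expB M t x) := by
  rw [expB_add hM]; rfl

lemma expB_commute_logB (s : ℂ) : Commute (expB M s) (logB M) :=
  fc_comm hM (fun α _ => by fun_prop) (fun α _ => by fun_prop)

lemma hasDerivAt_expB_zero (ℓ : V →ₗ[ℂ] ℂ) (v : V) :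
    HasDerivAt (fun ζ => ℓ (expB M ζ v)) (ϖ * ℓ (logB M v)) 0 := by
  have h2 : (ϖ : ℂ) ≠ 0 := two_pi_I_ne_zero
  refine strip_ind hM ⟨by simpa using hasDerivAt_const (0 : ℂ) (0 : ℂ), fun x y hx hy => ?_⟩
    (fun α hα x hx => ?_) v
  · have := hx.add hy
    simp only [map_add, mul_add]; exact this
  have h1 : (fun ζ => ℓ (expB M ζ x)) = fun ζ => ∑ k ∈ Finset.range (finrank ℂ V + 1),
      exp (ϖ * α * ζ) * ((-ζ) ^ k / (k.factorial : ℂ)) * ℓ ((nPart M ^ k) x) := by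
    funext ζ
    unfold expB
    rw [fc_apply hM _ hα hx]
    unfold locEnd nilSeries; simp [tay_exp]
  have h3 : 2 * Real.pi * I * ℓ (logB M x) = ∑ k ∈ Finset.range (finrank ℂ V + 1),
        ϖ * tay (fun x => x) α k * ℓ ((nPart M ^ k) x) := by
    unfold logB
    rw [fc_apply hM _ hα hx]
    unfold locEnd nilSeries
    rw [LinearMap.sum_apply, map_sum, Finset.mul_sum]
    refine sum_congr rfl fun k _ => ?_
    rw [LinearMap.smul_apply, map_smul, smul_eq_mul]; ring
  rw [h1, h3]
  apply HasDerivAt.fun_sum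
  intro k _
  apply HasDerivAt.mul_const
  have he : HasDerivAt (fun ζ : ℂ => exp (ϖ * α * ζ)) (ϖ * α) 0 := by
    simpa using ((hasDerivAt_id (0 : ℂ)).const_mul (ϖ * α)).cexp
  have hp : HasDerivAt (fun ζ : ℂ => (-ζ) ^ k / (k.factorial : ℂ)) (if k = 1 then -1 else 0) 0 := by
    have := (((hasDerivAt_id (0 : ℂ)).neg).pow k).div_const (k.factorial : ℂ)
    convert! this using 1
    rcases k with _ | _ | k <;> simp
  have := he.mul hp
  convert! this using 1
  rw [tay_id]
  rcases k with _ | _ | k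
  · simp
  · simp; field_simp
  · simp

lemma hasDerivAt_expB (ℓ : V →ₗ[ℂ] ℂ) (v : V) (ζ : ℂ) :
    HasDerivAt (fun ζ => ℓ (expB M ζ v)) (ϖ * ℓ (logB M (expB M ζ v))) ζ := by
  have h := hasDerivAt_expB_zero hM ℓ (expB M ζ v)
  rw [← sub_self ζ] at h
  have h1 := h.comp_sub_const ζ ζ
  have h2 : (fun s => ℓ (expB M (s - ζ) (expB M ζ v))) = fun s => ℓ (expB M s v) := by
    funext s
    rw [← expB_add_apply hM, sub_add_cancel]
  rwa [h2] at h1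

lemma differentiable_expB (ℓ : V →ₗ[ℂ] ℂ) (v : V) : Differentiable ℂ fun ζ => ℓ (expB M ζ v) :=
  fun ζ => (hasDerivAt_expB hM ℓ v ζ).differentiableAt

end

/-! ### Real structures, forms and isomorphisms -/

/-- The integer `n` with `n - α` in the strip: `2` if `Re α = 1`, and `1` otherwise. -/
def stripN (α : ℂ) : ℤ := 1 + ⌊α.re⌋

lemma stripN_eq_two {α : ℂ} (h : α.re = 1) : stripN α = 2 := by simp [stripN, h]

lemma stripN_eq_one {α : ℂ} (hα : InStrip α) (h : α.re ≠ 1) : stripN α = 1 := by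
  have : ⌊α.re⌋ = 0 := Int.floor_eq_zero_iff.2 ⟨hα.1.le, lt_of_le_of_ne hα.2 h⟩
  simp [stripN, this]

lemma inStrip_sub {α : ℂ} (hα : InStrip α) : InStrip ((stripN α : ℂ) - α) := by
  by_cases h : α.re = 1
  · rw [stripN_eq_two h]
    constructor <;> norm_num [h]
  · rw [stripN_eq_one hα h]
    have := lt_of_le_of_ne hα.2 h
    have h0 := hα.1
    constructor <;> simp <;> linarith

lemma stripN_sub {α : ℂ} (hα : InStrip α) : stripN ((stripN α : ℂ) - α) = stripN α := by
  by_cases h : α.re = 1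
  · rw [stripN_eq_two h]
    apply stripN_eq_two
    simp [h]; norm_num
  · have h2 := inStrip_sub hα
    rw [stripN_eq_one hα h] at h2 ⊢
    apply stripN_eq_one h2
    have h0 := hα.1
    simp only [Int.cast_one, Complex.sub_re, Complex.one_re]
    intro h3; linarith

lemma inStrip_conj {α : ℂ} (hα : InStrip α) : InStrip (Cj α) := by simpa [InStrip] using hα

lemma stripN_conj (α : ℂ) : stripN (Cj α) = stripN α := by simp [stripN]

lemma eig_int_sub (n : ℤ) (α : ℂ) : eig ((n : ℂ) - α) = (eig α)⁻¹ := by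
  have h : eig ((n : ℂ) - α) = eig (-α) := eig_eq_iff.2 ⟨n, by ring⟩
  rw [h, eig, eig, ← exp_neg]
  congr 1; ring

lemma conj_eig (α : ℂ) : Cj (eig α) = eig (-Cj α) := by
  unfold eig
  rw [← Complex.exp_conj]; simp [conj_I, conj_ofReal, map_ofNat]

lemma eig_sub_conj (n : ℤ) (α : ℂ) : eig ((n : ℂ) - Cj α) = Cj (eig α) := by
  rw [conj_eig]; exact eig_eq_iff.2 ⟨n, by ring⟩

lemma arg_eig {α : ℂ} (hα : InStrip α) : Complex.arg (eig α) = 0 ↔ α.re = 1 := by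
  have h1 : eig α = exp (-(ϖ * (α - 1))) := by
    have : eig α = eig (α - 1) := eig_eq_iff.2 ⟨1, by push_cast; ring⟩
    rw [this]; rfl
  have him : (-(ϖ * (α - 1))).im = 2 * Real.pi * (1 - α.re) := by simp; ring
  constructor
  · intro h
    have h2 : Complex.arg (eig α) = toIocMod Real.two_pi_pos (-Real.pi)
        (-(ϖ * (α - 1))).im := by rw [h1, Complex.arg_exp]
    rw [h, him] at h2
    have h3 := toIocMod_add_toIocDiv_zsmul Real.two_pi_pos (-Real.pi) (2 * Real.pi * (1 - α.re))
    rw [← h2, zero_add, zsmul_eq_mul] at h3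
    have h4 : ((toIocDiv Real.two_pi_pos (-Real.pi) (2 * Real.pi * (1 - α.re)) : ℤ) : ℝ)
        = 1 - α.re := by
      apply mul_right_cancel₀ Real.two_pi_pos.ne'; linarith
    generalize toIocDiv Real.two_pi_pos (-Real.pi) (2 * Real.pi * (1 - α.re)) = m at h4
    have h5 : (0 : ℝ) ≤ m := by rw [h4]; linarith [hα.2]
    have h6 : (m : ℝ) < 1 := by rw [h4]; linarith [hα.1]
    have h7 : m = 0 := by
      have : 0 ≤ m := by exact_mod_cast h5
      have : m < 1 := by exact_mod_cast h6
      omega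
    rw [h7] at h4
    simp at h4; linarith
  · intro h
    rw [h1, Complex.arg_exp, him, h, sub_self, mul_zero, toIocMod_eq_self]
    constructor <;> linarith [Real.pi_pos]

lemma genEig_le_argZero {M : End ℂ V} {α : ℂ} (hα : InStrip α) (h : α.re = 1) :
    genEig M (eig α) ≤ argZero M :=
  le_iSup₂_of_le (eig α) ((arg_eig hα).2 h) le_rfl

lemma genEig_le_argNeZero {M : End ℂ V} {α : ℂ} (hα : InStrip α) (h : α.re ≠ 1) :
    genEig M (eig α) ≤ argNeZero M :=
  le_iSup₂_of_le (eig α) (fun h' => h ((arg_eig hα).1 h')) le_rfl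

section

variable [FiniteDimensional ℂ V] {M : End ℂ V} (hM : Bijective M)

/-- The projection to `H_{arg = 0}` along `H_{arg ≠ 0}`. -/
def projZero (M : End ℂ V) : End ℂ V := ssOp M fun α => if α.re = 1 then 1 else 0

include hM

lemma mem_argZero_iff {x : V} : x ∈ argZero M ↔ projZero M x = x := by
  constructor
  · intro hx
    have : argZero M ≤ LinearMap.ker (projZero M - 1) := by
      refine iSup₂_le fun μ hμ x hx => ?_
      rw [LinearMap.mem_ker, LinearMap.sub_apply, sub_eq_zero, End.one_apply]
      rcases eq_or_ne μ 0 with rfl | h0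
      · rw [genEig_zero hM, Submodule.mem_bot] at hx
        rw [hx, map_zero]
      · obtain ⟨α, hα, rfl⟩ := exists_strip h0
        unfold projZero
        simp [ssOp_apply hM _ hα hx, if_pos ((arg_eig hα).1 hμ)]
    have h := this hx
    rwa [LinearMap.mem_ker, LinearMap.sub_apply, sub_eq_zero] at h
  · intro hx
    rw [← hx]
    clear hx
    refine strip_ind hM (by simp +contextual [add_mem]) (fun α hα x hx => ?_) x
    unfold projZero
    rw [ssOp_apply hM _ hα hx]
    split_ifs with h
    · rw [one_smul]; exact genEig_le_argZero hα h hx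
    · rw [zero_smul]; exact zero_mem _

lemma mem_argNeZero_iff {x : V} : x ∈ argNeZero M ↔ projZero M x = 0 := by
  constructor
  · intro hx
    have : argNeZero M ≤ LinearMap.ker (projZero M) := by
      refine iSup₂_le fun μ hμ x hx => ?_
      rw [LinearMap.mem_ker]
      rcases eq_or_ne μ 0 with rfl | h0
      · rw [genEig_zero hM, Submodule.mem_bot] at hx
        rw [hx, map_zero]
      · obtain ⟨α, hα, rfl⟩ := exists_strip h0
        unfold projZero
        simp [ssOp_apply hM _ hα hx, if_neg (fun h => hμ ((arg_eig hα).2 h))]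
    exact this hx
  · intro hx
    rw [← sub_zero x, ← hx]
    clear hx
    refine strip_ind hM (by simp +contextual [add_mem, add_sub_add_comm])
        (fun α hα x hx => ?_) x
    unfold projZero
    rw [ssOp_apply hM _ hα hx]
    split_ifs with h
    · simp
    · rw [zero_smul, sub_zero]; exact genEig_le_argNeZero hα h hx

end

/-! #### Conjugation -/

section Conj

variable {c : V →ₛₗ[Cj] V}

lemma conj_nilSeries {N N' : End ℂ V} (h : ∀ x, N' (c x) = c (N x)) (a : ℕ → ℂ) (x : V) :
    c (nilSeries a N x) = nilSeries (fun k => starRingEnd ℂ (a k)) N' (c x) := by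
  unfold nilSeries
  rw [LinearMap.sum_apply, LinearMap.sum_apply, map_sum]
  refine sum_congr rfl fun k hk => ?_
  clear hk
  rw [LinearMap.smul_apply, LinearMap.smul_apply, LinearMap.map_smulₛₗ]
  congr 1
  induction k with
  | zero => rfl
  | succ k ih => rw [pow_succ', pow_succ', End.mul_apply, End.mul_apply, ← h, ih]

lemma conj_genEig {M : End ℂ V} (hcM : ∀ a, M (c a) = c (M a)) {μ : ℂ} {x : V}
    (hx : x ∈ genEig M μ) : c x ∈ genEig M (Cj μ) := by
  rw [genEig, End.mem_maxGenEigenspace] at hx ⊢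
  obtain ⟨k, hk⟩ := hx
  refine ⟨k, ?_⟩
  have : ∀ k x, ((M - Cj μ • (1 : End ℂ V)) ^ k) (c x) = c (((M - μ • (1 : End ℂ V)) ^ k) x) := fun k => by
    induction k with
    | zero => intro x; rfl
    | succ k ih =>
      intro x
      rw [pow_succ, pow_succ, End.mul_apply, End.mul_apply, ← ih]
      congr 1; simp [hcM]
  rw [this, hk, map_zero]

/-- The function `x ↦ conj (f (n - conj x))`. -/
def cj (n : ℤ) (f : ℂ → ℂ) (x : ℂ) : ℂ := Cj (f (n - Cj x))

lemma conj_tay (n : ℤ) (f : ℂ → ℂ) (α : ℂ) (k : ℕ) :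
    Cj (tay f α k) = tay (cj n f) (n - Cj α) k := by
  have h : ∀ k, iteratedDeriv k (cj n f) =
      fun x => (-1) ^ k * Cj (iteratedDeriv k f (n - Cj x)) := fun k => by
    induction k with
    | zero => funext x; simp [cj]
    | succ k ih =>
      rw [iteratedDeriv_succ, ih]
      funext x
      have h1 : (fun x => (-1 : ℂ) ^ k * Cj (iteratedDeriv k f (n - Cj x))) =
          fun x => (-1 : ℂ) ^ k * (Cj ∘ iteratedDeriv k f ∘ Cj) (n - x) := by
        funext x; simp
      rw [h1, deriv_const_mul_field, deriv_comp_const_sub, deriv_conj_conj, pow_succ,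
        iteratedDeriv_succ]
      simp
  rw [tay, tay, h]
  simp only [map_mul, map_div₀, map_natCast, map_pow, map_sub, map_intCast, conj_conj,
    sub_sub_cancel, map_neg, map_one, conj_I, conj_ofReal, map_ofNat]
  have : (-1 / (2 * Real.pi * -I) : ℂ) = -1 * (-1 / ϖ) := by field_simp
  rw [this, mul_pow]; ring

lemma conj_mem_genEig {M : End ℂ V} (hcM : ∀ a, M (c a) = c (M a)) {α : ℂ} {x : V} (hx : x ∈ genEig M (eig α)) (n : ℤ) :
    c x ∈ genEig M (eig (n - Cj α)) := by
  rw [eig_sub_conj]; exact conj_genEig hcM hx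

variable [FiniteDimensional ℂ V] {M : End ℂ V} (hM : Bijective M)
  (hcc : ∀ a, c (c a) = a) (hcM : ∀ a, M (c a) = c (M a))
include hM hcM

lemma conj_semisimplePart (x : V) : ssPart M (c x) = c (ssPart M x) := by
  refine strip_ind hM (by simp +contextual) (fun α hα x hx => ?_) x
  rw [(mem_genEig_iff hM).1 hx, (mem_genEig_iff hM).1 (conj_genEig hcM hx), map_smulₛₗ]

include hcc

lemma conj_nilpotentPart (x : V) : nPart M (c x) = c (nPart M x) := by
  set N := nPart M
  obtain ⟨-, hNn, -, hJ⟩ := isJordan_parts hM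
  set N' : End ℂ V := c.comp (N.comp c) with hN'
  have h1 : ∀ x, N' (c x) = c (N x) := fun x => by simp [hN', hcc]
  have h2 : IsNilpotent N' := by
    obtain ⟨k, hk⟩ := hNn
    refine ⟨k, ?_⟩
    have : ∀ k x, (N' ^ k) (c x) = c ((N ^ k) x) := fun k => by
      induction k with
      | zero => intro x; rfl
      | succ k ih => intro x; rw [pow_succ, pow_succ, End.mul_apply, End.mul_apply, ← ih, h1]
    ext x
    rw [← hcc x, this, hk]; simp
  have h3 : nilExp 1 N' = nilExp 1 N := by
    ext x
    have hinj := ((End.isUnit_iff _).1 ((isJordan_parts hM).bijective hM)).1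
    apply hinj
    have h4 : ∀ x, ssPart M (nilExp 1 N x) = M x := fun x => by
      conv_rhs => rw [hJ]
      rfl
    rw [h4, ← hcc x, hcM, ← h4, ← conj_semisimplePart hM hcM]
    congr 1
    unfold nilExp; simp [conj_nilSeries h1]
  have h5 : N' = N := nilExp_injective h2 hNn h3
  rw [← h1, h5]

lemma conj_locEnd (n : ℤ) (f : ℂ → ℂ) (α : ℂ) (x : V) :
    c (locEnd M f α x) = locEnd M (cj n f) (n - Cj α) (c x) := by
  unfold locEnd
  rw [conj_nilSeries (conj_nilpotentPart hM hcc hcM)]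
  congr 2
  funext k
  exact conj_tay n f α k

lemma conj_expB (ζ : ℂ) {α : ℂ} (hα : InStrip α) {x : V} (hx : x ∈ genEig M (eig α)) :
    c (expB M ζ x) = exp (-(ϖ * stripN α * Cj ζ)) • expB M (Cj ζ) (c x) := by
  have hα' : InStrip (stripN α - Cj α) := by simpa using inStrip_conj (inStrip_sub hα)
  unfold expB
  rw [fc_apply hM _ hα hx, conj_locEnd hM hcc hcM (stripN α),
    fc_apply hM _ hα' (conj_mem_genEig hcM hx _)]
  have h1 : cj (stripN α) (fun x => exp (ϖ * x * ζ)) = fun x =>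
      exp (-(ϖ * stripN α * Cj ζ)) * exp (ϖ * x * Cj ζ) := by
    funext x
    rw [cj, ← Complex.exp_conj, ← exp_add]
    congr 1
    simp only [map_mul, map_sub, map_intCast, conj_conj, conj_I, conj_ofReal, map_ofNat]; ring
  rw [h1, ← locEnd_mul hM (f := fun _ => _) analyticAt_const (by fun_prop), locEnd_const hM]
  simp

end Conj

/-! #### Invariant bilinear forms -/

section Form

variable {M : End ℂ V} {S : BilinForm ℂ V} (hS : ∀ a b, S (M a) (M b) = S a b)
include hS

lemma form_genEig_eq_zero {μ ν : ℂ} (h : μ * ν ≠ 1) {a b : V} (ha : a ∈ genEig M μ)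
    (hb : b ∈ genEig M ν) : S a b = 0 := by
  have hstab : ∀ b ∈ genEig M ν, M b ∈ genEig M ν := fun b hb =>
    End.mapsTo_maxGenEigenspace_of_comm (Commute.refl M) ν hb
  rw [genEig, End.mem_maxGenEigenspace] at ha
  obtain ⟨k, hk⟩ := ha
  induction k generalizing a b with
  | zero =>
    have : a = 0 := hk
    rw [this]; simp
  | succ k ih =>
    rw [pow_succ, End.mul_apply] at hk
    have hb' := hb
    rw [genEig, End.mem_maxGenEigenspace] at hb'
    obtain ⟨l, hl⟩ := hb'
    have key : ∀ b ∈ genEig M ν, S a b = μ * S a (M b) := fun b hb => by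
      have h1 := ih (hstab b hb) hk
      rw [← hS]
      simp only [LinearMap.sub_apply, LinearMap.smul_apply, End.one_apply, map_sub,
        map_smul, smul_eq_mul] at h1
      linear_combination h1
    clear ih hk
    induction l generalizing b with
    | zero =>
      have : b = 0 := hl
      rw [this]; simp
    | succ l ih =>
      rw [pow_succ, End.mul_apply] at hl
      have hb2 : (M - ν • (1 : End ℂ V)) b ∈ genEig M ν := by
        simp only [LinearMap.sub_apply, LinearMap.smul_apply, End.one_apply]
        exact Submodule.sub_mem _ (hstab b hb) (smul_mem _ _ hb)
      have h1 := ih hb2 hl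
      have h2 := key b hb
      simp only [LinearMap.sub_apply, LinearMap.smul_apply, End.one_apply, map_sub,
        map_smul, smul_eq_mul] at h1
      have h3 : (1 - μ * ν) * S a b = 0 := by linear_combination h2 + μ * h1
      rcases mul_eq_zero.1 h3 with h4 | h4
      · exact absurd (by linear_combination -h4) h
      · exact h4

lemma form_strip_eq_zero {α β : ℂ} (hα : InStrip α) (hβ : InStrip β)
    (h : β ≠ stripN α - α) {a b : V} (ha : a ∈ genEig M (eig α))
    (hb : b ∈ genEig M (eig β)) : S a b = 0 := by
  apply form_genEig_eq_zero hS _ ha hb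
  intro h1
  apply h
  apply eig_injOn hβ (inStrip_sub hα)
  rw [eig_int_sub]; exact eq_inv_of_mul_eq_one_right h1

variable [FiniteDimensional ℂ V] (hM : Bijective M)
include hM

lemma form_semisimplePart (a b : V) : S (ssPart M a) (ssPart M b) = S a b := by
  refine strip_ind hM (by simp +contextual) (fun α hα a ha => ?_) a
  refine strip_ind hM (by simp +contextual) (fun β hβ b hb => ?_) b
  rw [(mem_genEig_iff hM).1 ha, (mem_genEig_iff hM).1 hb, map_smul, map_smul,
    LinearMap.smul_apply, smul_eq_mul, smul_eq_mul]
  by_cases h : eig α * eig β = 1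
  · linear_combination S a b * h
  · rw [form_genEig_eq_zero hS h ha hb]; simp

lemma form_nPart (a b : V) : S (nPart M a) b = -S a (nPart M b) := by
  obtain ⟨-, hNn, -, hJ⟩ := isJordan_parts hM
  set N := nPart M
  have hU : ∀ a b, S (nilExp 1 N a) (nilExp 1 N b) = S a b := by
    intro a b
    have h4 : ∀ x, ssPart M (nilExp 1 N x) = M x := fun x => by
      conv_rhs => rw [hJ]
      rfl
    rw [← form_semisimplePart hS hM, h4, h4, hS]
  have hinv : nilExp 1 N * nilExp 1 (-N) = 1 := by
    have h1 : nilExp 1 (-N) = evalNil N _ (pow_finrank hNn)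
        (PowerSeries.rescale (-1) (PowerSeries.exp ℂ)) := by
      rw [evalNil_apply, nilExp, nilSeries]
      refine sum_congr rfl fun k _ => ?_
      have h2 : (-N) ^ k = (-1 : ℂ) ^ k • N ^ k := by rw [← smul_pow, neg_one_smul]
      simp [PowerSeries.coeff_rescale, PowerSeries.coeff_exp, h2, smul_smul, mul_comm]
    have h2 := PowerSeries.exp_mul_exp_eq_exp_add (A := ℂ) 1 (-1)
    rw [PowerSeries.rescale_one, add_neg_cancel, PowerSeries.rescale_zero] at h2
    rw [nilExp_one_eq hNn, h1, ← map_mul]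
    simp only [RingHom.id_apply] at h2
    rw [h2]; simp
  have hadj : ∀ a b, S (nilExp 1 N a) b = S a (nilExp 1 (-N) b) := by
    intro a b
    rw [← hU a, ← End.mul_apply, hinv]; rfl
  have hgen : ∀ {m : ℕ} {n n' : End ℂ V} (hn : n ^ m = 0) (hn' : n' ^ m = 0)
      (_ : ∀ a b, S (n a) b = S a (n' b)) (f : PowerSeries ℂ) (a b : V),
      S (evalNil n m hn f a) b = S a (evalNil n' m hn' f b) := by
    intro m n n' hn hn' h f a b
    rw [evalNil_apply, evalNil_apply, LinearMap.sum_apply, LinearMap.sum_apply, map_sum, map_sum,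
      LinearMap.sum_apply]
    refine sum_congr rfl fun k hk => ?_
    clear hk
    simp only [LinearMap.smul_apply, map_smul]
    congr 1
    induction k generalizing a b with
    | zero => rfl
    | succ k ih => rw [pow_succ, pow_succ', End.mul_apply, End.mul_apply, ih, h]
  have := hgen (nilExp_sub_one_pow hNn) (nilExp_sub_one_pow hNn.neg)
    (fun a b => by simp [hadj]) (PowerSeries.log ℂ) a b
  rw [evalNil_log_nilExp hNn, evalNil_log_nilExp hNn.neg] at this
  rw [this]; simp

lemma form_nilpotentPart_pow (k : ℕ) (a b : V) :
    S ((nPart M ^ k) a) b = (-1) ^ k * S a ((nPart M ^ k) b) := by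
  induction k generalizing a b with
  | zero => simp
  | succ k ih =>
    rw [pow_succ, End.mul_apply, ih, form_nPart hS hM, ← End.mul_apply,
      ← pow_succ', pow_succ (nPart M), pow_succ (-1 : ℂ)]
    ring

lemma form_locEnd (n : ℤ) (f : ℂ → ℂ) (α : ℂ) (a b : V) :
    S (locEnd M f α a) b = S a (locEnd M (fun x => f (n - x)) (n - α) b) := by
  unfold locEnd nilSeries
  rw [LinearMap.sum_apply, LinearMap.sum_apply, map_sum, map_sum, LinearMap.sum_apply]
  refine sum_congr rfl fun k _ => ?_
  simp only [LinearMap.smul_apply, map_smul, smul_eq_mul]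
  rw [form_nilpotentPart_pow hS hM]
  have : tay (fun x => f (n - x)) (n - α) k = (-1) ^ k * tay f α k := by
    rw [tay, tay, iteratedDeriv_comp_const_sub]
    simp only [smul_eq_mul, sub_sub_cancel]; ring
  rw [this]; ring

end Form

/-! #### Isomorphisms -/

section Equiv

variable {V' : Type v} [AddCommGroup V'] [Module ℂ V'] {φ : V ≃ₗ[ℂ] V'}

lemma equiv_nilSeries {N : End ℂ V} {N' : End ℂ V'}
    (h : ∀ x, φ (N x) = N' (φ x)) (a : ℕ → ℂ) (x : V) :
    φ (nilSeries a N x) = nilSeries a N' (φ x) := by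
  unfold nilSeries
  rw [LinearMap.sum_apply, LinearMap.sum_apply, map_sum, φ.finrank_eq]
  refine sum_congr rfl fun k hk => ?_
  clear hk
  rw [LinearMap.smul_apply, LinearMap.smul_apply, map_smul]
  congr 1
  induction k with
  | zero => rfl
  | succ k ih => rw [pow_succ', pow_succ', End.mul_apply, End.mul_apply, h, ih]

variable {M : End ℂ V} {M' : End ℂ V'} (hφ : ∀ a, φ (M a) = M' (φ a))
include hφ

lemma equiv_genEig {μ : ℂ} {x : V} : φ x ∈ genEig M' μ ↔ x ∈ genEig M μ := by
  rw [genEig, genEig, End.mem_maxGenEigenspace, End.mem_maxGenEigenspace]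
  have : ∀ k x, ((M' - μ • (1 : End ℂ V')) ^ k) (φ x) = φ (((M - μ • (1 : End ℂ V)) ^ k) x) := fun k => by
    induction k with
    | zero => intro x; rfl
    | succ k ih =>
      intro x
      rw [pow_succ, pow_succ, End.mul_apply, End.mul_apply, ← ih]
      congr 1; simp [hφ]
  simp only [this, map_eq_zero_iff φ φ.injective]

variable [FiniteDimensional ℂ V] [FiniteDimensional ℂ V'] (hM : Bijective M) (hM' : Bijective M')
include hM hM'

lemma equiv_semisimplePart (x : V) : φ (ssPart M x) = ssPart M' (φ x) := by
  refine strip_ind hM (by simp +contextual) (fun α hα x hx => ?_) x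
  simp [(mem_genEig_iff hM).1 hx, (mem_genEig_iff hM').1 ((equiv_genEig hφ).2 hx)]

lemma equiv_nPart (x : V) : φ (nPart M x) = nPart M' (φ x) := by
  set N := nPart M
  obtain ⟨-, hNn, -, hJ⟩ := isJordan_parts hM
  obtain ⟨-, hNn', -, hJ'⟩ := isJordan_parts hM'
  set N' : End ℂ V' := φ.conj N with hN'
  have h1 : ∀ x, φ (N x) = N' (φ x) := fun x => by simp [hN', LinearEquiv.conj_apply]
  have h2 : IsNilpotent N' := by
    obtain ⟨k, hk⟩ := hNn
    refine ⟨k, ?_⟩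
    have : ∀ k x, (N' ^ k) (φ x) = φ ((N ^ k) x) := by
      intro k
      induction k with
      | zero => intro x; rfl
      | succ k ih => intro x; rw [pow_succ, pow_succ, End.mul_apply, End.mul_apply, ← ih, h1]
    ext x
    rw [← φ.apply_symm_apply x, this, hk]; simp
  have h3 : nilExp 1 N' = nilExp 1 (nPart M') := by
    ext x
    obtain ⟨x, rfl⟩ := φ.surjective x
    have hinj := ((End.isUnit_iff _).1 ((isJordan_parts hM').bijective hM')).1
    apply hinj
    have h4 : ∀ x, ssPart M (nilExp 1 N x) = M x := fun x => by
      conv_rhs => rw [hJ]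
      rfl
    have h4' : ∀ x, ssPart M' (nilExp 1 (nPart M') x) = M' x := fun x => by
      conv_rhs => rw [hJ']
      rfl
    rw [h4', ← hφ, ← h4, equiv_semisimplePart hφ hM hM']
    unfold nilExp
    rw [equiv_nilSeries h1]
  rw [h1, nilExp_injective h2 hNn' h3]

lemma equiv_locEnd (f : ℂ → ℂ) (α : ℂ) (x : V) : φ (locEnd M f α x) = locEnd M' f α (φ x) :=
  equiv_nilSeries (equiv_nPart hφ hM hM') _ _

lemma equiv_fc (f : ℂ → ℂ → ℂ) (x : V) : φ (fc M f x) = fc M' f (φ x) := by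
  refine strip_ind hM (by simp +contextual) (fun α hα x hx => ?_) x
  rw [fc_apply hM _ hα hx, fc_apply hM' _ hα ((equiv_genEig hφ).2 hx), equiv_locEnd hφ hM hM']

end Equiv

end

namespace HodgeTuple

variable {w : ℤ} (D : HodgeTuple.{u} w)

instance : FiniteDimensional ℂ D.V := D.finite

/-- The nilpotent part of the monodromy. -/
abbrev N : End ℂ D.V := nPart D.M

end HodgeTuple

/-- The constant `κ_n = -(-1)^w (2πi)^{2-n-w}`. -/
def kap (w n : ℤ) : ℂ := -(-1) ^ w * ϖ ^ (2 - n - w)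

lemma two_pi_I_ne : (ϖ : ℂ) ≠ 0 := two_pi_I_ne_zero

lemma kap_ne_zero (w n : ℤ) : kap w n ≠ 0 :=
  mul_ne_zero (neg_ne_zero.2 (zpow_ne_zero _ (by norm_num))) (zpow_ne_zero _ two_pi_I_ne)

lemma neg_one_zpow_conj (m : ℤ) : Cj ((-1 : ℂ) ^ m) = (-1) ^ m := by simp

lemma neg_one_mul_self (m : ℤ) : (-1 : ℂ) ^ m * (-1) ^ m = 1 := by rw [← mul_zpow]; simp

lemma neg_one_zpow_neg (m : ℤ) : (-1 : ℂ) ^ (-m) = (-1) ^ m := by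
  rw [zpow_neg]
  exact inv_eq_of_mul_eq_one_right (neg_one_mul_self m)

lemma conj_two_pi_I_zpow (m : ℤ) : Cj ((ϖ : ℂ) ^ m) = (-1) ^ m * ϖ ^ m := by
  rw [map_zpow₀, ← mul_zpow]; simp [map_ofNat, conj_ofReal, conj_I]

lemma conj_kap (w n : ℤ) : Cj (kap w n) = (-1) ^ (w + n) * kap w n := by
  have h : (-1 : ℂ) ^ (2 - n - w) = (-1) ^ (w + n) := by
    rw [← neg_one_zpow_neg (w + n), show (2 - n - w) = 2 + -(w + n) by ring,
      zpow_add₀ (by norm_num)]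
    norm_num
  rw [kap, map_mul, conj_two_pi_I_zpow, map_neg, neg_one_zpow_conj, h]; ring

/-- The function `κ_n / (Γ(x) Γ(n-x))`. -/
def psiN (w n : ℤ) (x : ℂ) : ℂ := kap w n * ((Gamma x)⁻¹ * (Gamma (n - x))⁻¹)

lemma an_inv_Gamma (x : ℂ) : An (fun x => (Gamma x)⁻¹) x :=
  Complex.differentiable_one_div_Gamma.analyticAt x

lemma an_inv_Gamma_sub (n : ℤ) (x : ℂ) : An (fun x => (Gamma (n - x))⁻¹) x := by
  have h : Differentiable ℂ fun x => (Gamma (n - x))⁻¹ :=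
    Complex.differentiable_one_div_Gamma.comp (by fun_prop : Differentiable ℂ fun x => (n : ℂ) - x)
  exact h.analyticAt x

lemma an_psiN (w n : ℤ) (x : ℂ) : An (psiN w n) x :=
  analyticAt_const.mul ((an_inv_Gamma x).mul (an_inv_Gamma_sub n x))

lemma psiN_sub (w n : ℤ) (x : ℂ) : psiN w n (n - x) = psiN w n x := by
  rw [psiN, psiN, sub_sub_cancel, mul_comm (Gamma x)⁻¹]

lemma cj_psiN (w n : ℤ) : cj n (psiN w n) = fun x => (-1) ^ (w + n) * psiN w n x := by
  funext x
  simp only [cj, psiN, map_mul, map_inv₀, ← Complex.Gamma_conj, map_sub, map_intCast,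
    conj_conj, sub_sub_cancel, conj_kap]
  ring

lemma analyticAt_Gamma {x : ℂ} (hx : 0 < x.re) : An Gamma x := by
  have h := (an_inv_Gamma x).inv (inv_ne_zero (Gamma_ne_zero_of_re_pos hx))
  have h1 : (fun x => (Gamma x)⁻¹)⁻¹ = Gamma := by funext y; simp
  rwa [h1] at h

lemma analyticAt_Gamma_sub {n : ℤ} {x : ℂ} (hx : 0 < ((n : ℂ) - x).re) :
    An (fun x => Gamma (n - x)) x := by
  have h := (an_inv_Gamma_sub n x).inv (inv_ne_zero (Gamma_ne_zero_of_re_pos hx))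
  have h1 : (fun x => (Gamma (n - x))⁻¹)⁻¹ = fun x => Gamma (n - x) := by funext y; simp
  rwa [h1] at h

lemma inStrip_sub_conj {α : ℂ} (hα : InStrip α) : InStrip ((stripN α : ℂ) - Cj α) := by
  simpa using inStrip_conj (inStrip_sub hα)

lemma stripN_sub_conj {α : ℂ} (hα : InStrip α) : stripN ((stripN α : ℂ) - Cj α) = stripN α := by
  have h := stripN_sub hα
  rw [← stripN_conj] at h; simpa using h

namespace HodgeTuple

variable {w : ℤ} (D : HodgeTuple.{u} w)

lemma S_symm {α β : ℂ} (hα : InStrip α) (hβ : InStrip β) {a b : D.V}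
    (ha : a ∈ genEig D.M (eig α)) (hb : b ∈ genEig D.M (eig β)) :
    D.S a b = (-1) ^ (w + stripN α) * D.S b a := by
  by_cases h : β = stripN α - α
  · subst h
    by_cases h1 : α.re = 1
    · have h2 : ((stripN α : ℂ) - α).re = 1 := by
        rw [stripN_eq_two h1]; simp [h1]; norm_num
      rw [D.S_symm_argZero a (genEig_le_argZero hα h1 ha) b (genEig_le_argZero hβ h2 hb),
        stripN_eq_two h1, zpow_add₀ (by norm_num)]
      norm_num
    · have h2 : ((stripN α : ℂ) - α).re ≠ 1 := fun h2 => by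
        have h3 := stripN_sub hα
        rw [stripN_eq_two h2, stripN_eq_one hα h1] at h3
        norm_num at h3
      rw [D.S_symm_argNeZero a (genEig_le_argNeZero hα h1 ha) b (genEig_le_argNeZero hβ h2 hb),
        stripN_eq_one hα h1, zpow_add₀ (by norm_num), zpow_sub₀ (by norm_num)]
      norm_num
      try ring
  · rw [form_strip_eq_zero D.S_M hα hβ h ha hb]
    have h' : α ≠ stripN β - β := by
      rintro rfl
      apply h
      rw [stripN_sub hβ]; ring
    simp [form_strip_eq_zero D.S_M hβ hα h' hb ha]

/-- The operator which is `κ_n / (Γ(B) Γ(n-B))` on `H_{e^{-2πiα}}`. -/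
def psi : End ℂ D.V := fc D.M fun α => psiN w (stripN α)

/-- The hermitian form `h(a, b) = S(a, ψ conj b)`, which is the pairing `Ŝ` in the trivialization
by elementary sections. -/
def hForm : D.V →ₗ[ℂ] D.V →ₛₗ[Cj] ℂ :=
  LinearMap.mk₂'ₛₗ (RingHom.id ℂ) (Cj) (fun a b => D.S a (D.psi (D.conj b)))
    (by simp) (by simp) (by simp) (by simp)

lemma hForm_apply (a b : D.V) : D.hForm a b = D.S a (D.psi (D.conj b)) := rfl

lemma conj_mem {α : ℂ} {b : D.V} (hb : b ∈ genEig D.M (eig α)) :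
    D.conj b ∈ genEig D.M (eig ((stripN α : ℂ) - Cj α)) :=
  conj_mem_genEig D.M_real hb _

lemma psi_conj_apply {β : ℂ} (hβ : InStrip β) {b : D.V} (hb : b ∈ genEig D.M (eig β)) :
    D.psi (D.conj b) = locEnd D.M (psiN w (stripN β)) (stripN β - Cj β) (D.conj b) := by
  unfold psi
  rw [fc_apply D.M_bij _ (inStrip_sub_conj hβ) (D.conj_mem hb), stripN_sub_conj hβ]

lemma hForm_eq_zero {α β : ℂ} (hα : InStrip α) (hβ : InStrip β) (h : β ≠ Cj α)
    {a b : D.V} (ha : a ∈ genEig D.M (eig α)) (hb : b ∈ genEig D.M (eig β)) :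
    D.hForm a b = 0 := by
  rw [hForm_apply]
  apply form_strip_eq_zero D.S_M hα (inStrip_sub_conj hβ) _ ha
    (fc_mem_genEig D.M_bij _ (inStrip_sub_conj hβ) (D.conj_mem hb))
  intro h1
  apply h
  have h2 : stripN β = stripN α := by
    have := congrArg stripN h1
    rwa [stripN_sub_conj hβ, stripN_sub hα] at this
  rw [h2, sub_right_inj] at h1
  rw [← h1, Complex.conj_conj]

lemma hForm_conj_symm (a b : D.V) : Cj (D.hForm a b) = D.hForm b a := by
  refine strip_ind D.M_bij (by simp +contextual) (fun α hα a ha => ?_) a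
  refine strip_ind D.M_bij (by simp +contextual) (fun β hβ b hb => ?_) b
  by_cases h : β = Cj α
  · subst h
    rw [hForm_apply, hForm_apply, D.psi_conj_apply hβ hb, D.psi_conj_apply hα ha, ← D.S_real,
      conj_locEnd D.M_bij D.conj_conj D.M_real (stripN α), D.conj_conj, stripN_conj,
      Complex.conj_conj, map_sub, map_intCast, sub_sub_cancel, cj_psiN,
      ← locEnd_mul D.M_bij (f := fun _ => _) analyticAt_const (an_psiN _ _ _),
      locEnd_const D.M_bij]
    have h1 := D.S_symm (inStrip_sub_conj hα) hβ (D.conj_mem ha)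
      (locEnd_mem_genEig D.M_bij (psiN w (stripN α)) (Cj α) hb)
    rw [End.mul_apply, LinearMap.smul_apply, End.one_apply, map_smul, smul_eq_mul,
      h1, stripN_sub_conj hα, ← mul_assoc, neg_one_mul_self, one_mul,
      form_locEnd D.S_M D.M_bij (stripN α)]
    congr 2
    congr 1
    funext x
    exact psiN_sub _ _ _
  · rw [D.hForm_eq_zero hα hβ h ha hb, D.hForm_eq_zero hβ hα _ hb ha, map_zero]
    intro h1
    apply h
    rw [h1, Complex.conj_conj]

lemma conj_N (a : D.V) : D.N (D.conj a) = D.conj (D.N a) :=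
  conj_nilpotentPart D.M_bij D.conj_conj D.M_real a

lemma psi_N (a : D.V) : D.psi (D.N a) = D.N (D.psi a) := by
  have := fc_commute_nPart D.M_bij fun α => psiN w (stripN α)
  rw [psi, ← End.mul_apply, this.eq]; rfl

lemma hForm_N (a b : D.V) : D.hForm (D.N a) b = -D.hForm a (D.N b) := by
  rw [hForm_apply, hForm_apply, form_nPart D.S_M D.M_bij, ← D.conj_N, D.psi_N]

lemma hForm_N_pow (k : ℕ) (a b : D.V) :
    D.hForm ((D.N ^ k) a) b = (-1) ^ k * D.hForm a ((D.N ^ k) b) := by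
  induction k generalizing a b with
  | zero => simp
  | succ k ih =>
    rw [pow_succ, End.mul_apply, ih, D.hForm_N, ← End.mul_apply, ← pow_succ',
      pow_succ D.N, pow_succ (-1 : ℂ)]
    ring

lemma hForm_locEnd (f : ℂ → ℂ) {α β : ℂ} (hα : InStrip α) (hβ : InStrip β) {a b : D.V}
    (ha : a ∈ genEig D.M (eig α)) (hb : b ∈ genEig D.M (eig β)) :
    D.hForm (locEnd D.M f α a) b = D.hForm a (locEnd D.M (cj 0 fun x => f (-x)) β b) := by
  by_cases h : β = Cj α
  · subst h
    rw [hForm_apply, hForm_apply, form_locEnd D.S_M D.M_bij (stripN α), D.psi_conj_apply hβ hb,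
      D.psi_conj_apply hβ (locEnd_mem_genEig D.M_bij _ _ hb),
      conj_locEnd D.M_bij D.conj_conj D.M_real (stripN α), stripN_conj, Complex.conj_conj]
    rw [← End.mul_apply, ← End.mul_apply,
      (locEnd_commute (locEnd_commute (Commute.refl _) _ _).symm _ _).eq]
    congr 4
    funext x
    simp [cj]
  · rw [D.hForm_eq_zero hα hβ h (locEnd_mem_genEig D.M_bij _ _ ha) hb,
      D.hForm_eq_zero hα hβ h ha (locEnd_mem_genEig D.M_bij _ _ hb)]

lemma hForm_expB (ζ : ℂ) (a b : D.V) :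
    D.hForm (expB D.M ζ a) b = D.hForm a (expB D.M (-Cj ζ) b) := by
  refine strip_ind D.M_bij (by simp +contextual) (fun α hα a ha => ?_) a
  refine strip_ind D.M_bij (by simp +contextual) (fun β hβ b hb => ?_) b
  unfold expB
  rw [fc_apply D.M_bij _ hα ha, fc_apply D.M_bij _ hβ hb, D.hForm_locEnd _ hα hβ ha hb]
  congr 3
  funext x
  simp only [cj, Int.cast_zero, zero_sub, neg_neg]
  rw [← Complex.exp_conj]
  simp [map_ofNat, Complex.conj_I, Complex.conj_ofReal]

lemma hForm_conj_conj {α : ℂ} (hα : InStrip α) {a : D.V} (ha : a ∈ genEig D.M (eig α))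
    (b : D.V) : D.hForm (D.conj a) (D.conj b) = (-1) ^ (w + stripN α) * Cj (D.hForm a b) := by
  refine strip_ind D.M_bij (by simp +contextual [mul_add]) (fun β hβ b hb => ?_) b
  by_cases h : β = Cj α
  · subst h
    rw [hForm_apply, hForm_apply, D.psi_conj_apply hβ hb, D.conj_conj, ← D.S_real,
      conj_locEnd D.M_bij D.conj_conj D.M_real (stripN α), D.conj_conj, stripN_conj,
      Complex.conj_conj, map_sub, map_intCast, sub_sub_cancel, cj_psiN,
      ← locEnd_mul D.M_bij (f := fun _ => _) analyticAt_const (an_psiN _ _ _),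
      locEnd_const D.M_bij]
    rw [End.mul_apply, LinearMap.smul_apply, End.one_apply, map_smul, smul_eq_mul,
      ← mul_assoc, neg_one_mul_self, one_mul, psi, fc_apply D.M_bij _ hβ hb, stripN_conj]
  · rw [D.hForm_eq_zero hα hβ h ha hb, map_zero, mul_zero]
    apply D.hForm_eq_zero (inStrip_sub_conj hα) (inStrip_sub_conj hβ) _ (D.conj_mem ha)
      (D.conj_mem hb)
    intro h1
    apply h
    have h2 : stripN β = stripN α := by
      have := congrArg stripN h1
      rwa [stripN_sub_conj hβ, stripN_conj, stripN_sub_conj hα] at this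
    rw [h2, map_sub, map_intCast, Complex.conj_conj, sub_right_inj] at h1
    rw [← h1, Complex.conj_conj]

/-- The inverse of `psi`. -/
def psiInv : End ℂ D.V := fc D.M fun α x => (kap w (stripN α))⁻¹ * (Gamma x * Gamma (stripN α - x))

lemma analyticAt_psiInv {α : ℂ} (hα : InStrip α) : An (fun x =>
    (kap w (stripN α))⁻¹ * (Gamma x * Gamma (stripN α - x))) α :=
  analyticAt_const.mul ((analyticAt_Gamma hα.1).mul (analyticAt_Gamma_sub (inStrip_sub hα).1))

lemma eventually_Gamma_ne_zero {α : ℂ} (hα : InStrip α) :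
    ∀ᶠ x in 𝓝 α, Gamma x ≠ 0 ∧ Gamma (stripN α - x) ≠ 0 := by
  have h1 : ∀ᶠ x in 𝓝 α, 0 < x.re :=
    Complex.continuous_re.continuousAt.eventually (lt_mem_nhds hα.1)
  have h2 : ∀ᶠ x in 𝓝 α, 0 < ((stripN α : ℂ) - x).re :=
    (show ContinuousAt (fun x : ℂ => ((stripN α : ℂ) - x).re) α by fun_prop).eventually
      (lt_mem_nhds (inStrip_sub hα).1)
  filter_upwards [h1, h2] with x h1 h2
  exact ⟨Gamma_ne_zero_of_re_pos h1, Gamma_ne_zero_of_re_pos h2⟩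

lemma psi_mul_psiInv : D.psi * D.psiInv = 1 := by
  unfold psi psiInv
  rw [fc_mul D.M_bij (fun α _ => an_psiN _ _ _) fun α hα => analyticAt_psiInv hα,
    ← fc_one D.M_bij]
  apply fc_congr D.M_bij
  intro α hα
  filter_upwards [eventually_Gamma_ne_zero hα] with x hx
  have := kap_ne_zero w (stripN α)
  have h1 := hx.1
  have h2 := hx.2
  simp only [psiN]; field_simp

lemma hForm_nondeg_left {a : D.V} (h : ∀ b, D.hForm a b = 0) : a = 0 := by
  apply D.S_nondeg.1
  intro b
  have h1 := h (D.conj (D.psiInv b))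
  rwa [hForm_apply, D.conj_conj, ← End.mul_apply, D.psi_mul_psiInv] at h1

end HodgeTuple

/-! ### Weight filtrations of nilpotent endomorphisms -/

section Weight

variable {V : Type u} [AddCommGroup V] [Module ℂ V]

lemma neg_pow_mem {V : Type*} [AddCommGroup V] [Module ℂ V] (N : End ℂ V) (X : Submodule ℂ V)
    (l : ℕ) (x : V) : ((-N) ^ l) x ∈ X ↔ (N ^ l) x ∈ X := by
  rcases neg_one_pow_eq_or (End ℂ V) l with h | h <;> simp [neg_pow N, h]

namespace IsWeightFiltration

variable {N : End ℂ V} {c : ℤ} {W : Fil(V)}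

lemma pow_mem (hW : IsWeightFiltration N c W) {k : ℤ} {a : V} (ha : a ∈ W k) (j : ℕ) :
    (N ^ j) a ∈ W (k - 2 * j) := by
  induction j with
  | zero => simpa using ha
  | succ j ih =>
    rw [pow_succ', End.mul_apply]
    have := hW.map_le _ (mem_map_of_mem ih)
    rwa [show k - 2 * (j : ℤ) - 2 = k - 2 * ((j + 1 : ℕ) : ℤ) by push_cast; ring] at this

lemma apply_mem (hW : IsWeightFiltration N c W) {k : ℤ} {a : V} (ha : a ∈ W k) :
    N a ∈ W (k - 2) := hW.map_le _ (mem_map_of_mem ha)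

lemma apply_mem_pred (hW : IsWeightFiltration N c W) {k : ℤ} {a : V} (ha : a ∈ W k) :
    N a ∈ W (k - 1) := hW.mono (by omega) (hW.apply_mem ha)

lemma pow_mem_of_le (hW : IsWeightFiltration N c W) {k m : ℤ} {a : V} (ha : a ∈ W k) (j : ℕ)
    (h : k - 2 * j ≤ m) : (N ^ j) a ∈ W m := hW.mono h (hW.pow_mem ha j)

/-- `W_{c+l} = (N^{l+1})⁻¹ W_{c-l-2}`. -/
lemma mem_add_iff (hW : IsWeightFiltration N c W) (l : ℕ) {a : V} :
    a ∈ W (c + l) ↔ (N ^ (l + 1)) a ∈ W (c - l - 2) := by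
  refine ⟨fun h => hW.pow_mem_of_le h _ (by push_cast; omega), fun h => ?_⟩
  obtain ⟨L, hL⟩ := hW.exists_top
  have key : ∀ m : ℕ, a ∈ W (c + l + m) → a ∈ W (c + l) := fun m => by
    induction m with
    | zero => simp
    | succ m ih =>
      intro hm
      apply ih
      have h1 : (N ^ (l + m + 1)) a ∈ W (c - ((l + m + 1 : ℕ) : ℤ) - 1) := by
        rw [show l + m + 1 = m + (l + 1) by ring, pow_add, End.mul_apply]
        exact hW.pow_mem_of_le h m (by push_cast; omega)
      have h2 := hW.inj (l + m + 1) a (by convert hm using 2; push_cast; ring) h1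
      convert h2 using 2
      push_cast; ring
  apply key (L - c).toNat
  exact hW.mono (by omega) (hL ▸ trivial : a ∈ W L)

/-- `W_{c-l} = N^l W_{c+l}`. -/
lemma mem_sub_iff (hW : IsWeightFiltration N c W) (l : ℕ) {b : V} :
    b ∈ W (c - l) ↔ ∃ a ∈ W (c + l), (N ^ l) a = b := by
  refine ⟨fun h => ?_, fun ⟨a, ha, h⟩ => h ▸ hW.pow_mem_of_le ha l (by omega)⟩
  obtain ⟨L, hL⟩ := hW.exists_bot
  have key : ∀ (m l : ℕ) (b : V), c - l - m ≤ L → b ∈ W (c - l) →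
      ∃ a ∈ W (c + l), (N ^ l) a = b := fun m => by
    induction m with
    | zero =>
      intro l b hl hb
      have : b ∈ W L := hW.mono (by simpa using hl) hb
      rw [hL, Submodule.mem_bot] at this; exact ⟨0, zero_mem _, by simp [this]⟩
    | succ m ih =>
      intro l b hl hb
      obtain ⟨a, ha, hab⟩ := hW.surj l b hb
      obtain ⟨a', ha', h'⟩ := ih (l + 1) (b - (N ^ l) a) (by push_cast at hl ⊢; omega)
        (by convert hab using 2; push_cast; ring)
      refine ⟨a + N a', add_mem ha (hW.mono (by push_cast; omega) (hW.apply_mem ha')), ?_⟩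
      rw [map_add, ← End.mul_apply, ← pow_succ, h']; abel
  exact key (c - l - L).toNat l b (by omega) h

/-- Functoriality of the weight filtration; it contains the uniqueness. -/
lemma map_apply (hW : IsWeightFiltration N c W) {V' : Type v} [AddCommGroup V'] [Module ℂ V']
    {N' : End ℂ V'} {W' : Fil(V')} (hW' : IsWeightFiltration N' c W')
    {X : V → V'} (h0 : X 0 = 0) (hX : ∀ a, X (N a) = N' (X a)) {k : ℤ} {a : V} (ha : a ∈ W k) :
    X a ∈ W' k := by
  have hXp : ∀ (j : ℕ) a, X ((N ^ j) a) = (N' ^ j) (X a) := fun j => by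
    induction j with
    | zero => simp
    | succ j ih => simp [pow_succ', hX, ih, pow_succ' N']
  obtain ⟨L, hL⟩ := hW.exists_bot
  obtain ⟨L', hL'⟩ := hW'.exists_top
  have key : ∀ m l : ℕ, c - l - m ≤ L → L' ≤ c + l + m →
      (∀ a ∈ W (c + l), X a ∈ W' (c + l)) ∧ ∀ a ∈ W (c - l), X a ∈ W' (c - l) := fun m => by
    induction m with
    | zero =>
      intro l h1 h2
      constructor
      · exact fun a _ => hW'.mono (show L' ≤ c + l by simpa using h2) (hL' ▸ trivial)
      · intro a ha
        have : a ∈ W L := hW.mono (by simpa using h1) ha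
        rw [hL, Submodule.mem_bot] at this; simp [this, h0]
    | succ m ih =>
      intro l h1 h2
      push_cast at h1 h2
      have h3 := (ih (l + 2) (by push_cast; omega) (by push_cast; omega)).2
      have h4 : ∀ a ∈ W (c + l), X a ∈ W' (c + l) := fun a ha => by
        rw [hW'.mem_add_iff, ← hXp]
        rw [hW.mem_add_iff] at ha
        push_cast at h3
        rw [show c - ((l : ℤ) + 2) = c - l - 2 by ring] at h3; exact h3 _ ha
      refine ⟨h4, fun a ha => ?_⟩
      obtain ⟨b, hb, rfl⟩ := (hW.mem_sub_iff l).1 ha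
      rw [hXp]; exact (hW'.mem_sub_iff l).2 ⟨_, h4 b hb, rfl⟩
  have h5 := fun l : ℕ => key ((c - L).toNat + (L' - c).toNat) l (by push_cast; omega)
    (by push_cast; omega)
  rcases le_total c k with h | h
  · have := (h5 (k - c).toNat).1
    rw [show c + ((k - c).toNat : ℤ) = k by omega] at this; exact this a ha
  · have := (h5 (c - k).toNat).2
    rw [show c - ((c - k).toNat : ℤ) = k by omega] at this; exact this a ha

lemma unique (hW : IsWeightFiltration N c W) {W' : Fil(V)}
    (hW' : IsWeightFiltration N c W') : W = W' := by
  funext k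
  ext a
  exact ⟨fun h => hW.map_apply hW' (X := id) rfl (fun _ => rfl) h,
    fun h => hW'.map_apply hW (X := id) rfl (fun _ => rfl) h⟩

lemma shift (hW : IsWeightFiltration N c W) (d : ℤ) :
    IsWeightFiltration N (c + d) fun k => W (k - d) where
  mono := fun i j h => hW.mono (by omega)
  exists_bot := hW.exists_bot.imp' (· + d) (by simp)
  exists_top := hW.exists_top.imp' (· + d) (by simp)
  map_le l := by
    have := hW.map_le (l - d)
    rwa [show l - d - 2 = l - 2 - d by ring] at this
  inj l a := by
    have := hW.inj l a
    rw [show c + d + l - d = c + l by ring, show c + d - l - 1 - d = c - l - 1 by ring,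
      show c + d + l - 1 - d = c + l - 1 by ring]
    exact this
  surj l b := by
    have := hW.surj l b
    rw [show c + d + l - d = c + l by ring, show c + d - l - 1 - d = c - l - 1 by ring,
      show c + d - l - d = c - l by ring]
    exact this

lemma neg (hW : IsWeightFiltration N c W) : IsWeightFiltration (-N) c W where
  mono := hW.mono
  exists_bot := hW.exists_bot
  exists_top := hW.exists_top
  map_le l := by
    rintro _ ⟨a, ha, rfl⟩; exact (W _).neg_mem (hW.apply_mem ha)
  inj l a ha h := by
    apply hW.inj l a ha
    rwa [neg_pow_mem] at h
  surj l b hb := by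
    obtain ⟨a, ha, h⟩ := hW.surj l b hb
    rcases neg_one_pow_eq_or (End ℂ V) l with h1 | h1
    · exact ⟨a, ha, by rw [neg_pow, h1]; simpa using h⟩
    · exact ⟨-a, (W _).neg_mem ha, by rw [neg_pow, h1]; simpa using h⟩

/-- `W_k` and `W_l` are orthogonal for `k + l < 0` with respect to any pairing for which `N` is an
infinitesimal isometry. -/
lemma pairing_eq_zero (hW : IsWeightFiltration N 0 W) {h : V → V → ℂ} (h0l : ∀ b, h 0 b = 0)
    (h0r : ∀ a, h a 0 = 0) (hN : ∀ a b, h (N a) b = -h a (N b)) {k l : ℤ} (hkl : k + l < 0)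
    {a b : V} (ha : a ∈ W k) (hb : b ∈ W l) : h a b = 0 := by
  have hNp : ∀ (j : ℕ) a b, h ((N ^ j) a) b = (-1) ^ j * h a ((N ^ j) b) := fun j => by
    induction j with
    | zero => simp
    | succ j ih =>
      intro a b
      rw [pow_succ', End.mul_apply, hN, ih, ← End.mul_apply, ← pow_succ, ← pow_succ',
        pow_succ (-1 : ℂ)]
      ring
  obtain ⟨L, hL⟩ := hW.exists_bot
  have key : ∀ m j : ℕ, -(j : ℤ) - 1 - m ≤ L → (∀ a ∈ W (-(j : ℤ) - 1), ∀ b ∈ W j, h a b = 0) ∧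
      ∀ a ∈ W j, ∀ b ∈ W (-(j : ℤ) - 1), h a b = 0 := fun m => by
    induction m with
    | zero =>
      intro j hj
      have h1 : W (-(j : ℤ) - 1) = ⊥ := by
        rw [eq_bot_iff, ← hL]; exact hW.mono (by simpa using hj)
      rw [h1]
      refine ⟨fun a ha b _ => ?_, fun a _ b hb => ?_⟩
      · rw [(Submodule.mem_bot ℂ).1 ha, h0l]
      · rw [(Submodule.mem_bot ℂ).1 hb, h0r]
    | succ m ih =>
      intro j hj
      push_cast at hj
      obtain ⟨h1, h2⟩ := ih (j + 1) (by push_cast; omega)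
      push_cast at h1 h2
      constructor
      · intro a ha b hb
        obtain ⟨a', ha', rfl⟩ := (hW.mem_sub_iff (j + 1)).1
          (show a ∈ W (0 - ((j + 1 : ℕ) : ℤ)) by convert ha using 2; push_cast; ring)
        rw [hNp, h2 a' (by simpa using ha') _ (hW.pow_mem_of_le hb _ (by push_cast; omega)),
          mul_zero]
      · intro a ha b hb
        obtain ⟨b', hb', rfl⟩ := (hW.mem_sub_iff (j + 1)).1
          (show b ∈ W (0 - ((j + 1 : ℕ) : ℤ)) by convert hb using 2; push_cast; ring)
        have := hNp (j + 1) a b'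
        rw [h1 _ (hW.pow_mem_of_le ha _ (by push_cast; omega)) b' (by simpa using hb')] at this
        exact (mul_eq_zero.1 this.symm).resolve_left (pow_ne_zero _ (by norm_num))
  have h5 := fun j : ℕ => key (-L).toNat j (by omega)
  rcases lt_or_ge k 0 with h | h
  · exact (h5 (-k - 1).toNat).1 a (hW.mono (by omega) ha) b (hW.mono (by omega) hb)
  · exact (h5 k.toNat).2 a (hW.mono (by omega) ha) b (hW.mono (by omega) hb)

end IsWeightFiltration

end Weight

lemma mem_grFil {V : Type u} [AddCommGroup V] [Module ℂ V] {W F : Fil(V)} {k p : ℤ}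
    {x : V} : x ∈ grFil W F k p ↔ ∃ y ∈ F p, y ∈ W k ∧ x - y ∈ W (k - 1) := by
  rw [grFil, Submodule.mem_sup]
  constructor
  · rintro ⟨y, ⟨hy, hy'⟩, z, hz, rfl⟩; exact ⟨y, hy, hy', by simpa using hz⟩
  · rintro ⟨y, hy, hy', hz⟩; exact ⟨y, ⟨hy, hy'⟩, _, hz, by abel⟩

/-! ### Monodromy filtrations -/

section MonodromyFiltration

variable {V : Type u} [AddCommGroup V] [Module ℂ V] [FiniteDimensional ℂ V]
  {M : End ℂ V} (hM : Bijective M)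

/-- The operator `G`, equal to `Γ(α - N/(2πi))` on `H_{e^{-2πiα}}`. -/
def gammaOp (M : End ℂ V) : End ℂ V := fc M fun _ => Gamma

/-- The inverse of `G`. -/
def gammaInv (M : End ℂ V) : End ℂ V := fc M fun _ x => (Gamma x)⁻¹

lemma proj_mem {X : Submodule ℂ V} (hX : X.map (ssPart M) ≤ X) {α : ℂ} {x : V}
    (hx : x ∈ X) : eigProj M α x ∈ X := ssOp_mem hX _ hx

lemma nilSeries_sub_mem {N : End ℂ V} {W : Fil(V)} (hW : Monotone W)
    (hN : ∀ k, ∀ x ∈ W k, N x ∈ W (k - 1)) (a : ℕ → ℂ) {k : ℤ} {x : V} (hx : x ∈ W k) :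
    nilSeries a N x - a 0 • x ∈ W (k - 1) := by
  rw [nilSeries, Finset.sum_range_succ']
  simp only [pow_zero, LinearMap.add_apply, LinearMap.smul_apply, End.one_apply,
    add_sub_cancel_right, LinearMap.sum_apply]
  refine Submodule.sum_mem _ fun j hj => smul_mem _ _ ?_
  clear hj
  induction j with
  | zero => simpa using hN k x hx
  | succ j ih =>
    rw [pow_succ', End.mul_apply]; exact hW (by omega) (hN _ _ ih)

lemma locEnd_sub_mem {W : Fil(V)} (hW : Monotone W)
    (hN : ∀ k, ∀ x ∈ W k, nPart M x ∈ W (k - 1)) (f : ℂ → ℂ) (α : ℂ) {k : ℤ} {x : V}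
    (hx : x ∈ W k) : locEnd M f α x - f α • x ∈ W (k - 1) := by
  have := nilSeries_sub_mem hW hN (tay f α) hx
  have h0 : tay f α 0 = f α := by simp [tay]
  rwa [h0] at this

include hM

lemma gammaOp_apply {α : ℂ} (hα : InStrip α) {x : V} (hx : x ∈ genEig M (eig α)) :
    gammaOp M x = gammaEnd M α x := fc_apply hM _ hα hx

lemma gammaOp_mul_gammaInv : gammaOp M * gammaInv M = 1 := by
  unfold gammaOp gammaInv
  rw [fc_mul hM (fun α hα => analyticAt_Gamma hα.1) fun α _ => an_inv_Gamma α, ← fc_one hM]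
  apply fc_congr hM
  intro α hα
  filter_upwards [HodgeTuple.eventually_Gamma_ne_zero hα] with x hx
  exact mul_inv_cancel₀ hx.1

lemma gammaInv_mul_gammaOp : gammaInv M * gammaOp M = 1 := by
  rw [← gammaOp_mul_gammaInv hM]
  exact (fc_comm hM (fun α _ => an_inv_Gamma α) fun α hα => analyticAt_Gamma hα.1).eq

lemma gammaOp_gammaInv (x : V) : gammaOp M (gammaInv M x) = x := by
  rw [← End.mul_apply, gammaOp_mul_gammaInv hM, End.one_apply]

lemma gammaInv_gammaOp (x : V) : gammaInv M (gammaOp M x) = x := by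
  rw [← End.mul_apply, gammaInv_mul_gammaOp hM, End.one_apply]

/-- The twisted filtration is `G⁻¹ Fᵖ`. -/
lemma mem_twistFil {F : Fil(V)} (hF : ∀ p, (F p).map (ssPart M) ≤ F p)
    {p : ℤ} {x : V} : x ∈ twistFil M F p ↔ gammaOp M x ∈ F p := by
  constructor
  · have h : twistFil M F p ≤ (F p).comap (gammaOp M) := by
      refine iSup₂_le fun α hα => ?_
      rintro y ⟨hy, hy'⟩
      rwa [Submodule.mem_comap, gammaOp_apply hM hα hy]
    exact fun hx => h hx
  · intro hx
    have h : ∀ y ∈ F p, gammaInv M y ∈ twistFil M F p := fun y hy => by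
      refine stable_induction hM (hF p) (P := fun y => gammaInv M y ∈ twistFil M F p) ?_ ?_ ?_ hy
      · intro α hα y hy hy'
        have hy2 : gammaInv M y ∈ genEig M (eig α) := fc_mem_genEig hM _ hα hy
        refine Submodule.mem_iSup_of_mem α (Submodule.mem_iSup_of_mem hα ⟨hy2, ?_⟩)
        change gammaEnd M α (gammaInv M y) ∈ F p
        rwa [← gammaOp_apply hM hα hy2, gammaOp_gammaInv hM]
      · simp
      · intro x y hx hy
        rw [map_add]; exact add_mem hx hy
    have := h _ hx
    rwa [gammaInv_gammaOp hM] at this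

lemma IsMonodromyFiltration.twistFil {F : Fil(V)} (hF : IsMonodromyFiltration M F) :
    IsMonodromyFiltration M (twistFil M F) := by
  have hm := fun {p x} => mem_twistFil hM hF.2.1 (p := p) (x := x)
  refine ⟨⟨fun p q h x hx => ?_, ?_, ?_⟩, ?_, ?_⟩
  · rw [hm] at hx ⊢; exact hF.1.1 h hx
  · obtain ⟨p, hp⟩ := hF.1.2.1
    refine ⟨p, eq_top_iff.2 fun x _ => ?_⟩
    rw [hm, hp]; trivial
  · obtain ⟨p, hp⟩ := hF.1.2.2
    refine ⟨p, eq_bot_iff.2 fun x hx => ?_⟩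
    rw [hm, hp, Submodule.mem_bot] at hx
    rw [Submodule.mem_bot, ← gammaInv_gammaOp hM x, hx, map_zero]
  · rintro p _ ⟨x, hx, rfl⟩
    have hx' := hm.1 hx
    rw [hm]
    have hc : ∀ y, gammaOp M (ssPart M y) = ssPart M (gammaOp M y) := fun y => by
      refine strip_ind hM (by simp +contextual) (fun α hα y hy => ?_) y
      simp [(mem_genEig_iff hM).1 hy, (mem_genEig_iff hM).1 (show gammaOp M y ∈ _ from fc_mem_genEig hM _ hα hy)]
    rw [hc]; exact hF.2.1 p (mem_map_of_mem hx')
  · rintro p _ ⟨x, hx, rfl⟩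
    have hx' := hm.1 hx
    rw [hm, ← End.mul_apply, gammaOp, (fc_commute_nPart hM _).eq]
    exact hF.2.2 p (mem_map_of_mem hx')

lemma IsMonodromyFiltration.conjFil {c : V →ₛₗ[Cj] V} (hcc : ∀ a, c (c a) = a)
    (hcM : ∀ a, M (c a) = c (M a)) {F : Fil(V)} (hF : IsMonodromyFiltration M F) :
    IsMonodromyFiltration M (conjFil c F) := by
  refine ⟨⟨fun p q h x hx => hF.1.1 h hx, ?_, ?_⟩, ?_, ?_⟩
  · exact hF.1.2.1.imp fun p hp => eq_top_iff.2 fun x _ => by simp [PMTS.conjFil, hp]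
  · obtain ⟨p, hp⟩ := hF.1.2.2
    refine ⟨p, eq_bot_iff.2 fun x hx => ?_⟩
    simp only [PMTS.conjFil, hp, Submodule.mem_comap, Submodule.mem_bot] at hx
    rw [Submodule.mem_bot, ← hcc x, hx, map_zero]
  · rintro p _ ⟨x, hx, rfl⟩
    rw [PMTS.conjFil, Submodule.mem_comap, ← conj_semisimplePart hM hcM]
    exact hF.2.1 p (mem_map_of_mem hx)
  · rintro p _ ⟨x, hx, rfl⟩
    rw [PMTS.conjFil, Submodule.mem_comap, ← conj_nilpotentPart hM hcc hcM]
    exact hF.2.2 p (mem_map_of_mem hx)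

/-- Passing from `F` to the twisted filtration does not change the filtrations induced on the graded
pieces of a filtration which `N` lowers: there `G` acts by nonzero scalars. -/
lemma exists_twist_sub_mem {W F : Fil(V)} (hW : Monotone W)
    (hN : ∀ k, ∀ x ∈ W k, nPart M x ∈ W (k - 1))
    (hF : ∀ p, (F p).map (ssPart M) ≤ F p) {α : ℂ} (hα : InStrip α) {x : V}
    (hx : x ∈ genEig M (eig α)) {k : ℤ} (hxk : x ∈ W k) {p : ℤ} :
    (x ∈ twistFil M F p → ∃ y ∈ F p, y ∈ genEig M (eig α) ∧ y ∈ W k ∧ x - y ∈ W (k - 1)) ∧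
    (x ∈ F p → ∃ y ∈ twistFil M F p, y ∈ genEig M (eig α) ∧ y ∈ W k ∧ x - y ∈ W (k - 1)) := by
  have hΓ : Gamma α ≠ 0 := Gamma_ne_zero_of_re_pos hα.1
  have hW' : ∀ (f : ℂ → ℂ → ℂ), f α α ≠ 0 → x - (f α α)⁻¹ • fc M f x ∈ W (k - 1) := fun f hf => by
    rw [fc_apply hM f hα hx]
    have h1 := smul_mem _ (-(f α α)⁻¹) (locEnd_sub_mem hW hN (f α) α hxk)
    rw [smul_sub, smul_smul, neg_mul, inv_mul_cancel₀ hf] at h1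
    convert h1 using 1
    module
  have hmem : ∀ (f : ℂ → ℂ → ℂ), f α α ≠ 0 → (f α α)⁻¹ • fc M f x ∈ W k := fun f hf => by
    have := sub_mem hxk (hW (by omega : k - 1 ≤ k) (hW' f hf))
    rwa [sub_sub_cancel] at this
  constructor
  · intro h
    rw [mem_twistFil hM hF] at h
    exact ⟨(Gamma α)⁻¹ • gammaOp M x, smul_mem _ _ h,
      smul_mem _ _ (fc_mem_genEig hM _ hα hx), hmem (fun _ => Gamma) hΓ,
      hW' (fun _ => Gamma) hΓ⟩
  · intro h
    refine ⟨((Gamma α)⁻¹)⁻¹ • gammaInv M x, smul_mem _ _ ?_,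
      smul_mem _ _ (fc_mem_genEig hM _ hα hx),
      hmem (fun _ x => (Gamma x)⁻¹) (inv_ne_zero hΓ),
      hW' (fun _ x => (Gamma x)⁻¹) (inv_ne_zero hΓ)⟩
    rwa [mem_twistFil hM hF, gammaOp_gammaInv hM]

end MonodromyFiltration

lemma ssOp_comm {V : Type u} [AddCommGroup V] [Module ℂ V] [FiniteDimensional ℂ V]
    {M : End ℂ V} (hM : Bijective M) {A : End ℂ V}
    (hA : ∀ α, InStrip α → ∀ x ∈ genEig M (eig α), A x ∈ genEig M (eig α)) (f : ℂ → ℂ) (x : V) :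
    ssOp M f (A x) = A (ssOp M f x) := by
  refine strip_ind hM (by simp +contextual) (fun α hα x hx => ?_) x
  simp [ssOp_apply hM f hα hx, ssOp_apply hM f hα (hA α hα x hx)]

lemma coe_pow_of_coe {V : Type u} [AddCommGroup V] [Module ℂ V] {U : Submodule ℂ V}
    {n : End ℂ U} {N : End ℂ V} (h : ∀ x, (n x : V) = N x) (k : ℕ) (x : U) :
    (((n ^ k) x : U) : V) = (N ^ k) x := by
  induction k with
  | zero => simp
  | succ k ih => rw [pow_succ', End.mul_apply, h, ih, pow_succ' N, End.mul_apply]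

/-! ### Hodge theoretic data of a tuple -/

namespace HodgeTuple

variable {w : ℤ} (D : HodgeTuple.{u} w)

/-- The generalized eigenspace of `M` with eigenvalue `e^{-2πiα}`. -/
abbrev Hα (α : ℂ) : Submodule ℂ D.V := genEig D.M (eig α)

/-- The filtration which describes the germ of the bundle at `∞`: it is the conjugate of `F` on
`H_{arg ≠ 0}` and the conjugate of `F`, shifted by one, on `H_{arg = 0}`. -/
def Fb (q : ℤ) : Submodule ℂ D.V :=
  (conjFil D.conj D.F (q + 1)).comap (projZero D.M) ⊓
    (conjFil D.conj D.F q).comap (1 - projZero D.M)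

lemma conjFil_fil : IsMonodromyFiltration D.M (conjFil D.conj D.F) :=
  D.F_fil.conjFil D.M_bij D.conj_conj D.M_real

lemma mem_Fb {α : ℂ} (hα : InStrip α) {x : D.V} (hx : x ∈ D.Hα α) {q : ℤ} :
    x ∈ D.Fb q ↔ D.conj x ∈ D.F (q + stripN α - 1) := by
  simp only [Fb, Submodule.mem_inf, Submodule.mem_comap, LinearMap.sub_apply, End.one_apply]
  by_cases h : α.re = 1
  · rw [(mem_argZero_iff D.M_bij).1 (genEig_le_argZero hα h hx), stripN_eq_two h, sub_self]
    simp only [Submodule.zero_mem, and_true]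
    rw [show q + 2 - 1 = q + 1 by ring]; rfl
  · rw [(mem_argNeZero_iff D.M_bij).1 (genEig_le_argNeZero hα h hx), stripN_eq_one hα h,
      sub_zero]
    simp only [Submodule.zero_mem, true_and]
    rw [show q + 1 - 1 = q by ring]; rfl

lemma Fb_ss (q : ℤ) : (D.Fb q).map (ssPart D.M) ≤ D.Fb q := by
  have hc : ∀ y, projZero D.M (ssPart D.M y) = ssPart D.M (projZero D.M y) := fun y => by
    refine strip_ind D.M_bij (by simp +contextual) (fun α hα y hy => ?_) y
    rw [(mem_genEig_iff D.M_bij).1 hy, map_smul, projZero, ssOp_apply D.M_bij _ hα hy, map_smul,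
      (mem_genEig_iff D.M_bij).1 hy, smul_comm]
  rintro _ ⟨x, hx, rfl⟩
  constructor
  · change projZero D.M (ssPart D.M x) ∈ conjFil D.conj D.F (q + 1)
    rw [hc]; exact D.conjFil_fil.2.1 _ (mem_map_of_mem hx.1)
  · change (1 - projZero D.M) (ssPart D.M x) ∈ conjFil D.conj D.F q
    have : (1 - projZero D.M) (ssPart D.M x) =
        ssPart D.M ((1 - projZero D.M) x) := by
      simp [hc]
    rw [this]; exact D.conjFil_fil.2.1 _ (mem_map_of_mem hx.2)

lemma Fb_fil : IsMonodromyFiltration D.M D.Fb := by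
  have hF := D.F_fil
  refine ⟨⟨fun p q h x hx => ⟨hF.1.1 (by omega) hx.1, hF.1.1 h hx.2⟩, ?_, ?_⟩, D.Fb_ss, ?_⟩
  · obtain ⟨p, hp⟩ := hF.1.2.1
    refine ⟨p - 1, eq_top_iff.2 fun x _ => ⟨?_, ?_⟩⟩
    · change D.conj _ ∈ D.F _
      rw [sub_add_cancel, hp]; trivial
    · change D.conj _ ∈ D.F _
      apply hF.1.1 (show p - 1 ≤ p by omega)
      rw [hp]; trivial
  · obtain ⟨p, hp⟩ := hF.1.2.2
    have h0 : ∀ y, D.conj y ∈ D.F p → y = 0 := fun y hy => by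
      rw [hp, Submodule.mem_bot] at hy
      rw [← D.conj_conj y, hy, map_zero]
    refine ⟨p, eq_bot_iff.2 fun x hx => ?_⟩
    have h1 := h0 _ (hF.1.1 (by omega : p ≤ p + 1) hx.1)
    have h2 := h0 _ hx.2
    rwa [LinearMap.sub_apply, End.one_apply, h1, sub_zero] at h2
  · rintro p _ ⟨x, hx, rfl⟩
    refine stable_induction D.M_bij (D.Fb_ss p)
      (P := fun x => nPart D.M x ∈ D.Fb (p - 1)) ?_ ?_ ?_ hx
    · intro α hα x hx hx'
      rw [D.mem_Fb hα hx] at hx'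
      rw [D.mem_Fb hα (nPart_mem D.M_bij hx), ← D.conj_N]
      have := hF.2.2 _ (mem_map_of_mem hx')
      rwa [show p + stripN α - 1 - 1 = p - 1 + stripN α - 1 by ring] at this
    · simp
    · intro x y hx hy
      rw [map_add]; exact add_mem hx hy

/-- The conditions which `F`, the filtration `Fb` at `∞` and the hermitian form have to satisfy on
the spaces `H_{e^{-2πiα}}` with `Re α ∈ (0,1)` (`n = 1`) or `Re α = 1` (`n = 2`), with respect
to the filtration `W`: `Gr_k` is the direct sum of the images of `F^p` and `Fb^{k+w-p}`, `F^p` and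
`Fb^q` are orthogonal for `p + q ≥ w`, and the form is definite on the primitive Hodge pieces. -/
structure IsPart (W : Fil(D.V)) (n : ℤ) : Prop where
  sup : ∀ α, InStrip α → stripN α = n → ∀ k p, ∀ a ∈ D.Hα α, a ∈ W k →
    ∃ x ∈ D.F p, ∃ y ∈ D.Fb (k + w - p), x ∈ D.Hα α ∧ x ∈ W k ∧ y ∈ D.Hα α ∧ y ∈ W k ∧
      a - x - y ∈ W (k - 1)
  inf : ∀ α, InStrip α → stripN α = n → ∀ k p, ∀ x ∈ D.F p, ∀ y ∈ D.Fb (k + w - p),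
    x ∈ D.Hα α → x ∈ W k → y ∈ D.Hα α → y ∈ W k → x - y ∈ W (k - 1) → x ∈ W (k - 1)
  orth : ∀ α, InStrip α → stripN α = n → ∀ p q, w ≤ p + q → ∀ a ∈ D.F p, ∀ b ∈ D.Fb q,
    a ∈ D.Hα α → b ∈ D.Hα (Cj α) → D.hForm a b = 0
  pos : ∀ α, InStrip α → stripN α = n → ∀ (l : ℕ) (p : ℤ), ∀ a ∈ D.Hα α, a ∈ W l →
    a ∉ W (l - 1) → (D.N ^ (l + 1)) a ∈ W (-l - 3) →
    ∀ x ∈ D.F p, ∀ y ∈ D.Fb (l + w - 1 - p), x ∈ D.Hα α → x ∈ W l → y ∈ D.Hα α → y ∈ W l →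
    a - x ∈ W (l - 1) → a - y ∈ W (l - 1) →
    ∃ r : ℝ, 0 < r ∧ I ^ (-(l : ℤ)) * (-1) ^ (w - 1 - p) * D.hForm ((D.N ^ l) a) a = r

/-- `W` is the weight filtration of `N`, and all Hodge theoretic conditions hold with respect
to it. -/
structure IsData (W : Fil(D.V)) : Prop where
  weight : IsWeightFiltration D.N 0 W
  part : ∀ n, D.IsPart W n

lemma IsPart.congr {D : HodgeTuple.{u} w} {W W' : Fil(D.V)} {n : ℤ} (h : D.IsPart W n)
    (hW : ∀ α, InStrip α → stripN α = n → ∀ k, ∀ x ∈ D.Hα α, x ∈ W k ↔ x ∈ W' k) :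
    D.IsPart W' n where
  sup α hα hn k p a ha hak := by
    obtain ⟨x, hx, y, hy, h1, h2, h3, h4, h5⟩ := h.sup α hα hn k p a ha ((hW α hα hn k a ha).2 hak)
    exact ⟨x, hx, y, hy, h1, (hW α hα hn k x h1).1 h2, h3, (hW α hα hn k y h3).1 h4,
      (hW α hα hn _ _ (sub_mem (sub_mem ha h1) h3)).1 h5⟩
  inf α hα hn k p x hx y hy h1 h2 h3 h4 h5 :=
    (hW α hα hn _ x h1).1 (h.inf α hα hn k p x hx y hy h1 ((hW α hα hn k x h1).2 h2) h3
      ((hW α hα hn k y h3).2 h4) ((hW α hα hn _ _ (sub_mem h1 h3)).2 h5))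
  orth := h.orth
  pos α hα hn l p a ha ha1 ha2 ha3 x hx y hy h1 h2 h3 h4 h5 h6 :=
    h.pos α hα hn l p a ha ((hW α hα hn _ a ha).2 ha1) (fun h' => ha2 ((hW α hα hn _ a ha).1 h'))
      ((hW α hα hn _ _ (nPart_pow_mem D.M_bij ha _)).2 ha3) x hx y hy h1
      ((hW α hα hn _ x h1).2 h2) h3 ((hW α hα hn _ y h3).2 h4)
      ((hW α hα hn _ _ (sub_mem ha h1)).2 h5)
      ((hW α hα hn _ _ (sub_mem ha h3)).2 h6)

/-- The projection to the sum of the `H_{e^{-2πiα}}` with `1 + ⌊Re α⌋ = n`. -/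
def projN (n : ℤ) : End ℂ D.V := ssOp D.M fun α => if stripN α = n then 1 else 0

lemma projN_eq {α : ℂ} (hα : InStrip α) {x : D.V} (hx : x ∈ D.Hα α) :
    D.projN (stripN α) x = x := by
  simp [projN, ssOp_apply D.M_bij _ hα hx]

lemma projN_ne {α : ℂ} (hα : InStrip α) {x : D.V} (hx : x ∈ D.Hα α) {n : ℤ}
    (h : stripN α ≠ n) : D.projN n x = 0 := by
  simp [projN, ssOp_apply D.M_bij _ hα hx, if_neg h]

lemma projN_mem {α : ℂ} (hα : InStrip α) {x : D.V} (hx : x ∈ D.Hα α) (n : ℤ) :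
    D.projN n x ∈ D.Hα α := by
  rw [projN, ssOp_apply D.M_bij _ hα hx]; exact smul_mem _ _ hx

lemma projN_projN (n : ℤ) (x : D.V) : D.projN n (D.projN n x) = D.projN n x := by
  refine strip_ind D.M_bij (by simp +contextual) (fun α hα x hx => ?_) x
  by_cases h : stripN α = n
  · rw [← h, D.projN_eq hα hx, D.projN_eq hα hx]
  · simp [D.projN_ne hα hx h]

lemma projN_N (n : ℤ) (x : D.V) : D.projN n (D.N x) = D.N (D.projN n x) := by
  refine strip_ind D.M_bij (by simp +contextual) (fun α hα x hx => ?_) x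
  have := nPart_mem D.M_bij hx
  by_cases h : stripN α = n
  · rw [← h, D.projN_eq hα hx, D.projN_eq hα this]
  · simp [D.projN_ne hα hx h, D.projN_ne hα this h]

lemma projN_conj (n : ℤ) (x : D.V) : D.projN n (D.conj x) = D.conj (D.projN n x) := by
  refine strip_ind D.M_bij (by simp +contextual) (fun α hα x hx => ?_) x
  have h1 := stripN_sub_conj hα
  by_cases h : stripN α = n
  · rw [← h, D.projN_eq hα hx]
    conv_lhs => rw [← h1, D.projN_eq (inStrip_sub_conj hα) (D.conj_mem hx)]
  · rw [D.projN_ne hα hx h,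
      D.projN_ne (inStrip_sub_conj hα) (D.conj_mem hx) (by rwa [h1]), map_zero]

lemma projN_ss (n : ℤ) (x : D.V) :
    D.projN n (ssPart D.M x) = ssPart D.M (D.projN n x) := by
  refine strip_ind D.M_bij (by simp +contextual) (fun α hα x hx => ?_) x
  simp [(mem_genEig_iff D.M_bij).1 hx, (mem_genEig_iff D.M_bij).1 (D.projN_mem hα hx n)]

lemma S_projN (n : ℤ) (x y : D.V) : D.S (D.projN n x) y = D.S x (D.projN n y) := by
  refine strip_ind D.M_bij (by simp +contextual) (fun α hα x hx => ?_) x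
  refine strip_ind D.M_bij (by simp +contextual) (fun β hβ y hy => ?_) y
  by_cases h : β = stripN α - α
  · subst h
    have h1 := stripN_sub hα
    by_cases h : stripN α = n
    · rw [← h, D.projN_eq hα hx]
      conv_rhs => rw [← h1, D.projN_eq hβ hy]
    · rw [D.projN_ne hα hx h, D.projN_ne hβ hy (by rwa [h1])]; simp
  · rw [form_strip_eq_zero D.S_M hα hβ h (D.projN_mem hα hx n) hy,
      form_strip_eq_zero D.S_M hα hβ h hx (D.projN_mem hβ hy n)]

lemma mem_argZero_iff_projN {x : D.V} : x ∈ argZero D.M ↔ D.projN 2 x = x := by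
  have : projZero D.M = D.projN 2 := by
    apply end_ext_strip D.M_bij
    intro α hα x hx
    by_cases h : α.re = 1
    · rw [(mem_argZero_iff D.M_bij).1 (genEig_le_argZero hα h hx), ← stripN_eq_two h,
        D.projN_eq hα hx]
    · rw [(mem_argNeZero_iff D.M_bij).1 (genEig_le_argNeZero hα h hx),
        D.projN_ne hα hx (by rw [stripN_eq_one hα h]; norm_num)]
  rw [mem_argZero_iff D.M_bij, this]

lemma projN_one_add_projN_two (x : D.V) : D.projN 1 x + D.projN 2 x = x := by
  refine strip_ind D.M_bij ⟨by simp, fun x y hx hy => by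
      rw [map_add, map_add, add_add_add_comm, hx, hy]⟩ (fun α hα x hx => ?_) x
  by_cases h : α.re = 1
  · have h1 := stripN_eq_two h
    rw [D.projN_ne hα hx (by rw [h1]; norm_num), zero_add, ← h1, D.projN_eq hα hx]
  · have h1 := stripN_eq_one hα h
    rw [D.projN_ne hα hx (n := 2) (by rw [h1]; norm_num), add_zero, ← h1,
      D.projN_eq hα hx]

lemma mem_argNeZero_iff_projN {x : D.V} : x ∈ argNeZero D.M ↔ D.projN 1 x = x := by
  have : projZero D.M = D.projN 2 := by
    apply end_ext_strip D.M_bij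
    intro α hα x hx
    by_cases h : α.re = 1
    · rw [(mem_argZero_iff D.M_bij).1 (genEig_le_argZero hα h hx), ← stripN_eq_two h,
        D.projN_eq hα hx]
    · rw [(mem_argNeZero_iff D.M_bij).1 (genEig_le_argNeZero hα h hx),
        D.projN_ne hα hx (by rw [stripN_eq_one hα h]; norm_num)]
  rw [mem_argNeZero_iff D.M_bij, this]
  have h := D.projN_one_add_projN_two x
  constructor
  · intro h1
    rwa [h1, add_zero] at h
  · intro h1
    rw [h1] at h; exact left_eq_add.1 h.symm

/-- The relation between the orthogonality of `F` for the form `S`, twisted by the Gamma function,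
and the orthogonality for the hermitian form. -/
lemma S_gammaInv {α : ℂ} (hα : InStrip α) {a b : D.V} (ha : a ∈ D.Hα α) (hb : b ∈ D.Hα (Cj α)) :
    D.hForm a b = kap w (stripN α) * D.S (gammaInv D.M a) (gammaInv D.M (D.conj b)) := by
  have hc := D.conj_mem hb
  rw [stripN_conj, Complex.conj_conj] at hc
  have hs := inStrip_sub hα
  rw [hForm_apply, D.psi_conj_apply (inStrip_conj hα) hb, stripN_conj, Complex.conj_conj,
    gammaInv, fc_apply D.M_bij _ hα ha, fc_apply D.M_bij _ hs hc,
    form_locEnd D.S_M D.M_bij (stripN α), ← End.mul_apply,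
    locEnd_mul D.M_bij (an_inv_Gamma_sub _ _) (an_inv_Gamma _)]
  have h1 : locEnd D.M (psiN w (stripN α)) (stripN α - α) =
      kap w (stripN α) • locEnd D.M (fun x => (Gamma (stripN α - x))⁻¹ *
        (Gamma x)⁻¹) (stripN α - α) := by
    have := locEnd_mul D.M_bij (f := fun _ => kap w (stripN α)) (α := stripN α - α) analyticAt_const
      ((an_inv_Gamma_sub (stripN α) _).mul (an_inv_Gamma _))
    rw [locEnd_const D.M_bij, smul_one_mul] at this
    refine Eq.trans ?_ this.symm
    congr 1
    funext x
    rw [psiN, mul_comm (Gamma x)⁻¹]; rfl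
  simp [h1]

lemma weight_ss {W : Fil(D.V)} (hW : IsWeightFiltration D.N 0 W) {k : ℤ} {x : D.V}
    (hx : x ∈ W k) : ssPart D.M x ∈ W k :=
  hW.map_apply hW (map_zero _)
    (fun a => by rw [← End.mul_apply, (commute_parts D.M_bij).eq]; rfl) hx

lemma weight_conj {W : Fil(D.V)} (hW : IsWeightFiltration D.N 0 W) {k : ℤ} {x : D.V}
    (hx : x ∈ W k) : D.conj x ∈ W k :=
  hW.map_apply hW (map_zero _) (fun a => (D.conj_N a).symm) hx

lemma weight_projN {W : Fil(D.V)} (hW : IsWeightFiltration D.N 0 W) (n : ℤ) {k : ℤ}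
    {x : D.V} (hx : x ∈ W k) : D.projN n x ∈ W k :=
  hW.map_apply hW (map_zero _) (fun a => D.projN_N n a) hx

lemma hForm_weight {W : Fil(D.V)} (hW : IsWeightFiltration D.N 0 W) {k l : ℤ}
    (hkl : k + l < 0) {a b : D.V} (ha : a ∈ W k) (hb : b ∈ W l) : D.hForm a b = 0 :=
  hW.pairing_eq_zero (h := fun a b => D.hForm a b) (by simp) (by simp) D.hForm_N hkl ha hb

/-- `Gr` of the twisted conjugate filtration is `Gr` of the filtration `Fb`. -/
lemma exists_conjTwist_sub_mem {W : Fil(D.V)} (hW : Monotone W)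
    (hN : ∀ k, ∀ x ∈ W k, nPart D.M x ∈ W (k - 1))
    (hc : ∀ k, ∀ x ∈ W k, D.conj x ∈ W k) {α : ℂ} (hα : InStrip α) {x : D.V} (hx : x ∈ D.Hα α)
    {k : ℤ} (hxk : x ∈ W k) {q : ℤ} :
    (x ∈ conjFil D.conj (twistFil D.M D.F) (q + stripN α - 1) →
      ∃ y ∈ D.Fb q, y ∈ D.Hα α ∧ y ∈ W k ∧ x - y ∈ W (k - 1)) ∧
    (x ∈ D.Fb q → ∃ y ∈ conjFil D.conj (twistFil D.M D.F) (q + stripN α - 1),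
      y ∈ D.Hα α ∧ y ∈ W k ∧ x - y ∈ W (k - 1)) := by
  have h := exists_twist_sub_mem D.M_bij hW hN D.F_fil.2.1 (inStrip_sub_conj hα) (D.conj_mem hx)
    (hc k x hxk) (p := q + stripN α - 1)
  have hα' : ∀ y, y ∈ D.Hα ((stripN α : ℂ) - Cj α) → D.conj y ∈ D.Hα α := fun y hy => by
    have := conj_mem_genEig D.M_real hy (stripN α)
    rwa [map_sub, map_intCast, Complex.conj_conj, sub_sub_cancel] at this
  have hsub : ∀ y, D.conj x - y ∈ W (k - 1) → x - D.conj y ∈ W (k - 1) := fun y hy => by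
    have := hc _ _ hy
    rwa [map_sub, D.conj_conj] at this
  constructor
  · intro hx'
    obtain ⟨y, hy, h1, h2, h3⟩ := h.1 hx'
    refine ⟨D.conj y, ?_, hα' y h1, hc k y h2, hsub y h3⟩
    rwa [D.mem_Fb hα (hα' y h1), D.conj_conj]
  · intro hx'
    obtain ⟨y, hy, h1, h2, h3⟩ := h.2 ((D.mem_Fb hα hx).1 hx')
    refine ⟨D.conj y, ?_, hα' y h1, hc k y h2, hsub y h3⟩
    rwa [conjFil, Submodule.mem_comap, D.conj_conj]

/-- The comparison of the two forms on the primitive parts. -/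
lemma hForm_eq_S {W : Fil(D.V)} (hW : Monotone W)
    (hN : ∀ k, ∀ x ∈ W k, nPart D.M x ∈ W (k - 1))
    (hc : ∀ k, ∀ x ∈ W k, D.conj x ∈ W k)
    (hS : ∀ (l : ℕ), ∀ x ∈ W l, ∀ y ∈ W (l - 1), D.S ((D.N ^ l) x) y = 0)
    {α : ℂ} (hα : InStrip α) (hre : Cj α = α)
    (l : ℕ) {a : D.V} (ha : a ∈ D.Hα α) (hal : a ∈ W l) :
    D.hForm ((D.N ^ l) a) a = kap w (stripN α) * ((Gamma α)⁻¹ * (Gamma (stripN α - α))⁻¹) *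
        D.S a (((-D.N) ^ l) (D.conj a)) := by
  rw [hForm_apply, D.psi_conj_apply hα ha, hre]
  have h1 := locEnd_sub_mem hW hN (psiN w (stripN α)) (stripN α - α) (hc _ _ hal)
  have h2 := hS l a hal _ h1
  rw [map_sub, sub_eq_zero] at h2
  rw [h2, map_smul, smul_eq_mul, psiN_sub, psiN, form_nilpotentPart_pow D.S_M D.M_bij, neg_pow D.N l,
    End.mul_apply]
  congr 1
  rcases neg_one_pow_eq_or (End ℂ D.V) l with h | h <;>
    rcases Nat.even_or_odd l with h3 | h3
  · rw [h, h3.neg_one_pow]; simp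
  · rw [h3.neg_one_pow, h3.neg_one_pow]; simp
  · rw [h3.neg_one_pow, h3.neg_one_pow]; simp
  · rw [h, h3.neg_one_pow]; simp

/-- The sign comparison: the factor of the Hodge theoretic positivity condition for `S` and the one
for the hermitian form differ by a positive real number. -/
lemma exists_pos_factor {α : ℂ} (hα : InStrip α) (hre : Cj α = α) (l : ℕ) (p : ℤ) :
    ∃ s : ℝ, 0 < s ∧ I ^ (-(l : ℤ)) * (-1) ^ (w - 1 - p) *
      (kap w (stripN α) * ((Gamma α)⁻¹ * (Gamma (stripN α - α))⁻¹)) =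
      s * I ^ (p - (w + stripN α - 2 + l - p)) := by
  obtain ⟨x, rfl⟩ := Complex.conj_eq_iff_real.1 hre
  have hs := (inStrip_sub hα).1
  have h1 : 0 < Real.Gamma x := Real.Gamma_pos_of_pos (by simpa using hα.1)
  have h2 : 0 < Real.Gamma (stripN (x : ℂ) - x) := Real.Gamma_pos_of_pos (by simpa using hs)
  set n := stripN (x : ℂ)
  have h3 : Gamma ((n : ℂ) - x) = (Real.Gamma (n - x) : ℂ) := by
    rw [← Complex.Gamma_ofReal]
    push_cast; rfl
  refine ⟨(2 * Real.pi) ^ (2 - n - w) * ((Real.Gamma x)⁻¹ * (Real.Gamma (n - x))⁻¹),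
    by positivity, ?_⟩
  rw [h3, Complex.Gamma_ofReal, kap, mul_zpow _ I]
  push_cast
  have h4 : I ^ (p - (w + n - 2 + l - p)) = (-1) ^ p * I ^ (-(l : ℤ)) * I ^ (2 - n - w) := by
    rw [show p - (w + n - 2 + l - p) = p + p + -(l : ℤ) + (2 - n - w) by ring,
      zpow_add₀ Complex.I_ne_zero, zpow_add₀ Complex.I_ne_zero, zpow_add₀ Complex.I_ne_zero,
      ← mul_zpow, Complex.I_mul_I]
  have h5 : (-1 : ℂ) ^ (w - 1 - p) * -(-1) ^ w = (-1) ^ p := by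
    rw [show w - 1 - p = w + -1 + -p by ring, zpow_add₀ (by norm_num), zpow_add₀ (by norm_num),
      neg_one_zpow_neg p, neg_one_zpow_neg 1, zpow_one]
    linear_combination (-1 : ℂ) ^ p * neg_one_mul_self w
  rw [h4, ← h5]; ring

lemma twistFil_fil : IsMonodromyFiltration D.M (twistFil D.M D.F) := D.F_fil.twistFil D.M_bij

lemma gammaInv_mem_twistFil {p : ℤ} {a : D.V} (ha : a ∈ D.F p) :
    gammaInv D.M a ∈ twistFil D.M D.F p := by
  rwa [mem_twistFil D.M_bij D.F_fil.2.1, gammaOp_gammaInv D.M_bij]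

lemma eigProj_N_pow (α : ℂ) (j : ℕ) (x : D.V) :
    eigProj D.M α ((D.N ^ j) x) = (D.N ^ j) (eigProj D.M α x) :=
  ssOp_comm D.M_bij (fun _ _ _ hx => nPart_pow_mem D.M_bij hx j) _ x

lemma projN_N_pow (n : ℤ) (j : ℕ) (x : D.V) : D.projN n ((D.N ^ j) x) = (D.N ^ j) (D.projN n x) :=
  ssOp_comm D.M_bij (fun _ _ _ hx => nPart_pow_mem D.M_bij hx j) _ x

lemma S_pow_conj_eq_zero {α β : ℂ} (hα : InStrip α) (hβ : InStrip β)
    (h : α ≠ Cj β) {a b : D.V} (ha : a ∈ D.Hα α) (hb : b ∈ D.Hα β) (l : ℕ) :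
    D.S a (((-D.N) ^ l) (D.conj b)) = 0 := by
  refine form_strip_eq_zero D.S_M hα (inStrip_sub_conj hβ) (fun h1 => ?_) ha
    ((neg_pow_mem _ _ _ _).2 (nPart_pow_mem D.M_bij (D.conj_mem hb) l))
  have h2 := congrArg stripN h1
  rw [stripN_sub_conj hβ, stripN_sub hα] at h2
  rw [h2, sub_right_inj] at h1; exact h h1.symm

/-! #### Comparison with polarized mixed Hodge structures -/

lemma exists_isPart_of_isPMHSOn {U : Submodule ℂ D.V} {n : ℤ} (hU : ∀ x, x ∈ U ↔ D.projN n x = x)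
    (h : IsPMHSOn (w + n - 2) D.conj D.S (-D.N) (twistFil D.M D.F) U) :
    ∃ (W : Fil(U)) (N : End ℂ U), (∀ x, (N x : D.V) = D.N x) ∧
      IsWeightFiltration N 0 W ∧ D.IsPart (fun k => (W k).map U.subtype) n := by
  obtain ⟨c, nn, hc, hnn, hP⟩ := h
  obtain ⟨W0, hW0, hopp, hpos⟩ := hP.weight
  have hN' : ∀ x, ((-nn) x : D.V) = D.N x := fun x => by simp [hnn]
  have hW' := hW0.neg.shift (-(w + n - 2))
  rw [add_neg_cancel] at hW'
  set W' : Fil(U) := fun k => W0 (k - -(w + n - 2))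
  have hidx : ∀ k j, j = k + (w + n - 2) → W' k = W0 j := fun k j h => by simp only [W', h, sub_neg_eq_add]
  refine ⟨W', -nn, hN', hW', ?_⟩
  have hαU : ∀ {α}, InStrip α → stripN α = n → ∀ {x}, x ∈ D.Hα α → x ∈ U := by
    intro α hα hn x hx
    rw [hU, ← hn]; exact D.projN_eq hα hx
  set W : Fil(D.V) := fun k => (W' k).map U.subtype with hWdef
  have hmem : ∀ {k} (x : U), (x : D.V) ∈ W k ↔ x ∈ W' k := by simp [hWdef]
  have hWU : ∀ {k x}, x ∈ W k → x ∈ U := by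
    rintro k _ ⟨y, -, rfl⟩; exact y.2
  have hmono : Monotone W := fun i j hij => Submodule.map_mono (hW'.mono hij)
  have hN : ∀ k, ∀ x ∈ W k, nPart D.M x ∈ W (k - 1) := by
    rintro k _ ⟨y, hy, rfl⟩; exact ⟨_, hW'.apply_mem_pred hy, hN' y⟩
  have hcW : ∀ k, ∀ x ∈ W k, D.conj x ∈ W k := by
    rintro k _ ⟨y, hy, rfl⟩
    refine ⟨_, hW'.map_apply hW' (X := c) (map_zero _) (fun a => ?_) hy, hc y⟩
    apply Subtype.ext
    rw [hc, hN', hN', hc, D.conj_N]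
  have hssU : ∀ x ∈ U, ssPart D.M x ∈ U := by
    intro x hx
    rw [hU] at hx ⊢
    rw [D.projN_ss, hx]
  have hss : ∀ k, (W k).map (ssPart D.M) ≤ W k := by
    rintro k _ ⟨_, ⟨y, hy, rfl⟩, rfl⟩
    refine ⟨_, hW'.map_apply hW' (X := fun y : U => (⟨_, hssU y y.2⟩ : U)) (by ext; simp)
      (fun a => ?_) hy, rfl⟩
    apply Subtype.ext
    change ssPart D.M (((-nn) a : U) : D.V) = (((-nn) (⟨_, hssU a a.2⟩ : U) : U) : D.V)
    rw [hN' a, hN', ← End.mul_apply, (commute_parts D.M_bij).eq]; rfl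
  have hS : ∀ (l : ℕ), ∀ x ∈ W l, ∀ y ∈ W (l - 1), D.S ((D.N ^ l) x) y = 0 := by
    rintro l _ ⟨x, hx, rfl⟩ _ ⟨y, hy, rfl⟩
    have h1 := hW'.pairing_eq_zero (h := fun a b => D.S a b) (by simp) (by simp)
      (fun a b => by rw [hN', hN', form_nPart D.S_M D.M_bij]) (k := (l : ℤ) - 2 * l)
      (by omega) (hW'.pow_mem hx l) hy
    rwa [coe_pow_of_coe hN'] at h1
  have hmc : ∀ q (u : U), u ∈ conjFil c (fun p => (twistFil D.M D.F p).comap U.subtype) q ↔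
      (u : D.V) ∈ conjFil D.conj (twistFil D.M D.F) q := by
    intro q u
    change ((c u : U) : D.V) ∈ twistFil D.M D.F q ↔ D.conj u ∈ twistFil D.M D.F q
    rw [hc]
  have hsup : ∀ k p, ∀ a ∈ W k, ∃ x ∈ twistFil D.M D.F p,
      ∃ y ∈ conjFil D.conj (twistFil D.M D.F) (k + w + n - 1 - p), x ∈ W k ∧ y ∈ W k ∧
        a - x - y ∈ W (k - 1) := by
    rintro k p _ ⟨a, ha, rfl⟩
    have ha : a ∈ W' k := ha
    rw [hidx k _ rfl, ← (hopp _ p).1, Submodule.mem_sup] at ha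
    obtain ⟨f, hf, g, hg, rfl⟩ := ha
    obtain ⟨x, hx, hxk, hx'⟩ := mem_grFil.1 hf
    obtain ⟨y, hy, hyk, hy'⟩ := mem_grFil.1 hg
    rw [← hidx (k - 1) _ (by ring)] at hx' hy'
    rw [← hidx k _ rfl] at hxk hyk
    refine ⟨x, hx, y, ?_, (hmem _).2 hxk, (hmem _).2 hyk, ?_⟩
    · have := (hmc _ y).1 hy
      rwa [show k + (w + n - 2) + 1 - p = k + w + n - 1 - p by ring] at this
    · convert (hmem _).2 (add_mem hx' hy') using 1
      simp only [subtype_apply, Submodule.coe_add, Submodule.coe_sub]; abel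
  have hinf : ∀ k p, ∀ x ∈ twistFil D.M D.F p,
      ∀ y ∈ conjFil D.conj (twistFil D.M D.F) (k + w + n - 1 - p), x ∈ W k → y ∈ W k →
        x - y ∈ W (k - 1) → x ∈ W (k - 1) := by
    rintro k p _ hx _ hy ⟨x, hxk, rfl⟩ ⟨y, hyk, rfl⟩ hxy
    rw [← map_sub] at hxy
    have hxy := (hmem (x - y)).1 hxy
    replace hxk : x ∈ W' k := hxk
    replace hyk : y ∈ W' k := hyk
    refine (hmem _).2 ?_
    rw [hidx (k - 1) (k + (w + n - 2) - 1) (by ring)] at hxy ⊢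
    rw [hidx k _ rfl] at hxk hyk
    rw [← (hopp _ p).2]
    refine ⟨mem_grFil.2 ⟨x, hx, hxk, by simp⟩, mem_grFil.2 ⟨y, ?_, hyk, hxy⟩⟩
    rwa [hmc, show k + (w + n - 2) + 1 - p = k + w + n - 1 - p by ring]
  have hgr := fun {α} (hα : InStrip α) {x} (hx : x ∈ D.Hα α) {k} (hxk : x ∈ W k) p =>
    exists_twist_sub_mem D.M_bij hmono hN D.F_fil.2.1 hα hx hxk (p := p)
  have hgrc := fun {α} (hα : InStrip α) {x} (hx : x ∈ D.Hα α) {k} (hxk : x ∈ W k) q =>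
    D.exists_conjTwist_sub_mem hmono hN hcW hα hx hxk (q := q)
  constructor
  · intro α hα hn k p a ha hak
    obtain ⟨x, hx, y, hy, hxk, hyk, h1⟩ := hsup k p a hak
    have hx1 := proj_mem (D.twistFil_fil.2.1 p) (α := α) hx
    have hy1 := proj_mem ((D.twistFil_fil.conjFil D.M_bij D.conj_conj D.M_real).2.1 _) (α := α) hy
    have hx2 := proj_mem (hss k) (α := α) hxk
    have hy2 := proj_mem (hss k) (α := α) hyk
    have h2 := proj_mem (hss (k - 1)) (α := α) h1
    rw [map_sub, map_sub, eigProj_apply D.M_bij hα ha] at h2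
    rw [show k + w + n - 1 - p = k + w - p + stripN α - 1 by rw [hn]; ring] at hy1
    obtain ⟨x', hx', h3, h4, h5⟩ := (hgr hα (eigProj_mem D.M_bij hα x) hx2 p).1 hx1
    obtain ⟨y', hy', h6, h7, h8⟩ := (hgrc hα (eigProj_mem D.M_bij hα y) hy2 _).1 hy1
    refine ⟨x', hx', y', hy', h3, h4, h6, h7, ?_⟩
    convert add_mem (add_mem h2 h5) h8 using 1
    abel
  · intro α hα hn k p x hx y hy hxα hxk hyα hyk hxy
    obtain ⟨x', hx', h3, h4, h5⟩ := (hgr hα hxα hxk p).2 hx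
    obtain ⟨y', hy', h6, h7, h8⟩ := (hgrc hα hyα hyk _).2 hy
    rw [show k + w - p + stripN α - 1 = k + w + n - 1 - p by rw [hn]; ring] at hy'
    have h9 : x' - y' ∈ W (k - 1) := by
      convert add_mem (sub_mem hxy h5) h8 using 1
      abel
    convert add_mem (hinf k p x' hx' y' hy' h4 h7 h9) h5 using 1
    abel
  · intro α hα hn p q hpq a ha b hb haα hbα
    have hcb := D.conj_mem hbα
    rw [stripN_conj, Complex.conj_conj] at hcb
    rw [D.mem_Fb (inStrip_conj hα) hbα, stripN_conj, hn] at hb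
    rw [D.S_gammaInv hα haα hbα]
    have h1 := D.gammaInv_mem_twistFil ha
    have h2 := D.twistFil_fil.1.1 (show w + n - 2 + 1 - p ≤ q + n - 1 by omega)
      (D.gammaInv_mem_twistFil hb)
    have h3 := hαU hα hn (fc_mem_genEig D.M_bij _ hα haα : gammaInv D.M a ∈ D.Hα α)
    have h4 := hαU (inStrip_sub hα) (by rw [stripN_sub hα, hn])
      (fc_mem_genEig D.M_bij _ (inStrip_sub hα) hcb : gammaInv D.M (D.conj b) ∈ _)
    have h5 := hP.S_F p ⟨_, h3⟩ h1 ⟨_, h4⟩ h2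
    have h6 : D.S (gammaInv D.M a) (gammaInv D.M (D.conj b)) = 0 := h5
    rw [h6, mul_zero]
  · intro α hα hn l p a haα hal hal' hNa x hx y hy hxα hxl hyα hyl hax hay
    obtain ⟨x', hx', h3, h4, h5⟩ := (hgr hα hxα hxl p).2 hx
    obtain ⟨y', hy', h6, h7, h8⟩ := (hgrc hα hyα hyl _).2 hy
    have haU := hαU hα hn haα
    have hxU := hWU h4
    have hyU := hWU h7
    have hNU : (((nn ^ (l + 1)) ⟨a, haU⟩ : U) : D.V) ∈ W (-l - 3) := by
      rwa [coe_pow_of_coe hnn, neg_pow_mem]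
    obtain ⟨r, hr, hr'⟩ := hpos l p ⟨a, haU⟩
      (by rw [← hidx l _ (by ring)]; exact (hmem ⟨a, haU⟩).1 hal)
      (by rw [← hidx (l - 1) _ (by ring)]; exact fun h => hal' ((hmem ⟨a, haU⟩).2 h))
      (by rw [← hidx (-l - 3) _ (by ring)]; exact (hmem _).1 hNU)
      (by
        refine mem_grFil.2 ⟨⟨x', hxU⟩, hx', ?_, ?_⟩
        · rw [← hidx l _ (by ring)]; exact (hmem ⟨x', hxU⟩).1 h4
        · rw [← hidx (l - 1) _ (by ring)]; exact (hmem _).1 (by simpa using add_mem hax h5))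
      (by
        refine mem_grFil.2 ⟨⟨y', hyU⟩, ?_, ?_, ?_⟩
        · rwa [hmc, show w + n - 2 + l - p = l + w - 1 - p + stripN α - 1 by rw [hn]; ring]
        · rw [← hidx l _ (by ring)]; exact (hmem ⟨y', hyU⟩).1 h7
        · rw [← hidx (l - 1) _ (by ring)]; exact (hmem _).1 (by simpa using add_mem hay h8))
    have hr2 : I ^ (p - (w + n - 2 + l - p)) * D.S a (((-D.N) ^ l) (D.conj a)) = r := by
      rw [← hr']; simp [coe_pow_of_coe hnn, hc]
    have hre : Cj α = α := by
      by_contra hne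
      rw [D.S_pow_conj_eq_zero hα hα (Ne.symm hne) haα haα, mul_zero] at hr2; exact hr.ne (by exact_mod_cast hr2)
    obtain ⟨s, hs, hs'⟩ := exists_pos_factor (w := w) hα hre l p
    refine ⟨s * r, mul_pos hs hr, ?_⟩
    rw [D.hForm_eq_S hmono hN hcW hS hα hre l haα hal, ← mul_assoc, hs', hn]
    push_cast
    rw [← hr2]; ring

lemma S_symm_projN (n : ℤ) (a b : D.V) : D.S (D.projN n a) (D.projN n b) =
    (-1) ^ (w + n) * D.S (D.projN n b) (D.projN n a) := by
  refine strip_ind D.M_bij (by simp +contextual [mul_add]) (fun α hα a ha => ?_) a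
  refine strip_ind D.M_bij (by simp +contextual [mul_add]) (fun β hβ b hb => ?_) b
  by_cases h : stripN α = n
  · rw [D.S_symm hα hβ (D.projN_mem hα ha n) (D.projN_mem hβ hb n), h]
  · rw [D.projN_ne hα ha h]; simp

lemma weight_stable {W : Fil(D.V)} (hW : IsWeightFiltration D.N 0 W) (k : ℤ) :
    (W k).map (ssPart D.M) ≤ W k := by
  rintro _ ⟨x, hx, rfl⟩; exact D.weight_ss hW hx

lemma mem_of_forall_eigProj {X : Submodule ℂ D.V} {x : D.V}
    (h : ∀ α, InStrip α → eigProj D.M α x ∈ X) : x ∈ X := by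
  rw [← sum_eigProj D.M_bij x]
  refine sum_mem fun μ hμ => h _ ?_
  exact inStrip_stripRep D.M_bij (by simpa using hμ)

lemma projN_eigProj (n : ℤ) (α : ℂ) (x : D.V) :
    D.projN n (eigProj D.M α x) = eigProj D.M α (D.projN n x) :=
  (ssOp_comm D.M_bij (fun _ hβ _ hy => D.projN_mem hβ hy n) _ x).symm

/-- A form is positive on a vector `a ∉ X` if it is positive on the components of `a` which are not in
`X`, and if the other components do not contribute. -/
lemma exists_pos_of_eigProj {q : D.V → D.V → ℂ} {X : Submodule ℂ D.V} {a : D.V}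
    (h₁ : ∀ (s : Finset ℂ) (f : ℂ → D.V) b, q (∑ μ ∈ s, f μ) b = ∑ μ ∈ s, q (f μ) b)
    (h₂ : ∀ (s : Finset ℂ) (f : ℂ → D.V) b, q b (∑ μ ∈ s, f μ) = ∑ μ ∈ s, q b (f μ)) (ha : a ∉ X)
    (hoff : ∀ α β, InStrip α → InStrip β → α ≠ β → q (eigProj D.M α a) (eigProj D.M β a) = 0)
    (hzero : ∀ α, InStrip α → eigProj D.M α a ∈ X → q (eigProj D.M α a) (eigProj D.M α a) = 0)
    (hpos : ∀ α, InStrip α → eigProj D.M α a ∉ X →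
      ∃ r : ℝ, 0 < r ∧ q (eigProj D.M α a) (eigProj D.M α a) = r) :
    ∃ r : ℝ, 0 < r ∧ q a a = r := by
  set s := (ssPart D.M).finite_hasEigenvalue.toFinset with hs
  have hstrip : ∀ μ ∈ s, InStrip (stripRep μ) := fun μ hμ =>
    inStrip_stripRep D.M_bij (by simpa [hs] using hμ)
  have hinj : ∀ μ ∈ s, ∀ ν ∈ s, μ ≠ ν → stripRep μ ≠ stripRep ν := fun μ hμ ν hν hne h => by
    apply hne
    have h0 : ∀ μ ∈ s, μ ≠ 0 := fun μ hμ h0 => by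
      have hμ' : (ssPart D.M).HasEigenvalue μ := by simpa [hs] using hμ
      obtain ⟨v, hv⟩ := hμ'.exists_hasEigenvector
      apply hv.2
      have h1 : v ∈ genEig D.M μ := (mem_genEig_iff D.M_bij).2 hv.apply_eq_smul
      rw [h0, genEig_zero D.M_bij] at h1; simpa using h1
    rw [← (stripRep_spec (h0 μ hμ)).2, ← (stripRep_spec (h0 ν hν)).2, h]
  have hsum : q a a = ∑ μ ∈ s, q (eigProj D.M (stripRep μ) a) (eigProj D.M (stripRep μ) a) := by
    have h1 : q a a = ∑ μ ∈ s, ∑ ν ∈ s,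
        q (eigProj D.M (stripRep μ) a) (eigProj D.M (stripRep ν) a) := by
      conv_lhs => rw [← sum_eigProj D.M_bij a, h₁]
      exact sum_congr rfl fun μ _ => h₂ _ _ _
    rw [h1]
    refine sum_congr rfl fun μ hμ => ?_
    rw [sum_eq_single μ]
    · intro ν hν hne
      exact hoff _ _ (hstrip μ hμ) (hstrip ν hν) (hinj _ hμ _ hν hne.symm)
    · intro h; exact absurd hμ h
  have hex : ∃ μ ∈ s, eigProj D.M (stripRep μ) a ∉ X := by
    by_contra hcon
    push Not at hcon
    apply ha
    rw [← sum_eigProj D.M_bij a]; exact sum_mem hcon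
  have hreal : ∀ μ ∈ s, ∃ r : ℝ, 0 ≤ r ∧ (eigProj D.M (stripRep μ) a ∉ X → 0 < r) ∧
      q (eigProj D.M (stripRep μ) a) (eigProj D.M (stripRep μ) a) = r := fun μ hμ => by
    by_cases h : eigProj D.M (stripRep μ) a ∈ X
    · exact ⟨0, le_rfl, fun h' => absurd h h', by rw [hzero _ (hstrip μ hμ) h, Complex.ofReal_zero]⟩
    · obtain ⟨r, hr, hr'⟩ := hpos _ (hstrip μ hμ) h
      exact ⟨r, hr.le, fun _ => hr, hr'⟩
  choose! r hr0 hr1 hr2 using hreal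
  obtain ⟨μ, hμ, hμ'⟩ := hex
  refine ⟨∑ μ ∈ s, r μ, Finset.sum_pos' hr0 ⟨μ, hμ, hr1 μ hμ hμ'⟩, ?_⟩
  rw [hsum, Complex.ofReal_sum]; exact sum_congr rfl hr2

/-- The positivity on the homogeneous elements of the primitive Hodge pieces implies the positivity
on all their elements. -/
lemma IsData.pos {D : HodgeTuple.{u} w} {W : Fil(D.V)} (hD : D.IsData W) {n : ℤ}
    (l : ℕ) (p : ℤ) {a : D.V} (han : D.projN n a = a) (hal : a ∈ W l) (hal' : a ∉ W (l - 1))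
    (hNa : (D.N ^ (l + 1)) a ∈ W (-l - 3)) {x y : D.V} (hx : x ∈ twistFil D.M D.F p)
    (hxl : x ∈ W l) (hax : a - x ∈ W (l - 1))
    (hy : y ∈ conjFil D.conj (twistFil D.M D.F) (w + n - 2 + l - p)) (hyl : y ∈ W l)
    (hay : a - y ∈ W (l - 1)) :
    ∃ r : ℝ, 0 < r ∧ I ^ (p - (w + n - 2 + l - p)) * D.S a (((-D.N) ^ l) (D.conj a)) = r := by
  have hW := hD.weight
  have hN : ∀ k, ∀ x ∈ W k, nPart D.M x ∈ W (k - 1) := fun k x hx => hW.apply_mem_pred hx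
  have hcW : ∀ k, ∀ x ∈ W k, D.conj x ∈ W k := fun k x hx => D.weight_conj hW hx
  have hS : ∀ (l : ℕ), ∀ x ∈ W l, ∀ y ∈ W (l - 1), D.S ((D.N ^ l) x) y = 0 :=
    fun l x hx y hy => hW.pairing_eq_zero (h := fun a b => D.S a b) (by simp) (by simp)
      (form_nPart D.S_M D.M_bij) (k := (l : ℤ) - 2 * l) (by omega) (hW.pow_mem hx l) hy
  have hS' : ∀ (l : ℕ), ∀ x ∈ W (l - 1), ∀ y ∈ W l, D.S x (((-D.N) ^ l) y) = 0 :=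
    fun l x hx y hy => hW.neg.pairing_eq_zero (h := fun a b => D.S a b) (by simp) (by simp)
      (fun a b => by
        simp only [LinearMap.neg_apply, map_neg, neg_neg]
        rw [form_nPart D.S_M D.M_bij, neg_neg])
      (l := (l : ℤ) - 2 * l) (by omega) hx (hW.neg.pow_mem hy l)
  set f := I ^ (p - (w + n - 2 + l - p)) with hf
  set q : D.V → D.V → ℂ := fun a b => f * D.S a (((-D.N) ^ l) (D.conj b)) with hq
  -- the homogeneous components
  have hdiag : ∀ α, InStrip α → eigProj D.M α a ∉ W (l - 1) → Cj α = α ∧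
      ∃ r : ℝ, 0 < r ∧ q (eigProj D.M α a) (eigProj D.M α a) = r := fun α hα hnot => by
    have hmem := eigProj_mem D.M_bij hα a
    have hn : stripN α = n := by
      by_contra hn
      apply hnot
      rw [← han, ← D.projN_eigProj, D.projN_ne hα hmem hn]; exact zero_mem _
    have hl1 := proj_mem (D.weight_stable hW l) (α := α) hal
    have hx1 := proj_mem (D.twistFil_fil.2.1 p) (α := α) hx
    have hy1 := proj_mem ((D.twistFil_fil.conjFil D.M_bij D.conj_conj D.M_real).2.1 _) (α := α) hy
    rw [show w + n - 2 + l - p = l + w - 1 - p + stripN α - 1 by rw [hn]; ring] at hy1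
    have hx2 := proj_mem (D.weight_stable hW l) (α := α) hxl
    have hy2 := proj_mem (D.weight_stable hW l) (α := α) hyl
    have hx3 := proj_mem (D.weight_stable hW (l - 1)) (α := α) hax
    have hy3 := proj_mem (D.weight_stable hW (l - 1)) (α := α) hay
    have hN3 := proj_mem (D.weight_stable hW (-l - 3)) (α := α) hNa
    rw [D.eigProj_N_pow] at hN3
    rw [map_sub] at hx3 hy3
    obtain ⟨x', hx', h3, h4, h5⟩ := (exists_twist_sub_mem D.M_bij hW.mono hN D.F_fil.2.1 hα
      (eigProj_mem D.M_bij hα x) hx2 (p := p)).1 hx1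
    obtain ⟨y', hy', h6, h7, h8⟩ := (D.exists_conjTwist_sub_mem hW.mono hN hcW hα
      (eigProj_mem D.M_bij hα y) hy2).1 hy1
    obtain ⟨r, hr, hr'⟩ := (hD.part n).pos α hα hn l p _ hmem hl1 hnot hN3 x' hx' y' hy' h3 h4 h6
      h7 (by simpa using add_mem hx3 h5) (by simpa using add_mem hy3 h8)
    have hre : Cj α = α := by
      by_contra hne
      rw [D.hForm_eq_zero hα hα (Ne.symm hne)
        (nPart_pow_mem D.M_bij hmem l) hmem, mul_zero] at hr'
      exact hr.ne (by exact_mod_cast hr')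
    obtain ⟨s, hs, hs'⟩ := exists_pos_factor (w := w) hα hre l p
    refine ⟨hre, r / s, div_pos hr hs, ?_⟩
    rw [D.hForm_eq_S hW.mono hN hcW hS hα hre l hmem hl1, ← mul_assoc, hs', hn, ← hf] at hr'
    have hsC : (s : ℂ) ≠ 0 := by exact_mod_cast hs.ne'
    rw [Complex.ofReal_div, eq_div_iff hsC, ← hr']
    simp only [hq]; ring
  have hzero : ∀ α, eigProj D.M α a ∈ W (l - 1) → ∀ b ∈ W l, q (eigProj D.M α a) b = 0 := fun α h b hb => by
    simp [hq, hS' l _ h _ (hcW _ _ hb)]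
  have hoff : ∀ α β, InStrip α → InStrip β → α ≠ β → q (eigProj D.M α a) (eigProj D.M β a) = 0 := fun α β hα hβ hne => by
    by_cases h : eigProj D.M α a ∈ W (l - 1)
    · exact hzero α h _ (proj_mem (D.weight_stable hW l) hal)
    · have hre := (hdiag α hα h).1
      simp only [hq]
      rw [D.S_pow_conj_eq_zero hα hβ _ (eigProj_mem D.M_bij hα a)
        (eigProj_mem D.M_bij hβ a), mul_zero]
      intro h1
      apply hne
      rw [← hre, h1, Complex.conj_conj]
  refine D.exists_pos_of_eigProj (q := q) (by simp [hq, mul_sum]) (by simp [hq, mul_sum])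
    (X := W (l - 1)) hal' hoff (fun α _ h => hzero α h _ (proj_mem (D.weight_stable hW l) hal))
    fun α hα h => (hdiag α hα h).2

/-- All eigenvalues of the monodromy have absolute value one: a primitive vector of pure Hodge type
in `H_{e^{-2πiα}}` pairs non-trivially with itself, and `H_{e^{-2πiα}}` is orthogonal to itself
for non-real `α`. -/
lemma IsData.conj_eq {D : HodgeTuple.{u} w} {W : Fil(D.V)} (hD : D.IsData W) {α : ℂ}
    (hα : InStrip α) (hne : D.Hα α ≠ ⊥) : Cj α = α := by
  have hW := hD.weight
  -- the largest weight which occurs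
  obtain ⟨L, ⟨a, haα, haL, haL'⟩, hmax⟩ := Int.exists_greatest_of_bdd
    (P := fun L => ∃ a ∈ D.Hα α, a ∈ W L ∧ a ∉ W (L - 1)) (by
      obtain ⟨l, hl⟩ := hW.exists_top
      refine ⟨l, fun z ⟨a, _, _, h⟩ => ?_⟩
      by_contra hlt
      apply h
      exact hW.mono (by omega) (hl ▸ trivial : a ∈ W l)) (by
      by_contra hcon
      push Not at hcon
      obtain ⟨l, hl⟩ := hW.exists_top
      obtain ⟨l', hl'⟩ := hW.exists_bot
      obtain ⟨a, ha, ha0⟩ := Submodule.exists_mem_ne_zero_of_ne_bot hne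
      have : ∀ m : ℕ, a ∈ W (l - m) := by
        intro m
        induction m with
        | zero => simp [hl]
        | succ m ih =>
          have := hcon _ a ha ih
          push_cast
          rwa [show l - ((m : ℤ) + 1) = l - m - 1 by ring]
      have h1 := hW.mono (show l - ((l - l').toNat : ℤ) ≤ l' by omega) (this (l - l').toNat)
      rw [hl', Submodule.mem_bot] at h1
      exact ha0 h1)
  have hle : ∀ {b}, b ∈ D.Hα α → b ∈ W L := by
    intro b hb
    by_contra hbL
    obtain ⟨l, hl⟩ := hW.exists_top
    have : ∀ m : ℕ, b ∉ W (L + m) := by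
      intro m
      induction m with
      | zero => simpa using hbL
      | succ m ih =>
        intro h
        have := hmax _ ⟨b, hb, h, by
          push_cast
          rwa [show L + ((m : ℤ) + 1) - 1 = L + m by ring]⟩
        push_cast at this; omega
    apply this (l - L).toNat
    exact hW.mono (by omega) (hl ▸ trivial : b ∈ W l)
  have hlift : ∀ (j : ℕ) b, b ∈ D.Hα α → b ∈ W (-j) → ∃ b' ∈ D.Hα α, b' ∈ W j ∧
      (D.N ^ j) b' = b := by
    intro j b hb hbj
    obtain ⟨b', hb', h⟩ := (hW.mem_sub_iff j).1 (by simpa using hbj)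
    refine ⟨eigProj D.M α b', eigProj_mem D.M_bij hα _,
      proj_mem (D.weight_stable hW _) (by simpa using hb'), ?_⟩
    rw [← D.eigProj_N_pow, h, eigProj_apply D.M_bij hα hb]
  have hL0 : 0 ≤ L := by
    by_contra hlt
    obtain ⟨j, hj⟩ := Int.eq_ofNat_of_zero_le (show 0 ≤ -L by omega)
    obtain ⟨a', ha'α, ha', rfl⟩ := hlift j a haα (by rwa [← hj, neg_neg])
    exact haL' (hW.pow_mem_of_le (hle ha'α) j (by omega))
  obtain ⟨l, rfl⟩ := Int.eq_ofNat_of_zero_le hL0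
  have hprim : ∀ {b}, b ∈ D.Hα α → (D.N ^ (l + 1)) b ∈ W (-l - 3) := by
    intro b hb
    obtain ⟨b', hb', -, h⟩ := hlift (l + 2) _ (nPart_pow_mem D.M_bij hb (l + 1))
      (hW.pow_mem_of_le (hle hb) _ (by push_cast; omega))
    rw [← h]
    exact hW.pow_mem_of_le (hle hb') _ (by push_cast; omega)
  -- the largest Hodge number which occurs
  obtain ⟨p, ⟨x, hxα, hxp, hxl'⟩, hpmax⟩ := Int.exists_greatest_of_bdd
    (P := fun p => ∃ x ∈ D.Hα α, x ∈ D.F p ∧ x ∉ W (l - 1)) (by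
      obtain ⟨p, hp⟩ := D.F_fil.1.2.2
      refine ⟨p, fun z ⟨x, _, hx, h⟩ => ?_⟩
      by_contra hlt
      have h1 : x ∈ D.F p := D.F_fil.1.1 (by omega) hx
      rw [hp, Submodule.mem_bot] at h1
      exact h (h1 ▸ zero_mem _)) (by
      obtain ⟨p, hp⟩ := D.F_fil.1.2.1
      exact ⟨p, a, haα, by rw [hp]; trivial, haL'⟩)
  obtain ⟨x', hx', y, hy, h1, h2, h3, h4, h5⟩ := (hD.part _).sup α hα rfl l (p + 1) x hxα (hle hxα)
  have hx'l : x' ∈ W (l - 1) := by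
    by_contra h
    have := hpmax _ ⟨x', h1, hx', h⟩
    omega
  obtain ⟨r, hr, hr'⟩ := (hD.part _).pos α hα rfl l p x hxα (hle hxα) hxl' (hprim hxα) x hxp y
    (by rwa [show (l : ℤ) + w - 1 - p = l + w - (p + 1) by ring]) hxα (hle hxα) h3 h4 (by simp)
    (by
      convert add_mem h5 hx'l using 1
      abel)
  by_contra hne'
  rw [D.hForm_eq_zero hα hα (Ne.symm hne')
    (nPart_pow_mem D.M_bij hxα l) hxα, mul_zero] at hr'
  exact hr.ne (by exact_mod_cast hr')

lemma IsData.norm_eq_one {D : HodgeTuple.{u} w} {W : Fil(D.V)} (hD : D.IsData W)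
    {μ : ℂ} (hμ : End.HasEigenvalue D.M μ) : ‖μ‖ = 1 := by
  obtain ⟨v, hv⟩ := hμ.exists_hasEigenvector
  have hvμ : v ∈ genEig D.M μ := End.mem_maxGenEigenspace _ _ _ |>.2 ⟨1, by simp [hv.apply_eq_smul]⟩
  have hμ0 : μ ≠ 0 := by
    rintro rfl
    rw [genEig_zero D.M_bij] at hvμ; exact hv.2 (by simpa using hvμ)
  obtain ⟨α, hα, rfl⟩ := exists_strip hμ0
  have h := hD.conj_eq hα (Submodule.ne_bot_iff _ |>.2 ⟨v, hvμ, hv.2⟩)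
  obtain ⟨x, rfl⟩ := Complex.conj_eq_iff_real.1 h
  rw [eig, Complex.norm_exp]; simp

lemma IsData.isPMHSOn {D : HodgeTuple.{u} w} {W : Fil(D.V)} (hD : D.IsData W)
    {U : Submodule ℂ D.V} {n : ℤ} (hU : ∀ x, x ∈ U ↔ D.projN n x = x) :
    IsPMHSOn (w + n - 2) D.conj D.S (-D.N) (twistFil D.M D.F) U := by
  have hW := hD.weight
  have hN : ∀ k, ∀ x ∈ W k, nPart D.M x ∈ W (k - 1) := fun k x hx => hW.apply_mem_pred hx
  have hcW : ∀ k, ∀ x ∈ W k, D.conj x ∈ W k := fun k x hx => D.weight_conj hW hx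
  have hNU : ∀ x ∈ U, D.N x ∈ U := fun x hx => by
    rw [hU] at hx ⊢
    rw [D.projN_N, hx]
  have hcU : ∀ x ∈ U, D.conj x ∈ U := fun x hx => by
    rw [hU] at hx ⊢
    rw [D.projN_conj, hx]
  have hpU : ∀ x, D.projN n x ∈ U := fun x => by rw [hU, D.projN_projN]
  have hαU : ∀ {α}, InStrip α → stripN α = n → ∀ {x}, x ∈ D.Hα α → x ∈ U := by
    intro α hα hn x hx
    rw [hU, ← hn]; exact D.projN_eq hα hx
  set c : U →ₛₗ[Cj] U :=
    { toFun := fun x => ⟨D.conj x, hcU x x.2⟩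
      map_add' := fun x y => by ext; simp
      map_smul' := fun t x => by ext; simp } with hcdef
  have hc : ∀ x, (c x : D.V) = D.conj x := fun x => rfl
  set nn : End ℂ U := D.N.restrict hNU
  have hnn : ∀ x, (nn x : D.V) = D.N x := fun x => rfl
  have hnn' : ∀ x, ((-nn) x : D.V) = (-D.N) x := fun x => rfl
  refine ⟨c, -nn, hc, hnn', ?_⟩
  have hW' : IsWeightFiltration nn 0 fun k => (W k).comap U.subtype := by
    refine ⟨fun i j h x hx => hW.mono h hx, ?_, ?_, ?_, ?_, ?_⟩
    · exact hW.exists_bot.imp fun l hl => by simp [hl]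
    · exact hW.exists_top.imp fun l hl => by simp [hl]
    · rintro l _ ⟨x, hx, rfl⟩; exact hW.apply_mem hx
    · intro l a ha h
      refine hW.inj l a ha ?_
      rwa [← coe_pow_of_coe hnn]
    · intro l b hb
      obtain ⟨a, ha, h⟩ := hW.surj l b hb
      refine ⟨⟨_, hpU a⟩, D.weight_projN hW n ha, ?_⟩
      change ((b - (nn ^ l) ⟨_, hpU a⟩ : U) : D.V) ∈ W (0 - l - 1)
      have h1 := D.weight_projN hW n h
      rw [map_sub, (hU _).1 b.2, D.projN_N_pow] at h1
      rwa [Submodule.coe_sub, coe_pow_of_coe hnn]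
  have hW0 := hW'.neg.shift (w + n - 2)
  rw [zero_add] at hW0
  have hFt := D.twistFil_fil
  have hmc : ∀ q (u : U), u ∈ conjFil c (fun p => (twistFil D.M D.F p).comap U.subtype) q ↔
      (u : D.V) ∈ conjFil D.conj (twistFil D.M D.F) q := fun q u => Iff.rfl
  refine
    { finite := inferInstance
      conj_conj := fun a => Subtype.ext (by rw [hc, hc, D.conj_conj])
      S_nondeg := ?_
      S_symm := ?_
      S_real := fun a b => D.S_real a b
      N_nilp := ?_
      N_real := fun a => Subtype.ext ?_
      N_isometry := fun a b => ?_
      F_fil := ⟨fun p q h x hx => hFt.1.1 h hx, ?_, ?_⟩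
      N_F := ?_
      S_F := ?_
      weight := ⟨_, hW0, ?_, ?_⟩ }
  · have key : ∀ a b, D.S (D.projN n a) b = D.S a (D.projN n b) := D.S_projN n
    constructor
    · intro a h
      apply Subtype.ext
      apply D.S_nondeg.1
      intro b
      have := h ⟨_, hpU b⟩
      change D.S a (D.projN n b) = 0 at this
      rwa [← key, (hU _).1 a.2] at this
    · intro a h
      apply Subtype.ext
      apply D.S_nondeg.2
      intro b
      have := h ⟨_, hpU b⟩
      change D.S (D.projN n b) a = 0 at this
      rwa [key, (hU _).1 a.2] at this
  · intro a b
    have := D.S_symm_projN n a b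
    rw [(hU _).1 a.2, (hU _).1 b.2] at this
    change D.S a b = _ * D.S b a
    rw [this, show w + n = w + n - 2 + 2 by ring, zpow_add₀ (by norm_num)]; norm_num
  · obtain ⟨k, hk⟩ := isNilpotent_nPart D.M_bij
    refine ⟨k, LinearMap.ext fun x => Subtype.ext ?_⟩
    rw [coe_pow_of_coe hnn', neg_pow, hk, mul_zero]; rfl
  · rw [hnn', hc, hc, hnn', LinearMap.neg_apply, LinearMap.neg_apply, D.conj_N, map_neg]
  · change D.S ((-D.N) a) b + D.S a ((-D.N) b) = 0
    simp [LinearMap.neg_apply, form_nPart D.S_M D.M_bij]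
  · exact hFt.1.2.1.imp fun p hp => by simp [hp]
  · exact hFt.1.2.2.imp fun p hp => by simp [hp]
  · rintro p _ ⟨x, hx, rfl⟩
    change (-D.N) (x : D.V) ∈ twistFil D.M D.F (p - 1)
    exact neg_mem (hFt.2.2 p (mem_map_of_mem hx))
  · intro p a ha b hb
    change D.S a b = 0
    have hres : ∀ a ∈ twistFil D.M D.F p, ∀ b ∈ twistFil D.M D.F (w + n - 2 + 1 - p),
        D.S (D.projN n a) b = 0 := by
      intro a ha b hb
      refine stable_induction D.M_bij (hFt.2.1 p) (P := fun a => D.S (D.projN n a) b = 0)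
        ?_ ?_ ?_ ha
      · intro α hα a haα ha
        refine stable_induction D.M_bij (hFt.2.1 _) (P := fun b => D.S (D.projN n a) b = 0)
          ?_ ?_ ?_ hb
        · intro β hβ b hbβ hb
          by_cases hn : stripN α = n
          · by_cases h : β = stripN α - α
            · subst h
              rw [← hn, D.projN_eq hα haα]
              have hb' := D.conj_mem hbβ
              have hsub : (stripN ((stripN α : ℂ) - α) : ℂ) -
                  Cj ((stripN α : ℂ) - α) = Cj α := by
                simp [stripN_sub hα, map_intCast, sub_sub_cancel]
              rw [hsub] at hb'
              rw [mem_twistFil D.M_bij D.F_fil.2.1] at ha hb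
              have h2 : D.conj (gammaOp D.M b) ∈ D.Hα (Cj α) := by
                have := D.conj_mem (fc_mem_genEig D.M_bij (fun _ => Gamma) hβ hbβ)
                rwa [hsub] at this
              have h1 := (hD.part n).orth α hα hn p (w - p) (by omega) _ ha
                (D.conj (gammaOp D.M b)) (by
                  rw [D.mem_Fb (inStrip_conj hα) h2, D.conj_conj, stripN_conj, hn]
                  rwa [show w + n - 2 + 1 - p = w - p + n - 1 by ring] at hb)
                (fc_mem_genEig D.M_bij _ hα haα) h2
              have h4 : gammaOp D.M a ∈ D.Hα α := fc_mem_genEig D.M_bij _ hα haα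
              rw [D.S_gammaInv hα h4 h2, D.conj_conj, gammaInv_gammaOp D.M_bij,
                gammaInv_gammaOp D.M_bij] at h1
              exact (mul_eq_zero.1 h1).resolve_left (kap_ne_zero _ _)
            · exact form_strip_eq_zero D.S_M hα hβ h (D.projN_mem hα haα n) hbβ
          · rw [D.projN_ne hα haα hn]; simp
        · simp
        · intro x y hx hy
          rw [map_add, hx, hy, add_zero]
      · simp
      · intro x y hx hy
        simp [hx, hy]
    have := hres a ha b hb
    rwa [(hU _).1 a.2] at this
  · intro k p
    constructor
    · apply le_antisymm
      · refine sup_le ?_ ?_ <;>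
        · refine sup_le inf_le_right ?_
          exact Submodule.comap_mono (hW.mono (by omega))
      · rintro ⟨x, hxU⟩ hx
        have key : ∀ x ∈ W (k - (w + n - 2)), (⟨_, hpU x⟩ : U) ∈
            grFil (fun k => (W (k - (w + n - 2))).comap U.subtype)
              (fun p => (twistFil D.M D.F p).comap U.subtype) k p ⊔
            grFil (fun k => (W (k - (w + n - 2))).comap U.subtype)
              (conjFil c fun p => (twistFil D.M D.F p).comap U.subtype) k (k + 1 - p) := by
          intro x hx
          refine stable_induction D.M_bij (D.weight_stable hW _) (P := fun x =>
            (⟨_, hpU x⟩ : U) ∈ _) ?_ ?_ ?_ hx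
          · intro α hα x hxα hx
            by_cases hn : stripN α = n
            · obtain ⟨f, hf, g, hg, hfα, hfk, hgα, hgk, hfg⟩ :=
                (hD.part n).sup α hα hn _ p x hxα hx
              obtain ⟨f', hf', h3, h4, h5⟩ := (exists_twist_sub_mem D.M_bij hW.mono hN
                D.F_fil.2.1 hα hfα hfk (p := p)).2 hf
              obtain ⟨g', hg', h6, h7, h8⟩ := (D.exists_conjTwist_sub_mem hW.mono hN hcW hα
                hgα hgk).2 hg
              rw [Submodule.mem_sup]
              refine ⟨⟨x - g', sub_mem (hαU hα hn hxα) (hαU hα hn h6)⟩,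
                mem_grFil.2 ⟨⟨f', hαU hα hn h3⟩, hf', h4, ?_⟩, ⟨g', hαU hα hn h6⟩,
                mem_grFil.2 ⟨⟨g', hαU hα hn h6⟩, ?_, h7, by simp⟩, ?_⟩
              · change x - g' - f' ∈ W (k - 1 - (w + n - 2))
                convert add_mem (add_mem hfg h5) h8 using 1
                · ring_nf
                · abel
              · rw [hmc]
                rwa [show k - (w + n - 2) + w - p + stripN α - 1 = k + 1 - p by rw [hn]; ring]
                  at hg'
              · apply Subtype.ext
                have h9 := D.projN_eq hα hxα
                rw [hn] at h9; simp [h9]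
            · have : (⟨_, hpU x⟩ : U) = 0 := Subtype.ext (D.projN_ne hα hxα hn)
              rw [this]; exact zero_mem _
          · have : (⟨_, hpU 0⟩ : U) = 0 := Subtype.ext (map_zero _)
            rw [this]; exact zero_mem _
          · intro x y hx hy
            have : (⟨_, hpU (x + y)⟩ : U) = ⟨_, hpU x⟩ + ⟨_, hpU y⟩ :=
              Subtype.ext (map_add _ _ _)
            rw [this]; exact add_mem hx hy
        convert key x hx using 1
        exact Subtype.ext ((hU _).1 hxU).symm
    · apply le_antisymm
      · rintro z ⟨hz1, hz2⟩
        obtain ⟨f, hf, hfk, hzf⟩ := mem_grFil.1 hz1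
        obtain ⟨g, hg, hgk, hzg⟩ := mem_grFil.1 hz2
        rw [hmc] at hg
        have hf : (f : D.V) ∈ twistFil D.M D.F p := hf
        have hfk : (f : D.V) ∈ W (k - (w + n - 2)) := hfk
        have hgk : (g : D.V) ∈ W (k - (w + n - 2)) := hgk
        have hfg : (f - g : D.V) ∈ W (k - (w + n - 2) - 1) := by
          have h1 : (z - f : D.V) ∈ W (k - 1 - (w + n - 2)) := hzf
          have h2 : (z - g : D.V) ∈ W (k - 1 - (w + n - 2)) := hzg
          have := sub_mem h2 h1
          rw [show k - (w + n - 2) - 1 = k - 1 - (w + n - 2) by ring]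
          convert this using 1
          abel
        have hfW : (f : D.V) ∈ W (k - (w + n - 2) - 1) := by
          apply D.mem_of_forall_eigProj
          intro α hα
          by_cases hn : stripN α = n
          · have hx1 := proj_mem (hFt.2.1 p) (α := α) hf
            have hy1 := proj_mem ((hFt.conjFil D.M_bij D.conj_conj D.M_real).2.1 _)
              (α := α) hg
            have hx2 := proj_mem (D.weight_stable hW _) (α := α) hfk
            have hy2 := proj_mem (D.weight_stable hW _) (α := α) hgk
            have h2 := proj_mem (D.weight_stable hW _) (α := α) hfg
            rw [map_sub] at h2
            rw [show k + 1 - p = k - (w + n - 2) + w - p + stripN α - 1 by rw [hn]; ring] at hy1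
            obtain ⟨x', hx', h3, h4, h5⟩ := (exists_twist_sub_mem D.M_bij hW.mono hN
              D.F_fil.2.1 hα (eigProj_mem D.M_bij hα _) hx2 (p := p)).1 hx1
            obtain ⟨y', hy', h6, h7, h8⟩ := (D.exists_conjTwist_sub_mem hW.mono hN hcW hα
              (eigProj_mem D.M_bij hα _) hy2).1 hy1
            have h9 := (hD.part n).inf α hα hn _ p x' hx' y' hy' h3 h4 h6 h7 (by
              convert add_mem (sub_mem h2 h5) h8 using 1
              abel)
            convert add_mem h5 h9 using 1
            abel
          · rw [← (hU _).1 f.2, ← D.projN_eigProj,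
              D.projN_ne hα (eigProj_mem D.M_bij hα _) hn]
            exact zero_mem _
        change (z : D.V) ∈ W (k - 1 - (w + n - 2))
        rw [show k - (w + n - 2) - 1 = k - 1 - (w + n - 2) by ring] at hfW
        simpa using add_mem (show (z - f : D.V) ∈ W (k - 1 - (w + n - 2)) from hzf) hfW
      · exact le_inf le_sup_right le_sup_right
  · intro l p a hal hal' hNa hF hFc
    have hidx : ∀ (x : U) (k j : ℤ), k - (w + n - 2) = j →
        x ∈ (W (k - (w + n - 2))).comap U.subtype → (x : D.V) ∈ W j := by
      rintro x k j rfl h; exact h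
    obtain ⟨x, hx, hxl, hax⟩ := mem_grFil.1 hF
    obtain ⟨y, hy, hyl, hay⟩ := mem_grFil.1 hFc
    obtain ⟨r, hr, hr'⟩ := hD.pos l p ((hU _).1 a.2) (hidx a _ _ (by ring) hal)
      (fun h => hal' (by
        change (a : D.V) ∈ W _
        rwa [show w + n - 2 + l - 1 - (w + n - 2) = (l : ℤ) - 1 by ring]))
      (by
        have h1 := hidx _ _ (-l - 3) (by ring) hNa
        rwa [coe_pow_of_coe hnn', neg_pow_mem] at h1)
      hx (hidx x _ _ (by ring) hxl) (hidx _ _ _ (by ring) hax) ((hmc _ _).1 hy)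
      (hidx y _ _ (by ring) hyl) (hidx _ _ _ (by ring) hay)
    refine ⟨r, hr, ?_⟩
    rw [← hr']; simp [coe_pow_of_coe hnn', hc]

/-- A tuple induces polarized mixed Hodge structures iff the weight filtration of `N` satisfies the
Hodge theoretic conditions which are expressed with the untwisted filtration `F` and the
hermitian form. -/
lemma inducesPMHS_iff : D.InducesPMHS ↔ ∃ W, D.IsData W := by
  constructor
  · rintro ⟨h1, h2⟩
    rw [show w - 1 = w + 1 - 2 by ring] at h1
    rw [show IsPMHSOn w D.conj = IsPMHSOn (w + 2 - 2) D.conj by rw [add_sub_cancel_right]] at h2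
    obtain ⟨W1, N1, hN1, hW1, hP1⟩ :=
      D.exists_isPart_of_isPMHSOn (fun x => D.mem_argNeZero_iff_projN) h1
    obtain ⟨W2, N2, hN2, hW2, hP2⟩ :=
      D.exists_isPart_of_isPMHSOn (fun x => D.mem_argZero_iff_projN) h2
    have hm1 : ∀ x, D.projN 1 x ∈ argNeZero D.M := fun x => by
      rw [D.mem_argNeZero_iff_projN, D.projN_projN]
    have hm2 : ∀ x, D.projN 2 x ∈ argZero D.M := fun x => by
      rw [D.mem_argZero_iff_projN, D.projN_projN]
    set p1 := (D.projN 1).codRestrict _ hm1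
    set p2 := (D.projN 2).codRestrict _ hm2
    have hp1N : ∀ (l : ℕ) x, p1 ((D.N ^ l) x) = (N1 ^ l) (p1 x) := fun l x => Subtype.ext (by
      rw [coe_pow_of_coe hN1]; exact D.projN_N_pow 1 l x)
    have hp2N : ∀ (l : ℕ) x, p2 ((D.N ^ l) x) = (N2 ^ l) (p2 x) := fun l x => Subtype.ext (by
      rw [coe_pow_of_coe hN2]; exact D.projN_N_pow 2 l x)
    have hadd : ∀ x, (p1 x : D.V) + p2 x = x := D.projN_one_add_projN_two
    have hp1a : ∀ (a : argNeZero D.M), p1 a = a := fun a =>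
      Subtype.ext (D.mem_argNeZero_iff_projN.1 a.2)
    have hp2a : ∀ (a : argZero D.M), p2 a = a := fun a =>
      Subtype.ext (D.mem_argZero_iff_projN.1 a.2)
    have hp1b : ∀ (a : argZero D.M), p1 a = 0 := fun a => Subtype.ext (by
      simpa [hp2a] using hadd a)
    have hp2b : ∀ (a : argNeZero D.M), p2 a = 0 := fun a => Subtype.ext (by
      simpa [hp1a] using hadd a)
    refine ⟨fun k => (W1 k).comap p1 ⊓ (W2 k).comap p2, ?_, ?_⟩
    · refine ⟨fun i j h x hx => ⟨hW1.mono h hx.1, hW2.mono h hx.2⟩, ?_, ?_, ?_, fun l a ha h =>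
        ⟨hW1.inj l _ ha.1 (hp1N _ _ ▸ h.1), hW2.inj l _ ha.2 (hp2N _ _ ▸ h.2)⟩, ?_⟩
      · obtain ⟨l1, hl1⟩ := hW1.exists_bot
        obtain ⟨l2, hl2⟩ := hW2.exists_bot
        refine ⟨min l1 l2, eq_bot_iff.2 fun x hx => ?_⟩
        have h1 : p1 x ∈ W1 l1 := hW1.mono (min_le_left _ _) hx.1
        have h2 : p2 x ∈ W2 l2 := hW2.mono (min_le_right _ _) hx.2
        rw [hl1, Submodule.mem_bot] at h1
        rw [hl2, Submodule.mem_bot] at h2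
        rw [Submodule.mem_bot, ← hadd x, h1, h2]; simp
      · obtain ⟨l1, hl1⟩ := hW1.exists_top
        obtain ⟨l2, hl2⟩ := hW2.exists_top
        exact ⟨max l1 l2, eq_top_iff.2 fun x _ => ⟨hW1.mono (le_max_left _ _) (hl1 ▸ trivial),
          hW2.mono (le_max_right _ _) (hl2 ▸ trivial)⟩⟩
      · rintro l _ ⟨x, hx, rfl⟩
        have e1 := hp1N 1 x
        have e2 := hp2N 1 x
        rw [pow_one, pow_one] at e1 e2
        exact ⟨Submodule.mem_comap.2 (e1 ▸ hW1.apply_mem hx.1),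
          Submodule.mem_comap.2 (e2 ▸ hW2.apply_mem hx.2)⟩
      · intro l b hb
        obtain ⟨a1, ha1, h1⟩ := hW1.surj l _ hb.1
        obtain ⟨a2, ha2, h2⟩ := hW2.surj l _ hb.2
        refine ⟨a1 + a2, ⟨?_, ?_⟩, ?_, ?_⟩ <;> refine Submodule.mem_comap.2 ?_
        · simpa [hp1a, hp1b] using ha1
        · simpa [hp2a, hp2b] using ha2
        · simpa [hp1a, hp1b, hp1N] using h1
        · simpa [hp2a, hp2b, hp2N] using h2
    · intro n
      by_cases h1 : n = 1
      · subst h1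
        refine hP1.congr fun α hα hn k x hx => ?_
        have hx1 : x ∈ argNeZero D.M := by
          rw [D.mem_argNeZero_iff_projN, ← hn]; exact D.projN_eq hα hx
        lift x to argNeZero D.M using hx1
        simp [Submodule.mem_inf, Submodule.mem_comap, hp1a, hp2b, Submodule.mem_map]
      · by_cases h2 : n = 2
        · subst h2
          refine hP2.congr fun α hα hn k x hx => ?_
          have hx1 : x ∈ argZero D.M := by
            rw [D.mem_argZero_iff_projN, ← hn]; exact D.projN_eq hα hx
          lift x to argZero D.M using hx1
          simp [Submodule.mem_inf, Submodule.mem_comap, hp1b, hp2a, Submodule.mem_map]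
        · have hn : ∀ α, InStrip α → stripN α ≠ n := fun α hα hn => by
            by_cases h : α.re = 1
            · exact h2 (hn ▸ stripN_eq_two h)
            · exact h1 (hn ▸ stripN_eq_one hα h)
          exact ⟨fun α hα h => absurd h (hn α hα), fun α hα h => absurd h (hn α hα),
            fun α hα h => absurd h (hn α hα), fun α hα h => absurd h (hn α hα)⟩
  · rintro ⟨W, hD⟩
    have h1 := hD.isPMHSOn (fun x => D.mem_argNeZero_iff_projN)
    have h2 := hD.isPMHSOn (fun x => D.mem_argZero_iff_projN)
    rw [show w + 1 - 2 = w - 1 by ring] at h1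
    rw [add_sub_cancel_right] at h2; exact ⟨h1, h2⟩

end HodgeTuple

/-! ### Holomorphic functions and frames on the Riemann sphere -/

/-- The chart of `ℙ¹` centred at `x`. -/
def chart (x : P1) : ℂ → P1 := x.elim atInf fun z u => ((z + u : ℂ) : P1)

lemma chart_coe (z u : ℂ) : chart (z : P1) u = ((z + u : ℂ) : P1) := rfl

lemma chart_infty (u : ℂ) : chart ∞ u = atInf u := rfl

lemma atInf_zero : atInf 0 = ∞ := if_pos rfl

lemma atInf_of_ne {u : ℂ} (h : u ≠ 0) : atInf u = ((u⁻¹ : ℂ) : P1) := if_neg h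

lemma chart_zero (x : P1) : chart x 0 = x := by
  induction x using OnePoint.rec with
  | infty => exact atInf_zero
  | coe z => rw [chart_coe, add_zero]

lemma holFun_coe_iff {f : P1 → ℂ} {z : ℂ} : HolFun f z ↔ An (fun u : ℂ => f u) z :=
  ⟨fun h => h.1 z rfl, fun h => ⟨fun z' hz => by
    rw [← OnePoint.coe_injective hz]; exact h, fun h' => absurd h' (coe_ne_infty _)⟩⟩

lemma holFun_infty_iff {f : P1 → ℂ} : HolFun f ∞ ↔ An (fun u : ℂ => f (atInf u)) 0 :=
  ⟨fun h => h.2 rfl, fun h => ⟨fun _ hz => absurd hz.symm (coe_ne_infty _), fun _ => h⟩⟩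

lemma holFun_iff {f : P1 → ℂ} {x : P1} : HolFun f x ↔ An (fun u => f (chart x u)) 0 := by
  induction x using OnePoint.rec with
  | infty => exact holFun_infty_iff
  | coe z =>
    rw [holFun_coe_iff]
    simp only [chart_coe]
    constructor
    · intro h
      exact AnalyticAt.fun_comp (g := fun u : ℂ => f u) (f := fun u : ℂ => z + u)
        (by simpa using h) (analyticAt_const.add analyticAt_id)
    · intro h
      have := AnalyticAt.fun_comp (g := fun u : ℂ => f ((z + u : ℂ) : P1)) (f := fun u : ℂ => u - z)
        (x := z) (by simpa using h) (analyticAt_id.sub analyticAt_const)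
      simpa using this

lemma map_chart_nhdsNE (x : P1) : map (chart x) (𝓝[≠] 0) = 𝓝[≠] x := by
  induction x using OnePoint.rec with
  | infty =>
    have h1 : map (chart ∞) (𝓝[≠] 0) = map ((↑) : ℂ → P1) (map (fun u : ℂ => u⁻¹) (𝓝[≠] 0)) := by
      rw [map_map]
      apply Filter.map_congr
      filter_upwards [self_mem_nhdsWithin] with u hu
      exact atInf_of_ne hu
    rw [h1, OnePoint.nhdsNE_infty_eq, coclosedCompact_eq_cocompact, ← Metric.cobounded_eq_cocompact]
    simp
  | coe z =>
    have h1 : map (fun u : ℂ => z + u) (𝓝[≠] 0) = 𝓝[≠] z := by simp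
    have h2 : 𝓝[≠] (z : P1) = map ((↑) : ℂ → P1) (𝓝[≠] z) := by
      rw [OnePoint.nhdsWithin_coe]
      congr 2
      ext u
      simp
    rw [h2, ← h1, map_map]; rfl

lemma map_chart_nhds (x : P1) : map (chart x) (𝓝 0) = 𝓝 x := by
  rw [← pure_sup_nhdsNE, ← pure_sup_nhdsNE x, map_sup, map_chart_nhdsNE, map_pure, chart_zero]

lemma eventually_nhds_chart {x : P1} {P : P1 → Prop} :
    (∀ᶠ y in 𝓝 x, P y) ↔ ∀ᶠ u in 𝓝 0, P (chart x u) := by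
  rw [← map_chart_nhds, eventually_map]

lemma eventually_nhdsNE_chart {x : P1} {P : P1 → Prop} :
    (∀ᶠ y in 𝓝[≠] x, P y) ↔ ∀ᶠ u in 𝓝[≠] 0, P (chart x u) := by
  rw [← map_chart_nhdsNE, eventually_map]

lemma eventually_nhdsNE_zero {P : P1 → Prop} :
    (∀ᶠ y in 𝓝[≠] 𝟘, P y) ↔ ∀ᶠ u : ℂ in 𝓝[≠] 0, P u := by
  simp [eventually_nhdsNE_chart, chart_coe]

lemma eventually_nhdsNE_infty {P : P1 → Prop} :
    (∀ᶠ y in 𝓝[≠] (∞ : P1), P y) ↔ ∀ᶠ u in 𝓝[≠] (0 : ℂ), P (atInf u) :=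
  eventually_nhdsNE_chart

lemma mem_Cstar_coe {z : ℂ} : ((z : ℂ) : P1) ∈ Cstar ↔ z ≠ 0 :=
  ⟨fun h h0 => h.2 (by rw [h0]), fun h => ⟨coe_ne_infty _, fun h' => h (OnePoint.coe_injective h')⟩⟩

lemma atInf_mem_Cstar {u : ℂ} (hu : u ≠ 0) : atInf u ∈ Cstar := by
  rw [atInf_of_ne hu, mem_Cstar_coe]; exact inv_ne_zero hu

lemma cases_P1 x : x = 𝟘 ∨ x = ∞ ∨ x ∈ Cstar := by
  by_cases h : x = ∞
  · exact Or.inr (Or.inl h)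
  · by_cases h' : x = 𝟘
    · exact Or.inl h'
    · exact Or.inr (Or.inr ⟨h, h'⟩)

lemma exists_expP {x : P1} (hx : x ∈ Cstar) : ∃ ζ, expP ζ = x := by
  obtain ⟨z, rfl⟩ := ne_infty_iff_exists.1 hx.1
  rw [mem_Cstar_coe] at hx
  refine ⟨log z / ϖ, ?_⟩
  rw [expP, mul_div_cancel₀ _ two_pi_I_ne, Complex.exp_log hx]

lemma isOpen_Cstar : IsOpen Cstar :=
  (isOpen_compl_singleton (x := (∞ : P1))).inter (isOpen_compl_singleton (x := 𝟘))

lemma eventually_mem_Cstar x : ∀ᶠ y in 𝓝[≠] x, y ∈ Cstar := by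
  rcases cases_P1 x with rfl | rfl | h
  · rw [eventually_nhdsNE_zero]
    filter_upwards [self_mem_nhdsWithin] with u (hu : u ≠ 0)
    exact mem_Cstar_coe.2 hu
  · rw [eventually_nhdsNE_infty]
    filter_upwards [self_mem_nhdsWithin] with u hu
    exact atInf_mem_Cstar hu
  · exact nhdsWithin_le_nhds (isOpen_Cstar.mem_nhds h)

lemma map_expP_nhds (ζ : ℂ) : map expP (𝓝 ζ) = 𝓝 (expP ζ) := by
  have h : HasStrictDerivAt (fun ζ : ℂ => exp (ϖ * ζ)) (exp (ϖ * ζ) * ϖ) ζ := by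
    simpa using ((hasStrictDerivAt_id ζ).const_mul ϖ).cexp
  have h1 := h.map_nhds_eq (mul_ne_zero (Complex.exp_ne_zero _) two_pi_I_ne)
  rw [expP, OnePoint.nhds_coe_eq, ← h1, map_map]; rfl

lemma eventually_nhds_expP {ζ : ℂ} {P : P1 → Prop} :
    (∀ᶠ y in 𝓝 (expP ζ), P y) ↔ ∀ᶠ ξ in 𝓝 ζ, P (expP ξ) := by
  rw [← map_expP_nhds, eventually_map]

namespace HolFun

variable {f g : P1 → ℂ} {x : P1}

lemma mul (hf : HolFun f x) (hg : HolFun g x) : HolFun (fun y => f y * g y) x :=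
  ⟨fun z hz => (hf.1 z hz).mul (hg.1 z hz), fun h => (hf.2 h).mul (hg.2 h)⟩

lemma sum {ι : Type*} {s : Finset ι} {f : ι → P1 → ℂ} (h : ∀ i ∈ s, HolFun (f i) x) :
    HolFun (fun y => ∑ i ∈ s, f i y) x := by
  classical
  induction s using induction_on with
  | empty => simpa using HolFam.holFun_const 0 x
  | insert i s hi ih =>
    simp only [sum_insert hi]
    exact HolFam.HolFun.add (h i (mem_insert_self i s)) (ih fun j hj => h j (mem_insert_of_mem hj))

lemma prod {ι : Type*} {s : Finset ι} {f : ι → P1 → ℂ} (h : ∀ i ∈ s, HolFun (f i) x) :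
    HolFun (fun y => ∏ i ∈ s, f i y) x := by
  classical
  induction s using induction_on with
  | empty => simpa using HolFam.holFun_const 1 x
  | insert i s hi ih =>
    simp only [Finset.prod_insert hi]
    exact (h i (mem_insert_self i s)).mul (ih fun j hj => h j (mem_insert_of_mem hj))

lemma congr (hf : HolFun f x) (h : ∀ᶠ y in 𝓝 x, f y = g y) : HolFun g x := by
  rw [holFun_iff] at hf ⊢; exact hf.congr (eventually_nhds_chart.1 h)

lemma inv (hf : HolFun f x) (h : f x ≠ 0) : HolFun (fun y => (f y)⁻¹) x := by
  rw [holFun_iff] at hf ⊢; exact hf.fun_inv (by rwa [chart_zero])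

lemma eventually_ne (hf : HolFun f x) (h : f x ≠ 0) : ∀ᶠ y in 𝓝 x, f y ≠ 0 := by
  rw [eventually_nhds_chart]
  rw [holFun_iff] at hf
  exact hf.continuousAt.eventually_ne (by rwa [chart_zero])

lemma eq_of_eventually (hf : HolFun f x) (hg : HolFun g x) (h : ∀ᶠ y in 𝓝[≠] x, f y = g y) :
    f x = g x := by
  rw [holFun_iff] at hf hg
  have h1 : ∀ᶠ u in 𝓝[≠] 0, f (chart x u) = g (chart x u) := eventually_nhdsNE_chart.1 h
  have h2 := (hf.continuousAt.eventuallyEq_nhds_iff_eventuallyEq_nhdsNE hg.continuousAt).1 h1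
  have := h2.eq_of_nhds
  simpa [chart_zero] using this

lemma det {r : ℕ} {P : P1 → Matrix (Fin r) (Fin r) ℂ}
    (h : ∀ i j, HolFun (fun y => P y i j) x) : HolFun (fun y => (P y).det) x := by
  simp only [Matrix.det_apply']
  exact HolFun.sum fun σ _ => HolFam.HolFun.const_mul _ (HolFun.prod fun i _ => h _ _)

end HolFun

namespace HolFam

lemma HolAt.ext {E : HolFam.{u}} {s : ∀ x, E.Fib x} {x : P1} (hs : E.HolAt s x) : E.ExtHolAt s x :=
  ⟨s, hs, .of_forall fun _ => rfl⟩

namespace IsBundle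

variable {E : HolFam.{u}} {r : ℕ} (hE : E.IsBundle r)
include hE

lemma holAt_congr {s t : ∀ x, E.Fib x} {x : P1} (hs : E.HolAt s x)
    (h : ∀ᶠ y in 𝓝 x, s y = t y) : E.HolAt t x := by
  obtain ⟨U, -, hx, e, he⟩ := hE x
  rw [he _ x hx] at *
  intro i
  refine (hs i).congr ?_
  filter_upwards [h] with y hy
  rw [hy]

lemma holAt_smul_fun {s : ∀ x, E.Fib x} {f : P1 → ℂ} {x : P1} (hf : HolFun f x)
    (hs : E.HolAt s x) : E.HolAt (fun y => f y • s y) x := by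
  obtain ⟨U, -, hx, e, he⟩ := hE x
  rw [he _ x hx] at *
  intro i
  simpa using hf.mul (hs i)

lemma holAt_sum {ι : Type*} {S : Finset ι} {s : ι → ∀ x, E.Fib x} {x : P1}
    (h : ∀ i ∈ S, E.HolAt (s i) x) : E.HolAt (fun y => ∑ i ∈ S, s i y) x := by
  classical
  induction S using induction_on with
  | empty => exact hE.holAt_zero x
  | insert i S hi ih =>
    simp only [sum_insert hi]
    exact hE.holAt_add (h i (mem_insert_self i S)) (ih fun j hj => h j (mem_insert_of_mem hj))

/-- Cramer's rule: the coefficients of a holomorphic section with respect to holomorphic sections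
which form a basis of the fibre over `x` are holomorphic near `x`. -/
lemma holFun_coeff {x : P1} {t : Fin r → ∀ y, E.Fib y} (ht : ∀ j, E.HolAt (t j) x)
    (hli : LinearIndependent ℂ fun j => t j x) {f : Fin r → P1 → ℂ}
    (h : E.HolAt (fun y => ∑ j, f j y • t j y) x) (j : Fin r) : HolFun (f j) x := by
  obtain ⟨U, -, hx, e, he⟩ := hE x
  set P : P1 → Matrix (Fin r) (Fin r) ℂ := fun y => Matrix.of fun i j => (e y).repr (t j y) i
    with hP
  have hPh : ∀ i j, HolFun (fun y => P y i j) x := fun i j => (he _ x hx).1 (ht j) i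
  have hdet : (P x).det ≠ 0 := by
    have h1 : IsUnit ((e x).toMatrix fun j => t j x) := by
      have hb : Fintype.card (Fin r) = finrank ℂ (E.Fib x) := by
        rw [finrank_eq_card_basis (e x)]
      have : ⊤ ≤ span ℂ (Set.range fun j => t j x) := by
        have : Module.Finite ℂ (E.Fib x) := Module.Finite.of_basis (e x)
        exact (hli.span_eq_top_of_card_eq_finrank' hb).ge
      have := (e x).isUnit_det (Basis.mk hli this)
      rw [Basis.det_apply, Basis.coe_mk] at this; exact (Matrix.isUnit_iff_isUnit_det _).2 this
    exact ((Matrix.isUnit_iff_isUnit_det _).1 h1).ne_zero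
  have hd := HolFun.det hPh
  have hs := (he _ x hx).1 h
  have hadj : ∀ i, HolFun (fun y => (P y).adjugate j i) x := fun i => by
    simp only [Matrix.adjugate_apply]
    refine HolFun.det fun a b => ?_
    by_cases hai : a = i
    · subst hai; simpa using holFun_const _ x
    · simpa [Matrix.updateRow_ne hai] using hPh a b
  have h1 : HolFun (fun y => (P y).det⁻¹ *
      ∑ i, (P y).adjugate j i * (e y).repr (∑ j, f j y • t j y) i) x :=
    (hd.inv hdet).mul (HolFun.sum fun i _ => (hadj i).mul (hs i))
  refine h1.congr ?_
  filter_upwards [hd.eventually_ne hdet] with y hy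
  have h2 : ∀ i, (e y).repr (∑ j, f j y • t j y) i = (P y).mulVec (fun j => f j y) i := fun i => by
    simp only [map_sum, map_smul, Finsupp.coe_finsetSum, Finset.sum_apply, Finsupp.smul_apply,
      smul_eq_mul, Matrix.mulVec, dotProduct, hP, Matrix.of_apply]
    exact sum_congr rfl fun j _ => mul_comm _ _
  have h3 : ∑ i, (P y).adjugate j i * (e y).repr (∑ j, f j y • t j y) i =
      (P y).adjugate.mulVec ((P y).mulVec fun j => f j y) j := by
    rw [Matrix.mulVec, dotProduct]; exact sum_congr rfl fun i _ => by rw [h2]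
  rw [h3, Matrix.mulVec_mulVec, Matrix.adjugate_mul, Matrix.smul_mulVec, Matrix.one_mulVec,
    Pi.smul_apply, smul_eq_mul, inv_mul_cancel_left₀ hy]

lemma finrank_fib x : finrank ℂ (E.Fib x) = r := by
  obtain ⟨U, -, -, e, -⟩ := hE x
  rw [finrank_eq_card_basis (e x), Fintype.card_fin]

lemma finite_fib x : Module.Finite ℂ (E.Fib x) := by
  obtain ⟨U, -, -, e, -⟩ := hE x
  exact Module.Finite.of_basis (e x)

/-- A holomorphic section is determined by its values on a punctured neighbourhood. -/
lemma holAt_eq {s t : ∀ x, E.Fib x} {x : P1} (hs : E.HolAt s x) (ht : E.HolAt t x)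
    (h : ∀ᶠ y in 𝓝[≠] x, s y = t y) : s x = t x := by
  obtain ⟨U, -, hx, e, he⟩ := hE x
  rw [he _ x hx] at *
  apply (e x).repr.injective
  ext i
  refine (hs i).eq_of_eventually (ht i) ?_
  filter_upwards [h] with y hy
  rw [hy]

end IsBundle

end HolFam

/-! ### Vector valued functions and lattices -/

section Lattice

variable {V : Type u} [AddCommGroup V] [Module ℂ V]

/-- Holomorphy near `z` of a function with values in a finite dimensional space, tested by linear
forms. -/
def VAn (g : ℂ → V) (z : ℂ) : Prop := ∀ ℓ : V →ₗ[ℂ] ℂ, An (fun u => ℓ (g u)) z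

lemma apply_eq_sum_repr {r : ℕ} (b : Basis (Fin r) ℂ V) (L : V →ₗ[ℂ] ℂ) (x : V) :
    L x = ∑ j, b.repr x j * L (b j) := by
  have h := congrArg L (b.sum_repr x)
  rw [← h, map_sum]
  exact sum_congr rfl fun j _ => by rw [map_smul, smul_eq_mul]

lemma vAn_iff_repr {r : ℕ} (b : Basis (Fin r) ℂ V) {g : ℂ → V} {z : ℂ} :
    VAn g z ↔ ∀ j, An (fun u => b.repr (g u) j) z := by
  refine ⟨fun h j => h (b.coord j), fun h ℓ => ?_⟩
  have h1 : (fun u => ℓ (g u)) = fun u => ∑ j, b.repr (g u) j * ℓ (b j) :=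
    funext fun u => apply_eq_sum_repr b ℓ (g u)
  rw [h1]
  exact Finset.analyticAt_fun_sum _ fun j _ => (h j).mul analyticAt_const

/-- A germ at `0` of a function on a punctured neighbourhood, with values in `V`, is in the lattice
`∑ₙ uⁿ 𝒪 Φₙ`. -/
def Lat (Φ : Fil(V)) (g : ℂ → V) : Prop :=
  ∃ (m : ℕ) (n : Fin m → ℤ) (A : Fin m → V) (f : Fin m → ℂ → ℂ),
    (∀ i, A i ∈ Φ (n i) ∧ An (f i) 0) ∧
    ∀ᶠ u in 𝓝[≠] 0, g u = ∑ i, (f i u * u ^ n i) • A i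

namespace Lat

variable {Φ : Fil(V)} {g g' : ℂ → V}

lemma of_fintype {ι : Type*} [Fintype ι] {n : ι → ℤ} {A : ι → V} {f : ι → ℂ → ℂ}
    (h : ∀ i, A i ∈ Φ (n i) ∧ An (f i) 0)
    (hg : ∀ᶠ u in 𝓝[≠] 0, g u = ∑ i, (f i u * u ^ n i) • A i) : Lat Φ g := by
  let e := (Fintype.equivFin ι).symm
  refine ⟨Fintype.card ι, n ∘ e, A ∘ e, f ∘ e, fun i => h (e i), ?_⟩
  filter_upwards [hg] with u hu
  rw [hu]
  exact (Equiv.sum_comp e fun i => (f i u * u ^ n i) • A i).symm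

lemma congr (hg : Lat Φ g) (h : ∀ᶠ u in 𝓝[≠] 0, g u = g' u) : Lat Φ g' := by
  obtain ⟨m, n, A, f, h1, h2⟩ := hg
  refine ⟨m, n, A, f, h1, ?_⟩
  filter_upwards [h, h2] with u h3 h4
  rw [← h3, h4]

lemma gen {n : ℤ} {A : V} (hA : A ∈ Φ n) {f : ℂ → ℂ} (hf : An f 0) :
    Lat Φ fun u => (f u * u ^ n) • A :=
  of_fintype (ι := Unit) (n := fun _ => n) (A := fun _ => A) (f := fun _ => f)
    (fun _ => ⟨hA, hf⟩) (.of_forall fun _ => by simp)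

lemma gen_one {n : ℤ} {A : V} (hA : A ∈ Φ n) : Lat Φ fun u => u ^ n • A := by
  simpa using gen hA (f := fun _ => 1) analyticAt_const

lemma zero : Lat Φ fun _ => 0 := by
  simpa using gen (Φ := Φ) (n := 0) (zero_mem _) (f := fun _ => 1) analyticAt_const

lemma add (hg : Lat Φ g) (hg' : Lat Φ g') : Lat Φ fun u => g u + g' u := by
  obtain ⟨m, n, A, f, h1, h2⟩ := hg
  obtain ⟨m', n', A', f', h1', h2'⟩ := hg'
  refine of_fintype (ι := Fin m ⊕ Fin m') (n := Sum.elim n n') (A := Sum.elim A A')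
    (f := Sum.elim f f') ?_ ?_
  · rintro (i | i)
    · exact h1 i
    · exact h1' i
  · filter_upwards [h2, h2'] with u h3 h4
    rw [h3, h4, Fintype.sum_sum_type]; rfl

lemma sum {ι : Type*} {s : Finset ι} {g : ι → ℂ → V} (h : ∀ i ∈ s, Lat Φ (g i)) :
    Lat Φ fun u => ∑ i ∈ s, g i u := by
  classical
  induction s using induction_on with
  | empty => simpa using zero
  | insert i s hi ih =>
    simp only [sum_insert hi]
    exact (h i (mem_insert_self i s)).add (ih fun j hj => h j (mem_insert_of_mem hj))

/-- Lattices are compatible with linear maps which shift the exponents. -/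
lemma map {V' : Type v} [AddCommGroup V'] [Module ℂ V'] {Ψ : Fil(V')}
    (L : V →ₗ[ℂ] V') (d : ℤ) (hL : ∀ n, ∀ A ∈ Φ n, L A ∈ Ψ (n + d)) (hg : Lat Φ g) :
    Lat Ψ fun u => u ^ d • L (g u) := by
  obtain ⟨m, n, A, f, h1, h2⟩ := hg
  refine ⟨m, fun i => n i + d, fun i => L (A i), f, fun i => ⟨hL _ _ (h1 i).1, (h1 i).2⟩, ?_⟩
  filter_upwards [h2, self_mem_nhdsWithin] with u h3 hu
  rw [h3, map_sum, smul_sum]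
  refine sum_congr rfl fun i _ => ?_
  rw [map_smul, smul_smul, zpow_add₀ hu]
  congr 1; ring

/-- Lattices are stable under `u ∂_u`. -/
lemma deriv (hg : Lat Φ g) (hg' : ∀ᶠ u in 𝓝[≠] 0, ∀ ℓ : V →ₗ[ℂ] ℂ,
    ℓ (g' u) = u * _root_.deriv (fun t => ℓ (g t)) u) : Lat Φ g' := by
  obtain ⟨m, n, A, f, h1, h2⟩ := hg
  refine ⟨m, n, A, fun i u => u * _root_.deriv (f i) u + n i * f i u, fun i => ⟨(h1 i).1,
    (analyticAt_id.mul (h1 i).2.deriv).add (analyticAt_const.mul (h1 i).2)⟩, ?_⟩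
  have h3 : ∀ᶠ u in 𝓝[≠] (0 : ℂ), ∀ᶠ t in 𝓝 u, g t = ∑ i, (f i t * t ^ n i) • A i := by
    have := eventually_eventually_nhdsWithin.2 h2
    filter_upwards [this, self_mem_nhdsWithin] with u hu hu0
    rwa [nhdsWithin_eq_nhds.2 (compl_singleton_mem_nhds hu0)] at hu
  have h4 : ∀ i, ∀ᶠ u in 𝓝[≠] (0 : ℂ), An (f i) u := fun i =>
    nhdsWithin_le_nhds (h1 i).2.eventually_analyticAt
  filter_upwards [h3, hg', eventually_all.2 h4, self_mem_nhdsWithin] with u h5 h6 h7 hu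
  have hu : u ≠ 0 := hu
  refine sub_eq_zero.1 ((forall_dual_apply_eq_zero_iff ℂ _).1 fun ℓ => ?_)
  rw [map_sub, h6 ℓ, sub_eq_zero]
  have h8 : HasDerivAt (fun t => ℓ (g t))
      (∑ i, (_root_.deriv (f i) u * u ^ n i + f i u * (n i * u ^ (n i - 1))) * ℓ (A i)) u := by
    have h9 : HasDerivAt (fun t => ∑ i, (f i t * t ^ n i) * ℓ (A i))
        (∑ i, (_root_.deriv (f i) u * u ^ n i + f i u * (n i * u ^ (n i - 1))) * ℓ (A i)) u := by
      refine HasDerivAt.fun_sum fun i _ => HasDerivAt.mul_const ?_ _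
      exact (h7 i).differentiableAt.hasDerivAt.mul (hasDerivAt_zpow (n i) u (Or.inl hu))
    refine h9.congr_of_eventuallyEq ?_
    filter_upwards [h5] with t ht
    rw [ht]; simp
  rw [h8.deriv, mul_sum, map_sum]
  refine sum_congr rfl fun i _ => ?_
  rw [map_smul, smul_eq_mul, zpow_sub_one₀ hu]; field_simp

/-- A linear form which vanishes on `Φ_j` for `j ≤ n` has values of order `> n` on the lattice. -/
lemma functional (hg : Lat Φ g) {ℓ : V →ₗ[ℂ] ℂ} {n : ℤ} (hℓ : ∀ j ≤ n, ∀ A ∈ Φ j, ℓ A = 0) :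
    ∃ f : ℂ → ℂ, An f 0 ∧ ∀ᶠ u in 𝓝[≠] 0, ℓ (g u) = f u * u ^ (n + 1) := by
  obtain ⟨m, d, A, f, h1, h2⟩ := hg
  refine ⟨fun u => ∑ i, f i u * (u ^ (d i - n - 1).toNat * ℓ (A i)), ?_, ?_⟩
  · exact Finset.analyticAt_fun_sum _ fun i _ =>
      (h1 i).2.mul ((analyticAt_id.pow _).mul analyticAt_const)
  · filter_upwards [h2, self_mem_nhdsWithin] with u hu hu0
    rw [hu, map_sum, sum_mul]
    refine sum_congr rfl fun i _ => ?_
    rw [map_smul, smul_eq_mul]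
    by_cases h : d i ≤ n
    · rw [hℓ _ h _ (h1 i).1]; simp
    · have h3 : u ^ d i = u ^ (d i - n - 1).toNat * u ^ (n + 1) := by
        rw [← zpow_natCast, ← zpow_add₀ hu0]
        congr 1; omega
      rw [h3]; ring

lemma adapted_iff {r : ℕ} {b : Basis (Fin r) ℂ V} {n : Fin r → ℤ}
    (hb : ∀ j, b j ∈ Φ (n j)) (hΦ : ∀ m, ∀ A ∈ Φ m, ∀ j, b.repr A j ≠ 0 → n j ≤ m) :
    Lat Φ g ↔ ∀ j, ∃ f : ℂ → ℂ, An f 0 ∧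
      ∀ᶠ u in 𝓝[≠] 0, b.repr (g u) j = f u * u ^ n j := by
  constructor
  · intro hg j
    obtain ⟨f, hf, h⟩ := hg.functional (ℓ := b.coord j) (n := n j - 1) fun m hm A hA => by
      by_contra h
      have := hΦ m A hA j h
      omega
    refine ⟨f, hf, ?_⟩
    rwa [sub_add_cancel] at h
  · intro h
    choose f hf hfe using h
    refine ⟨r, n, b, f, fun i => ⟨hb i, hf i⟩, ?_⟩
    filter_upwards [eventually_all.2 hfe] with u hu
    conv_lhs => rw [← b.sum_repr (g u)]
    exact sum_congr rfl fun i _ => by rw [hu]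

end Lat

end Lattice

/-! ### Functions of `z` and of the logarithm of `z` -/

/-- `e^{2πiζ}`. -/
def ez (ζ : ℂ) : ℂ := exp (ϖ * ζ)

lemma expP_eq (ζ : ℂ) : expP ζ = ((ez ζ : ℂ) : P1) := rfl

lemma ez_ne_zero (ζ : ℂ) : ez ζ ≠ 0 := Complex.exp_ne_zero _

lemma hasDerivAt_ez (ζ : ℂ) : HasDerivAt ez (ϖ * ez ζ) ζ := by
  have h : HasDerivAt (fun ζ : ℂ => ϖ * ζ) ϖ ζ := by simpa using (hasDerivAt_id ζ).const_mul ϖ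
  exact h.cexp.congr_deriv (mul_comm _ _)

/-- A local inverse of `ζ ↦ e^{2πiζ}`. -/
lemma exists_log (ζ₀ : ℂ) : ∃ L : ℂ → ℂ, An L (ez ζ₀) ∧ L (ez ζ₀) = ζ₀ ∧
    (∀ᶠ u in 𝓝 (ez ζ₀), ez (L u) = u) ∧ ∀ᶠ ζ in 𝓝 ζ₀, L (ez ζ) = ζ := by
  set L : ℂ → ℂ := fun u => ζ₀ + log (u / ez ζ₀) / ϖ with hL
  refine ⟨L, ?_, by simp [hL, div_self (ez_ne_zero ζ₀)], ?_, ?_⟩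
  · refine analyticAt_const.add (AnalyticAt.div ?_ analyticAt_const two_pi_I_ne)
    refine AnalyticAt.clog (analyticAt_id.div analyticAt_const (ez_ne_zero _)) ?_
    simp [div_self (ez_ne_zero ζ₀)]
  · filter_upwards [compl_singleton_mem_nhds (ez_ne_zero ζ₀)] with u hu0
    have : ϖ * L u = ϖ * ζ₀ + log (u / ez ζ₀) := by
      rw [hL]; field_simp
    rw [ez, this, exp_add, Complex.exp_log (div_ne_zero hu0 (ez_ne_zero _))]
    exact mul_div_cancel₀ _ (ez_ne_zero ζ₀)
  · have hc : ContinuousAt (fun ζ : ℂ => (ϖ * (ζ - ζ₀)).im) ζ₀ := by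
      fun_prop
    have h0 : (ϖ * (ζ₀ - ζ₀)).im = 0 := by simp
    filter_upwards [hc.eventually_lt continuousAt_const (by rw [h0]; exact Real.pi_pos),
      continuousAt_const.eventually_lt hc (by rw [h0]; exact neg_neg_of_pos Real.pi_pos)]
      with ζ h1 h2
    have h3 : ez ζ / ez ζ₀ = exp (ϖ * (ζ - ζ₀)) := by
      rw [ez, ez, ← Complex.exp_sub]; ring_nf
    rw [hL]
    dsimp only
    rw [h3, Complex.log_exp h2 h1.le, mul_div_cancel_left₀ _ two_pi_I_ne]; ring

/-- A function `f` of `z` is holomorphic if `f (e^{2πiζ})` is. -/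
lemma analyticAt_of_comp_ez {f g : ℂ → ℂ} {ζ₀ : ℂ} (hg : An g ζ₀)
    (h : ∀ᶠ ζ in 𝓝 ζ₀, f (ez ζ) = g ζ) : An f (ez ζ₀) := by
  obtain ⟨L, h1, h2, h4, -⟩ := exists_log ζ₀
  have h3 : An (fun u => g (L u)) (ez ζ₀) := AnalyticAt.fun_comp (by rwa [h2]) h1
  have h5 := h1.continuousAt.tendsto
  rw [h2] at h5
  refine h3.congr ?_
  filter_upwards [h5.eventually h, h4] with u hu hu0
  rw [← hu, hu0]

lemma analyticAt_ez (ζ : ℂ) : An ez ζ := by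
  unfold ez
  fun_prop

section ExpB

variable {V : Type u} [AddCommGroup V] [Module ℂ V] [FiniteDimensional ℂ V]
  {M : End ℂ V} (hM : Bijective M)
include hM

lemma analyticAt_expB (ℓ : V →ₗ[ℂ] ℂ) (v : V) (ζ : ℂ) : An (fun ζ => ℓ (expB M ζ v)) ζ :=
  (differentiable_expB hM ℓ v).analyticAt ζ

lemma analyticAt_expB_neg (ℓ : V →ₗ[ℂ] ℂ) (v : V) (ζ : ℂ) :
    An (fun ζ => ℓ (expB M (-ζ) v)) ζ :=
  ((differentiable_expB hM ℓ v).comp differentiable_neg).analyticAt ζ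

lemma hasDerivAt_expB_neg (ℓ : V →ₗ[ℂ] ℂ) (v : V) (ζ : ℂ) :
    HasDerivAt (fun ζ => ℓ (expB M (-ζ) v)) (-(ϖ * ℓ (logB M (expB M (-ζ) v)))) ζ := by
  have h : HasDerivAt (fun ζ => ℓ (expB M (-ζ) v)) _ ζ :=
    HasDerivAt.comp ζ (hasDerivAt_expB hM ℓ v (-ζ)) (hasDerivAt_neg ζ)
  exact h.congr_deriv (by ring)

lemma hasDerivAt_expB_apply (ℓ : V →ₗ[ℂ] ℂ) {g : ℂ → V} {g' : V} {ζ : ℂ}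
    (hg : ∀ ℓ : V →ₗ[ℂ] ℂ, HasDerivAt (fun ζ => ℓ (g ζ)) (ℓ g') ζ) :
    HasDerivAt (fun ζ => ℓ (expB M ζ (g ζ)))
      (ϖ * ℓ (logB M (expB M ζ (g ζ))) + ℓ (expB M ζ g')) ζ := by
  set b := finBasis ℂ V
  have h1 : ∀ (x : V) (L : V →ₗ[ℂ] ℂ), L x = ∑ j, b.repr x j * L (b j) :=
    fun x L => apply_eq_sum_repr b L x
  have h2 : HasDerivAt (fun ζ => ∑ j, b.repr (g ζ) j * ℓ (expB M ζ (b j)))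
      (∑ j, (b.repr g' j * ℓ (expB M ζ (b j)) +
        b.repr (g ζ) j * (ϖ * ℓ (logB M (expB M ζ (b j)))))) ζ :=
    HasDerivAt.fun_sum fun j _ => (hg (b.coord j)).mul (hasDerivAt_expB hM ℓ (b j) ζ)
  have h3 : (fun ζ => ℓ (expB M ζ (g ζ))) = fun ζ => ∑ j, b.repr (g ζ) j * ℓ (expB M ζ (b j)) :=
    funext fun ζ => h1 (g ζ) (ℓ.comp (expB M ζ))
  rw [h3]
  convert h2 using 1
  have h4 := h1 (g ζ) (ℓ.comp ((logB M).comp (expB M ζ)))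
  have h5 := h1 g' (ℓ.comp (expB M ζ))
  simp only [LinearMap.comp_apply] at h4 h5
  rw [h4, h5, sum_add_distrib, mul_sum, add_comm]
  congr 1; exact sum_congr rfl fun j _ => by ring

end ExpB

/-! ### Trivializations by elementary sections -/

section PreModel

variable {V : Type u} [AddCommGroup V] [Module ℂ V] [FiniteDimensional ℂ V] {M : End ℂ V}

/-- A trivialization `τ` over `ℂ^*` of a bundle with connection such that `∇_{z∂_z}` becomes
`z∂_z + B` with `e^{-2πiB} = M`; the values of `τ` at `0` and `∞` are irrelevant. -/
structure IsTriv (M : End ℂ V) (E : HolFam.{v}) (D : (∀ x, E.Fib x) → ∀ x, E.Fib x)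
    (τ : ∀ x, E.Fib x ≃ₗ[ℂ] V) : Prop where
  hol : ∀ s (z : ℂ), z ≠ 0 → (E.HolAt s z ↔ VAn (fun u : ℂ => τ u (s u)) z)
  nabla : ∀ s (z : ℂ), z ≠ 0 → E.HolAt s z → ∀ ℓ : V →ₗ[ℂ] ℂ, ℓ (τ z (D s z)) =
      z * deriv (fun u : ℂ => ℓ (τ u (s u))) z + ℓ (logB M (τ z (s z)))

lemma VAn.eventually {g : ℂ → V} {z : ℂ} (h : VAn g z) : ∀ᶠ u in 𝓝 z, VAn g u := by
  have h1 := (vAn_iff_repr (finBasis ℂ V)).1 h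
  filter_upwards [eventually_all.2 fun j => (h1 j).eventually_analyticAt] with u hu
  exact (vAn_iff_repr (finBasis ℂ V)).2 hu

variable (hM : Bijective M)
include hM

/-- The flat sections are the multivalued sections `e^{-2πiζB} v`. -/
lemma IsTriv.flatAt_iff {E : HolFam.{v}} {D : (∀ x, E.Fib x) → ∀ x, E.Fib x}
    {τ : ∀ x, E.Fib x ≃ₗ[ℂ] V} (hτ : IsTriv M E D τ) {s : ∀ x, E.Fib x} {ζ₀ : ℂ} :
    FlatAt E D s (expP ζ₀) ↔ ∃ v, ∀ᶠ ζ in 𝓝 ζ₀, τ (expP ζ) (s (expP ζ)) = expB M (-ζ) v := by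
  constructor
  · rintro ⟨h1, h2⟩
    rw [eventually_nhds_expP] at h2
    rw [expP_eq, hτ.hol s _ (ez_ne_zero _)] at h1
    have h3 : ∀ᶠ ζ in 𝓝 ζ₀, VAn (fun u : ℂ => τ u (s u)) (ez ζ) :=
      (hasDerivAt_ez ζ₀).continuousAt.tendsto.eventually h1.eventually
    set F : ℂ → V := fun ζ => expB M ζ (τ (expP ζ) (s (expP ζ))) with hF
    have h4 : ∀ᶠ ζ in 𝓝 ζ₀, ∀ ℓ : V →ₗ[ℂ] ℂ, HasDerivAt (fun ζ => ℓ (F ζ)) 0 ζ := by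
      filter_upwards [h2, h3] with ζ h4 h5 ℓ
      have h6 := (hτ.hol s _ (ez_ne_zero ζ)).2 h5
      have h7 : ∀ ℓ : V →ₗ[ℂ] ℂ, HasDerivAt (fun ζ => ℓ (τ (expP ζ) (s (expP ζ))))
          (ℓ (-ϖ • logB M (τ (expP ζ) (s (expP ζ))))) ζ := fun ℓ => by
        have h8 : HasDerivAt (fun ζ => ℓ (τ (expP ζ) (s (expP ζ)))) _ ζ :=
          HasDerivAt.comp ζ (h5 ℓ).differentiableAt.hasDerivAt (hasDerivAt_ez ζ)
        have h9 := hτ.nabla s _ (ez_ne_zero ζ) h6 ℓ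
        rw [← expP_eq, h4, map_zero, map_zero] at h9
        refine h8.congr_deriv ?_
        rw [map_smul, smul_eq_mul]
        linear_combination (-ϖ) * h9
      have h10 := hasDerivAt_expB_apply hM ℓ h7
      refine h10.congr_deriv ?_
      rw [map_smul, map_smul, smul_eq_mul, ← End.mul_apply, ← End.mul_apply,
        (expB_commute_logB hM ζ).eq]
      ring
    obtain ⟨ε, hε, hball⟩ := Metric.eventually_nhds_iff_ball.1 h4
    refine ⟨F ζ₀, Metric.eventually_nhds_iff_ball.2 ⟨ε, hε, fun ζ hζ => ?_⟩⟩
    have h5 : F ζ = F ζ₀ := by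
      apply sub_eq_zero.1
      apply (forall_dual_apply_eq_zero_iff ℂ _).1
      intro ℓ
      have := (convex_ball ζ₀ ε).is_const_of_fderivWithin_eq_zero (𝕜 := ℂ) (f := fun ζ => ℓ (F ζ))
        (fun x hx => (hball x hx ℓ).differentiableAt.differentiableWithinAt) (fun x hx => by
          rw [fderivWithin_of_isOpen Metric.isOpen_ball hx, (hball x hx ℓ).hasFDerivAt.fderiv]
          ext
          simp) hζ (Metric.mem_ball_self hε)
      rwa [map_sub, sub_eq_zero]
    rw [← h5, hF, expB_neg_apply hM]
  · rintro ⟨v, hv⟩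
    have key : ∀ᶠ ζ in 𝓝 ζ₀, E.HolAt s (expP ζ) ∧ D s (expP ζ) = 0 := by
      filter_upwards [eventually_eventually_nhds.2 hv] with ζ hζ
      have h1 : VAn (fun u : ℂ => τ u (s u)) (ez ζ) := fun ℓ => by
        refine analyticAt_of_comp_ez (analyticAt_expB_neg hM ℓ v ζ) ?_
        filter_upwards [hζ] with ξ hξ
        rw [← expP_eq, hξ]
      have h2 := (hτ.hol s _ (ez_ne_zero ζ)).2 h1
      refine ⟨h2, ?_⟩
      apply (τ (expP ζ)).injective
      rw [map_zero]
      apply (forall_dual_apply_eq_zero_iff ℂ _).1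
      intro ℓ
      have h9 := hτ.nabla s _ (ez_ne_zero ζ) h2 ℓ
      rw [← expP_eq] at h9
      have h8 : HasDerivAt (fun ζ => ℓ (τ (expP ζ) (s (expP ζ)))) _ ζ :=
        HasDerivAt.comp ζ (h1 ℓ).differentiableAt.hasDerivAt (hasDerivAt_ez ζ)
      have h10 : HasDerivAt (fun ζ => ℓ (τ (expP ζ) (s (expP ζ))))
          (-(ϖ * ℓ (logB M (expB M (-ζ) v)))) ζ := by
        refine (hasDerivAt_expB_neg hM ℓ v ζ).congr_of_eventuallyEq ?_
        filter_upwards [hζ] with ξ hξ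
        rw [hξ]
      have h11 := h8.unique h10
      rw [h9, hζ.self_of_nhds]
      apply mul_left_cancel₀ two_pi_I_ne
      linear_combination h11
    refine ⟨key.self_of_nhds.1, eventually_nhds_expP.2 (key.mono fun _ h => h.2)⟩

end PreModel

/-! ### The space of multivalued flat sections -/

lemma tendsto_ez : Tendsto ez (comap Complex.im atTop) (𝓝[≠] 0) := by
  refine (Function.Periodic.qParam_tendsto (h := 1) one_pos).congr fun ζ => ?_
  simp [Function.Periodic.qParam, ez]

lemma tendsto_expP_zero : Tendsto expP (comap Complex.im atTop) (𝓝[≠] 𝟘) := by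
  rw [← map_chart_nhdsNE 𝟘]
  refine (tendsto_map.comp tendsto_ez).congr fun ζ => ?_
  simp [Function.comp_apply, chart_coe, expP_eq]

lemma atInf_ez (ζ : ℂ) : atInf (ez ζ) = expP (-ζ) := by
  rw [atInf_of_ne (ez_ne_zero ζ), expP_eq, ez, ez, ← exp_neg, mul_neg]

lemma tendsto_expP_infty : Tendsto (fun ζ => expP (-ζ)) (comap Complex.im atTop) (𝓝[≠] ∞) := by
  rw [← map_chart_nhdsNE ∞]
  refine (tendsto_map.comp tendsto_ez).congr fun ζ => ?_
  rw [Function.comp_apply, chart_infty, atInf_ez]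

lemma exists_of_eventually_im {P : ℂ → Prop} (h : ∀ᶠ ζ in comap Complex.im atTop, P ζ) :
    ∃ R : ℝ, ∀ ζ : ℂ, R ≤ ζ.im → P ζ := by
  rw [eventually_comap, eventually_atTop] at h
  obtain ⟨R, hR⟩ := h
  exact ⟨R, fun ζ hζ => hR ζ.im hζ ζ rfl⟩

lemma HolFam.fibCast_symm_apply (E : HolFam.{u}) {x y : P1} (h : x = y) (v : E.Fib x) :
    E.fibCast h.symm (E.fibCast h v) = v := by
  subst h; rfl

namespace Twistor

variable (T : Twistor.{u})

lemma exists_flat (A : T.Hinf) (ζ₀ : ℂ) : ∃ s, FlatAt T.E T.nabla s (expP ζ₀) ∧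
    ∀ᶠ ζ in 𝓝 ζ₀, T.ev ζ A = s (expP ζ) := A.2 ζ₀

/-- The flat pairing `Ŝ(A(ζ), B(ζ̄ + 1/2))` of multivalued flat sections. -/
def pr (ζ : ℂ) (A B : T.Hinf) : ℂ :=
  T.Shat (expP ζ) (T.ev ζ A) (T.E.fibCast (sig_expP ζ).symm (T.ev (Cj ζ + 1 / 2) B))

lemma pr_const (ζ ζ' : ℂ) (A B : T.Hinf) : T.pr ζ A B = T.pr ζ' A B := by
  refine IsLocallyConstant.apply_eq_of_preconnectedSpace (f := fun ζ => T.pr ζ A B) ?_ ζ ζ'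
  rw [IsLocallyConstant.iff_eventually_eq]
  intro ζ₀
  obtain ⟨s, hs, hs'⟩ := T.exists_flat A ζ₀
  obtain ⟨t, ht, ht'⟩ := T.exists_flat B (Cj ζ₀ + 1 / 2)
  rw [← sig_expP] at ht
  have h1 := T.Shat_flat s t _ (expP_mem ζ₀) hs ht
  rw [eventually_nhds_expP] at h1
  have h2 : Tendsto (fun ζ : ℂ => Cj ζ + 1 / 2) (𝓝 ζ₀) (𝓝 (Cj ζ₀ + 1 / 2)) :=
    (Complex.continuous_conj.add continuous_const).tendsto ζ₀
  have h3 : ∀ᶠ ζ in 𝓝 ζ₀, T.pr ζ A B = T.Shat (expP ζ) (s (expP ζ)) (t (sig (expP ζ))) := by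
    filter_upwards [hs', h2.eventually ht'] with ζ h3 h4
    rw [pr, h3, h4, fibCast_section]
  filter_upwards [h1, h3] with ζ h4 h5
  rw [h5, h4, h3.self_of_nhds]

lemma ev_surjective_of_generated {x : P1} {Φ : ℤ → ℂ → Submodule ℂ T.Hinf} (h : T.GeneratedAt x Φ) :
    ∀ᶠ y in 𝓝[≠] x, ∀ ζ, expP ζ = y → Surjective (T.ev ζ) := by
  obtain ⟨U, -, hx, e, he⟩ := T.bundle x
  have h1 : ∀ i : Fin T.rank, ∀ᶠ y in 𝓝[≠] x, ∀ ζ, expP ζ = y →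
      e (expP ζ) i ∈ LinearMap.range (T.ev ζ) := fun i => by
    have h2 : T.E.HolAt (fun y => e y i) x := by
      rw [he _ x hx]
      intro j
      simpa using HolFam.holFun_const _ x
    obtain ⟨m, n, α, A, es, f, h3, h4⟩ := (h _).1 h2.ext
    filter_upwards [h4] with y hy ζ hζ
    subst hζ
    have hy' : e (expP ζ) i = ∑ i, f i (expP ζ) • es i (expP ζ) := hy
    rw [hy']
    refine Submodule.sum_mem _ fun j _ => smul_mem _ _ ?_
    rw [(h3 j).2.2.2.1 ζ]
    exact smul_mem _ _ (LinearMap.mem_range_self _ _)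
  filter_upwards [eventually_all.2 h1] with y hy ζ hζ
  rw [← LinearMap.range_eq_top, ← top_le_iff, ← (e (expP ζ)).span_eq, Submodule.span_le]
  rintro _ ⟨i, rfl⟩; exact hy i ζ hζ

section Generated

variable {T} {Φ Ψ : ℤ → ℂ → Submodule ℂ T.Hinf} (h0 : T.GeneratedAt 𝟘 Φ)
  (h1 : T.GeneratedAt ∞ Ψ)

include h0 in
lemma exists_ev_surjective_zero : ∃ R : ℝ, ∀ ζ : ℂ, R ≤ ζ.im → Surjective (T.ev ζ) :=
  exists_of_eventually_im ((tendsto_expP_zero.eventually (ev_surjective_of_generated T h0)).mono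
    fun ζ h => h ζ rfl)

include h1 in
lemma exists_ev_surjective_infty : ∃ R : ℝ, ∀ ζ : ℂ, ζ.im ≤ -R → Surjective (T.ev ζ) := by
  obtain ⟨R, hR⟩ := exists_of_eventually_im (P := fun ζ => Surjective (T.ev (-ζ)))
    ((tendsto_expP_infty.eventually (ev_surjective_of_generated T h1)).mono fun ζ h => h (-ζ) rfl)
  refine ⟨R, fun ζ hζ => ?_⟩
  have := hR (-ζ) (by rw [Complex.neg_im]; linarith)
  rwa [neg_neg] at this

/-- Identity theorem for multivalued flat sections. -/
lemma eq_zero_of_eventually (A : T.Hinf) {ζ₀ : ℂ} (h : ∀ᶠ ζ in 𝓝 ζ₀, T.ev ζ A = 0) : A = 0 := by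
  set Z : Set ℂ := {ζ₁ | ∀ᶠ ζ in 𝓝 ζ₁, T.ev ζ A = 0}
  have hZo : IsOpen Z := isOpen_setOfPred_eventually_nhds
  have hZc : IsClosed Z := by
    refine isClosed_of_closure_subset fun ζ₁ hζ₁ => ?_
    obtain ⟨s, hs, hs'⟩ := T.exists_flat A ζ₁
    obtain ⟨U, hU, hx, e, he⟩ := T.bundle (expP ζ₁)
    have h2 := (he _ _ hx).1 hs.1
    have h3 : ∀ i, An (fun ζ => (e (expP ζ)).repr (s (expP ζ)) i) ζ₁ := fun i =>
      AnalyticAt.comp ((h2 i).1 (ez ζ₁) rfl) (analyticAt_ez ζ₁)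
    have h4 : ∀ i, ∀ᶠ ζ in 𝓝 ζ₁, (e (expP ζ)).repr (s (expP ζ)) i = 0 := fun i => by
      rcases (h3 i).eventually_eq_zero_or_eventually_ne_zero with h5 | h5
      · exact h5
      · exfalso
        rw [eventually_nhdsWithin_iff] at h5
        obtain ⟨O, hO, hO', hO''⟩ := eventually_nhds_iff.1 (h5.and hs')
        obtain ⟨ζ₂, h6, h7⟩ := mem_closure_iff_nhds.1 hζ₁ O (hO'.mem_nhds hO'')
        have h8 : ∀ᶠ ζ in 𝓝 ζ₂, ζ ∈ O ∧ T.ev ζ A = 0 := Eventually.and (hO'.mem_nhds h6) h7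
        obtain ⟨ζ₃, h11, h9, h10⟩ := ((mem_closure_iff_frequently.1
          (dense_compl_singleton ζ₁ ζ₂)).and_eventually h8).exists
        refine (hO ζ₃ h9).1 h11 ?_
        rw [← (hO ζ₃ h9).2, h10]; simp
    change ∀ᶠ ζ in 𝓝 ζ₁, T.ev ζ A = 0
    filter_upwards [hs', eventually_all.2 h4] with ζ h5 h6
    rw [h5]
    apply (e (expP ζ)).repr.injective
    ext i
    simpa using h6 i
  have h1 : Z = Set.univ := IsClopen.eq_univ ⟨hZc, hZo⟩ ⟨ζ₀, h⟩
  ext ζ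
  have h2 : ζ ∈ Z := h1 ▸ Set.mem_univ ζ
  exact Eventually.self_of_nhds (p := fun ζ => T.ev ζ A = 0) h2

section

include h1

lemma ev_injective (ζ : ℂ) : Injective (T.ev ζ) := by
  rw [injective_iff_map_eq_zero]
  intro A hA
  obtain ⟨R, hR⟩ := exists_ev_surjective_infty h1
  have h2 : ∀ ζ' : ℂ, R ≤ ζ'.im → T.ev ζ' A = 0 := fun ζ' hζ' => by
    refine T.Shat_nondeg_left _ _ fun b => ?_
    obtain ⟨B, hB⟩ := hR (Cj ζ' + 1 / 2) (by simpa using hζ') (T.E.fibCast (sig_expP ζ') b)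
    have h3 : b = T.E.fibCast (sig_expP ζ').symm (T.ev (Cj ζ' + 1 / 2) B) := by
      rw [hB, HolFam.fibCast_symm_apply]
    have h4 : T.pr ζ' A B = 0 := by
      rw [T.pr_const ζ' ζ, pr, hA]; simp
    rwa [h3]
  refine eq_zero_of_eventually A (ζ₀ := ((R + 1 : ℝ) : ℂ) * I) ?_
  have h5 : ∀ᶠ ζ' : ℂ in 𝓝 (((R + 1 : ℝ) : ℂ) * I), R < ζ'.im := by
    refine (isOpen_lt continuous_const Complex.continuous_im).mem_nhds ?_
    simp
  filter_upwards [h5] with ζ' h6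
  exact h2 ζ' h6.le

lemma finite_Hinf : FiniteDimensional ℂ T.Hinf := by
  have := T.bundle.finite_fib (expP 0)
  exact Module.Finite.of_injective (T.ev 0) (ev_injective h1 0)

lemma mono_bijective : Bijective T.mono := by
  have := finite_Hinf h1
  have h2 : Injective T.mono := by
    rw [injective_iff_map_eq_zero]
    intro A hA
    ext ζ
    have h3 := congrArg (T.ev (ζ - 1)) hA
    have h4 : T.E.fibCast (expP_add_one (ζ - 1)) (A.1 (ζ - 1 + 1)) = 0 := by rwa [map_zero] at h3
    rwa [LinearEquiv.map_eq_zero_iff, sub_add_cancel] at h4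
  exact ⟨h2, LinearMap.injective_iff_surjective.1 h2⟩

end

include h0 h1

lemma finrank_Hinf : finrank ℂ T.Hinf = T.rank := by
  have := finite_Hinf h1
  obtain ⟨R, hR⟩ := exists_ev_surjective_zero h0
  have h2 := hR ((R : ℂ) * I) (by simp)
  rw [← T.bundle.finrank_fib (expP ((R : ℂ) * I))]
  exact (ofBijective _ ⟨ev_injective h1 _, h2⟩).finrank_eq

lemma ev_bijective (ζ : ℂ) : Bijective (T.ev ζ) := by
  have := finite_Hinf h1
  have := T.bundle.finite_fib (expP ζ)
  refine ⟨ev_injective h1 ζ, ?_⟩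
  exact (LinearMap.injective_iff_surjective_of_finrank_eq_finrank
    ((finrank_Hinf h0 h1).trans (T.bundle.finrank_fib _).symm)).1 (ev_injective h1 ζ)

end Generated

end Twistor

/-! ### The operator comparing `S` and `L` -/

/-- The functions describing `Ω` with `L(a, b) = S(a, Ω b)`. -/
def omegaN (w n : ℤ) (x : ℂ) : ℂ := (-1) ^ (w + n) * (psiN w n x * exp (ϖ * x * (-1 / 2)))

lemma an_omegaN (w n : ℤ) (x : ℂ) : An (omegaN w n) x := by
  refine analyticAt_const.mul ((an_psiN w n x).mul ?_)
  fun_prop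

lemma two_I_sin_mul_exp (x : ℂ) : 2 * I * sin (Real.pi * x) * exp (ϖ * x * (-1 / 2)) =
      1 - exp (ϖ * x * -1) := by
  have h1 : exp (ϖ * x * -1) = exp (-(Real.pi * x) * I) * exp (-(Real.pi * x) * I) := by
    rw [← exp_add]; congr 1; ring
  have h2 : exp (ϖ * x * (-1 / 2)) = exp (-(Real.pi * x) * I) := by congr 1; ring
  have h3 : exp (Real.pi * x * I) * exp (-(Real.pi * x) * I) = 1 := by rw [← exp_add]; simp
  rw [h1, h2, sin]
  linear_combination h3 + (exp (-(Real.pi * x) * I) ^ 2 -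
    exp (Real.pi * x * I) * exp (-(Real.pi * x) * I)) * Complex.I_sq

lemma inv_Gamma_mul_inv_Gamma (x : ℂ) : (Gamma x)⁻¹ * (Gamma (1 - x))⁻¹ =
    sin (Real.pi * x) / Real.pi := by
  rw [← mul_inv, Complex.Gamma_mul_Gamma_one_sub, inv_div]

lemma omegaN_one (w : ℤ) (x : ℂ) : -ϖ ^ w * omegaN w 1 x = exp (ϖ * x * -1) - 1 := by
  have h1 := neg_one_mul_self w
  have h2 : (ϖ : ℂ) ^ (2 - 1 - w) * ϖ ^ w = ϖ := by rw [← zpow_add₀ two_pi_I_ne]; simp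
  have h4 := inv_Gamma_mul_inv_Gamma x
  have hpi : (Real.pi : ℂ) ≠ 0 := by exact_mod_cast Real.pi_ne_zero
  have h5 : (Real.pi : ℂ) * (sin (Real.pi * x) / Real.pi) = sin (Real.pi * x) := by
    field_simp
  rw [omegaN, psiN, kap, zpow_add₀ (by norm_num : (-1 : ℂ) ≠ 0), Int.cast_one, h4]
  have h3 := two_I_sin_mul_exp x
  set e := exp (ϖ * x * (-1 / 2))
  set s := sin (Real.pi * x) / Real.pi
  calc _ = -((-1 : ℂ) ^ w * (-1) ^ w) * ((ϖ : ℂ) ^ (2 - 1 - w) * ϖ ^ w) * (s * e) := by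
        ring
    _ = _ := by
        rw [h1, h2]
        linear_combination (-2 * I * e) * h5 - h3

lemma omegaN_two (w : ℤ) (x : ℂ) : ϖ ^ w * omegaN w 2 x * (ϖ * (1 - x)) = exp (ϖ * x * -1) - 1 := by
  by_cases hx : x = 1
  · subst hx
    simp [exp_neg, Complex.exp_two_pi_mul_I]
  have hx' : 1 - x ≠ 0 := sub_ne_zero.2 (Ne.symm hx)
  have h1 := neg_one_mul_self w
  have h2 : (ϖ : ℂ) ^ (2 - 2 - w) * ϖ ^ w = 1 := by rw [← zpow_add₀ two_pi_I_ne]; simp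
  have hG : Gamma (2 - x) = (1 - x) * Gamma (1 - x) := by
    rw [← Complex.Gamma_add_one _ hx']; congr 1; ring
  have h4 : (Gamma x)⁻¹ * (Gamma (2 - x))⁻¹ * (1 - x) = sin (Real.pi * x) / Real.pi := by
    rw [hG, ← inv_Gamma_mul_inv_Gamma, mul_inv]; field_simp
  have hpi : (Real.pi : ℂ) ≠ 0 := by exact_mod_cast Real.pi_ne_zero
  have h5 : (Real.pi : ℂ) * (sin (Real.pi * x) / Real.pi) = sin (Real.pi * x) := by
    field_simp
  rw [omegaN, psiN, kap, zpow_add₀ (by norm_num : (-1 : ℂ) ≠ 0), Int.cast_ofNat]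
  have h3 := two_I_sin_mul_exp x
  set e := exp (ϖ * x * (-1 / 2))
  calc _ = -((-1 : ℂ) ^ w * (-1) ^ w) * ((ϖ : ℂ) ^ (2 - 2 - w) * ϖ ^ w) * ϖ *
        (((Gamma x)⁻¹ * (Gamma (2 - x))⁻¹ * (1 - x)) * e) := by
        ring
    _ = _ := by
        rw [h1, h2, h4]
        linear_combination (-2 * I * e) * h5 - h3

lemma omegaN_ne_zero (w : ℤ) {α : ℂ} (hα : InStrip α) : omegaN w (stripN α) α ≠ 0 := by
  have h : Gamma α ≠ 0 ∧ Gamma (stripN α - α) ≠ 0 := by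
    exact ⟨Gamma_ne_zero_of_re_pos hα.1,
      Gamma_ne_zero_of_re_pos (inStrip_sub hα).1⟩
  unfold omegaN psiN
  have h1 : ((-1 : ℂ)) ^ (w + stripN α) ≠ 0 := zpow_ne_zero _ (by norm_num)
  have h2 := kap_ne_zero w (stripN α)
  have h3 := Complex.exp_ne_zero (ϖ * α * (-1 / 2))
  exact mul_ne_zero h1 (mul_ne_zero (mul_ne_zero h2
    (mul_ne_zero (inv_ne_zero h.1) (inv_ne_zero h.2))) h3)

lemma tay_sub_const {f : ℂ → ℂ} (c : ℂ) {α : ℂ} (hf : An f α) :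
    PowerSeries.mk (tay (fun x => f x - c) α) = PowerSeries.mk (tay f α) - C c := by
  rw [← tay_const c α]
  ext k
  rw [map_sub, coeff_mk, coeff_mk, coeff_mk, tay, tay, tay,
    iteratedDeriv_fun_sub hf.contDiffAt contDiffAt_const]
  ring

section Omega

variable {V : Type u} [AddCommGroup V] [Module ℂ V] [FiniteDimensional ℂ V]

/-- The operator `Ω` with `L(a, b) = S(a, Ω b)`. -/
def omega (w : ℤ) (M : End ℂ V) : End ℂ V := fc M fun α => omegaN w (stripN α)

/-- The inverse of `Ω`. -/
def omegaInv (w : ℤ) (M : End ℂ V) : End ℂ V := fc M fun α x => (omegaN w (stripN α) x)⁻¹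

variable {M : End ℂ V} (hM : Bijective M) (w : ℤ)
include hM

lemma omega_mul_omegaInv : omega w M * omegaInv w M = 1 := by
  rw [omega, omegaInv, fc_mul hM (fun α _ => an_omegaN w (stripN α) α)
    (g := fun α x => (omegaN w (stripN α) x)⁻¹) (fun α hα => (an_omegaN w _ α).inv (omegaN_ne_zero w hα)), ← fc_one hM]
  refine fc_congr hM fun α hα => ?_
  filter_upwards [(an_omegaN w (stripN α) α).continuousAt.eventually_ne
    (omegaN_ne_zero w hα)] with x hx
  exact mul_inv_cancel₀ hx

lemma omegaInv_mul_omega : omegaInv w M * omega w M = 1 :=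
  mul_eq_one_comm.1 (omega_mul_omegaInv hM w)

lemma apply_eq_locEnd {α : ℂ} (hα : InStrip α) {b : V} (hb : b ∈ genEig M (eig α)) :
    M b = locEnd M (fun x => exp (ϖ * x * -1)) α b := by
  rw [← fc_apply hM (fun _ x => exp (ϖ * x * -1)) hα hb, fc_exp_neg_one hM]

lemma locEnd_const_mul (c : ℂ) {f : ℂ → ℂ} {α : ℂ} (hf : An f α) :
    locEnd M (fun x => c * f x) α = c • locEnd M f α := by
  rw [← locEnd_mul hM analyticAt_const hf, locEnd_const hM, smul_mul_assoc, one_mul]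

lemma locEnd_sub_const {f : ℂ → ℂ} (c : ℂ) {α : ℂ} (hf : An f α) :
    locEnd M (fun x => f x - c) α = locEnd M f α - c • 1 := by
  unfold locEnd
  simp only [nilSeries_eq (isNilpotent_nPart hM)]
  have h : (C c : PowerSeries ℂ) = algebraMap ℂ (PowerSeries ℂ) c := rfl
  simp [tay_sub_const c hf, h, AlgHom.commutes, Algebra.algebraMap_eq_smul_one]

lemma locEnd_exp_sub_one {α : ℂ} (hα : InStrip α) {b : V} (hb : b ∈ genEig M (eig α)) :
    locEnd M (fun x => Complex.exp (2 * Real.pi * Complex.I * x * -1) - 1) α b = M b - b := by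
  rw [locEnd_sub_const hM 1 (by fun_prop), LinearMap.sub_apply, ← apply_eq_locEnd hM hα hb,
    one_smul]
  rfl

lemma argNeZero_omega {b : V} (hb : b ∈ argNeZero M) : M b - b = -ϖ ^ w • omega w M b := by
  have h : argNeZero M ≤ eqLocus (M - 1) (-(ϖ : ℂ) ^ w • omega w M) := by
    refine iSup₂_le fun μ hμ b hb => ?_
    have h0 : μ ≠ 0 := by
      rintro rfl; exact hμ Complex.arg_zero
    obtain ⟨α, hα, rfl⟩ := exists_strip h0
    have hn : stripN α = 1 := stripN_eq_one hα fun h => hμ ((arg_eig hα).2 h)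
    rw [LinearMap.mem_eqLocus, LinearMap.smul_apply, omega, fc_apply hM _ hα hb, hn,
      ← LinearMap.smul_apply, ← locEnd_const_mul hM _ (an_omegaN w 1 α)]
    simp only [omegaN_one]
    rw [locEnd_exp_sub_one hM hα hb]; rfl
  exact h hb

lemma locEnd_two_pi_I {α : ℂ} (b : V) : locEnd M (fun x => ϖ * (1 - x)) α b =
      (ϖ * (1 - α)) • b + nPart M b := by
  have h : (fun x : ℂ => ϖ * (1 - x)) = fun x => (-ϖ) * (x - 1) := by funext x; ring
  rw [h, locEnd_const_mul hM _ (by fun_prop), locEnd_sub_const hM (f := fun x => x) 1 analyticAt_id,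
    locEnd_id hM]
  simp only [LinearMap.smul_apply, LinearMap.sub_apply, End.one_apply, smul_sub, smul_smul]
  have h1 : -(2 * Real.pi * Complex.I : ℂ) * (1 / (2 * Real.pi * Complex.I)) = -1 := by
    field_simp [two_pi_I_ne]
  rw [h1]
  module

lemma argZero_omega {α : ℂ} (hα : InStrip α) (hn : stripN α = 2) {b : V}
    (hb : b ∈ genEig M (eig α)) :
    M b - b = ϖ ^ w •
      omega w M ((2 * Real.pi * Complex.I * (1 - α)) • b + nPart M b) := by
  have hb' : locEnd M (fun x => 2 * Real.pi * I * (1 - x)) α b ∈ genEig M (eig α) :=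
    locEnd_mem_genEig hM _ _ hb
  rw [← locEnd_two_pi_I hM, omega, fc_apply hM _ hα hb', hn, ← LinearMap.smul_apply,
    ← locEnd_const_mul hM _ (an_omegaN w 2 α), ← End.mul_apply,
    locEnd_mul hM (f := fun x => ϖ ^ w * omegaN w 2 x)
      (analyticAt_const.mul (an_omegaN w 2 α)) (by fun_prop)]
  simp only [omegaN_two]
  rw [locEnd_exp_sub_one hM hα hb]

lemma genEig_one_omega {b : V} (hb : b ∈ genEig M 1) :
    nilSeries (fun k => 1 / ((k + 1).factorial : ℂ)) (nPart M) b =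
      (2 * Real.pi * Complex.I) ^ w • omega w M b := by
  have h1 : eig 1 = 1 := by rw [eig, mul_one, exp_neg, Complex.exp_two_pi_mul_I, inv_one]
  have hα : InStrip 1 := by constructor <;> simp
  have hn : stripN 1 = 2 := stripN_eq_two (by simp)
  rw [← h1] at hb
  rw [omega, fc_apply hM _ hα hb, hn, ← LinearMap.smul_apply,
    ← locEnd_const_mul hM _ (an_omegaN w 2 1)]
  have hX : PowerSeries.mk (tay (fun x => ϖ * (1 - x)) 1) = (X : PowerSeries ℂ) := by
    have h : (fun x : ℂ => ϖ * (1 - x)) = fun x => (-ϖ) * (x - 1) := by funext x; ring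
    rw [h, tay_mul (f := fun _ => -ϖ) (g := fun x => x - 1)
      analyticAt_const (by fun_prop), tay_const, tay_sub_const (f := fun x => x) 1 analyticAt_id]
    ext k
    rw [PowerSeries.coeff_C_mul, map_sub, coeff_mk, tay_id, coeff_C, PowerSeries.coeff_X]
    rcases k with _ | _ | k
    · simp
    · simp
      field_simp [two_pi_I_ne]
    · simp
  have he : PowerSeries.mk (tay (fun x => exp (ϖ * x * -1) - 1) 1) =
      PowerSeries.mk (fun k => 1 / ((k + 1).factorial : ℂ)) * X := by
    rw [tay_sub_const 1 (by fun_prop)]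
    ext k
    rw [map_sub, coeff_mk, tay_exp, coeff_C]
    rcases k with _ | k
    · simp [exp_neg, Complex.exp_two_pi_mul_I]
    · simp [PowerSeries.coeff_succ_mul_X, coeff_mk, exp_neg, Complex.exp_two_pi_mul_I]
  have h2 : PowerSeries.mk (tay (fun x => ϖ ^ w * omegaN w 2 x) 1) =
      PowerSeries.mk (fun k => 1 / ((k + 1).factorial : ℂ)) := by
    apply mul_right_cancel₀ (PowerSeries.X_ne_zero (R := ℂ))
    rw [← he, ← hX, ← tay_mul (f := fun x => ϖ ^ w * omegaN w 2 x)
      (analyticAt_const.mul (an_omegaN w 2 1)) (by fun_prop)]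
    simp only [omegaN_two]
  have h3 : tay (fun x => ϖ ^ w * omegaN w 2 x) 1 = fun k => 1 / ((k + 1).factorial : ℂ) := by
    funext k
    have := congrArg (PowerSeries.coeff k) h2
    rwa [coeff_mk, coeff_mk] at this
  rw [locEnd, h3]

end Omega

lemma log_eig {α : ℂ} (h : α.re = 1) : log (eig α) = ϖ * (1 - α) := by
  have h1 : eig α = exp (ϖ * (1 - α)) := by
    have : eig α = eig (α - 1) := eig_eq_iff.2 ⟨1, by push_cast; ring⟩
    rw [this, eig]
    congr 1; ring
  have him : (ϖ * (1 - α)).im = 0 := by simp [h]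
  rw [h1, Complex.log_exp] <;> rw [him]
  · linarith [Real.pi_pos]
  · exact Real.pi_pos.le

namespace HodgeTuple

variable {w : ℤ} (D : HodgeTuple.{u} w)

lemma S_omega (a b : D.V) : D.S a (omega w D.M b) =
    (-1) ^ w * D.hForm a (expB D.M (-1 / 2) (D.conj b)) := by
  refine strip_ind D.M_bij (by simp +contextual [mul_add]) (fun α hα b hb => ?_) b
  have h1 := conj_expB D.M_bij D.conj_conj D.M_real (-1 / 2) (inStrip_sub_conj hα) (D.conj_mem hb)
  rw [stripN_sub_conj hα, D.conj_conj] at h1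
  have h3 : Cj (-1 / 2) = (-1 / 2 : ℂ) := by rw [map_div₀, map_neg, map_one, map_ofNat]
  have h2 : exp (-(ϖ * (stripN α : ℂ) * Cj (-1 / 2))) = (-1) ^ (stripN α) := by
    rw [h3, ← Complex.exp_pi_mul_I, ← Complex.exp_int_mul]
    congr 1
    rw [Complex.exp_pi_mul_I]; ring
  rw [h2, h3] at h1
  rw [hForm_apply, h1, map_smul, map_smul, smul_eq_mul, ← End.mul_apply D.psi, psi, expB,
    fc_mul D.M_bij (fun α _ => an_psiN w (stripN α) α) (fun α _ => by fun_prop), omega,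
    fc_apply D.M_bij _ hα hb, fc_apply D.M_bij _ hα hb]
  have h4 : omegaN w (stripN α) = fun x => (-1) ^ (w + stripN α) *
    (psiN w (stripN α) x * exp (ϖ * x * (-1 / 2))) := rfl
  rw [h4, locEnd_const_mul D.M_bij _ (f := fun x => psiN w (stripN α) x *
      exp (ϖ * x * (-1 / 2))) ((an_psiN w _ α).mul (by fun_prop)),
    LinearMap.smul_apply, map_smul, smul_eq_mul, zpow_add₀ (by norm_num : (-1 : ℂ) ≠ 0), mul_assoc]

end HodgeTuple

namespace Twistor

variable (T : Twistor.{u})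

/-- The pairing `L` on `H^∞` as a bilinear form. -/
def lForm (w : ℤ) : BilinForm ℂ T.Hinf :=
  LinearMap.mk₂ ℂ (fun a b => T.seifert w 0 a b) (by intro a a' b; simp [seifert, mul_add])
    (by intro c a b; simp [seifert]; ring)
    (by intro a b b'; simp [seifert, mul_add])
    (by intro c a b; simp [seifert]; ring)

lemma seifert_eq_pr (w : ℤ) (ζ : ℂ) (a b : T.Hinf) :
    T.seifert w ζ a b = (-1) ^ w * T.pr ζ a (T.conjInf b) := rfl

lemma seifert_eq (w : ℤ) (ζ : ℂ) (a b : T.Hinf) : T.seifert w ζ a b = T.lForm w a b := by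
  change _ = T.seifert w 0 a b
  simp [seifert_eq_pr, T.pr_const ζ 0]

lemma isTopPolarization_iff [FiniteDimensional ℂ T.Hinf] (hM : Bijective T.mono)
    (w : ℤ) (B : BilinForm ℂ T.Hinf) :
    T.IsTopPolarization w (fun a b => B a b) ↔ ∀ a b, B a (omega w T.mono b) = T.lForm w a b := by
  have hz : (ϖ : ℂ) ^ w ≠ 0 := zpow_ne_zero _ two_pi_I_ne
  constructor
  · intro h a b
    refine strip_ind hM (by simp +contextual) (fun α hα b hb => ?_) b
    by_cases hre : α.re = 1
    · by_cases he : eig α = 1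
      · rw [he] at hb
        have h1 := h.one 0 a b hb
        rw [N, genEig_one_omega hM w hb, seifert_eq, map_smul, smul_eq_mul] at h1
        exact mul_left_cancel₀ hz h1
      · set c : ℂ := ϖ * (1 - α) with hc
        have hc0 : c ≠ 0 := by
          refine mul_ne_zero two_pi_I_ne (sub_ne_zero.2 fun h1 => he ?_)
          rw [← h1, eig, mul_one, exp_neg, Complex.exp_two_pi_mul_I, inv_one]
        set b' := locEnd T.mono (fun x => (ϖ * (1 - x))⁻¹) α b with hb'
        have hb2 : b' ∈ genEig T.mono (eig α) := locEnd_mem_genEig hM _ _ hb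
        have hb3 : c • b' + T.N b' = b := by
          have han : An (fun x : ℂ => ϖ * (1 - x)) α := by fun_prop
          have h1 := locEnd_two_pi_I hM (α := α) b'
          rw [hb', ← End.mul_apply, locEnd_mul hM han
            (g := fun x => (ϖ * (1 - x))⁻¹) (han.inv hc0)] at h1
          rw [N, hb', hc, ← h1]
          have h2 : (fun x : ℂ => ϖ * (1 - x) * (ϖ * (1 - x))⁻¹) =ᶠ[𝓝 α] fun _ => 1 := by
            filter_upwards [han.continuousAt.eventually_ne hc0] with x hx
            exact mul_inv_cancel₀ hx
          have h3 := locEnd_congr T.mono h2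
          rw [locEnd_const hM, one_smul] at h3; exact congrArg (fun f : End ℂ T.Hinf => f b) h3
        have h1 := h.argZero 0 (eig α) a _ ((arg_eig hα).2 hre) he hb2
        rw [argZero_omega hM w hα (stripN_eq_two hre) hb2, log_eig hre, ← hc,
          show nPart T.mono = T.N from rfl, hb3, seifert_eq, map_smul, smul_eq_mul] at h1
        exact mul_left_cancel₀ hz h1
    · have h1 := h.argNeZero 0 a b (genEig_le_argNeZero hα hre hb)
      rw [argNeZero_omega hM w (genEig_le_argNeZero hα hre hb), seifert_eq, map_smul,
        smul_eq_mul] at h1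
      exact mul_left_cancel₀ (neg_ne_zero.2 hz) h1
  · intro h
    refine ⟨fun ζ a b hb => ?_, fun ζ μ a b hμ hμ1 hb => ?_, fun ζ a b hb => ?_⟩
    · simp [argNeZero_omega hM w hb, seifert_eq, h]
    · by_cases hμ0 : μ = 0
      · subst hμ0
        rw [genEig_zero hM, Submodule.mem_bot] at hb
        subst hb; simp [seifert_eq]
      obtain ⟨α, hα, rfl⟩ := exists_strip hμ0
      have hre := (arg_eig hα).1 hμ
      rw [argZero_omega hM w hα (stripN_eq_two hre) hb, log_eig hre, seifert_eq, map_smul,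
        smul_eq_mul, h]
      rfl
    · rw [N, genEig_one_omega hM w hb, seifert_eq, map_smul, smul_eq_mul, h]

/-- In terms of the hermitian form, `S` and `Ŝ` are related by
`Ŝ(A(ζ), B(ζ̄ + 1/2)) = h(A, e^{-πiB} B)`. -/
lemma isTopPolarization_iff_pr {w : ℤ} {D : HodgeTuple.{u} w} {φ : D.V ≃ₗ[ℂ] T.Hinf}
    (hc : ∀ a, φ (D.conj a) = T.conjInf (φ a)) (hφ : ∀ a, φ (D.M a) = T.mono (φ a)) :
    T.IsTopPolarization w (fun a b => D.S (φ.symm a) (φ.symm b)) ↔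
      ∀ ζ a b, T.pr ζ (φ a) (φ b) = D.hForm a (expB D.M (-1 / 2) b) := by
  have : FiniteDimensional ℂ T.Hinf := Module.Finite.equiv φ
  have hM : Bijective T.mono := by
    have h1 : (T.mono : T.Hinf → T.Hinf) = φ ∘ D.M ∘ φ.symm := by
      funext a
      simp [hφ]
    rw [h1]
    exact φ.bijective.comp (D.M_bij.comp φ.symm.bijective)
  have h1 := T.isTopPolarization_iff hM w
    (D.S.compl₁₂ (φ.symm : T.Hinf →ₗ[ℂ] D.V) (φ.symm : T.Hinf →ₗ[ℂ] D.V))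
  refine Iff.trans h1 ?_
  have h2 : ∀ a b, (D.S.compl₁₂ (φ.symm : T.Hinf →ₗ[ℂ] D.V) (φ.symm : T.Hinf →ₗ[ℂ] D.V)) (φ a)
      (omega w T.mono (φ b)) = D.S a (omega w D.M b) := fun a b => by
    rw [omega, ← equiv_fc hφ D.M_bij hM]; simp [omega]
  have hw : ((-1 : ℂ)) ^ w ≠ 0 := zpow_ne_zero _ (by norm_num)
  constructor
  · intro h ζ a b
    have h3 := h (φ a) (φ (D.conj b))
    rw [h2, D.S_omega, ← T.seifert_eq w ζ, seifert_eq_pr, ← hc, D.conj_conj] at h3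
    exact (mul_left_cancel₀ hw h3).symm
  · intro h a b
    obtain ⟨a, rfl⟩ := φ.surjective a
    obtain ⟨b, rfl⟩ := φ.surjective b
    rw [h2, D.S_omega, ← T.seifert_eq w 0, seifert_eq_pr, ← hc, h]

end Twistor

/-! ### The tuple belonging to a twistor -/

lemma exp_neg_two_pi_I_int (n : ℤ) : exp (-(ϖ * n)) = 1 := by
  rw [exp_neg, mul_comm, Complex.exp_int_mul_two_pi_mul_I, inv_one]

lemma exp_pi_I_int (n : ℤ) : exp (Real.pi * I * n) = (-1) ^ n := by
  rw [mul_comm, Complex.exp_int_mul, Complex.exp_pi_mul_I]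

lemma omegaN_sub (w n : ℤ) (x : ℂ) : omegaN w n (n - x) =
    (-1) ^ n * (exp (ϖ * (n - x) * -1) * omegaN w n x) := by
  have h1 : exp (ϖ * (n - x) * -1) = exp (-(ϖ * n)) * exp (ϖ * x) := by
    rw [← exp_add]; congr 1; ring
  have h2 : exp (ϖ * (n - x) * (-1 / 2)) = (-1) ^ n * (exp (ϖ * x) * exp (ϖ * x * (-1 / 2))) := by
    rw [← exp_add, ← exp_pi_I_int, ← exp_add]
    have h3 : ϖ * (n - x) * (-1 / 2) = -(ϖ * n) + (Real.pi * I * n + (ϖ * x +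
          ϖ * x * (-1 / 2))) := by ring
    simp [h3, exp_add, exp_neg_two_pi_I_int]
  rw [omegaN, omegaN, psiN_sub, h1, h2, exp_neg_two_pi_I_int]; ring

lemma cj_omegaN (w n : ℤ) : cj n (omegaN w n) = fun x => (-1) ^ w * omegaN w n x := by
  funext x
  have h1 : Cj (psiN w n (n - Cj x)) = (-1) ^ (w + n) * psiN w n x := congrFun (cj_psiN w n) x
  have h2 : Cj (exp (ϖ * (n - Cj x) * (-1 / 2))) = (-1) ^ n * exp (ϖ * x * (-1 / 2)) := by
    rw [← Complex.exp_conj, ← exp_pi_I_int, ← exp_add]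
    congr 1
    simp only [map_mul, map_sub, map_div₀, map_neg, map_one, map_ofNat, conj_I,
      conj_ofReal, conj_conj, map_intCast]
    ring
  rw [cj, omegaN, omegaN, map_mul, map_mul, h1, h2, neg_one_zpow_conj,
    zpow_add₀ (by norm_num : (-1 : ℂ) ≠ 0)]
  linear_combination ((-1) ^ w * (-1) ^ w * (-1) ^ n * psiN w n x *
    exp (ϖ * x * (-1 / 2))) * neg_one_mul_self n

lemma exists_section_eq (E : HolFam.{u}) {x : P1} (v : E.Fib x) : ∃ s : ∀ y, E.Fib y, s x = v := by
  classical
  exact ⟨Function.update 0 x v, Function.update_self _ _ _⟩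

namespace Twistor

variable (T : Twistor.{u})

lemma fibCast_conj {x y : P1} (h : x = y) (v : T.E.Fib x) :
    T.conj y (T.E.fibCast h v) = T.E.fibCast h (T.conj x v) := by
  subst h; rfl

lemma ev_mono (ζ : ℂ) (A : T.Hinf) :
    T.ev ζ (T.mono A) = T.E.fibCast (expP_add_one ζ) (T.ev (ζ + 1) A) := rfl

lemma ev_conjInf (ζ : ℂ) (A : T.Hinf) : T.ev ζ (T.conjInf A) = T.conj (expP ζ) (T.ev ζ A) := rfl

lemma pr_eq_of_sections {ζ : ℂ} {A B : T.Hinf} {a b : ∀ y, T.E.Fib y} (ha : a (expP ζ) = T.ev ζ A)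
    (hb : b (expP (Cj ζ + 1 / 2)) = T.ev (Cj ζ + 1 / 2) B) :
    T.pr ζ A B = T.Shat (expP ζ) (a (expP ζ)) (b (sig (expP ζ))) := by
  rw [pr, ← ha, ← hb, fibCast_section]

lemma section_congr {a : ∀ y, T.E.Fib y} {A : T.Hinf} {ζ ξ : ℂ} (h : ξ = ζ)
    (ha : a (expP ζ) = T.ev ζ A) : a (expP ξ) = T.ev ξ A := by
  subst h; exact ha

lemma section_mono {a : ∀ y, T.E.Fib y} {A : T.Hinf} {ζ : ℂ} :
    a (expP ζ) = T.ev ζ (T.mono A) ↔ a (expP (ζ + 1)) = T.ev (ζ + 1) A := by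
  rw [ev_mono, ← fibCast_section T.E a (expP_add_one ζ)]; simp

lemma pr_mono_mono (A B : T.Hinf) : T.pr 0 (T.mono A) (T.mono B) = T.pr 0 A B := by
  obtain ⟨a, ha⟩ := exists_section_eq T.E (T.ev 0 (T.mono A))
  obtain ⟨b, hb⟩ := exists_section_eq T.E (T.ev (Cj 0 + 1 / 2) (T.mono B))
  rw [T.pr_const 0 (0 + 1) A B, T.pr_eq_of_sections ha hb,
    T.pr_eq_of_sections (section_mono T |>.1 ha)
      (T.section_congr (by simp; ring) (section_mono T |>.1 hb))]
  exact congrArg (fun y => T.Shat y (a y) (b (sig y))) (expP_add_one 0).symm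

lemma pr_symm (A B : T.Hinf) : T.pr 0 (T.mono A) B = Cj (T.pr 0 B A) := by
  obtain ⟨a, ha⟩ := exists_section_eq T.E (T.ev 0 (T.mono A))
  obtain ⟨b, hb⟩ := exists_section_eq T.E (T.ev (Cj 0 + 1 / 2) B)
  rw [T.pr_const 0 (Cj 0 + 1 / 2) B A, T.pr_eq_of_sections ha hb,
    T.pr_eq_of_sections hb (T.section_congr (by simp only [map_add, map_zero, map_div₀, map_one, map_ofNat]; norm_num)
        (section_mono T |>.1 ha)),
    T.Shat_symm]
  exact congrArg (fun y => Cj (T.Shat y (b y) (a (sig y)))) (sig_expP 0)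

lemma sig_mem_Cstar {x : P1} (hx : x ∈ Cstar) : sig x ∈ Cstar := by
  obtain ⟨ζ, rfl⟩ := exists_expP hx
  rw [sig_expP]; exact expP_mem _

lemma Shat_conj {w : ℤ} (h : T.IsReal w) {x : P1} (hx : x ∈ Cstar) (a : T.E.Fib x)
    (b : T.E.Fib (sig x)) :
    T.Shat x (T.conj x a) (T.conj (sig x) b) = (-1) ^ w * Cj (T.Shat x a b) := by
  have hdec : ∀ y ∈ Cstar, ∀ v : T.E.Fib y, ∃ v₁ v₂, v = v₁ + I • v₂ ∧
      T.conj y v₁ = v₁ ∧ T.conj y v₂ = v₂ := fun y hy v => by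
    refine ⟨(1 / 2 : ℂ) • (v + T.conj y v), (-(1 / 2) * I : ℂ) • (v - T.conj y v), ?_, ?_, ?_⟩
    · rw [smul_smul, show I * (-(1 / 2) * I) = 1 / 2 by
        linear_combination (-1 / 2 : ℂ) * Complex.I_mul_I]
      module
    · simp [LinearMap.map_smulₛₗ, T.conj_conj y hy, add_comm, map_ofNat (Cj) 2]
    · rw [LinearMap.map_smulₛₗ, map_sub, T.conj_conj y hy]
      have : Cj (-(1 / 2) * I) = (1 / 2) * I := by simp [map_ofNat (Cj) 2]
      rw [this]
      module
  have hr : ∀ a b, T.conj x a = a → T.conj (sig x) b = b →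
      Cj (T.Shat x a b) = (-1) ^ w * T.Shat x a b := fun a b ha hb => by
    obtain ⟨r, hr⟩ := h x hx a b ha hb
    rw [hr, map_mul, Complex.conj_ofReal, map_zpow₀, Complex.conj_I, ← mul_assoc, ← mul_zpow]
    simp
  obtain ⟨a₁, a₂, rfl, h1, h2⟩ := hdec x hx a
  obtain ⟨b₁, b₂, rfl, h3, h4⟩ := hdec (sig x) (sig_mem_Cstar hx) b
  simp only [map_add, LinearMap.map_smulₛₗ, LinearMap.add_apply, LinearMap.smul_apply, h1, h2, h3,
    h4, map_mul, smul_eq_mul, Complex.conj_I, RingHom.id_apply, hr _ _ h1 h3, hr _ _ h1 h4,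
    hr _ _ h2 h3, hr _ _ h2 h4, map_neg, neg_neg]
  have := neg_one_mul_self w
  generalize ((-1 : ℂ)) ^ w = e at *
  linear_combination (- (T.Shat x a₁ b₁ + Complex.I * T.Shat x a₁ b₂ - Complex.I * T.Shat x a₂ b₁
    - Complex.I * Complex.I * T.Shat x a₂ b₂)) * this

lemma pr_conj {w : ℤ} (h : T.IsReal w) (A B : T.Hinf) :
    T.pr 0 (T.conjInf A) (T.conjInf B) = (-1) ^ w * Cj (T.pr 0 A B) := by
  rw [pr, ev_conjInf, ev_conjInf, ← fibCast_conj, T.Shat_conj h (expP_mem _)]; rfl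

lemma lForm_apply (w : ℤ) (A B : T.Hinf) : T.lForm w A B = (-1) ^ w * T.pr 0 A (T.conjInf B) := rfl

lemma conjInf_conjInf (A : T.Hinf) : T.conjInf (T.conjInf A) = A := by
  ext ζ
  exact T.conj_conj _ (expP_mem ζ) _

lemma mono_conjInf (A : T.Hinf) : T.mono (T.conjInf A) = T.conjInf (T.mono A) := by
  ext ζ
  exact (T.fibCast_conj (expP_add_one ζ) (T.ev (ζ + 1) A)).symm

lemma lForm_mono (w : ℤ) (A B : T.Hinf) : T.lForm w (T.mono A) (T.mono B) = T.lForm w A B := by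
  rw [lForm_apply, lForm_apply, ← mono_conjInf, pr_mono_mono]

lemma lForm_conj {w : ℤ} (h : T.IsReal w) (A B : T.Hinf) :
    T.lForm w (T.conjInf A) (T.conjInf B) = (-1) ^ w * Cj (T.lForm w A B) := by
  simp [lForm_apply, T.pr_conj h]

lemma lForm_symm {w : ℤ} (h : T.IsReal w) (A B : T.Hinf) :
    T.lForm w (T.mono A) B = (-1) ^ w * T.lForm w B A := by
  have h1 := T.pr_conj h B (T.conjInf A)
  rw [conjInf_conjInf] at h1
  simp [lForm_apply, pr_symm, h1]

end Twistor

/-! ### From `L` to `S` -/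

section FormOfL

variable {V : Type u} [AddCommGroup V] [Module ℂ V] [FiniteDimensional ℂ V]
  {M : End ℂ V} (hM : Bijective M) {L : BilinForm ℂ V} {w : ℤ}

/-- The bilinear form `S(a, b) = L(a, Ω⁻¹ b)`. -/
def formOfL (w : ℤ) (M : End ℂ V) (L : BilinForm ℂ V) : BilinForm ℂ V :=
  L.compl₁₂ LinearMap.id (omegaInv w M)

include hM

lemma formOfL_omega (a b : V) : formOfL w M L a (omega w M b) = L a b := by
  exact congrArg (fun f : End ℂ V => L a (f b)) (omegaInv_mul_omega hM w)

lemma omega_surjective (w : ℤ) (b : V) : ∃ b', omega w M b' = b :=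
  ⟨omegaInv w M b, congrArg (fun f : End ℂ V => f b) (omega_mul_omegaInv hM w)⟩

lemma omega_surjective_genEig (w : ℤ) {α : ℂ} (hα : InStrip α) {b : V}
    (hb : b ∈ genEig M (eig α)) : ∃ b' ∈ genEig M (eig α), omega w M b' = b :=
  ⟨omegaInv w M b, fc_mem_genEig hM _ hα hb,
    congrArg (fun f : End ℂ V => f b) (omega_mul_omegaInv hM w)⟩

lemma omega_comm (w : ℤ) (b : V) : omega w M (M b) = M (omega w M b) :=
  congrArg (fun f : End ℂ V => f b)
    (fc_commute_self hM (f := fun α => omegaN w (stripN α)) fun α _ => an_omegaN w _ α).eq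

lemma formOfL_real {c : V →ₛₗ[Cj] V} (hcc : ∀ a, c (c a) = a) (hcM : ∀ a, M (c a) = c (M a))
    (hc : ∀ a b, L (c a) (c b) = (-1) ^ w * Cj (L a b)) (a b : V) :
    formOfL w M L (c a) (c b) = Cj (formOfL w M L a b) := by
  refine strip_ind hM (by simp +contextual) (fun α hα b hb' => ?_) b
  obtain ⟨b, hb, rfl⟩ := omega_surjective_genEig hM w hα hb'
  have h1 : c (omega w M b) = (-1 : ℂ) ^ w • omega w M (c b) := by
    rw [omega, fc_apply hM _ hα hb, conj_locEnd hM hcc hcM (stripN α), cj_omegaN,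
      locEnd_const_mul hM _ (an_omegaN w _ _), LinearMap.smul_apply,
      fc_apply hM _ (inStrip_sub_conj hα) (conj_mem_genEig hcM hb _), stripN_sub_conj hα]
  rw [h1, map_smul, formOfL_omega hM, formOfL_omega hM, hc, smul_eq_mul, ← mul_assoc,
    neg_one_mul_self, one_mul]

variable (hL : ∀ a b, L (M a) (M b) = L a b)
include hL

lemma formOfL_mono (a b : V) : formOfL w M L (M a) (M b) = formOfL w M L a b := by
  obtain ⟨b, rfl⟩ := omega_surjective hM w b
  rw [← omega_comm hM, formOfL_omega hM, formOfL_omega hM, hL]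

lemma formOfL_symm (hs : ∀ a b, L (M a) b = (-1) ^ w * L b a) {α β : ℂ} (hα : InStrip α)
    (hβ : InStrip β) (hn : stripN α = stripN β) {a b : V} (ha : a ∈ genEig M (eig α))
    (hb : b ∈ genEig M (eig β)) :
    formOfL w M L a b = (-1) ^ (w + stripN α) * formOfL w M L b a := by
  have hS := formOfL_mono hM hL (w := w)
  by_cases h : β = stripN α - α
  · obtain ⟨a, ha', rfl⟩ := omega_surjective_genEig hM w hα ha
    obtain ⟨b, hb', rfl⟩ := omega_surjective_genEig hM w hβ hb
    rw [formOfL_omega hM, formOfL_omega hM]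
    have h1 : L (omega w M a) b =
        L a (locEnd M (fun x => omegaN w (stripN α) (stripN α - x)) β b) := by
      rw [omega, fc_apply hM _ hα ha', form_locEnd hL hM (stripN α), ← h]
    have h2 : L (M a) (omega w M b) = L a (locEnd M (fun x =>
        exp (ϖ * (stripN α - x) * -1) * omegaN w (stripN α) x) β b) := by
      rw [apply_eq_locEnd hM hα ha', form_locEnd hL hM (stripN α), ← h, omega,
        fc_apply hM _ hβ hb', ← hn, ← End.mul_apply, locEnd_mul hM (by fun_prop)
          (an_omegaN w _ β)]
    rw [hs] at h2
    simp only [omegaN_sub] at h1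
    rw [locEnd_const_mul hM _ (f := fun x =>
      exp (ϖ * (stripN α - x) * -1) * omegaN w (stripN α) x)
      ((by fun_prop : An (fun x : ℂ =>
        exp (ϖ * (stripN α - x) * -1)) β).mul
        (an_omegaN w _ β)), LinearMap.smul_apply, map_smul, smul_eq_mul, ← h2] at h1
    rw [h1, zpow_add₀ (by norm_num : (-1 : ℂ) ≠ 0)]; ring
  · rw [form_strip_eq_zero hS hα hβ h ha hb, form_strip_eq_zero hS hβ hα _ hb ha, mul_zero]
    rw [← hn]; exact fun h' => h (by linear_combination h')

end FormOfL

namespace Twistor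

variable {T : Twistor.{u}} {w : ℤ}

lemma lForm_nondeg (hev : ∀ ζ, Surjective (T.ev ζ)) (w : ℤ) : (T.lForm w).Nondegenerate := by
  have hw : ((-1 : ℂ)) ^ w ≠ 0 := zpow_ne_zero _ (by norm_num)
  have key : ∀ A, (∀ B, T.lForm w A B = 0) → A = 0 := fun A hA => by
    ext ζ
    refine T.Shat_nondeg_left _ _ fun b => ?_
    obtain ⟨B, hB⟩ := hev (Cj ζ + 1 / 2) (T.E.fibCast (sig_expP ζ) b)
    have h1 := hA (T.conjInf B)
    rw [← T.seifert_eq w ζ, seifert_eq_pr, conjInf_conjInf, mul_eq_zero, or_iff_right hw, pr, hB,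
      HolFam.fibCast_symm_apply] at h1
    exact h1
  refine ⟨key, fun B hB => ?_⟩
  have h1 : T.conjInf B = 0 := by
    ext ζ
    have h2 : T.E.fibCast (sig_expP (Cj (ζ - 1 / 2))).symm
        (T.ev (Cj (Cj (ζ - 1 / 2)) + 1 / 2) (T.conjInf B)) = 0 := by
      refine T.Shat_nondeg_right _ _ fun a => ?_
      obtain ⟨A, hA⟩ := hev _ a
      have h1 := hB A
      rw [← T.seifert_eq w (Cj (ζ - 1 / 2)), seifert_eq_pr, mul_eq_zero,
        or_iff_right hw, pr, hA] at h1
      exact h1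
    rw [LinearEquiv.map_eq_zero_iff] at h2
    have h3 : Cj (Cj (ζ - 1 / 2)) + 1 / 2 = ζ := by rw [Complex.conj_conj]; ring
    rwa [h3] at h2
  rw [← T.conjInf_conjInf B, h1, map_zero]

/-- The tuple belonging to an integrable polarized mixed twistor structure generated by elementary
sections. -/
lemma exists_tuple (hT : T.IsPMTS w) : ∃ D : HodgeTuple.{u} w, Corresponds D T := by
  obtain ⟨F, hF, hg⟩ := hT.elementary
  have hev := ev_bijective hg.1 hg.2
  have hfin := finite_Hinf hg.2
  have hM := mono_bijective hg.2
  have hL := T.lForm_mono w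
  have hs := T.lForm_symm hT.real
  have hnd := lForm_nondeg (fun ζ => (hev ζ).2) w
  set S := formOfL w T.mono (T.lForm w)
  have hsym := @formOfL_symm T.Hinf _ _ _ T.mono hM (T.lForm w) w hL hs
  have hc := T.lForm_conj hT.real
  let D : HodgeTuple.{u} w :=
    { V := T.Hinf
      finite := hfin
      conj := T.conjInf
      conj_conj := T.conjInf_conjInf
      M := T.mono
      M_bij := hM
      M_real := T.mono_conjInf
      F := F
      F_fil := hF
      S := S
      S_nondeg := by
        refine ⟨fun a ha => hnd.1 a fun b => ?_, fun b hb => ?_⟩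
        · rw [← formOfL_omega hM]; exact ha _
        · obtain ⟨b, rfl⟩ := omega_surjective hM w b
          rw [hnd.2 b fun a => by rw [← formOfL_omega hM]; exact hb a, map_zero]
      S_M := formOfL_mono hM hL
      S_symm_argNeZero := by
        have h1 : ∀ β, InStrip β → stripN β = 1 → ∀ b ∈ genEig T.mono (eig β),
            argNeZero T.mono ≤ eqLocus (S.flip b) ((-1 : ℂ) ^ (w - 1) • S b) := fun β hβ hn b hb => by
          refine iSup₂_le fun μ hμ a ha => ?_
          have h0 : μ ≠ 0 := by
            rintro rfl; exact hμ Complex.arg_zero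
          obtain ⟨α, hα, rfl⟩ := exists_strip h0
          have hn' : stripN α = 1 := stripN_eq_one hα fun h => hμ ((arg_eig hα).2 h)
          have h2 := hsym hα hβ (hn'.trans hn.symm) ha hb
          rw [hn'] at h2
          have h3 : ((-1 : ℂ)) ^ (w + 1) = (-1) ^ (w - 1) := by
            rw [show w + 1 = w - 1 + 2 by ring, zpow_add₀ (by norm_num)]; norm_num
          rwa [h3] at h2
        intro a ha
        have h2 : argNeZero T.mono ≤ eqLocus (S a) ((-1 : ℂ) ^ (w - 1) • S.flip a) := by
          refine iSup₂_le fun μ hμ b hb => ?_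
          have h0 : μ ≠ 0 := by
            rintro rfl; exact hμ Complex.arg_zero
          obtain ⟨α, hα, rfl⟩ := exists_strip h0
          exact h1 α hα (stripN_eq_one hα fun h => hμ ((arg_eig hα).2 h)) b hb ha
        exact fun b hb => h2 hb
      S_symm_argZero := by
        have h1 : ∀ β, InStrip β → stripN β = 2 → ∀ b ∈ genEig T.mono (eig β),
            argZero T.mono ≤ eqLocus (S.flip b) ((-1 : ℂ) ^ w • S b) := fun β hβ hn b hb => by
          refine iSup₂_le fun μ hμ a ha => ?_
          by_cases h0 : μ = 0
          · subst h0
            rw [genEig_zero hM, Submodule.mem_bot] at ha; simp [ha]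
          obtain ⟨α, hα, rfl⟩ := exists_strip h0
          have hn' : stripN α = 2 := stripN_eq_two ((arg_eig hα).1 hμ)
          have h2 := hsym hα hβ (hn'.trans hn.symm) ha hb
          rw [hn', zpow_add₀ (by norm_num : (-1 : ℂ) ≠ 0)] at h2
          have h3 : ((-1 : ℂ)) ^ (2 : ℤ) = 1 := by norm_num
          rwa [h3, mul_one] at h2
        intro a ha
        have h2 : argZero T.mono ≤ eqLocus (S a) ((-1 : ℂ) ^ w • S.flip a) := by
          refine iSup₂_le fun μ hμ b hb => ?_
          by_cases h0 : μ = 0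
          · subst h0
            rw [genEig_zero hM, Submodule.mem_bot] at hb; simp [hb]
          obtain ⟨α, hα, rfl⟩ := exists_strip h0
          exact h1 α hα (stripN_eq_two ((arg_eig hα).1 hμ)) b hb ha
        exact fun b hb => h2 hb
      S_real := formOfL_real hM T.conjInf_conjInf T.mono_conjInf hc }
  refine ⟨D, LinearEquiv.refl ℂ T.Hinf, fun _ => rfl, fun _ => rfl, hg, ?_⟩
  exact (T.isTopPolarization_iff hM w S).2 (formOfL_omega hM)

end Twistor

/-! ### Models of a twistor -/

/-- A model of the twistor `T` on the space of the tuple `D`: over `ℂ^*` the trivialization `τ`,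
which maps `e^{-2πiBζ}A ∈ V` to the value at `ζ` of the flat section belonging to `A ∈ V`, identifies
all data of `T` with constant data on `V`, and `ext_zero`, `ext_infty` describe the germs of the
bundle at `0` and `∞` as the lattices `∑ z^n 𝒪 F^{w-1-n}` and `∑ z^n 𝒪 Fbⁿ`. -/
structure IsModel {w : ℤ} (D : HodgeTuple.{u} w) (W : Fil(D.V)) (T : Twistor.{u})
    (τ : ∀ x, T.E.Fib x ≃ₗ[ℂ] D.V) : Prop where
  weight : IsWeightFiltration D.N 0 W
  triv : IsTriv D.M T.E T.nabla τ
  ext_zero : ∀ s, T.E.ExtHolAt s 𝟘 ↔ Lat (fun n => D.F (w - 1 - n)) fun u => τ u (s u)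
  ext_infty : ∀ s, T.E.ExtHolAt s ∞ ↔ Lat (fun n => D.Fb (-n)) fun u => τ (atInf u) (s (atInf u))
  conj : ∀ ζ v, τ (expP ζ) (T.conj (expP ζ) ((τ (expP ζ)).symm (expB D.M (-ζ) v))) =
    expB D.M (-ζ) (D.conj v)
  What : ∀ k, ∀ x ∈ Cstar, ∀ v, v ∈ T.What k x ↔ τ x v ∈ W k
  Nhat : ∀ x ∈ Cstar, ∀ v, τ x (T.Nhat x v) = D.N (τ x v)
  Shat : ∀ x ∈ Cstar, ∀ a b, T.Shat x a b = D.hForm (τ x a) (τ (sig x) b)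

lemma zc_coe (z : ℂ) : zc z = z := rfl

lemma zc_infty : zc ∞ = 0 := rfl

lemma zc_atInf (u : ℂ) : zc (atInf u) = u⁻¹ := by
  by_cases h : u = 0
  · subst h
    rw [atInf_zero, zc_infty, inv_zero]
  · rw [atInf_of_ne h, zc_coe]

lemma zc_expP (ζ : ℂ) : zc (expP ζ) = ez ζ := rfl

/-- The generators of a lattice may be chosen in the generalized eigenspaces of `M`. -/
lemma lat_iff_strip {V : Type u} [AddCommGroup V] [Module ℂ V] [FiniteDimensional ℂ V]
    {M : End ℂ V} (hM : Bijective M) {Φ : Fil(V)}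
    (hΦ : ∀ n, (Φ n).map (ssPart M) ≤ Φ n) {g : ℂ → V} :
    Lat Φ g ↔ ∃ (m : ℕ) (n : Fin m → ℤ) (α : Fin m → ℂ) (A : Fin m → V) (f : Fin m → ℂ → ℂ),
      (∀ i, InStrip (α i) ∧ A i ∈ genEig M (eig (α i)) ∧ A i ∈ Φ (n i) ∧ An (f i) 0) ∧
      ∀ᶠ u in 𝓝[≠] 0, g u = ∑ i, (f i u * u ^ n i) • A i := by
  constructor
  · rintro ⟨m, n, A, f, h1, h2⟩
    have key : ∃ S : Finset ℂ, (∀ μ ∈ S, InStrip (stripRep μ)) ∧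
        ∀ x, ∑ μ ∈ S, eigProj M (stripRep μ) x = x :=
      ⟨_, fun μ hμ => inStrip_stripRep hM ((Set.Finite.mem_toFinset _).1 hμ),
        sum_eigProj hM⟩
    obtain ⟨S, hS, hsum⟩ := key
    let e := (Fintype.equivFin (Fin m × S)).symm
    refine ⟨_, fun i => n (e i).1, fun i => stripRep (e i).2,
      fun i => eigProj M (stripRep (e i).2) (A (e i).1), fun i => f (e i).1, fun i => ?_, ?_⟩
    · exact ⟨hS _ (e i).2.2, eigProj_mem hM (hS _ (e i).2.2) _,
        proj_mem (hΦ _) (h1 _).1, (h1 _).2⟩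
    · filter_upwards [h2] with u hu
      rw [hu, Equiv.sum_comp e fun p : Fin m × S =>
        (f p.1 u * u ^ n p.1) • eigProj M (stripRep (p.2 : ℂ)) (A p.1), Fintype.sum_prod_type]
      refine sum_congr rfl fun i _ => ?_
      change _ = ∑ μ : S, (f i u * u ^ n i) • eigProj M (stripRep (μ : ℂ)) (A i)
      rw [← smul_sum]
      congr 1
      conv_lhs => rw [← hsum (A i)]
      exact (Finset.sum_coe_sort S fun μ => eigProj M (stripRep μ) (A i)).symm
  · rintro ⟨m, n, α, A, f, h1, h2⟩; exact ⟨m, n, A, f, fun i => (h1 i).2.2, h2⟩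

section Generation

variable {w : ℤ} {D : HodgeTuple.{u} w} {T : Twistor.{u}} {φ : D.V ≃ₗ[ℂ] T.Hinf}
  {τ : ∀ x, T.E.Fib x ≃ₗ[ℂ] D.V}

lemma mono_bijective_of_equiv (hφ : ∀ a, φ (D.M a) = T.mono (φ a)) : Bijective T.mono := by
  have h1 : (T.mono : T.Hinf → T.Hinf) = φ ∘ D.M ∘ φ.symm := by
    funext a
    simp [hφ]
  rw [h1]
  exact φ.bijective.comp (D.M_bij.comp φ.symm.bijective)

variable (hφ : ∀ a, φ (D.M a) = T.mono (φ a))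
  (hτ : ∀ ζ A, τ (expP ζ) (T.ev ζ (φ A)) = expB D.M (-ζ) A)

include hφ hτ

/-- The elementary section `es(A, α + n)` is `z^n A` in the trivialization `τ`. -/
lemma isElementary_iff {α : ℂ} (hα : InStrip α) {n : ℤ} {a : D.V} (ha : a ∈ D.Hα α)
    {s : ∀ x, T.E.Fib x} : T.IsElementary (φ a) (α + n) s ↔
      ∀ x ∈ Cstar, τ x (s x) = zc x ^ n • a := by
  have : FiniteDimensional ℂ T.Hinf := Module.Finite.equiv φ
  have hM := mono_bijective_of_equiv hφ
  have key : ∀ ζ : ℂ, τ (expP ζ) (exp (ϖ * (α + n) * ζ) •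
      T.ev ζ (nilExp (-ζ) T.N (φ a))) = zc (expP ζ) ^ n • a := fun ζ => by
    have h1 : nilExp (-ζ) T.N (φ a) = φ (nilExp (-ζ) D.N a) :=
      (equiv_nilSeries (fun x => equiv_nPart hφ D.M_bij hM x) _ a).symm
    have h2 := expB_apply D.M_bij ζ hα ha
    have h3 : exp (ϖ * (α + n) * ζ) = ez ζ ^ n * exp (ϖ * α * ζ) := by
      rw [ez, ← Complex.exp_int_mul, ← exp_add]
      congr 1; ring
    have h4 : exp (ϖ * α * ζ) • nilExp (-ζ) D.N a = expB D.M ζ a := h2.symm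
    rw [h1, LinearEquiv.map_smul, hτ, h3, mul_smul, zc_expP, ← LinearMap.map_smul, h4,
      expB_neg_apply D.M_bij]
  constructor
  · intro h x hx
    obtain ⟨ζ, rfl⟩ := exists_expP hx
    rw [h ζ, key]
  · intro h ζ
    apply (τ (expP ζ)).injective
    rw [key, h _ (expP_mem ζ)]

lemma generatedAt_iff {x : P1} {Φ : ℤ → ℂ → Submodule ℂ T.Hinf} :
    T.GeneratedAt x Φ ↔ ∀ s, T.E.ExtHolAt s x ↔
    ∃ (m : ℕ) (n : Fin m → ℤ) (α : Fin m → ℂ) (A : Fin m → D.V) (f : Fin m → P1 → ℂ),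
      (∀ i, InStrip (α i) ∧ A i ∈ D.Hα (α i) ∧ φ (A i) ∈ Φ (n i) (α i) ∧ HolFun (f i) x) ∧
      ∀ᶠ y in 𝓝[≠] x, τ y (s y) = ∑ i, (f i y * zc y ^ n i) • A i := by
  refine forall_congr' fun s => iff_congr Iff.rfl ?_
  constructor
  · rintro ⟨m, n, α, A, es, f, h1, h2⟩
    have h3 : ∀ i, φ.symm (A i) ∈ D.Hα (α i) := fun i =>
      (equiv_genEig hφ).1 (by rw [φ.apply_symm_apply]; exact (h1 i).2.1)
    refine ⟨m, n, α, fun i => φ.symm (A i), f, fun i => ⟨(h1 i).1, h3 i, ?_, (h1 i).2.2.2.2⟩, ?_⟩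
    · rw [φ.apply_symm_apply]; exact (h1 i).2.2.1
    · filter_upwards [h2, eventually_mem_Cstar x] with y hy hyC
      rw [hy, map_sum]
      refine sum_congr rfl fun i _ => ?_
      have h4 := (h1 i).2.2.2.1
      rw [← φ.apply_symm_apply (A i), isElementary_iff hφ hτ (h1 i).1 (h3 i)] at h4
      rw [map_smul, h4 y hyC, smul_smul]
  · rintro ⟨m, n, α, A, f, h1, h2⟩
    have h4 : ∀ i, T.IsElementary (φ (A i)) (α i + n i) fun y => (τ y).symm (zc y ^ n i • A i) :=
      fun i => (isElementary_iff hφ hτ (h1 i).1 (h1 i).2.1).2 fun y _ => by simp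
    refine ⟨m, n, α, fun i => φ (A i), _, f, fun i => ⟨(h1 i).1, (equiv_genEig hφ).2 (h1 i).2.1,
      (h1 i).2.2.1, h4 i, (h1 i).2.2.2⟩, ?_⟩
    filter_upwards [h2] with y hy
    apply (τ y).injective; simp [hy, apply_symm_apply, smul_smul]

lemma generatedAt_zero_iff :
    T.GeneratedAt 𝟘 (fun n _ => (D.F (w - 1 - n)).comap φ.symm.toLinearMap) ↔
      ∀ s, T.E.ExtHolAt s 𝟘 ↔ Lat (fun n => D.F (w - 1 - n)) fun u => τ u (s u) := by
  refine (generatedAt_iff hφ hτ).trans (forall_congr' fun s => ?_)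
  rw [lat_iff_strip D.M_bij fun n => D.F_fil.2.1 _]
  refine iff_congr Iff.rfl (Iff.intro ?_ ?_)
  · rintro ⟨m, n, α, A, f, h1, h2⟩
    refine ⟨m, n, α, A, fun i u => f i u, fun i => ⟨(h1 i).1, (h1 i).2.1, ?_,
      holFun_coe_iff.1 (h1 i).2.2.2⟩, eventually_nhdsNE_zero.1 h2⟩
    have := (h1 i).2.2.1
    rw [Submodule.mem_comap] at this; simpa using this
  · rintro ⟨m, n, α, A, f, h1, h2⟩
    refine ⟨m, n, α, A, fun i y => f i (zc y), fun i => ⟨(h1 i).1, (h1 i).2.1, ?_,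
      holFun_coe_iff.2 (h1 i).2.2.2⟩, eventually_nhdsNE_zero.2 h2⟩
    rw [Submodule.mem_comap]; simpa using (h1 i).2.2.1

lemma generatedAt_infty_iff (hc : ∀ a, φ (D.conj a) = T.conjInf (φ a)) :
    T.GeneratedAt ∞ (fun n α => conjFil T.conjInf
      (fun p => (D.F p).comap φ.symm.toLinearMap) (n + ⌊α.re⌋)) ↔
      ∀ s, T.E.ExtHolAt s ∞ ↔ Lat (fun n => D.Fb (-n)) fun u => τ (atInf u) (s (atInf u)) := by
  refine (generatedAt_iff hφ hτ).trans (forall_congr' fun s => ?_)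
  rw [lat_iff_strip D.M_bij fun n => D.Fb_fil.2.1 _]
  have key : ∀ {n : ℤ} {α : ℂ} {a : D.V}, InStrip α → a ∈ D.Hα α →
      (φ a ∈ conjFil T.conjInf (fun p => (D.F p).comap φ.symm.toLinearMap) (n + ⌊α.re⌋) ↔
        a ∈ D.Fb n) := by
    intro n α a hα ha
    rw [D.mem_Fb hα ha, conjFil, Submodule.mem_comap, Submodule.mem_comap, ← hc]
    have h1 : n + stripN α - 1 = n + ⌊α.re⌋ := by rw [stripN]; ring
    rw [h1]; simp
  refine iff_congr Iff.rfl (Iff.intro ?_ ?_)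
  · rintro ⟨m, n, α, A, f, h1, h2⟩
    refine ⟨m, fun i => -n i, α, A, fun i u => f i (atInf u), fun i => ⟨(h1 i).1, (h1 i).2.1, ?_,
      holFun_infty_iff.1 (h1 i).2.2.2⟩, ?_⟩
    · rw [neg_neg]; exact (key (h1 i).1 (h1 i).2.1).1 (h1 i).2.2.1
    · filter_upwards [eventually_nhdsNE_infty.1 h2] with u hu
      simp [hu, zc_atInf, inv_zpow']
  · rintro ⟨m, n, α, A, f, h1, h2⟩
    refine ⟨m, fun i => -n i, α, A, fun i y => f i (zc y)⁻¹, fun i => ⟨(h1 i).1, (h1 i).2.1,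
      (key (h1 i).1 (h1 i).2.1).2 (h1 i).2.2.1, ?_⟩, ?_⟩
    · rw [holFun_infty_iff]
      simp only [zc_atInf, inv_inv]; exact (h1 i).2.2.2
    · rw [eventually_nhdsNE_infty]
      filter_upwards [h2] with u hu
      simp [hu, zc_atInf, inv_zpow', inv_inv]

end Generation

section Connection

variable {E : HolFam.{u}} {r : ℕ} (hE : E.IsBundle r) {nab : (∀ x, E.Fib x) → ∀ x, E.Fib x}
  (hD : IsMerConnection E nab)

include hD in
/-- The connection only depends on germs. -/
lemma IsMerConnection.congr {s t : ∀ x, E.Fib x} {z : ℂ} (hz : z ≠ 0) (hs : E.HolAt s z)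
    (ht : E.HolAt t z) (h : ∀ᶠ y in 𝓝 z, s y = t y) :
    nab s z = nab t z := by
  classical
  set f : P1 → ℂ := fun y => if s y = t y then 1 else 0 with hf
  have h1 : ∀ᶠ u : ℂ in 𝓝 z, f u = 1 := by
    rw [OnePoint.nhds_coe_eq, eventually_map] at h
    filter_upwards [h] with u hu
    rw [hf]; exact if_pos hu
  have hfh : HolFun f z := holFun_coe_iff.2 (analyticAt_const.congr (h1.mono fun _ h => h.symm))
  have hd : deriv (fun u : ℂ => f u) z = 0 := by
    have : (fun u : ℂ => f u) =ᶠ[𝓝 z] fun _ => 1 := h1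
    rw [this.deriv_eq, deriv_const]
  have h2 := hD.leibniz f s z hz hfh hs
  have h3 := hD.leibniz f t z hz hfh ht
  rw [hd, h1.self_of_nhds, one_smul, mul_zero, zero_smul, add_zero] at h2 h3
  rw [← h2, ← h3]
  congr 1
  funext y
  by_cases hy : s y = t y
  · rw [hy]
  · simp [hf, hy]

include hE hD in
lemma IsMerConnection.sum {ι : Type*} {S : Finset ι} {s : ι → ∀ x, E.Fib x} {x : P1}
    (hx : x ∈ Cstar) (h : ∀ i ∈ S, E.HolAt (s i) x) :
    nab (fun y => ∑ i ∈ S, s i y) x = ∑ i ∈ S, nab (s i) x := by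
  classical
  induction S using induction_on with
  | empty =>
    have := hD.add 0 0 x hx (hE.holAt_zero x) (hE.holAt_zero x)
    rw [add_zero, left_eq_add] at this
    simp only [Finset.sum_empty]; exact this
  | insert i S hi ih =>
    simp only [sum_insert hi]
    rw [← ih fun j hj => h j (mem_insert_of_mem hj)]
    exact hD.add _ _ x hx (h i (mem_insert_self i S))
      (hE.holAt_sum fun j hj => h j (mem_insert_of_mem hj))

end Connection

section Trivialization

variable {w : ℤ} {D : HodgeTuple.{u} w} {T : Twistor.{u}} {φ : D.V ≃ₗ[ℂ] T.Hinf}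

lemma section_shift (hφ : ∀ a, φ (D.M a) = T.mono (φ a)) (n : ℤ) (ζ : ℂ)
    (a : ∀ x, T.E.Fib x) : ∀ A : D.V, a (expP ζ) = T.ev ζ (φ (expB D.M (-n) A)) ↔
      a (expP (ζ + n)) = T.ev (ζ + n) (φ A) := by
  have h1 : ∀ {ξ ξ' : ℂ} (A : D.V), ξ = ξ' →
      (a (expP ξ) = T.ev ξ (φ A) ↔ a (expP ξ') = T.ev ξ' (φ A)) := by
    rintro ξ _ A rfl
    rfl
  have h2 : ∀ (ξ : ℂ) (A : D.V), a (expP ξ) = T.ev ξ (φ (D.M A)) ↔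
      a (expP (ξ + 1)) = T.ev (ξ + 1) (φ A) := fun ξ A => by
    rw [hφ]; exact Twistor.section_mono T
  induction n using Int.induction_on with
  | zero =>
    intro A
    rw [Int.cast_zero, neg_zero, expB_zero D.M_bij]; exact h1 A (by ring)
  | succ n ih =>
    intro A
    have h3 : expB D.M (-((n + 1 : ℤ) : ℂ)) A = expB D.M (-((n : ℤ) : ℂ)) (D.M A) := by
      rw [Int.cast_add, neg_add, expB_add_apply D.M_bij, Int.cast_one, expB_neg_one D.M_bij]
    rw [h3, ih, h2]; exact h1 A (by push_cast; ring)
  | pred n ih =>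
    intro A
    have h3 : D.M (expB D.M 1 A) = A := by
      have := expB_neg_apply D.M_bij 1 A
      rwa [expB_neg_one D.M_bij] at this
    have h4 : expB D.M (-((-n - 1 : ℤ) : ℂ)) A = expB D.M (-((-n : ℤ) : ℂ)) (expB D.M 1 A) := by
      rw [← expB_add_apply D.M_bij]
      congr 2
      push_cast; ring
    rw [h4, ih]
    have h5 := h2 (ζ + ((-n - 1 : ℤ) : ℂ)) (expB D.M 1 A)
    rw [h3] at h5
    rw [h5]; exact h1 _ (by push_cast; ring)

lemma expP_eq_iff {ζ ξ : ℂ} : expP ζ = expP ξ ↔ ∃ n : ℤ, ζ = ξ + n := by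
  constructor
  · intro h
    have h1 := Complex.exp_eq_exp_iff_exists_int.1 (OnePoint.coe_injective h)
    obtain ⟨n, hn⟩ := h1
    refine ⟨n, mul_left_cancel₀ two_pi_I_ne ?_⟩
    rw [hn]; ring
  · rintro ⟨n, rfl⟩
    have : ϖ * (ξ + n) = ϖ * ξ + n * ϖ := by ring
    simp [expP, this, exp_add, Complex.exp_int_mul_two_pi_mul_I]

/-- The automorphism `e^{2πiζB}`. -/
def expBEquiv {V : Type u} [AddCommGroup V] [Module ℂ V] [FiniteDimensional ℂ V]
    {M : End ℂ V} (hM : Bijective M) (ζ : ℂ) : V ≃ₗ[ℂ] V :=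
  LinearEquiv.ofLinearMap (expB M ζ) (expB M (-ζ))
    (LinearMap.ext fun x => expB_apply_neg hM ζ x) (LinearMap.ext fun x => expB_neg_apply hM ζ x)

lemma exists_triv (hφ : ∀ a, φ (D.M a) = T.mono (φ a)) (hev : ∀ ζ, Bijective (T.ev ζ)) :
    ∃ τ : ∀ x, T.E.Fib x ≃ₗ[ℂ] D.V, ∀ ζ A, τ (expP ζ) (T.ev ζ (φ A)) = expB D.M (-ζ) A := by
  have key : ∀ x, ∃ τ : T.E.Fib x ≃ₗ[ℂ] D.V, ∀ ζ, expP ζ = x → ∀ (a : ∀ x, T.E.Fib x) A,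
      a (expP ζ) = T.ev ζ (φ A) → τ (a x) = expB D.M (-ζ) A := fun x => by
    by_cases hx : x ∈ Cstar
    · obtain ⟨ξ, rfl⟩ := exists_expP hx
      refine ⟨((ofBijective _ (hev ξ)).symm.trans φ.symm).trans
        (expBEquiv D.M_bij (-ξ)), fun ζ hζ a A hA => ?_⟩
      obtain ⟨n, rfl⟩ := expP_eq_iff.1 hζ
      rw [← section_shift hφ] at hA
      have h1 : (ofBijective _ (hev ξ)).symm (a (expP ξ)) = φ (expB D.M (-n) A) := by
        rw [LinearEquiv.symm_apply_eq, hA]; rfl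
      rw [trans_apply, trans_apply, h1, φ.symm_apply_apply]
      change expB D.M (-ξ) _ = _
      rw [← expB_add_apply D.M_bij, neg_add]
    · have := T.bundle.finite_fib x
      have := T.bundle.finite_fib (expP 0)
      have h1 : finrank ℂ (T.E.Fib x) = finrank ℂ D.V := by
        rw [T.bundle.finrank_fib, ← T.bundle.finrank_fib (expP 0)]
        exact (φ.trans (ofBijective _ (hev 0))).finrank_eq.symm
      refine ⟨LinearEquiv.ofFinrankEq _ _ h1, ?_⟩
      rintro ζ rfl; exact absurd (expP_mem ζ) hx
  choose τ hτ using key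
  refine ⟨τ, fun ζ A => ?_⟩
  obtain ⟨a, ha⟩ := exists_section_eq T.E (T.ev ζ (φ A))
  rw [← ha]; exact hτ _ ζ rfl a A ha

variable {τ : ∀ x, T.E.Fib x ≃ₗ[ℂ] D.V} (hτ : ∀ ζ A, τ (expP ζ) (T.ev ζ (φ A)) = expB D.M (-ζ) A)

include hτ

lemma isTriv_of_ev : IsTriv D.M T.E T.nabla τ := by
  have hfr : finrank ℂ D.V = T.rank := by
    have := T.bundle.finite_fib (expP 0)
    rw [← T.bundle.finrank_fib (expP 0)]; exact (τ (expP 0)).finrank_eq.symm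
  set b : Basis (Fin T.rank) ℂ D.V := finBasisOfFinrankEq ℂ D.V hfr
  have key : ∀ z : ℂ, z ≠ 0 → ∃ (L : ℂ → ℂ) (t : Fin T.rank → ∀ x, T.E.Fib x),
      An L z ∧ (∀ᶠ u in 𝓝 z, ez (L u) = u) ∧ (∀ i, FlatAt T.E T.nabla (t i) z) ∧
      ∀ᶠ u : ℂ in 𝓝 z, ∀ i, τ u (t i u) = expB D.M (-L u) (b i) := fun z hz => by
    obtain ⟨ζ₀, hζ₀⟩ := exists_expP (mem_Cstar_coe.2 hz)
    have hz' : ez ζ₀ = z := OnePoint.coe_injective hζ₀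
    obtain ⟨L, h1, h2, h3, -⟩ := exists_log ζ₀
    rw [hz'] at h1 h2 h3
    choose t ht ht' using fun i => T.exists_flat (φ (b i)) ζ₀
    refine ⟨L, t, h1, h3, fun i => by rw [← hζ₀]; exact ht i, ?_⟩
    have h4 := h1.continuousAt.tendsto
    rw [h2] at h4
    filter_upwards [h4.eventually (eventually_all.2 ht'), h3] with u hu hu' i
    have h5 := hτ (L u) (b i)
    rwa [hu i, expP_eq, hu'] at h5
  have main : ∀ (s : ∀ x, T.E.Fib x) (z : ℂ), z ≠ 0 →
      (T.E.HolAt s z ↔ VAn (fun u : ℂ => τ u (s u)) z) ∧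
      (T.E.HolAt s z → ∀ ℓ : D.V →ₗ[ℂ] ℂ, ℓ (τ z (T.nabla s z)) =
        z * deriv (fun u : ℂ => ℓ (τ u (s u))) z + ℓ (logB D.M (τ z (s z)))) := fun s z hz => by
    obtain ⟨L, t, hL, hL', ht, ht'⟩ := key z hz
    set f : Fin T.rank → P1 → ℂ := fun i y => b.repr (expB D.M (L (zc y)) (τ y (s y))) i
    have hg : ∀ᶠ u : ℂ in 𝓝 z, τ u (s u) = ∑ i, f i u • expB D.M (-L u) (b i) := by
      refine .of_forall fun u => ?_
      have h1 := congrArg (expB D.M (-L u)) (b.sum_repr (expB D.M (L u) (τ u (s u))))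
      rw [expB_neg_apply D.M_bij, map_sum] at h1
      rw [← h1]
      refine sum_congr rfl fun i _ => ?_
      rw [LinearMap.map_smul]; rfl
    have hs : ∀ᶠ y in 𝓝 z, s y = ∑ i, f i y • t i y := by
      rw [OnePoint.nhds_coe_eq, eventually_map]
      filter_upwards [hg, ht'] with u h1 h2
      apply (τ u).injective; simp [h1, h2]
    have hli : LinearIndependent ℂ fun i => t i z := by
      have h1 := (b.linearIndependent.map' (expBEquiv D.M_bij (-L z)).toLinearMap
        (LinearEquiv.ker _)).map' (τ z).symm.toLinearMap (LinearEquiv.ker _)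
      have h2 : (fun i => t i z) =
          (τ z).symm.toLinearMap ∘ (expBEquiv D.M_bij (-L z)).toLinearMap ∘ b := by
        funext i
        rw [← (τ z).symm_apply_apply (t i z), ht'.self_of_nhds i]; rfl
      rwa [h2]
    have hEan : ∀ (ℓ : D.V →ₗ[ℂ] ℂ) v, An (fun u => ℓ (expB D.M (-L u) v)) z :=
      fun ℓ v => AnalyticAt.comp (g := fun ζ => ℓ (expB D.M (-ζ) v))
        (analyticAt_expB_neg D.M_bij ℓ v (L z)) hL
    have hEan' : ∀ (ℓ : D.V →ₗ[ℂ] ℂ) v, An (fun u => ℓ (expB D.M (L u) v)) z :=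
      fun ℓ v => AnalyticAt.comp (g := fun ζ => ℓ (expB D.M ζ v))
        (analyticAt_expB D.M_bij ℓ v (L z)) hL
    have hf1 : T.E.HolAt s z → ∀ i, HolFun (f i) z := fun h i =>
      T.bundle.holFun_coeff (fun i => (ht i).1) hli (T.bundle.holAt_congr h hs) i
    refine ⟨⟨fun h ℓ => ?_, fun h => ?_⟩, fun h ℓ => ?_⟩
    · have h1 : An (fun u : ℂ => ∑ i, f i u * ℓ (expB D.M (-L u) (b i))) z :=
        Finset.analyticAt_fun_sum _ fun i _ => (holFun_coe_iff.1 (hf1 h i)).mul (hEan ℓ (b i))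
      refine h1.congr ?_
      filter_upwards [hg] with u hu
      simp [hu]
    · have h1 : ∀ i, HolFun (f i) z := fun i => by
        rw [holFun_coe_iff]
        have h2 : An (fun u : ℂ => ∑ j, b.repr (τ u (s u)) j *
            (b.coord i) (expB D.M (L u) (b j))) z :=
          Finset.analyticAt_fun_sum _ fun j _ => ((vAn_iff_repr b).1 h j).mul (hEan' _ _)
        refine h2.congr (.of_forall fun u => ?_)
        exact (apply_eq_sum_repr b ((b.coord i).comp (expB D.M (L u))) _).symm
      refine T.bundle.holAt_congr (T.bundle.holAt_sum (S := univ) fun i _ =>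
        T.bundle.holAt_smul_fun (h1 i) (ht i).1) (hs.mono fun y hy => hy.symm)
    · have hfa := fun i => holFun_coe_iff.1 (hf1 h i)
      have h1 : T.nabla s z = ∑ i, (z * deriv (fun u : ℂ => f i u) z) • t i z := by
        have hsm : ∀ i ∈ univ, T.E.HolAt (fun y => f i y • t i y) z := fun i _ =>
          T.bundle.holAt_smul_fun (hf1 h i) (ht i).1
        rw [T.conn.congr hz h (T.bundle.holAt_sum hsm) hs,
          T.conn.sum T.bundle (mem_Cstar_coe.2 hz) hsm]
        refine sum_congr rfl fun i _ => ?_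
        simp [T.conn.leibniz (f i) (t i) z hz (hf1 h i) (ht i).1, (ht i).2.self_of_nhds]
      have hLd : ϖ * z * deriv L z = 1 := by
        have h2 : HasDerivAt (fun u => ez (L u)) _ z :=
          HasDerivAt.comp z (h₂ := ez) (hasDerivAt_ez (L z)) hL.differentiableAt.hasDerivAt
        have h3 : HasDerivAt (fun u => ez (L u)) 1 z := (hasDerivAt_id z).congr_of_eventuallyEq hL'
        have h4 := h2.unique h3
        rwa [hL'.self_of_nhds] at h4
      have h2 : HasDerivAt (fun u : ℂ => ℓ (τ u (s u)))
          (∑ i, (deriv (fun u : ℂ => f i u) z * ℓ (expB D.M (-L z) (b i)) +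
            f i z * (-(ϖ * ℓ (logB D.M (expB D.M (-L z) (b i)))) * deriv L z))) z := by
        have h3 : HasDerivAt (fun u : ℂ => ∑ i, f i u * ℓ (expB D.M (-L u) (b i)))
            (∑ i, (deriv (fun u : ℂ => f i u) z * ℓ (expB D.M (-L z) (b i)) +
            f i z * (-(ϖ * ℓ (logB D.M (expB D.M (-L z) (b i)))) * deriv L z))) z := by
          refine HasDerivAt.fun_sum fun i _ => (hfa i).differentiableAt.hasDerivAt.mul ?_
          exact HasDerivAt.comp z (hasDerivAt_expB_neg D.M_bij ℓ (b i) (L z))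
            hL.differentiableAt.hasDerivAt
        refine h3.congr_of_eventuallyEq ?_
        filter_upwards [hg] with u hu
        simp [hu]
      have hg0 := hg.self_of_nhds
      rw [h2.deriv, h1, hg0, map_sum, map_sum, map_sum, map_sum, mul_sum, ← sum_add_distrib]
      refine sum_congr rfl fun i _ => ?_
      rw [LinearEquiv.map_smul, LinearMap.map_smul, LinearMap.map_smul, LinearMap.map_smul,
        ht'.self_of_nhds i, smul_eq_mul, smul_eq_mul]
      linear_combination (f i z * ℓ (logB D.M (expB D.M (-L z) (b i)))) * hLd
  exact ⟨fun s z hz => (main s z hz).1, fun s z hz => (main s z hz).2⟩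

end Trivialization

lemma IsWeightFiltration.comap_equiv {V V' : Type u} [AddCommGroup V] [Module ℂ V]
    [AddCommGroup V'] [Module ℂ V'] {N : End ℂ V} {N' : End ℂ V'} {c : ℤ}
    {W : Fil(V')} (φ : V ≃ₗ[ℂ] V') (hN : ∀ a, φ (N a) = N' (φ a))
    (hW : IsWeightFiltration N' c W) :
    IsWeightFiltration N c fun k => (W k).comap φ.toLinearMap := by
  have hp : ∀ (l : ℕ) a, φ ((N ^ l) a) = (N' ^ l) (φ a) := fun l a => by
    induction l with
    | zero => rfl
    | succ l ih => rw [pow_succ', pow_succ', End.mul_apply, End.mul_apply, hN, ih]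
  refine ⟨fun a b h => Submodule.comap_mono (hW.mono h), ?_, ?_, ?_, ?_, ?_⟩
  · obtain ⟨l, hl⟩ := hW.exists_bot
    refine ⟨l, ?_⟩
    rw [hl]; exact LinearEquiv.ker φ
  · exact hW.exists_top.imp fun l hl => by rw [hl, Submodule.comap_top]
  · rintro l _ ⟨a, ha, rfl⟩
    refine Submodule.mem_comap.2 ?_
    have h1 := hW.map_le l (mem_map_of_mem (f := N') (Submodule.mem_comap.1 ha))
    rw [coe_coe] at h1 ⊢
    rwa [hN]
  · intro l a ha h
    have h := Submodule.mem_comap.1 h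
    rw [coe_coe, hp] at h
    exact Submodule.mem_comap.2 (hW.inj l _ (Submodule.mem_comap.1 ha) h)
  · intro l b hb
    obtain ⟨a, ha, h⟩ := hW.surj l _ (Submodule.mem_comap.1 hb)
    refine ⟨φ.symm a, Submodule.mem_comap.2 (by simpa using ha), Submodule.mem_comap.2 ?_⟩
    rwa [coe_coe, map_sub, hp, φ.apply_symm_apply]

namespace HodgeTuple

variable {w : ℤ} (D : HodgeTuple.{u} w)

lemma expB_mem_weight {W : Fil(D.V)} (hW : IsWeightFiltration D.N 0 W) (k : ℤ)
    (ζ : ℂ) {v : D.V} : expB D.M ζ v ∈ W k ↔ v ∈ W k := by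
  have h : ∀ ζ v, v ∈ W k → expB D.M ζ v ∈ W k := fun ζ v hv =>
    fc_mem (D.weight_stable hW k) (fun _ hx => hW.mono (by omega) (hW.apply_mem hx)) _ hv
  refine ⟨fun hv => ?_, h ζ v⟩
  rw [← expB_neg_apply D.M_bij ζ v]; exact h _ _ hv

lemma hForm_expB_expB (ζ : ℂ) (a b : D.V) :
    D.hForm (expB D.M (-ζ) a) (expB D.M (-(Cj ζ + 1 / 2)) b) = D.hForm a (expB D.M (-1 / 2) b) := by
  have h : -(Cj) (-ζ) + -(Cj ζ + 1 / 2) = -1 / 2 := by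
    simp only [map_neg]; ring
  rw [hForm_expB, ← expB_add_apply D.M_bij, h]

end HodgeTuple

variable {w : ℤ} {D : HodgeTuple.{u} w} {T : Twistor.{u}}

lemma triv_fibCast {τ : ∀ x, T.E.Fib x ≃ₗ[ℂ] D.V} {x y : P1} (h : x = y) (v : T.E.Fib x) :
    τ y (T.E.fibCast h v) = τ x v := by
  subst h; rfl

/-- Twistors which correspond to `D` have a model on the space of `D`. -/
lemma Corresponds.exists_isModel (h : Corresponds D T) (hT : T.IsPMTS w) :
    ∃ W τ, IsModel D W T τ := by
  obtain ⟨φ, hc, hφ, hg, htop⟩ := h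
  have hev := Twistor.ev_bijective hg.1 hg.2
  have : FiniteDimensional ℂ T.Hinf := Module.Finite.equiv φ
  obtain ⟨τ, hτ⟩ := exists_triv hφ hev
  have hN : ∀ a, φ (D.N a) = T.N (φ a) :=
    fun a => equiv_nPart hφ D.M_bij (mono_bijective_of_equiv hφ) a
  obtain ⟨⟨W, hW, hWh⟩, hNh⟩ := hT.induced
  have hW' := hW.comap_equiv φ hN
  have hsurj : ∀ ζ (v : T.E.Fib (expP ζ)), ∃ a, v = T.ev ζ (φ a) := by
    intro ζ v
    obtain ⟨A, rfl⟩ := (hev ζ).2 v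
    exact ⟨φ.symm A, by rw [φ.apply_symm_apply]⟩
  refine ⟨_, τ, hW', isTriv_of_ev hτ, (generatedAt_zero_iff hφ hτ).1 hg.1,
    (generatedAt_infty_iff hφ hτ hc).1 hg.2, ?_, ?_, ?_, ?_⟩
  · intro ζ v
    have h1 : (τ (expP ζ)).symm (expB D.M (-ζ) v) = T.ev ζ (φ v) := by
      rw [LinearEquiv.symm_apply_eq, hτ]
    rw [h1, ← Twistor.ev_conjInf, ← hc, hτ]
  · intro k x hx v
    obtain ⟨ζ, rfl⟩ := exists_expP hx
    obtain ⟨a, rfl⟩ := hsurj ζ v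
    rw [hτ, D.expB_mem_weight hW', hWh, Submodule.mem_comap]
    constructor
    · rintro ⟨A, hA, h⟩
      rwa [(hev ζ).1 h] at hA
    · exact fun h => mem_map_of_mem h
  · intro x hx v
    obtain ⟨ζ, rfl⟩ := exists_expP hx
    obtain ⟨a, rfl⟩ := hsurj ζ v
    rw [hNh, ← hN, hτ, hτ]
    exact congrArg (fun f : End ℂ D.V => f a) (fc_commute_nPart D.M_bij _).eq
  · intro x hx a b
    obtain ⟨ζ, rfl⟩ := exists_expP hx
    obtain ⟨A, rfl⟩ := hsurj ζ a
    obtain ⟨B, hB⟩ := hsurj (Cj ζ + 1 / 2) (T.E.fibCast (sig_expP ζ) b)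
    have h1 := (T.isTopPolarization_iff_pr hc hφ).1 htop ζ A B
    rw [Twistor.pr, ← hB, HolFam.fibCast_symm_apply] at h1
    rw [h1, hτ, ← triv_fibCast (τ := τ) (sig_expP ζ) b, hB, hτ, D.hForm_expB_expB]

/-- A model identifies the space of `D` with `H^∞`. -/
lemma IsModel.exists_equiv {W : Fil(D.V)} {τ : ∀ x, T.E.Fib x ≃ₗ[ℂ] D.V}
    (h : IsModel D W T τ) : ∃ φ : D.V ≃ₗ[ℂ] T.Hinf,
      (∀ ζ A, τ (expP ζ) (T.ev ζ (φ A)) = expB D.M (-ζ) A) ∧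
      (∀ a, φ (D.M a) = T.mono (φ a)) ∧ ∀ a, φ (D.conj a) = T.conjInf (φ a) := by
  have hflat := fun s ζ₀ => h.triv.flatAt_iff D.M_bij (s := s) (ζ₀ := ζ₀)
  let φ₀ : D.V →ₗ[ℂ] T.Hinf :=
    { toFun := fun A => ⟨fun ζ => (τ (expP ζ)).symm (expB D.M (-ζ) A), by
        intro ζ₀
        obtain ⟨L, -, -, -, h4⟩ := exists_log ζ₀
        refine ⟨fun x => (τ x).symm (expB D.M (-L (zc x)) A), (hflat _ _).2 ⟨A, ?_⟩, ?_⟩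
        · filter_upwards [h4] with ζ hζ
          rw [apply_symm_apply, zc_expP, hζ]
        · filter_upwards [h4] with ζ hζ
          rw [zc_expP, hζ]⟩
      map_add' := fun A B => by
        ext ζ
        simp
      map_smul' := fun c A => by
        ext ζ
        simp }
  have hφ₀ : ∀ ζ A, τ (expP ζ) (T.ev ζ (φ₀ A)) = expB D.M (-ζ) A := fun ζ A =>
    (τ (expP ζ)).apply_symm_apply _
  have hbij : Bijective φ₀ := by
    constructor
    · rw [injective_iff_map_eq_zero]
      intro A hA
      have := hφ₀ 0 A
      rw [hA, map_zero, map_zero, neg_zero, expB_zero D.M_bij] at this; exact this.symm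
    · intro B
      have hconst : ∀ ζ ζ', expB D.M ζ (τ (expP ζ) (T.ev ζ B)) =
          expB D.M ζ' (τ (expP ζ') (T.ev ζ' B)) := fun ζ ζ' => by
        refine IsLocallyConstant.apply_eq_of_preconnectedSpace
          (f := fun ζ => expB D.M ζ (τ (expP ζ) (T.ev ζ B))) ?_ ζ ζ'
        rw [IsLocallyConstant.iff_eventually_eq]
        intro ζ₀
        obtain ⟨s, hs, hs'⟩ := T.exists_flat B ζ₀
        obtain ⟨v, hv⟩ := (hflat _ _).1 hs
        have h1 : ∀ᶠ ζ in 𝓝 ζ₀, expB D.M ζ (τ (expP ζ) (T.ev ζ B)) = v := by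
          filter_upwards [hs', hv] with ζ h1 h2
          rw [h1, h2, expB_apply_neg D.M_bij]
        filter_upwards [h1] with ζ h2
        rw [h2, h1.self_of_nhds]
      refine ⟨expB D.M 0 (τ (expP 0) (T.ev 0 B)), ?_⟩
      ext ζ
      apply (τ (expP ζ)).injective
      refine (hφ₀ ζ _).trans ?_
      rw [hconst 0 ζ, expB_neg_apply D.M_bij]; rfl
  let φ : D.V ≃ₗ[ℂ] T.Hinf := ofBijective φ₀ hbij
  have hτ : ∀ ζ A, τ (expP ζ) (T.ev ζ (φ A)) = expB D.M (-ζ) A := hφ₀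
  have hφ : ∀ a, φ (D.M a) = T.mono (φ a) := fun a => by
    ext ζ
    apply (τ (expP ζ)).injective
    refine (hτ ζ _).trans ?_
    change _ = τ (expP ζ) (T.ev ζ (T.mono (φ a)))
    rw [Twistor.ev_mono, triv_fibCast, hτ, neg_add, expB_add_apply D.M_bij, expB_neg_one D.M_bij]
  have hc : ∀ a, φ (D.conj a) = T.conjInf (φ a) := fun a => by
    ext ζ
    apply (τ (expP ζ)).injective
    refine (hτ ζ _).trans ?_
    change _ = τ (expP ζ) (T.ev ζ (T.conjInf (φ a)))
    rw [Twistor.ev_conjInf, ← h.conj ζ a]; rfl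
  exact ⟨φ, hτ, hφ, hc⟩

/-- A twistor with a model on the space of `D` corresponds to `D`. -/
lemma IsModel.corresponds {W : Fil(D.V)} {τ : ∀ x, T.E.Fib x ≃ₗ[ℂ] D.V}
    (h : IsModel D W T τ) : Corresponds D T := by
  obtain ⟨φ, hτ, hφ, hc⟩ := h.exists_equiv
  refine ⟨φ, hc, hφ, ⟨(generatedAt_zero_iff hφ hτ).2 h.ext_zero,
    (generatedAt_infty_iff hφ hτ hc).2 h.ext_infty⟩, ?_⟩
  rw [T.isTopPolarization_iff_pr hc hφ]
  intro ζ a b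
  rw [Twistor.pr, h.Shat _ (expP_mem ζ), hτ, triv_fibCast, hτ, D.hForm_expB_expB]

/-! ### Global sections -/

/-- Liouville's theorem for functions on `ℂ^*`: a function with a zero of order `m` at `0` and of
order `n` at `∞` vanishes if `m + n > 0`. -/
lemma eq_zero_of_orders {g f₀ f₁ : ℂ → ℂ} {m n : ℤ} (hg : ∀ z : ℂ, z ≠ 0 → An g z)
    (h₀ : An f₀ 0) (h₀' : ∀ᶠ u : ℂ in 𝓝[≠] 0, g u = f₀ u * u ^ m)
    (h₁ : An f₁ 0) (h₁' : ∀ᶠ u : ℂ in 𝓝[≠] 0, g u⁻¹ = f₁ u * u ^ n) (hmn : 0 < m + n)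
    {z : ℂ} (hz : z ≠ 0) : g z = 0 := by
  set G : ℂ → ℂ := fun z => if z = 0 then f₀ 0 else g z * z ^ (-m) with hG
  have hG1 : ∀ z : ℂ, z ≠ 0 → G z = g z * z ^ (-m) := fun z hz => if_neg hz
  have hd : Differentiable ℂ G := fun z => by
    by_cases hz : z = 0
    · subst hz
      refine (h₀.congr ?_).differentiableAt
      rw [← nhdsNE_sup_pure, EventuallyEq, eventually_sup]
      refine ⟨?_, by simp [hG]⟩
      filter_upwards [h₀', self_mem_nhdsWithin] with u hu hu0
      rw [hG1 u hu0, hu, mul_assoc, ← zpow_add₀ hu0, add_neg_cancel, zpow_zero, mul_one]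
    · refine (((hg z hz).mul ((analyticAt_id.zpow hz : An (fun z => z ^ (-m)) z))).congr
        ?_).differentiableAt
      filter_upwards [compl_singleton_mem_nhds hz] with u hu
      exact (hG1 u hu).symm
  have ht : Tendsto G (cocompact ℂ) (𝓝 0) := by
    have h2 : Tendsto (fun u : ℂ => f₁ u * u ^ (n + m).toNat) (𝓝[≠] 0) (𝓝 0) := by
      have h3 : ContinuousAt (fun u : ℂ => f₁ u * u ^ (n + m).toNat) 0 :=
        h₁.continuousAt.mul (continuousAt_id.pow _)
      have h4 : (n + m).toNat ≠ 0 := by omega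
      have := h3.tendsto
      rw [zero_pow h4, mul_zero] at this; exact this.mono_left nhdsWithin_le_nhds
    rw [← Metric.cobounded_eq_cocompact]
    refine (h2.comp (tendsto_inv₀_cobounded' (α := ℂ))).congr' ?_
    filter_upwards [(tendsto_inv₀_cobounded' (α := ℂ)).eventually h₁',
      (tendsto_inv₀_cobounded' (α := ℂ)).eventually self_mem_nhdsWithin] with u hu hu0
    have hu0' : u ≠ 0 := fun h => hu0 (by rw [h, inv_zero]; rfl)
    rw [inv_inv] at hu
    rw [hG1 u hu0', hu, Function.comp_apply, mul_assoc, ← inv_zpow', ← zpow_add₀ hu0,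
      ← zpow_natCast, Int.toNat_of_nonneg (by omega)]
  have h6 := hd.apply_eq_of_tendsto_cocompact z ht
  rw [hG1 z hz] at h6
  exact (mul_eq_zero.1 h6).resolve_right (zpow_ne_zero _ hz)

/-- A linear form which vanishes on `X ∩ Y` agrees on `Y` with a linear form which vanishes
on `X`. -/
lemma exists_extend_of_inf_le_ker {V : Type u} [AddCommGroup V] [Module ℂ V]
    {X Y : Submodule ℂ V} {ℓ : V →ₗ[ℂ] ℂ} (hℓ : X ⊓ Y ≤ LinearMap.ker ℓ) :
    ∃ ℓ' : V →ₗ[ℂ] ℂ, (∀ v ∈ X, ℓ' v = 0) ∧ ∀ v ∈ Y, ℓ' v = ℓ v := by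
  have h1 : ℓ.comp Y.subtype ∈ LinearMap.range (X.mkQ.comp Y.subtype).dualMap := by
    rw [LinearMap.range_dualMap_eq_dualAnnihilator_ker, Submodule.mem_dualAnnihilator]
    exact fun v hv => hℓ ⟨(Submodule.Quotient.mk_eq_zero _).1 hv, v.2⟩
  obtain ⟨g, hg⟩ := h1
  refine ⟨g.comp X.mkQ, fun v hv => ?_, fun v hv => LinearMap.congr_fun hg ⟨v, hv⟩⟩
  simp [LinearMap.comp_apply, Submodule.mkQ_apply, (Submodule.Quotient.mk_eq_zero _).2 hv]

namespace HolFam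

variable {E : HolFam.{u}} {r : ℕ}

/-- A section of `𝒪(k)^r` over `ℂ` vanishes if its product with `z^{k+1}` is holomorphic at `∞`. -/
lemma IsPure.eq_zero {k : ℤ} (h : E.IsPure k) {s : ∀ x, E.Fib x} (hs : ∀ z : ℂ, E.HolAt s z)
    (hinf : E.ExtHolAt (fun x => zc x ^ (k + 1) • s x) ∞) {z : ℂ} (hz : z ≠ 0) :
    s z = 0 := by
  obtain ⟨r, ⟨f⟩⟩ := h
  apply (f.e z).injective
  rw [map_zero]
  refine funext fun i => ?_
  have h1 : ∀ z : ℂ, An (fun u : ℂ => f.e u (s u) i) z := fun z =>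
    ((f.hol s z).2 (hs z)).1 z rfl i
  obtain ⟨t, ht, hts⟩ := hinf
  refine eq_zero_of_orders (m := 0) (n := 1) (fun z _ => h1 z) (h1 0) (by simp)
    (((f.hol t ∞).2 ht).2 rfl i) ?_ (by norm_num) hz
  rw [eventually_nhdsNE_infty] at hts
  filter_upwards [hts, self_mem_nhdsWithin] with u hu (hu0 : u ≠ 0)
  rw [if_neg hu0, hu, map_smul, zc_atInf, atInf_of_ne hu0]
  change _ = u ^ k * (u⁻¹ ^ (k + 1) * f.e _ (s _) i) * u ^ (1 : ℤ)
  rw [zpow_one, inv_zpow', neg_add, zpow_add₀ hu0, zpow_neg, zpow_neg_one]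
  have := zpow_ne_zero k hu0
  field_simp

/-- The value at `x` of a section of `E` which is in a subbundle away from `x` is in the subbundle,
too. -/
lemma IsSubbundle.exists_section (hE : E.IsBundle r) {W : ∀ x, Submodule ℂ (E.Fib x)}
    (hW : E.IsSubbundle W) {t : ∀ x, E.Fib x} {x : P1} (ht : E.HolAt t x)
    (h : ∀ᶠ y in 𝓝[≠] x, t y ∈ W y) :
    ∃ t' : ∀ y, W y, E.HolAt (fun y => (t' y : E.Fib y)) x ∧ ∀ᶠ y in 𝓝 x, (t' y : E.Fib y) = t y := by
  classical
  have h1 : t x ∈ W x := by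
    obtain ⟨U, hU, hx, r, e, J, he, hJ⟩ := hW x
    rw [hJ x hx, Basis.mem_span_image]
    intro i hi
    by_contra hiJ
    refine (Finsupp.mem_support_iff.1 hi) (((he _ x hx).1 ht i).eq_of_eventually
      (holFun_const 0 x) ?_)
    filter_upwards [h, nhdsWithin_le_nhds (hU.mem_nhds hx)] with y hy hyU
    rw [hJ y hyU, Basis.mem_span_image] at hy
    by_contra h0
    exact hiJ (hy (Finsupp.mem_support_iff.2 h0))
  have h2 : ∀ᶠ y in 𝓝 x, t y ∈ W y := by
    rw [← nhdsNE_sup_pure, eventually_sup]; exact ⟨h, h1⟩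
  have h3 : ∀ᶠ y in 𝓝 x, ((if h : t y ∈ W y then ⟨t y, h⟩ else 0 : W y) : E.Fib y) = t y := by
    filter_upwards [h2] with y hy
    rw [dif_pos hy]
  exact ⟨fun y => if h : t y ∈ W y then ⟨t y, h⟩ else 0,
    hE.holAt_congr ht (h3.mono fun y hy => hy.symm), h3⟩

end HolFam

/-! ### Twistor structures with a model induce polarized mixed Hodge structures -/

lemma zc_ne_zero {x : P1} (hx : x ∈ Cstar) : zc x ≠ 0 := by
  obtain ⟨z, rfl⟩ := ne_infty_iff_exists.1 hx.1
  exact mem_Cstar_coe.1 hx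

namespace IsModel

variable {w : ℤ} {D : HodgeTuple.{u} w} {W : Fil(D.V)} {T : Twistor.{u}}
  {τ : ∀ x, T.E.Fib x ≃ₗ[ℂ] D.V} (h : IsModel D W T τ)
include h

lemma hol_zero {n : ℤ} {v : D.V} (hv : v ∈ D.F (w - 1 - n)) :
    ∃ t, T.E.HolAt t 𝟘 ∧ ∀ᶠ y in 𝓝[≠] 𝟘, τ y (t y) = zc y ^ n • v := by
  obtain ⟨t, ht, hts⟩ := (h.ext_zero fun y => (τ y).symm (zc y ^ n • v)).2 (by
    simpa [zc_coe] using Lat.gen_one (Φ := fun n => D.F (w - 1 - n)) hv)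
  exact ⟨t, ht, hts.mono fun y hy => by rw [hy, apply_symm_apply]⟩

lemma hol_infty {n : ℤ} {v : D.V} (hv : v ∈ D.Fb n) : ∃ t, T.E.HolAt t ∞ ∧
      ∀ᶠ y in 𝓝[≠] (∞ : P1), τ y (t y) = zc y ^ n • v := by
  obtain ⟨t, ht, hts⟩ := (h.ext_infty fun y => (τ y).symm (zc y ^ n • v)).2 (by
    simpa [zc_atInf] using Lat.gen_one (Φ := fun n => D.Fb (-n)) (n := -n) (by simpa using hv))
  exact ⟨t, ht, hts.mono fun y hy => by rw [hy, apply_symm_apply]⟩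

/-- `F^p` and `Fb^{k+w-p}` span `Gr_k`: a linear form on `Gr_k` which vanishes on both would map the
global sections of `Gr_k ⊗ 𝒪(-k)` to functions of total order `1` at `0` and `∞`. -/
lemma exists_sup {k p : ℤ} (hp : (T.E.Gr T.What k).IsPure k) {a : D.V} (ha : a ∈ W k) :
    ∃ x ∈ D.F p ⊓ W k, ∃ y ∈ D.Fb (k + w - p) ⊓ W k, a - x - y ∈ W (k - 1) := by
  set Y := (D.F p ⊓ W k) ⊔ (D.Fb (k + w - p) ⊓ W k) ⊔ W (k - 1)
  by_cases haY : a ∈ Y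
  · obtain ⟨b, hb, c, hc, rfl⟩ := Submodule.mem_sup.1 haY
    obtain ⟨x, hx, y, hy, rfl⟩ := Submodule.mem_sup.1 hb
    exact ⟨x, hx, y, hy, by rwa [show x + y + c - x - y = c by abel]⟩
  exfalso
  obtain ⟨ℓ, hℓa, hℓY⟩ := Submodule.exists_le_ker_of_notMem haY
  obtain ⟨ℓ₀, h₀, h₀'⟩ := exists_extend_of_inf_le_ker (X := D.F p) (Y := W k) (ℓ := ℓ)
    ((le_sup_left.trans le_sup_left).trans hℓY)
  obtain ⟨ℓ₁, h₁, h₁'⟩ := exists_extend_of_inf_le_ker (X := D.Fb (k + w - p)) (Y := W k) (ℓ := ℓ)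
    ((le_sup_right.trans le_sup_left).trans hℓY)
  have hℓW : ∀ v ∈ W (k - 1), ℓ v = 0 := fun v hv => hℓY (Submodule.mem_sup_right hv)
  obtain ⟨r, ⟨f⟩⟩ := hp
  have h1C : ((1 : ℂ) : P1) ∈ Cstar := mem_Cstar_coe.2 one_ne_zero
  have ha1 : (τ ((1 : ℂ) : P1)).symm a ∈ T.What k ((1 : ℂ) : P1) := by
    rwa [h.What k _ h1C, apply_symm_apply]
  set c : Fin r → ℂ := f.e ((1 : ℂ) : P1) (qmk ⟨_, ha1⟩) with hc
  set s : ∀ x, (T.E.Gr T.What k).Fib x := fun x => (f.e x).symm c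
  choose o ho using fun x => Submodule.Quotient.mk_surjective _ (s x)
  set g : P1 → ℂ := fun x => ℓ (τ x (o x))
  have hlift : ∀ x ∈ Cstar, ∀ (v : T.What k x) (d : ℂ),
      qmk v = d • s x → ℓ (τ x v) = d * g x := fun x hx v d hv => by
    have hv : qmk v = T.grClass k (fun _ => d • o _) x := by
      rw [hv, ← ho]; rfl
    have hv := Submodule.mem_comap.1 ((Submodule.Quotient.eq _).1 hv)
    have h3 := hℓW _ ((h.What _ x hx _).1 hv)
    rw [map_sub, map_sub, map_sub, sub_eq_zero, map_smul, LinearEquiv.map_smul, map_smul,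
      smul_eq_mul] at h3
    exact h3
  have hs0 : ∀ z : ℂ, (T.E.Gr T.What k).HolAt s z := fun z => by
    rw [← f.hol, show (fun y => f.e y (s y)) = fun _ => c from
      funext fun y => (f.e y).apply_symm_apply c]
    exact ⟨fun _ _ _ => analyticAt_const, fun h0 => absurd h0 (coe_ne_infty z)⟩
  have hs1 : (T.E.Gr T.What k).ExtHolAt (fun x => zc x ^ k • s x) ∞ := by
    classical
    set c' : P1 → Fin r → ℂ := fun x => if x = ∞ then c else zc x ^ k • c with hc'
    refine ⟨fun x => (f.e x).symm (c' x), ?_, ?_⟩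
    · rw [← f.hol, show (fun y => f.e y ((f.e y).symm (c' y))) = c' from
        funext fun y => (f.e y).apply_symm_apply (c' y)]
      refine ⟨fun z hz => absurd hz.symm (coe_ne_infty z), fun _ i => ?_⟩
      refine (analyticAt_const (v := c i)).congr (.of_forall fun u => ?_)
      by_cases hu : u = 0
      · simp [hu, hc']
      · have h5 : atInf u ≠ ∞ := (atInf_mem_Cstar hu).1
        have := zpow_ne_zero k hu
        simp only [hc', hu, if_false, h5, zc_atInf, inv_zpow', Pi.smul_apply, smul_eq_mul, zpow_neg]
        field_simp
    · filter_upwards [eventually_mem_Cstar _] with x hx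
      rw [hc']
      simp only [if_neg hx.1]; exact LinearEquiv.map_smul (f.e x).symm (zc x ^ k) c
  have hgz : ∀ z : ℂ, z ≠ 0 → An (fun u : ℂ => g u) z := fun z hz => by
    obtain ⟨t, ht, ht'⟩ := hs0 z
    refine ((h.triv.hol _ z hz).1 ht ℓ).congr ?_
    rw [OnePoint.nhds_coe_eq, eventually_map] at ht'
    filter_upwards [ht', compl_singleton_mem_nhds hz] with u h2 h3
    rw [hlift _ (mem_Cstar_coe.2 h3) _ 1 (by rw [one_smul, h2]), one_mul]
  obtain ⟨t, ht, ht'⟩ := hs0 0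
  obtain ⟨f₀, hf₀, hf₀'⟩ := ((h.ext_zero _).1 (HolFam.HolAt.ext ht)).functional (ℓ := ℓ₀)
    (n := w - 1 - p) fun j hj A hA => h₀ A (D.F_fil.1.1 (by omega) hA)
  obtain ⟨t', ⟨t₁, ht₁, ht₁'⟩, hs1'⟩ := hs1
  obtain ⟨f₁, hf₁, hf₁'⟩ := ((h.ext_infty _).1 (HolFam.HolAt.ext ht₁)).functional (ℓ := ℓ₁)
    (n := -(k + w - p)) fun j hj A hA => h₁ A (D.Fb_fil.1.1 (by omega) hA)
  have hg0 := eq_zero_of_orders (m := w - 1 - p + 1) (n := k + 1 - (k + w - p)) hgz hf₀ ?_ hf₁ ?_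
    (by omega) one_ne_zero
  · have h6 := hlift _ h1C ⟨_, ha1⟩ 1 (by
      rw [one_smul]
      exact ((f.e _).symm_apply_apply _).symm)
    rw [hg0, mul_zero] at h6
    change ℓ (τ _ ((τ _).symm a)) = 0 at h6
    rw [apply_symm_apply] at h6; exact hℓa h6
  · filter_upwards [hf₀', eventually_nhdsNE_zero.1 (nhdsWithin_le_nhds ht'),
      self_mem_nhdsWithin] with u h2 h3 hu
    have hu := mem_Cstar_coe.2 hu
    rw [← h2, h₀' _ ((h.What _ _ hu _).1 (t u).2), hlift _ hu _ 1 (by rw [one_smul, h3]), one_mul]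
  · filter_upwards [hf₁', eventually_nhdsNE_infty.1 (nhdsWithin_le_nhds ht₁'),
      eventually_nhdsNE_infty.1 hs1', self_mem_nhdsWithin] with u h2 h3 h4 (hu0 : u ≠ 0)
    have hu := atInf_mem_Cstar hu0
    rw [h₁' _ ((h.What _ _ hu _).1 (t₁ _).2), hlift _ hu _ _ (h3.trans h4), zc_atInf,
      inv_zpow'] at h2
    rw [← atInf_of_ne hu0, show k + 1 - (k + w - p) = k + (-(k + w - p) + 1) by ring,
      zpow_add₀ hu0, mul_left_comm, ← h2, ← mul_assoc, ← zpow_add₀ hu0, add_neg_cancel, zpow_zero,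
      one_mul]

lemma hForm_eq_zero_of_le {p q : ℤ} (hpq : w ≤ p + q) {a b : D.V} (ha : a ∈ D.F p)
    (hb : b ∈ D.Fb q) : D.hForm a b = 0 := by
  obtain ⟨s, hs, hs'⟩ := h.hol_zero (n := w - 1 - p) (v := a) (by simpa using ha)
  obtain ⟨t, ht, ht'⟩ := h.hol_infty hb
  have h1 : sig 𝟘 = ∞ := by
    change atInf _ = _
    rw [map_zero, neg_zero, atInf_zero]
  have h2 := holFun_coe_iff.1 (T.Shat_hol s t _ hs (by rwa [h1]))
  have h3 : ∀ᶠ u : ℂ in 𝓝[≠] 0, τ (sig (u : P1)) (t (sig (u : P1))) = (-(Cj u))⁻¹ ^ q • b := by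
    have h4 : Tendsto (fun u : ℂ => -(Cj u)) (𝓝[≠] 0) (𝓝[≠] 0) := by
      refine tendsto_nhdsWithin_iff.2 ⟨?_, ?_⟩
      · have : Continuous fun u : ℂ => -(Cj u) := Complex.continuous_conj.neg
        simpa using (this.tendsto 0).mono_left nhdsWithin_le_nhds
      · filter_upwards [self_mem_nhdsWithin] with u hu
        simpa using hu
    filter_upwards [h4.eventually (eventually_nhdsNE_infty.1 ht')] with u hu
    rwa [← zc_atInf]
  have h5 : ∀ᶠ u : ℂ in 𝓝[≠] 0, T.Shat (u : P1) (s u) (t (sig (u : P1))) * u ^ (p + q - w).toNat * u =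
      (-1) ^ q * D.hForm a b := by
    filter_upwards [eventually_nhdsNE_zero.1 hs', h3, self_mem_nhdsWithin] with u h4 h5 (hu : u ≠ 0)
    rw [h.Shat _ (mem_Cstar_coe.2 hu), h4, h5, zc_coe]
    simp only [map_smul, LinearMap.smul_apply, map_smulₛₗ, smul_eq_mul, map_zpow₀, map_inv₀,
      map_neg, Complex.conj_conj]
    rw [inv_zpow', neg_eq_neg_one_mul u, mul_zpow, ← zpow_natCast, Int.toNat_of_nonneg (by omega),
      neg_one_zpow_neg]
    have h6 : u ^ (w - 1 - p) * (u ^ (-q) * (u ^ (p + q - w) * u)) = 1 := by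
      rw [← zpow_add_one₀ hu, ← zpow_add₀ hu, ← zpow_add₀ hu]
      ring_nf
      rw [zpow_zero]
    linear_combination ((-1) ^ q * D.hForm a b) * h6
  have h6 : An (fun u : ℂ => T.Shat (u : P1) (s u) (t (sig (u : P1))) *
      u ^ (p + q - w).toNat * u) 0 := (h2.mul (analyticAt_id.pow _)).mul analyticAt_id
  have h7 := h6.continuousAt.tendsto.mono_left (nhdsWithin_le_nhds (s := {0}ᶜ))
  rw [mul_zero] at h7
  exact (mul_eq_zero.1 (tendsto_nhds_unique (h7.congr' h5) tendsto_const_nhds).symm).resolve_left (zpow_ne_zero _ (by norm_num))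

section Lift

variable (hb : ∀ k, T.E.IsSubbundle (T.What k))
include hb

lemma exists_lift {k n : ℤ} {v : D.V} {x : P1} {t : ∀ x, T.E.Fib x} (ht : T.E.HolAt t x)
    (hv : v ∈ W k) (hts : ∀ᶠ y in 𝓝[≠] x, τ y (t y) = zc y ^ n • v) :
    ∃ t : ∀ y, T.What k y, T.E.HolAt (fun y => (t y : T.E.Fib y)) x ∧
      ∀ᶠ y in 𝓝[≠] x, τ y (t y) = zc y ^ n • v := by
  obtain ⟨t', ht', h'⟩ := (hb k).exists_section T.bundle ht (by
    filter_upwards [hts, eventually_mem_Cstar x] with y hy hyC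
    rw [h.What k y hyC, hy]
    exact (W k).smul_mem _ hv)
  refine ⟨t', ht', ?_⟩
  filter_upwards [hts, nhdsWithin_le_nhds h'] with y h1 h2
  rw [h2, h1]

/-- If the class of `v` in `Gr_k` is in the images of `F^{w-1-n}` and `Fb^{m+n}`, then `z^n v` is
a section of `Gr_k` over `ℂ`, whose product with `z^m` is holomorphic at `∞`. -/
lemma exists_grSection {k n m : ℤ} {v x y : D.V} (hv : v ∈ W k) (hxF : x ∈ D.F (w - 1 - n))
    (hx : x ∈ W k) (hxv : x - v ∈ W (k - 1)) (hyF : y ∈ D.Fb (m + n)) (hy : y ∈ W k)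
    (hyv : y - v ∈ W (k - 1)) :
    ∃ a : ∀ x, T.What k x, (∀ x ∈ Cstar, τ x (a x) = zc x ^ n • v) ∧
      (∀ z : ℂ, (T.E.Gr T.What k).HolAt (T.grClass k a) z) ∧
      (T.E.Gr T.What k).ExtHolAt (fun x => zc x ^ m • T.grClass k a x) ∞ := by
  classical
  obtain ⟨t₀, ht₀, ht₀'⟩ := h.hol_zero hxF
  obtain ⟨t₀, ht₀, ht₀'⟩ := h.exists_lift hb ht₀ hx ht₀'
  obtain ⟨t₁, ht₁, ht₁'⟩ := h.hol_infty hyF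
  obtain ⟨t₁, ht₁, ht₁'⟩ := h.exists_lift hb ht₁ hy ht₁'
  have hmem : ∀ x ∈ Cstar, (τ x).symm (zc x ^ n • v) ∈ T.What k x := fun x hx => by
    rw [h.What k x hx, apply_symm_apply]; exact (W k).smul_mem _ hv
  set a : ∀ x, T.What k x := fun x =>
    if hx : x ∈ Cstar then ⟨(τ x).symm (zc x ^ n • v), hmem x hx⟩ else t₀ x with ha
  have ha1 : ∀ x ∈ Cstar, τ x (a x) = zc x ^ n • v := fun x hx => by
    simp [ha, dif_pos hx, apply_symm_apply]
  refine ⟨a, ha1, fun z => ?_, fun y => qmk (t₁ y),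
    ⟨t₁, ht₁, .of_forall fun _ => rfl⟩, ?_⟩
  · by_cases hz : z = 0
    · subst hz
      refine ⟨t₀, ht₀, ?_⟩
      rw [← nhdsNE_sup_pure, eventually_sup]
      constructor
      · filter_upwards [ht₀', eventually_mem_Cstar _] with y h1 h2
        refine (Submodule.Quotient.eq _).2 (Submodule.mem_comap.2 ?_)
        change (t₀ y - a y : T.E.Fib y) ∈ _
        rw [h.What _ y h2, map_sub, h1, ha1 y h2, ← smul_sub]; exact smul_mem _ _ hxv
      · refine congrArg qmk ?_
        have h0 : 𝟘 ∉ Cstar := fun h0 => h0.2 rfl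
        rw [ha]
        simp only [dif_neg h0]
    · refine ⟨a, (h.triv.hol _ z hz).2 fun ℓ => ?_, .of_forall fun _ => rfl⟩
      have h1 : An (fun u : ℂ => u ^ n * ℓ v) z :=
        (analyticAt_id.zpow hz : An (fun u : ℂ => u ^ n) z).mul analyticAt_const
      refine h1.congr ?_
      filter_upwards [compl_singleton_mem_nhds hz] with u (hu : u ≠ 0)
      simp [ha1 _ (mem_Cstar_coe.2 hu), zc_coe]
  · filter_upwards [ht₁', eventually_mem_Cstar _] with y h1 h2
    refine (Submodule.Quotient.eq _).2 (Submodule.mem_comap.2 ?_)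
    change (t₁ y - zc y ^ m • (a y : T.E.Fib y)) ∈ _
    rw [h.What _ y h2, map_sub, LinearEquiv.map_smul, h1, ha1 y h2, smul_smul,
      ← zpow_add₀ (zc_ne_zero h2), ← smul_sub]
    exact smul_mem _ _ hyv

lemma inf_le {k p : ℤ} (hp : (T.E.Gr T.What k).IsPure k) {x y : D.V} (hxF : x ∈ D.F p)
    (hyF : y ∈ D.Fb (k + w - p)) (hx : x ∈ W k) (hy : y ∈ W k) (hxy : x - y ∈ W (k - 1)) :
    x ∈ W (k - 1) := by
  obtain ⟨a, h1, h2, h3⟩ := h.exists_grSection hb (n := w - 1 - p) (m := k + 1) hx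
    (by simpa using hxF) hx (by simp) (by convert hyF using 2; ring) hy
    (sub_mem_comm_iff.1 hxy)
  have h4 := hp.eq_zero h2 h3 one_ne_zero
  have h5 := Submodule.mem_comap.1 ((Submodule.Quotient.mk_eq_zero _).1 h4)
  have h1C : ((1 : ℂ) : P1) ∈ Cstar := mem_Cstar_coe.2 one_ne_zero
  have h6 := (h.What _ _ h1C _).1 h5
  rwa [subtype_apply, h1 _ h1C, zc_coe, one_zpow, one_smul] at h6

end Lift

/-- The conditions of a polarized mixed twistor structure on the constant data of a model. -/
lemma isData (hT : T.IsPMTS w) : D.IsData W := by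
  have hb := hT.mixed.mixed.subbundle
  have hp := hT.mixed.mixed.pure
  refine ⟨h.weight, fun n => ⟨?_, ?_, ?_, ?_⟩⟩
  · intro α hα _ k p a ha hak
    obtain ⟨x, hx, y, hy, h1⟩ := h.exists_sup (hp k) (p := p) hak
    have hW := D.weight_stable h.weight
    refine ⟨_, proj_mem (D.F_fil.2.1 p) hx.1, _, proj_mem (D.Fb_ss _) hy.1,
      eigProj_mem D.M_bij hα x, proj_mem (hW k) hx.2, eigProj_mem D.M_bij hα y,
      proj_mem (hW k) hy.2, ?_⟩
    have h2 := proj_mem (α := α) (hW _) h1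
    rwa [map_sub, map_sub, eigProj_apply D.M_bij hα ha] at h2
  · exact fun α _ _ k p x hx y hy _ h2 _ h4 h5 => h.inf_le hb (hp k) hx hy h2 h4 h5
  · exact fun α _ _ p q hpq a ha b hb _ _ => h.hForm_eq_zero_of_le hpq ha hb
  · intro α _ _ l p v _ hvl hvl' hN x hxF y hyF _ hx _ hy hvx hvy
    obtain ⟨a, h1, h2, h3⟩ := h.exists_grSection hb (n := w - 1 - p) (m := l) hvl
      (by simpa using hxF) hx (sub_mem_comm_iff.1 hvx)
      (by convert hyF using 2; ring) hy (sub_mem_comm_iff.1 hvy)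
    have hNp : ∀ (j : ℕ), ∀ x ∈ Cstar, ∀ v, τ x ((T.Nhat x ^ j) v) = (D.N ^ j) (τ x v) := fun j x hx v => by
      induction j with
      | zero => rfl
      | succ j ih => rw [pow_succ', pow_succ', End.mul_apply, End.mul_apply,
          h.Nhat x hx, ih]
    have h1C : ((1 : ℂ) : P1) ∈ Cstar := mem_Cstar_coe.2 one_ne_zero
    have h4 : sig ((1 : ℂ) : P1) = ((-1 : ℂ) : P1) := by
      change atInf _ = _
      rw [map_one, atInf_of_ne (by norm_num)]; norm_num
    have hprim : T.IsPrimitiveSection l a := by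
      refine ⟨fun x hx => ?_, h2, by simpa using h3⟩
      rw [h.What _ _ hx, hNp _ _ hx, h1 x hx, LinearMap.map_smul]
      exact smul_mem _ _ hN
    have hne : T.grClass l a ((1 : ℂ) : P1) ≠ 0 := fun h6 => by
      have h7 := (h.What _ _ h1C _).1 (Submodule.mem_comap.1 ((Submodule.Quotient.mk_eq_zero _).1 h6))
      rw [subtype_apply, h1 _ h1C, zc_coe, one_zpow, one_smul] at h7; exact hvl' h7
    obtain ⟨r, hr, h5⟩ := hT.polarized.pos l a hprim ⟨1, hne⟩ _ h1C
    refine ⟨r, hr, ?_⟩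
    rw [← h5, h.Shat _ h1C, hNp _ _ h1C, h1 _ h1C, h1 _ (Twistor.sig_mem_Cstar h1C), h4, zc_coe,
      zc_coe, one_zpow, one_smul]
    simp [map_smulₛₗ, map_zpow₀, mul_assoc]

end IsModel

/-! ### Bases adapted to a mixed Hodge structure -/

section Opposite

variable {V : Type u} [AddCommGroup V] [Module ℂ V]

/-- The decreasing filtrations `A` and `B` are opposite on `Gr^W`: they induce on `Gr_k` opposite
filtrations with sum of the indices `k + c`. -/
structure IsOpposite (W A B : Fil(V)) (c : ℤ) : Prop where
  mono : Monotone W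
  exists_bot : ∃ l, W l = ⊥
  exists_top : ∃ l, W l = ⊤
  left : IsDecFiltration A
  right : IsDecFiltration B
  sup : ∀ k p, ∀ a ∈ W k, ∃ x ∈ A p ⊓ W k, ∃ y ∈ B (k + c + 1 - p) ⊓ W k, a - x - y ∈ W (k - 1)
  inf : ∀ k p, ∀ x ∈ A p ⊓ W k, ∀ y ∈ B (k + c + 1 - p) ⊓ W k, x - y ∈ W (k - 1) → x ∈ W (k - 1)

namespace IsOpposite

variable {W A B : Fil(V)} {c : ℤ}

/-- The lifts to `A^p ∩ W_k` of the elements of `A^p ∩ B^{k+c-p}` of `Gr_k`. -/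
def piece (W A B : Fil(V)) (c : ℤ) (i : ℤ × ℤ) : Submodule ℂ V :=
  A i.2 ⊓ W i.1 ⊓ (B (i.1 + c - i.2) ⊓ W i.1 ⊔ W (i.1 - 1))

lemma mem_piece {i : ℤ × ℤ} {x : V} : x ∈ piece W A B c i ↔
    x ∈ A i.2 ⊓ W i.1 ∧ ∃ y ∈ B (i.1 + c - i.2) ⊓ W i.1, x - y ∈ W (i.1 - 1) := by
  rw [piece, Submodule.mem_inf, Submodule.mem_sup]
  refine and_congr_right fun _ => ⟨?_, ?_⟩
  · rintro ⟨y, hy, z, hz, rfl⟩; exact ⟨y, hy, by rwa [add_sub_cancel_left]⟩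
  · rintro ⟨y, hy, hz⟩; exact ⟨y, hy, _, hz, add_sub_cancel _ _⟩

lemma symm (h : IsOpposite W A B c) : IsOpposite W B A c where
  mono := h.mono
  exists_bot := h.exists_bot
  exists_top := h.exists_top
  left := h.right
  right := h.left
  sup k p a ha := by
    obtain ⟨x, hx, y, hy, h1⟩ := h.sup k (k + c + 1 - p) a ha
    rw [sub_sub_cancel] at hy; exact ⟨y, hy, x, hx, by rwa [sub_right_comm]⟩
  inf k p x hx y hy hxy := by
    have h0 : y - x ∈ W (k - 1) := sub_mem_comm_iff.1 hxy
    have h1 := h.inf k (k + c + 1 - p) y hy x (by rwa [sub_sub_cancel]) h0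
    have h2 := sub_mem h1 h0
    rwa [sub_sub_cancel] at h2

/-- A family in `A^p ∩ W_k` whose classes span the pieces `A^p ∩ B^{k+c-p}` of all `Gr_k` spans
all intersections `A^m ∩ W_k`. -/
lemma le_span (h : IsOpposite W A B c) {ι : Type*} {b : ι → V} {κ p : ι → ℤ}
    (hb : ∀ j, b j ∈ A (p j))
    (hX : ∀ k m, ∀ u ∈ A m ⊓ W k, ∀ y ∈ B (k + c - m) ⊓ W k, u - y ∈ W (k - 1) →
      ∃ v ∈ span ℂ (b '' {j | κ j = k ∧ p j = m}), u - v ∈ W (k - 1)) (k m : ℤ) :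
    A m ⊓ W k ≤ span ℂ (b '' {j | κ j ≤ k ∧ m ≤ p j}) := by
  obtain ⟨l, hl⟩ := h.exists_bot
  obtain ⟨q, hq⟩ := h.left.2.2
  have key : ∀ (n : ℕ) (k : ℤ), k ≤ l + n → ∀ (n' : ℕ) (m : ℤ), q ≤ m + n' →
      A m ⊓ W k ≤ span ℂ (b '' {j | κ j ≤ k ∧ m ≤ p j}) := fun n => by
    induction n with
    | zero =>
      intro k hk n' m _ x hx
      have := h.mono (show k ≤ l by simpa using hk) hx.2
      rw [hl, Submodule.mem_bot] at this; simp [this]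
    | succ n ih =>
      intro k hk n'
      induction n' with
      | zero =>
        intro m hm x hx
        have := h.left.1 (show q ≤ m by simpa using hm) hx.1
        rw [hq, Submodule.mem_bot] at this; simp [this]
      | succ n' ih' =>
        intro m hm x hx
        obtain ⟨v, hv, y, hy, h1⟩ := h.sup k (m + 1) x hx.2
        have hu : x - v ∈ A m ⊓ W k := ⟨sub_mem hx.1 (h.left.1 (by omega) hv.1), sub_mem hx.2 hv.2⟩
        obtain ⟨t, ht, h2⟩ := hX k m (x - v) hu y (by convert hy using 3; ring) h1
        have htA : t ∈ A m := by
          refine (Submodule.span_le (p := A m)).2 ?_ ht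
          rintro _ ⟨j, hj, rfl⟩
          rw [← hj.2]; exact hb j
        have h3 := ih (k - 1) (by push_cast at hk; omega) (n' + 1) m hm ⟨sub_mem hu.1 htA, h2⟩
        have h4 := ih' (m + 1) (by push_cast at hm; omega) hv
        have h5 : x = t + (x - v - t) + v := by abel
        have hmono : ∀ {k' m' : ℤ}, k' ≤ k → m ≤ m' → b '' {j | κ j ≤ k' ∧ m' ≤ p j} ⊆
            b '' {j | κ j ≤ k ∧ m ≤ p j} := fun hk' hm' =>
          Set.image_mono fun j hj => ⟨hj.1.trans hk', hm'.trans hj.2⟩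
        rw [h5]
        refine add_mem (add_mem ?_ ?_) ?_
        · refine span_mono (Set.image_mono ?_) ht
          exact fun j hj => ⟨hj.1.le, hj.2.ge⟩
        · exact span_mono (hmono (by omega) le_rfl) h3
        · exact span_mono (hmono le_rfl (by omega)) h4
  exact key (k - l).toNat k (by omega) (q - m).toNat m (by omega)

/-- Complements of `A^p ∩ W_{k-1}` in the pieces are independent. -/
lemma iSupIndep_compl (h : IsOpposite W A B c) {C : ℤ × ℤ → Submodule ℂ V}
    (hC : ∀ i, C i ≤ piece W A B c i) (hd : ∀ i, Disjoint (C i) (W (i.1 - 1))) : iSupIndep C := by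
  classical
  rw [iSupIndep_iff_finsetSum_eq_zero_imp_eq_zero]
  intro s v hv hs
  by_contra hne
  push Not at hne
  obtain ⟨i₀, hi₀, hv₀⟩ := hne
  set s' := s.filter fun i => v i ≠ 0
  -- the nonzero term with the largest weight and, among those, the smallest Hodge index
  obtain ⟨i, hi, hmax⟩ := s'.exists_max_image (fun i => toLex (i.1, -i.2))
    ⟨i₀, Finset.mem_filter.2 ⟨hi₀, hv₀⟩⟩
  have hi' := Finset.mem_filter.1 hi
  have hle : ∀ j ∈ s'.erase i, v j ∈ A (i.2 + 1) ⊓ W i.1 ⊔ W (i.1 - 1) := fun j hj => by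
    have hj' := Finset.mem_erase.1 hj
    have h1 := hmax j hj'.2
    have h2 := (mem_piece.1 (hC j (hv j (Finset.mem_filter.1 hj'.2).1))).1
    rw [Prod.Lex.toLex_le_toLex] at h1
    rcases h1 with h1 | ⟨h1, h3⟩
    · exact Submodule.mem_sup_right (h.mono (by simp only at h1; omega) h2.2)
    · refine Submodule.mem_sup_left ⟨h.left.1 ?_ h2.1, by simp only at h1; rw [← h1]; exact h2.2⟩
      simp only at h1 h3
      have : j.2 ≠ i.2 := fun h4 => hj'.1 (Prod.ext h1 h4)
      omega
  have h1 : v i + ∑ j ∈ s'.erase i, v j = 0 := by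
    rw [Finset.add_sum_erase _ _ hi, ← hs]; exact Finset.sum_filter_ne_zero s
  obtain ⟨x, hx, z, hz, hxz⟩ := Submodule.mem_sup.1 (sum_mem hle)
  rw [← hxz] at h1
  obtain ⟨-, y, hy, hvy⟩ := mem_piece.1 (hC i (hv i hi'.1))
  have h2 : x ∈ W (i.1 - 1) := by
    refine h.inf i.1 (i.2 + 1) x hx (-y) ?_ ?_
    · convert neg_mem hy using 3
      ring
    · have h3 := add_mem hvy hz
      have h4 : x - -y = -(v i - y + z) := by
        rw [eq_comm, ← sub_eq_zero]
        rw [show -(v i - y + z) - (x - -y) = -(v i + (x + z)) by abel, h1, neg_zero]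
      rw [h4]; exact neg_mem h3
  have h3 : v i ∈ W (i.1 - 1) := by
    rw [eq_neg_of_add_eq_zero_left h1]; exact neg_mem (add_mem h2 hz)
  exact hi'.2 ((Submodule.disjoint_def.1 (hd i)) _ (hv i hi'.1) h3)

/-- There are two bases, adapted to `W` and `A` respectively to `W` and `B`, which induce the same
bases of the spaces `Gr_k`. -/
lemma exists_bases [FiniteDimensional ℂ V] (h : IsOpposite W A B c) :
    ∃ (κ p : Fin (finrank ℂ V) → ℤ) (b₀ b₁ : Basis (Fin (finrank ℂ V)) ℂ V),
      (∀ j, b₀ j ∈ A (p j) ⊓ W (κ j)) ∧ (∀ j, b₁ j ∈ B (κ j + c - p j) ⊓ W (κ j)) ∧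
      (∀ j, b₀ j - b₁ j ∈ W (κ j - 1)) ∧
      (∀ k m, ∀ x ∈ A m ⊓ W k, ∀ j, b₀.repr x j ≠ 0 → κ j ≤ k ∧ m ≤ p j) ∧
      ∀ k m, ∀ x ∈ B m ⊓ W k, ∀ j, b₁.repr x j ≠ 0 → κ j ≤ k ∧ m ≤ κ j + c - p j := by
  classical
  have hC : ∀ i : ℤ × ℤ, ∃ C ≤ piece W A B c i, Disjoint C (W (i.1 - 1)) ∧
      ∀ x ∈ piece W A B c i, ∃ y ∈ C, x - y ∈ W (i.1 - 1) := by
    intro i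
    obtain ⟨C, hC⟩ := exists_isCompl ((W (i.1 - 1)).comap (piece W A B c i).subtype)
    refine ⟨C.map (Submodule.subtype _), Submodule.map_subtype_le _ _, ?_, ?_⟩
    · rw [Submodule.disjoint_def]
      rintro _ ⟨x, hx, rfl⟩ hx'
      simp [(Submodule.disjoint_def.1 hC.disjoint) x hx' hx]
    · intro x hx
      obtain ⟨y, hy, z, hz, hyz⟩ := Submodule.mem_sup.1
        (hC.sup_eq_top.symm ▸ Submodule.mem_top : (⟨x, hx⟩ : piece W A B c i) ∈ _)
      refine ⟨z, mem_map_of_mem hz, ?_⟩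
      have h1 : x - z = y := by rw [sub_eq_iff_eq_add, ← Submodule.coe_add, hyz]
      rwa [h1]
  choose C hC hd hsurj using hC
  let v := fun i => finBasis ℂ (C i)
  let b : (Σ i, Fin (finrank ℂ (C i))) → V := fun j => v j.1 j.2
  have hbC : ∀ j, b j ∈ C j.1 := fun j => (v j.1 j.2).2
  have hbA : ∀ j, b j ∈ A j.1.2 ⊓ W j.1.1 := fun j => (mem_piece.1 (hC _ (hbC j))).1
  have hspan : ∀ i, C i ≤ span ℂ (b '' {j | j.1 = i}) := by
    intro i
    have h1 := congrArg (Submodule.map (C i).subtype) (v i).span_eq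
    rw [Submodule.map_span, Submodule.map_subtype_top] at h1
    rw [← h1]
    refine span_mono ?_
    rintro _ ⟨_, ⟨j, rfl⟩, rfl⟩; exact ⟨⟨i, j⟩, rfl, rfl⟩
  have hX : ∀ k m, ∀ u ∈ A m ⊓ W k, ∀ y ∈ B (k + c - m) ⊓ W k, u - y ∈ W (k - 1) →
      ∃ t ∈ C (k, m), u - t ∈ W (k - 1) := fun k m u hu y hy huy =>
    hsurj (k, m) u (mem_piece.2 ⟨hu, y, hy, huy⟩)
  have hle := h.le_span (κ := fun j => j.1.1) (p := fun j => j.1.2) (fun j => (hbA j).1)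
    fun k m u hu y hy huy => by
      obtain ⟨t, ht, h1⟩ := hX k m u hu y hy huy
      refine ⟨t, ?_, h1⟩
      refine (hspan _).trans (span_mono (Set.image_mono ?_)) ht
      intro j (hj : j.1 = (k, m))
      exact ⟨congrArg Prod.fst hj, congrArg Prod.snd hj⟩
  have htop : iSup C = ⊤ := by
    obtain ⟨l, hl⟩ := h.exists_top
    obtain ⟨q, hq⟩ := h.left.2.1
    have h1 := hle l q
    rw [hl, hq, inf_top_eq, top_le_iff] at h1
    rw [← top_le_iff, ← h1, Submodule.span_le]
    rintro _ ⟨j, -, rfl⟩; exact (le_iSup C j.1) (hbC j)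
  have hint := DirectSum.isInternal_submodule_of_iSupIndep_of_iSup_eq_top
    (h.iSupIndep_compl hC hd) htop
  let β := hint.collectedBasis v
  have hβ : ∀ j, β j = b j := fun j => congrFun (hint.collectedBasis_coe v) j
  have : Fintype (Σ i, Fin (finrank ℂ (C i))) := FiniteDimensional.fintypeBasisIndex β
  let e := Fintype.equivFinOfCardEq (finrank_eq_card_basis β).symm
  let b₀ := β.reindex e
  let κ : Fin (finrank ℂ V) → ℤ := fun j => (e.symm j).1.1
  let p : Fin (finrank ℂ V) → ℤ := fun j => (e.symm j).1.2
  have hb₀ : ∀ j, b₀ j = b (e.symm j) := fun j => by rw [β.reindex_apply, hβ]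
  choose y hy hy' using fun j => (mem_piece.1 (hC _ (hbC (e.symm j)))).2
  have hy1 := h.symm.le_span (b := y) (κ := κ) (p := fun j => κ j + c - p j) (fun j => (hy j).1)
    fun k m u hu a ha hua => by
      obtain ⟨t, ht, h1⟩ := hX k (k + c - m) a ha u (by rwa [sub_sub_cancel]) (by
        rw [← neg_sub u a]
        exact neg_mem hua)
      -- the combination of the `y j` with the coefficients of `t`
      have key : ∀ t ∈ span ℂ (b '' {j | j.1 = (k, k + c - m)}),
          ∃ t' ∈ span ℂ (y '' {j | κ j = k ∧ κ j + c - p j = m}), t - t' ∈ W (k - 1) := by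
        intro t ht
        induction ht using Submodule.span_induction with
        | mem x hx =>
          obtain ⟨j, hj, rfl⟩ := hx
          have hj : j.1 = (k, k + c - m) := hj
          have hk : κ (e j) = k := by simp [κ, hj]
          have hp : p (e j) = k + c - m := by simp [p, hj]
          refine ⟨y (e j), Submodule.subset_span ⟨e j, ⟨hk, by rw [hk, hp]; ring⟩, rfl⟩, ?_⟩
          have := hy' (e j)
          rw [e.symm_apply_apply] at this
          rwa [hj] at this
        | zero => exact ⟨0, zero_mem _, by simp⟩
        | add x x' _ _ h1 h2 =>
          obtain ⟨t, ht, h1⟩ := h1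
          obtain ⟨t', ht', h2⟩ := h2
          exact ⟨t + t', add_mem ht ht', by
            rw [add_sub_add_comm]; exact add_mem h1 h2⟩
        | smul z x _ h1 =>
          obtain ⟨t, ht, h1⟩ := h1
          exact ⟨z • t, smul_mem _ _ ht, by
            rw [← smul_sub]; exact smul_mem _ _ h1⟩
      obtain ⟨t', ht', h2⟩ := key t (hspan _ ht)
      refine ⟨t', ht', ?_⟩
      rw [show u - t' = (u - a) + (a - t) + (t - t') by abel]; exact add_mem (add_mem hua h1) h2
  have hytop : ⊤ ≤ span ℂ (Set.range y) := by
    obtain ⟨l, hl⟩ := h.exists_top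
    obtain ⟨q, hq⟩ := h.right.2.1
    have h1 := hy1 l q
    rw [hl, hq, inf_top_eq] at h1
    exact h1.trans (span_mono (Set.image_subset_range _ _))
  let b₁ := basisOfTopLeSpanOfCardEqFinrank y hytop (by simp)
  have hb₁ : ⇑b₁ = y := coe_basisOfTopLeSpanOfCardEqFinrank _ _ _
  refine ⟨κ, p, b₀, b₁, fun j => ?_, fun j => ?_, fun j => ?_, fun k m x hx j hj => ?_,
    fun k m x hx j hj => ?_⟩
  · rw [hb₀]; exact hbA _
  · rw [hb₁]; exact hy j
  · rw [hb₀, hb₁]; exact hy' j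
  · have h1 := hle k m hx
    rw [← funext hβ, Basis.mem_span_image] at h1
    rw [β.repr_reindex_apply] at hj; exact h1 (Finsupp.mem_support_iff.2 hj)
  · have h1 := hy1 k m hx
    rw [← hb₁, Basis.mem_span_image] at h1; exact h1 (Finsupp.mem_support_iff.2 hj)

end IsOpposite

end Opposite

namespace HodgeTuple

variable {w : ℤ} {D : HodgeTuple.{u} w} {W : Fil(D.V)}

/-- `F` and `Fb` are opposite on `Gr^W`. -/
lemma IsData.isOpposite (hD : D.IsData W) : IsOpposite W D.F D.Fb (w - 1) where
  mono := hD.weight.mono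
  exists_bot := hD.weight.exists_bot
  exists_top := hD.weight.exists_top
  left := D.F_fil.1
  right := D.Fb_fil.1
  sup k p a ha := by
    have h1 : ∀ μ ∈ (ssPart D.M).finite_hasEigenvalue.toFinset, ∃ x ∈ D.F p ⊓ W k,
        ∃ y ∈ D.Fb (k + w - p) ⊓ W k, eigProj D.M (stripRep μ) a - x - y ∈ W (k - 1) := fun μ hμ => by
      have hα := inStrip_stripRep D.M_bij (by simpa using hμ)
      obtain ⟨x, hx, y, hy, -, hxk, -, hyk, h⟩ := (hD.part _).sup _ hα rfl k p _
        (eigProj_mem D.M_bij hα a) (proj_mem (D.weight_stable hD.weight k) ha)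
      exact ⟨x, ⟨hx, hxk⟩, y, ⟨hy, hyk⟩, h⟩
    choose! x hx y hy hxy using h1
    rw [show k + (w - 1) + 1 - p = k + w - p by ring]
    refine ⟨_, sum_mem hx, _, sum_mem hy, ?_⟩
    have h2 := sum_mem hxy
    rwa [sum_sub_distrib, sum_sub_distrib, sum_eigProj D.M_bij a] at h2
  inf k p x hx y hy hxy := by
    rw [show k + (w - 1) + 1 - p = k + w - p by ring] at hy
    have hW := D.weight_stable hD.weight
    refine D.mem_of_forall_eigProj fun α hα => (hD.part _).inf α hα rfl k p _
      (proj_mem (D.F_fil.2.1 p) hx.1) (eigProj D.M α y) (proj_mem (D.Fb_ss _) hy.1)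
      (eigProj_mem D.M_bij hα x) (proj_mem (hW k) hx.2) (eigProj_mem D.M_bij hα y)
      (proj_mem (hW k) hy.2) ?_
    rw [← map_sub]; exact proj_mem (hW _) hxy

lemma IsData.hForm_eq_zero (hD : D.IsData W) {p q : ℤ} (hpq : w ≤ p + q) {a b : D.V}
    (ha : a ∈ D.F p) (hb : b ∈ D.Fb q) : D.hForm a b = 0 := by
  rw [← sum_eigProj D.M_bij a, ← sum_eigProj D.M_bij b, map_sum]
  refine sum_eq_zero fun ν hν => ?_
  rw [map_sum, LinearMap.sum_apply]
  refine sum_eq_zero fun μ hμ => ?_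
  have hα := inStrip_stripRep D.M_bij ((Set.Finite.mem_toFinset _).1 hμ)
  have hβ := inStrip_stripRep D.M_bij ((Set.Finite.mem_toFinset _).1 hν)
  have ha' := eigProj_mem D.M_bij hα a
  have hb' := eigProj_mem D.M_bij hβ b
  by_cases h : stripRep ν = Cj (stripRep μ)
  · rw [h] at hb' ⊢
    exact (hD.part _).orth _ hα rfl p q hpq _ (proj_mem (D.F_fil.2.1 p) ha) _
      (proj_mem (D.Fb_ss q) hb) ha' hb'
  · exact D.hForm_eq_zero hα hβ h ha' hb'

lemma IsData.hForm_pos (hD : D.IsData W) (l : ℕ) {p : ℤ} {a x y : D.V} (ha : a ∈ W l)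
    (ha' : a ∉ W (l - 1)) (hN : (D.N ^ (l + 1)) a ∈ W (-l - 3)) (hx : x ∈ D.F p ⊓ W l)
    (hy : y ∈ D.Fb (l + w - 1 - p) ⊓ W l) (hax : a - x ∈ W (l - 1)) (hay : a - y ∈ W (l - 1)) :
    ∃ r : ℝ, 0 < r ∧ I ^ (-(l : ℤ)) * (-1) ^ (w - 1 - p) * D.hForm ((D.N ^ l) a) a = r := by
  have hW := D.weight_stable hD.weight
  set f := I ^ (-(l : ℤ)) * (-1 : ℂ) ^ (w - 1 - p)
  have hmem := fun {α} (hα : InStrip α) => eigProj_mem D.M_bij hα a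
  have hzero : ∀ α, eigProj D.M α a ∈ W (l - 1) → ∀ b ∈ W l,
      D.hForm ((D.N ^ l) (eigProj D.M α a)) b = 0 := fun α h b hb =>
    D.hForm_weight hD.weight (by omega) (hD.weight.pow_mem h l) hb
  refine D.exists_pos_of_eigProj (q := fun a b => f * D.hForm ((D.N ^ l) a) b) (X := W (l - 1))
    (by simp [mul_sum]) (by simp [mul_sum]) ha' (fun α β hα hβ hne => ?_)
    (fun α _ h => ?_) fun α hα h => ?_
  · by_cases h : eigProj D.M α a ∈ W (l - 1)
    · rw [hzero α h _ (proj_mem (hW l) ha), mul_zero]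
    · have hα' := hD.conj_eq hα ((Submodule.ne_bot_iff _).2 ⟨_, hmem hα, fun h0 => h (by
        rw [h0]
        exact zero_mem _)⟩)
      rw [D.hForm_eq_zero hα hβ (by rw [hα']; exact hne.symm)
        (nPart_pow_mem D.M_bij (hmem hα) l) (hmem hβ), mul_zero]
  · rw [hzero α h _ (proj_mem (hW l) ha), mul_zero]
  · have hN' := proj_mem (α := α) (hW _) hN
    have hax' := proj_mem (α := α) (hW _) hax
    have hay' := proj_mem (α := α) (hW _) hay
    rw [map_sub] at hax' hay'
    rw [D.eigProj_N_pow] at hN'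
    exact (hD.part _).pos α hα rfl l p _ (hmem hα) (proj_mem (hW l) ha) h hN' _
      (proj_mem (D.F_fil.2.1 p) hx.1) _ (proj_mem (D.Fb_ss _) hy.1)
      (eigProj_mem D.M_bij hα x) (proj_mem (hW l) hx.2)
      (eigProj_mem D.M_bij hα y) (proj_mem (hW l) hy.2) hax' hay'

end HodgeTuple

/-! ### Bundles given by two frames -/

/-- The coordinate `z` as a unit on `ℂ^*`, continued by the value `1` to `0` and `∞`. -/
def zunit (y : P1) : ℂˣ := if h : zc y = 0 then 1 else Units.mk0 (zc y) h

lemma zunit_of_mem {y : P1} (hy : y ∈ Cstar) : (zunit y : ℂ) = zc y := by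
  rw [zunit, dif_neg (zc_ne_zero hy), Units.val_mk0]

lemma zunit_zero : zunit 𝟘 = 1 := dif_pos rfl

lemma zunit_infty : zunit ∞ = 1 := dif_pos rfl

section ZBasis

variable {V : Type u} [AddCommGroup V] [Module ℂ V] {r : ℕ}

/-- The basis `z^{n_j} b_j`. -/
def zBasis (b : Basis (Fin r) ℂ V) (n : Fin r → ℤ) (y : P1) : Basis (Fin r) ℂ V :=
  b.unitsSMul fun j => zunit y ^ n j

variable (b : Basis (Fin r) ℂ V) (n : Fin r → ℤ)

lemma zBasis_apply y (j : Fin r) : zBasis b n y j = ((zunit y : ℂ) ^ n j) • b j := by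
  rw [zBasis, Basis.unitsSMul_apply, Units.smul_def, Units.val_zpow_eq_zpow_val]

lemma zBasis_repr y (v : V) (j : Fin r) :
    (zBasis b n y).repr v j = (zunit y : ℂ) ^ (-n j) * b.repr v j := by
  simp [zBasis, Basis.repr_unitsSMul, Units.smul_def, Units.val_zpow_eq_zpow_val]

lemma zBasis_of_eq_one {y : P1} (hy : zunit y = 1) : zBasis b n y = b := by
  ext j
  simp [zBasis_apply, hy, Units.val_one, one_zpow]

lemma holFun_zBasis_iff {s : P1 → V} {z : ℂ} (hz : z ≠ 0) :
    (∀ j, HolFun (fun y => (zBasis b n y).repr (s y) j) z) ↔ VAn (fun u : ℂ => s u) z := by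
  rw [vAn_iff_repr b]
  refine forall_congr' fun j => ?_
  rw [holFun_coe_iff]
  have h1 : ∀ m : ℤ, An (fun u : ℂ => u ^ m) z := fun m =>
    (analyticAt_id.zpow hz : An (fun u : ℂ => u ^ m) z)
  have h2 : ∀ᶠ u : ℂ in 𝓝 z, (zBasis b n u).repr (s u) j = u ^ (-n j) * b.repr (s u) j := by
    filter_upwards [compl_singleton_mem_nhds hz] with u hu
    rw [zBasis_repr, zunit_of_mem (mem_Cstar_coe.2 hu), zc_coe]
  refine ⟨fun h => ((h1 (n j)).mul h).congr ?_, fun h => ((h1 (-n j)).mul h).congr ?_⟩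
  · filter_upwards [h2, compl_singleton_mem_nhds hz] with u hu hu0
    rw [Pi.mul_apply, hu, ← mul_assoc, ← zpow_add₀ hu0, add_neg_cancel, zpow_zero, one_mul]
  · filter_upwards [h2] with u hu
    rw [Pi.mul_apply, hu]

/-- The bundle with fibres `V` and with the frame `z^{n₀} b₀` on `ℂ` and the frame `z^{n₁} b₁` on
`ℙ¹ ∖ {0}`. -/
abbrev twoFrame (b₀ b₁ : Basis (Fin r) ℂ V) (n₀ n₁ : Fin r → ℤ) : HolFam.{u} where
  Fib _ := V
  HolAt s x := (x ≠ ∞ → ∀ j, HolFun (fun y => (zBasis b₀ n₀ y).repr (s y) j) x) ∧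
    (x = ∞ → ∀ j, HolFun (fun y => (zBasis b₁ n₁ y).repr (s y) j) x)

variable {b₀ b₁ : Basis (Fin r) ℂ V} {n₀ n₁ : Fin r → ℤ}

lemma twoFrame_holAt {s : P1 → V} {z : ℂ} (hz : z ≠ 0) :
    (twoFrame b₀ b₁ n₀ n₁).HolAt s z ↔ VAn (fun u : ℂ => s u) z := by
  rw [← holFun_zBasis_iff b₀ n₀ hz]; simp

lemma twoFrame_frame_left : (twoFrame b₀ b₁ n₀ n₁).IsFrameOn {∞}ᶜ (zBasis b₀ n₀) := fun _ _ hx =>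
  ⟨fun h => h.1 hx, fun h => ⟨fun _ => h, fun h0 => absurd h0 hx⟩⟩

lemma twoFrame_frame_right :
    (twoFrame b₀ b₁ n₀ n₁).IsFrameOn {𝟘}ᶜ (zBasis b₁ n₁) := fun s x hx => by
  rcases cases_P1 x with h | rfl | h
  · exact absurd h hx
  · simp
  · obtain ⟨z, rfl⟩ := ne_infty_iff_exists.1 h.1
    exact (twoFrame_holAt (mem_Cstar_coe.1 h)).trans (holFun_zBasis_iff b₁ n₁ (mem_Cstar_coe.1 h)).symm

lemma twoFrame_bundle : (twoFrame b₀ b₁ n₀ n₁).IsBundle r := fun x => by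
  by_cases hx : x = ∞
  · refine ⟨_, isOpen_compl_singleton, ?_, _, twoFrame_frame_right⟩
    rw [hx]; exact (coe_ne_infty 0).symm
  · exact ⟨_, isOpen_compl_singleton, hx, _, twoFrame_frame_left⟩

/-- The germs at a point `x` where the frame is `z^n b` form a lattice; here `lc` is a local
coordinate at `x` and `m = ± n`. -/
lemma extHolAt_iff_lat {E : HolFam.{u}} {τ : ∀ y, E.Fib y ≃ₗ[ℂ] V} {U : Set P1} {x : P1}
    (hx : x ∈ U) {e : ∀ y, Basis (Fin r) ℂ (E.Fib y)} (hE : E.IsFrameOn U e)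
    {b : Basis (Fin r) ℂ V} {m : Fin r → ℤ} {Φ : Fil(V)} {lc : P1 → ℂ}
    (hlc : ∀ u, lc (chart x u) = u)
    (he : ∀ u, u ≠ 0 → ∀ v j, (e (chart x u)).repr v j = u ^ (-m j) * b.repr (τ _ v) j)
    (hb : ∀ j, b j ∈ Φ (m j)) (hΦ : ∀ k, ∀ A ∈ Φ k, ∀ j, b.repr A j ≠ 0 → m j ≤ k)
    {s : ∀ y, E.Fib y} :
    E.ExtHolAt s x ↔ Lat Φ fun u => τ _ (s (chart x u)) := by
  rw [Lat.adapted_iff hb hΦ]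
  constructor
  · rintro ⟨t, ht, hts⟩ j
    refine ⟨_, holFun_iff.1 ((hE t x hx).1 ht j), ?_⟩
    filter_upwards [eventually_nhdsNE_chart.1 hts, self_mem_nhdsWithin] with u hu (hu0 : u ≠ 0)
    rw [hu, he u hu0, mul_right_comm, ← zpow_add₀ hu0, neg_add_cancel, zpow_zero, one_mul]
  · intro h
    choose f hf hfs using h
    refine ⟨fun y => ∑ j, f j (lc y) • e y j, (hE _ x hx).2 fun i => ?_, ?_⟩
    · rw [holFun_iff]
      refine (hf i).congr (.of_forall fun u => ?_)
      simp [hlc, Finsupp.single_apply]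
    · rw [eventually_nhdsNE_chart]
      filter_upwards [eventually_all.2 hfs, self_mem_nhdsWithin] with u hu (hu0 : u ≠ 0)
      apply (e (chart x u)).repr.injective
      ext i
      rw [he u hu0 (s _), hu i, hlc, mul_comm (f i u), ← mul_assoc, ← zpow_add₀ hu0, neg_add_cancel,
        zpow_zero, one_mul]
      simp [Finsupp.single_apply]

end ZBasis

lemma Lat.vAn {V : Type u} [AddCommGroup V] [Module ℂ V] {Φ : Fil(V)} {g : ℂ → V}
    (hg : Lat Φ g) : ∀ᶠ u in 𝓝[≠] 0, VAn g u := by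
  obtain ⟨m, n, A, f, h1, h2⟩ := hg
  have h4 : ∀ i, ∀ᶠ u in 𝓝[≠] (0 : ℂ), An (f i) u := fun i =>
    nhdsWithin_le_nhds (h1 i).2.eventually_analyticAt
  filter_upwards [eventually_eventually_nhdsWithin.2 h2, eventually_all.2 h4, self_mem_nhdsWithin]
    with u hu hf hu0 ℓ
  rw [nhdsWithin_eq_nhds.2 (compl_singleton_mem_nhds hu0)] at hu
  have h3 : An (fun t => ∑ i, (f i t * t ^ n i) * ℓ (A i)) u :=
    Finset.analyticAt_fun_sum _ fun i _ =>
      ((hf i).mul (analyticAt_id.zpow hu0)).mul analyticAt_const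
  refine h3.congr ?_
  filter_upwards [hu] with t ht
  rw [ht]; simp

lemma logB_mem {V : Type u} [AddCommGroup V] [Module ℂ V] [FiniteDimensional ℂ V]
    {M : End ℂ V} (hM : Bijective M) {F : Fil(V)}
    (hF : IsMonodromyFiltration M F) {p : ℤ} {x : V} (hx : x ∈ F p) : logB M x ∈ F (p - 1) := by
  refine stable_induction hM (hF.2.1 p) (P := fun x => logB M x ∈ F (p - 1)) ?_ ?_ ?_ hx
  · intro α hα x hx hxF
    rw [logB_apply hM hα hx]
    exact Submodule.sub_mem _ (smul_mem _ _ (hF.1.1 (by omega) hxF))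
      (smul_mem _ _ (hF.2.2 p (Submodule.mem_map_of_mem hxF)))
  · simp
  · intro x y hx hy
    rw [map_add]; exact add_mem hx hy

/-- Bases of the space of `D` which are adapted to `W` and the filtrations `F` and `Fb` which
describe the germs of the bundle at `0` and `∞`, and which induce the same bases of `Gr^W`. -/
structure AdaptedFrame {w : ℤ} (D : HodgeTuple.{u} w) (W : Fil(D.V)) where
  isData : D.IsData W
  κ : Fin (finrank ℂ D.V) → ℤ
  n : Fin (finrank ℂ D.V) → ℤ
  b₀ : Basis (Fin (finrank ℂ D.V)) ℂ D.V
  b₁ : Basis (Fin (finrank ℂ D.V)) ℂ D.V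
  mem₀ : ∀ j, b₀ j ∈ D.F (w - 1 - n j) ⊓ W (κ j)
  mem₁ : ∀ j, b₁ j ∈ D.Fb (κ j + n j) ⊓ W (κ j)
  sub_mem : ∀ j, b₀ j - b₁ j ∈ W (κ j - 1)
  repr₀ : ∀ k m, ∀ x ∈ D.F m ⊓ W k, ∀ j, b₀.repr x j ≠ 0 → κ j ≤ k ∧ m ≤ w - 1 - n j
  repr₁ : ∀ k m, ∀ x ∈ D.Fb m ⊓ W k, ∀ j, b₁.repr x j ≠ 0 → κ j ≤ k ∧ m ≤ κ j + n j

namespace AdaptedFrame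

variable {w : ℤ} {D : HodgeTuple.{u} w} {W : Fil(D.V)}

attribute [instance] HodgeTuple.finite

lemma nonempty (hD : D.IsData W) : Nonempty (AdaptedFrame D W) := by
  obtain ⟨κ, p, b₀, b₁, h1, h2, h3, h4, h5⟩ := hD.isOpposite.exists_bases
  have e1 : ∀ j, κ j + (w - 1) - p j = κ j + (w - 1 - p j) := fun j => by ring
  refine ⟨⟨hD, κ, fun j => w - 1 - p j, b₀, b₁, ?_, ?_, h3, ?_, ?_⟩⟩
  · simpa using h1
  · simpa [e1] using h2
  · simpa using h4
  · simpa [e1] using h5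

variable (A : AdaptedFrame D W)

/-- The bundle on `ℙ¹` with fibres `D.V`, whose germs at `0` and `∞` are the lattices belonging to
`F` and `Fb`. -/
abbrev E : HolFam.{u} := twoFrame A.b₀ A.b₁ A.n fun j => A.κ j + A.n j

/-- The frame on `ℂ`. -/
abbrev e₀ (y : P1) : Basis (Fin (finrank ℂ D.V)) ℂ D.V := zBasis A.b₀ A.n y

/-- The frame on `ℙ¹ ∖ {0}`. -/
abbrev e₁ (y : P1) : Basis (Fin (finrank ℂ D.V)) ℂ D.V := zBasis A.b₁ (fun j => A.κ j + A.n j) y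

lemma frame₀ : A.E.IsFrameOn {∞}ᶜ A.e₀ := twoFrame_frame_left

lemma frame₁ : A.E.IsFrameOn {𝟘}ᶜ A.e₁ := twoFrame_frame_right

lemma extHolAt_zero {s : P1 → D.V} : A.E.ExtHolAt s 𝟘 ↔
    Lat (fun n => D.F (w - 1 - n)) fun u => s u := by
  obtain ⟨l, hl⟩ := A.isData.weight.exists_top
  have h := extHolAt_iff_lat (E := A.E) (τ := fun _ => LinearEquiv.refl ℂ D.V)
    (Φ := fun n => D.F (w - 1 - n)) (coe_ne_infty 0 : 𝟘 ∈ {∞}ᶜ)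
    A.frame₀ (b := A.b₀) (m := A.n) (lc := zc) (s := s)
    (fun u => by rw [chart_coe, zc_coe, zero_add]) (fun u hu v j => by
      rw [chart_coe, zero_add, zBasis_repr, zunit_of_mem (mem_Cstar_coe.2 hu), zc_coe]
      rfl) (fun j => (A.mem₀ j).1) fun k x hx j hj => by
      have := (A.repr₀ l _ x ⟨hx, by rw [hl]; trivial⟩ j hj).2
      omega
  simp only [chart_coe, zero_add] at h; exact h

lemma extHolAt_infty {s : P1 → D.V} : A.E.ExtHolAt s ∞ ↔
    Lat (fun n => D.Fb (-n)) fun u => s (atInf u) := by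
  obtain ⟨l, hl⟩ := A.isData.weight.exists_top
  exact extHolAt_iff_lat (E := A.E) (τ := fun _ => LinearEquiv.refl ℂ D.V) (Φ := fun n => D.Fb (-n))
    ((coe_ne_infty 0).symm : ∞ ∈ {𝟘}ᶜ)
    A.frame₁ (b := A.b₁) (m := fun j => -(A.κ j + A.n j)) (lc := fun y => (zc y)⁻¹) (s := s)
    (fun u => by rw [chart_infty, zc_atInf, inv_inv]) (fun u hu v j => by
      rw [chart_infty, zBasis_repr, zunit_of_mem (atInf_mem_Cstar hu), zc_atInf, inv_zpow']
      rfl) (fun j => by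
      rw [neg_neg]
      exact (A.mem₁ j).1) fun k x hx j hj => by
      have := (A.repr₁ l _ x ⟨hx, by rw [hl]; trivial⟩ j hj).2
      omega

/-- The operator `∇_{z∂_z} = z∂_z + B`. -/
def nabla (s : P1 → D.V) (x : P1) : D.V :=
  ∑ j, (zc x * deriv (fun u : ℂ => A.b₀.repr (s u) j) (zc x)) • A.b₀ j + logB D.M (s x)

lemma apply_nabla {s : P1 → D.V} {z : ℂ} (hs : VAn (fun u : ℂ => s u) z)
    (ℓ : D.V →ₗ[ℂ] ℂ) : ℓ (A.nabla s z) =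
      z * deriv (fun u : ℂ => ℓ (s u)) z + ℓ (logB D.M (s z)) := by
  have h1 : (fun u : ℂ => ℓ (s u)) = fun u : ℂ => ∑ j, A.b₀.repr (s u) j * ℓ (A.b₀ j) :=
    funext fun u => apply_eq_sum_repr A.b₀ ℓ _
  have h2 := (vAn_iff_repr A.b₀).1 hs
  rw [nabla, map_add, map_sum, h1, deriv_fun_sum fun j _ =>
    (h2 j).differentiableAt.mul_const _, mul_sum, zc_coe]
  congr 1
  refine sum_congr rfl fun j _ => ?_
  simp [deriv_mul_const (h2 j).differentiableAt, mul_assoc]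

lemma isTriv : IsTriv D.M A.E A.nabla fun _ => LinearEquiv.refl ℂ D.V where
  hol _ _ hz := twoFrame_holAt hz
  nabla _ _ hz hs ℓ := A.apply_nabla ((twoFrame_holAt hz).1 hs) ℓ

lemma isMerConnection : IsMerConnection A.E A.nabla := by
  have hev : ∀ {s : P1 → D.V} {z : ℂ}, z ≠ 0 → A.E.HolAt s z →
      VAn (fun u : ℂ => s u) z := fun hz hs => (twoFrame_holAt hz).1 hs
  refine ⟨?_, ?_, ?_, ?_, ?_⟩
  · intro s x hx hs
    obtain ⟨z, rfl⟩ := ne_infty_iff_exists.1 hx.1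
    have hz := mem_Cstar_coe.1 hx
    have hs := hev hz hs
    refine (twoFrame_holAt hz).2 fun ℓ => ?_
    have h1 := (analyticAt_id.mul (hs ℓ).deriv).add (hs (ℓ.comp (logB D.M)))
    refine h1.congr ?_
    filter_upwards [hs.eventually] with u hu
    exact (A.apply_nabla hu ℓ).symm
  · intro s t x hx hs ht
    obtain ⟨z, rfl⟩ := ne_infty_iff_exists.1 hx.1
    have hz := mem_Cstar_coe.1 hx
    have hs := hev hz hs
    have ht := hev hz ht
    refine sub_eq_zero.1 ((forall_dual_apply_eq_zero_iff ℂ _).1 fun ℓ => ?_)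
    have h1 : VAn (fun u : ℂ => (s + t) u) z := fun ℓ => by simpa using (hs ℓ).fun_add (ht ℓ)
    rw [map_sub, map_add, A.apply_nabla h1, A.apply_nabla hs, A.apply_nabla ht]
    simp only [Pi.add_apply, map_add]
    rw [deriv_fun_add (hs ℓ).differentiableAt (ht ℓ).differentiableAt]; ring
  · intro f s z hz hf hs
    have hs := hev hz hs
    have hf := holFun_coe_iff.1 hf
    have h1 : VAn (fun u : ℂ => (f u • s u : D.V)) z := fun ℓ => by simpa using hf.fun_mul (hs ℓ)
    have key : A.nabla (fun y => (f y • s y : D.V)) z = f z • A.nabla s z +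
        (z * deriv (fun u : ℂ => f u) z) • (s z : D.V) := by
      refine sub_eq_zero.1 ((forall_dual_apply_eq_zero_iff ℂ _).1 fun ℓ => ?_)
      rw [map_sub, map_add, A.apply_nabla h1, map_smul, map_smul ℓ, map_smul ℓ, A.apply_nabla hs]
      simp only [map_smul, smul_eq_mul]
      rw [deriv_fun_mul hf.differentiableAt (hs ℓ).differentiableAt]; ring
    exact key
  · intro s hs
    have hs := A.extHolAt_zero.1 (HolFam.HolAt.ext hs)
    refine A.extHolAt_zero.2 ?_
    have h1 := hs.deriv (g' := fun u => A.nabla s u - logB D.M (s u)) (by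
      filter_upwards [hs.vAn] with u hu ℓ
      rw [map_sub, A.apply_nabla hu]
      ring)
    have h2 := (h1.map (Ψ := fun n => D.F (w - 1 - n)) LinearMap.id 1
      fun n x hx => D.F_fil.1.1 (by omega) hx).add (hs.map (Ψ := fun n => D.F (w - 1 - n))
        (logB D.M) 1 fun n x hx => by
          rw [show w - 1 - (n + 1) = w - 1 - n - 1 by ring]
          exact logB_mem D.M_bij D.F_fil hx)
    refine h2.congr (.of_forall fun u => ?_)
    rw [LinearMap.id_apply, ← smul_add, sub_add_cancel, zpow_one]; rfl
  · intro s hs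
    have hs := A.extHolAt_infty.1 (HolFam.HolAt.ext hs)
    refine A.extHolAt_infty.2 ?_
    have h1 := hs.deriv (g' := fun u => logB D.M (s (atInf u)) - A.nabla s (atInf u)) (by
      filter_upwards [hs.vAn, self_mem_nhdsWithin] with u hu (hu0 : u ≠ 0) ℓ
      have h3 : VAn (fun z : ℂ => (s z : D.V)) u⁻¹ := fun ℓ => by
        have h4 : An (fun z : ℂ => ℓ (s (atInf z⁻¹))) u⁻¹ :=
          AnalyticAt.fun_comp (g := fun t : ℂ => ℓ (s (atInf t))) (by
            rw [inv_inv]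
            exact hu ℓ) (analyticAt_id.inv (inv_ne_zero hu0))
        refine h4.congr ?_
        filter_upwards [compl_singleton_mem_nhds (inv_ne_zero hu0)] with z hz
        rw [atInf_of_ne (inv_ne_zero hz), inv_inv]
      have h5 : HasDerivAt (fun t : ℂ => ℓ (s (atInf t))) _ u :=
        (HasDerivAt.comp u (h₂ := fun z : ℂ => ℓ (s z)) (h3 ℓ).differentiableAt.hasDerivAt
          (hasDerivAt_inv hu0)).congr_of_eventuallyEq (by
            filter_upwards [compl_singleton_mem_nhds hu0] with t ht
            rw [atInf_of_ne ht]
            rfl)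
      rw [map_sub, h5.deriv, atInf_of_ne hu0, A.apply_nabla h3]
      field_simp
      ring)
    have h2 := (h1.map (Ψ := fun n => D.Fb (-n)) (-LinearMap.id) 1
      fun n x hx => neg_mem (D.Fb_fil.1.1 (by omega) hx)).add
        (hs.map (Ψ := fun n => D.Fb (-n)) (logB D.M) 1 fun n x hx => by
          rw [show -(n + 1) = -n - 1 by ring]
          exact logB_mem D.M_bij D.Fb_fil hx)
    refine h2.congr (.of_forall fun u => ?_)
    rw [LinearMap.neg_apply, LinearMap.id_apply, ← smul_add, neg_sub, sub_add_cancel, zpow_one,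
      zc_atInf, inv_inv]

end AdaptedFrame

/-! ### The pairing and the twistor of an adapted frame -/

lemma zc_sig (z : ℂ) : zc (sig z) = (-Cj z)⁻¹ := zc_atInf _

lemma sig_zero : sig 𝟘 = ∞ := by
  change atInf (-Cj 0) = _
  rw [map_zero, neg_zero, atInf_zero]

lemma sig_infty : sig ∞ = 𝟘 := rfl

lemma sig_coe {z : ℂ} (hz : z ≠ 0) : sig z = (((-Cj z)⁻¹ : ℂ) : P1) :=
  atInf_of_ne (by simpa using hz)

lemma sig_sig x : sig (sig x) = x := by
  rcases cases_P1 x with rfl | rfl | hx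
  · rw [sig_zero, sig_infty]
  · rw [sig_infty, sig_zero]
  · obtain ⟨z, rfl⟩ := ne_infty_iff_exists.1 hx.1
    have hz := mem_Cstar_coe.1 hx
    rw [sig_coe hz, sig_coe (inv_ne_zero (by simpa using hz))]; simp

lemma analyticAt_conj {f : ℂ → ℂ} {z : ℂ} (hf : An f (Cj z)) :
    An (fun u => Cj (f (Cj u))) z := by
  rw [Complex.analyticAt_iff_eventually_differentiableAt] at hf ⊢
  have h1 := (Complex.continuous_conj.tendsto z).eventually hf
  filter_upwards [h1] with u hu
  have := hu.conj_conj
  rwa [conj_conj] at this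

/-- The conjugate of the pull back of a holomorphic function by the antiholomorphic map `σ` is
holomorphic. -/
lemma HolFun.conj_sig {f : P1 → ℂ} {x : P1} (hf : HolFun f (sig x)) :
    HolFun (fun y => Cj (f (sig y))) x := by
  have hneg : ∀ z : ℂ, An (fun u : ℂ => -u) z := fun z => analyticAt_id.neg
  rcases cases_P1 x with rfl | rfl | hx
  · rw [sig_zero, holFun_infty_iff] at hf
    rw [holFun_coe_iff]
    have h1 : An (fun u : ℂ => f (atInf (-u))) 0 :=
      AnalyticAt.fun_comp (g := fun u => f (atInf u)) (by simpa using hf) (hneg 0)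
    exact analyticAt_conj (f := fun u : ℂ => f (atInf (-u))) (by simpa using h1)
  · rw [sig_infty, holFun_coe_iff] at hf
    rw [holFun_infty_iff]
    have h1 : An (fun u : ℂ => f ((-u : ℂ) : P1)) 0 :=
      AnalyticAt.fun_comp (g := fun u : ℂ => f u) (by simpa using hf) (hneg 0)
    refine (analyticAt_conj (f := fun u : ℂ => f ((-u : ℂ) : P1)) (by simpa using h1)).congr
      (.of_forall fun u => ?_)
    by_cases hu : u = 0
    · subst hu; simp [atInf_zero, sig_infty]
    · simp [atInf_of_ne hu, sig_coe (inv_ne_zero hu)]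
  · obtain ⟨z, rfl⟩ := ne_infty_iff_exists.1 hx.1
    have hz := mem_Cstar_coe.1 hx
    rw [sig_coe hz, holFun_coe_iff] at hf
    rw [holFun_coe_iff]
    have hz' : (Cj z) ≠ 0 := by simpa using hz
    have h1 : An (fun u : ℂ => f (((-u)⁻¹ : ℂ) : P1)) (Cj z) :=
      AnalyticAt.fun_comp (g := fun u : ℂ => f u) hf ((hneg _).inv (neg_ne_zero.2 hz'))
    refine (analyticAt_conj (f := fun u : ℂ => f (((-u)⁻¹ : ℂ) : P1)) h1).congr ?_
    filter_upwards [compl_singleton_mem_nhds hz] with u hu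
    rw [sig_coe hu]

section Sesq

variable {V : Type u} [AddCommGroup V] [Module ℂ V] {r : ℕ}

/-- The sesquilinear form with the matrix `G` with respect to the bases `b` and `b'`. -/
def sesq (b b' : Basis (Fin r) ℂ V) (G : Matrix (Fin r) (Fin r) ℂ) : V →ₗ[ℂ] V →ₛₗ[Cj] ℂ :=
  LinearMap.mk₂'ₛₗ (RingHom.id ℂ) (Cj) (fun x y => ∑ i, ∑ j, b.repr x i * Cj (b'.repr y j) * G i j)
    (by intros; simp [add_mul, sum_add_distrib])
    (by intros; simp [mul_sum, mul_assoc])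
    (by intros; simp [add_mul, mul_add, sum_add_distrib])
    (by
      intros
      simp only [map_smul, Finsupp.smul_apply, smul_eq_mul, map_mul, mul_sum]
      refine sum_congr rfl fun i _ => sum_congr rfl fun j _ => ?_
      ring)

variable (b b' : Basis (Fin r) ℂ V) (G : Matrix (Fin r) (Fin r) ℂ)

lemma sesq_apply (x y : V) : sesq b b' G x y =
    ∑ i, ∑ j, b.repr x i * Cj (b'.repr y j) * G i j := rfl

lemma sesq_conj (x y : V) : Cj (sesq b b' G x y) = sesq b' b G.conjTranspose y x := by
  rw [sesq_apply, sesq_apply, Finset.sum_comm, map_sum]; simp [mul_comm (Cj _)]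

lemma sesq_basis_right (x : V) (j : Fin r) : sesq b b' G x (b' j) = ∑ i, b.repr x i * G i j := by
  rw [sesq_apply]
  refine sum_congr rfl fun i _ => ?_
  rw [sum_eq_single j]
  · simp
  · intro k _ hk
    simp [hk.symm]
  · simp

lemma sesq_basis (i j : Fin r) : sesq b b' G (b i) (b' j) = G i j := by
  rw [sesq_basis_right, sum_eq_single i]
  · simp
  · intro k _ hk
    simp [hk.symm]
  · simp

lemma eq_sesq {h : V →ₗ[ℂ] V →ₛₗ[Cj] ℂ} (H : ∀ i j, h (b i) (b' j) = G i j) : h = sesq b b' G :=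
  b.ext fun i => b'.ext fun j => (H i j).trans (sesq_basis b b' G i j).symm

variable {b b' G}

lemma sesq_nondeg_left (hG : G.det ≠ 0) {x : V} (hx : ∀ y, sesq b b' G x y = 0) : x = 0 := by
  have h1 : (fun i => b.repr x i) = 0 := by
    exact Matrix.eq_zero_of_vecMul_eq_zero hG
      (funext fun j => (sesq_basis_right b b' G x j).symm.trans (hx (b' j)))
  apply b.repr.injective
  ext i
  simpa using congrFun h1 i

lemma sesq_nondeg_right (hG : G.det ≠ 0) {y : V} (hy : ∀ x, sesq b b' G x y = 0) : y = 0 := by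
  refine sesq_nondeg_left (b := b') (b' := b) (G := G.conjTranspose) ?_ fun x => ?_
  · rw [Matrix.det_conjTranspose]; simpa using hG
  · rw [← sesq_conj, hy, map_zero]

end Sesq

namespace AdaptedFrame

variable {w : ℤ} {D : HodgeTuple.{u} w} {W : Fil(D.V)} (A : AdaptedFrame D W)

/-- The matrix of the pairing at `z ∈ ℂ` with respect to the frames `e₀` at `z` and `e₁` at
`σ(z)`. -/
def gram (z : ℂ) : Matrix (Fin (finrank ℂ D.V)) (Fin (finrank ℂ D.V)) ℂ := fun i j =>
  (-1) ^ (A.κ j + A.n j) * z ^ (A.n i - (A.κ j + A.n j)).toNat * D.hForm (A.b₀ i) (A.b₁ j)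

lemma hForm_eq_zero_of_lt {i j : Fin (finrank ℂ D.V)} (h : A.n i < A.κ j + A.n j) :
    D.hForm (A.b₀ i) (A.b₁ j) = 0 :=
  A.isData.hForm_eq_zero (by omega) (A.mem₀ i).1 (A.mem₁ j).1

lemma det_hForm_ne_zero : Matrix.det (Matrix.of fun i j => D.hForm (A.b₀ i) (A.b₁ j)) ≠ 0 := fun h0 => by
  obtain ⟨v, hv, hv0⟩ := Matrix.exists_vecMul_eq_zero_iff.2 h0
  apply hv
  have h1 : ∑ i, v i • A.b₀ i = 0 := by
    refine D.hForm_nondeg_left fun b => ?_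
    have h2 : D.hForm (∑ i, v i • A.b₀ i) = 0 := by
      refine A.b₁.ext fun j => ?_
      have := congrFun hv0 j
      rw [map_sum]
      simpa [Matrix.vecMul, dotProduct] using this
    rw [h2]; rfl
  exact funext fun i => Fintype.linearIndependent_iff.1 A.b₀.linearIndependent v h1 i

/-- In the Leibniz expansion of the determinant of `gram z`, a permutation `s` contributes only if
`n (s i) ≥ κ i + n i` for all `i`, and only if `κ (s i) + κ i ≥ 0`. The sums over `i` of these
inequalities force equality, so that the powers of `z` vanish. -/
lemma det_gram_zero_ne_zero : (A.gram 0).det ≠ 0 := by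
  have key : (A.gram 0).det = (∏ j, (-1 : ℂ) ^ (A.κ j + A.n j)) *
      Matrix.det (Matrix.of fun i j => D.hForm (A.b₀ i) (A.b₁ j)) := by
    rw [Matrix.det_apply', Matrix.det_apply', mul_sum]
    refine sum_congr rfl fun s _ => ?_
    rw [mul_left_comm, ← Finset.prod_mul_distrib]
    congr 1
    by_cases h : ∃ i, D.hForm (A.b₀ (s i)) (A.b₁ i) = 0
    · obtain ⟨i, hi⟩ := h
      simp [Finset.prod_eq_zero (mem_univ i), hi, gram]
    · push Not at h
      have h1 : ∀ i, A.κ i + A.n i ≤ A.n (s i) := fun i => by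
        by_contra h2
        exact h i (A.hForm_eq_zero_of_lt (by omega))
      have h2 : ∀ i, 0 ≤ A.κ (s i) + A.κ i := fun i => by
        by_contra h2
        exact h i (D.hForm_weight A.isData.weight (by omega) (A.mem₀ _).2 (A.mem₁ _).2)
      have h3 : 0 ≤ ∑ i, (A.κ (s i) + A.κ i) := Finset.sum_nonneg fun i _ => h2 i
      rw [sum_add_distrib, Equiv.sum_comp s] at h3
      have h4 : ∑ i, (A.κ i + A.n i) = ∑ i, A.n (s i) := by
        refine le_antisymm (Finset.sum_le_sum fun i _ => h1 i) ?_
        rw [sum_add_distrib, Equiv.sum_comp s]; omega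
      have h5 := (Finset.sum_eq_sum_iff_of_le fun i _ => h1 i).1 h4
      refine Finset.prod_congr rfl fun i hi => ?_
      simp only [Matrix.of_apply, gram]
      rw [← h5 i hi, sub_self, Int.toNat_zero, pow_zero, mul_one]
  rw [key]
  refine mul_ne_zero (Finset.prod_ne_zero_iff.2 fun j _ => zpow_ne_zero _ (by norm_num))
    A.det_hForm_ne_zero

open scoped Classical in
/-- The pairing: on `ℂ` it has the matrix `gram` with respect to the frames `e₀` and `e₁`, and it
is continued to `∞` by hermitian symmetry. -/
def Shat (y : P1) : D.V →ₗ[ℂ] D.V →ₛₗ[Cj] ℂ :=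
  if y = ∞ then sesq A.b₁ A.b₀ (A.gram 0).conjTranspose
  else sesq (A.e₀ y) (A.e₁ (sig y)) (A.gram (zc y))

lemma Shat_of_mem {y : P1} (hy : y ∈ Cstar) : A.Shat y = D.hForm := by
  rw [Shat, if_neg hy.1]
  refine (eq_sesq _ _ _ fun i j => ?_).symm
  obtain ⟨z, rfl⟩ := ne_infty_iff_exists.1 hy.1
  have hz := mem_Cstar_coe.1 hy
  rw [zBasis_apply, zBasis_apply, zunit_of_mem hy, zunit_of_mem (Twistor.sig_mem_Cstar hy), zc_sig,
    zc_coe, gram, LinearMap.map_smulₛₗ, LinearMap.map_smul, LinearMap.smul_apply, smul_eq_mul, smul_eq_mul,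
    map_zpow₀, map_inv₀, map_neg, conj_conj, inv_zpow', ← neg_one_mul z, mul_zpow,
    neg_one_zpow_neg, ← mul_assoc,
    mul_assoc ((-1 : ℂ) ^ _), ← zpow_add₀ hz, neg_add_eq_sub]
  by_cases h : A.n i < A.κ j + A.n j
  · simp [A.hForm_eq_zero_of_lt h]
  · rw [← zpow_natCast, Int.toNat_of_nonneg (by omega)]

lemma Shat_zero : A.Shat 𝟘 = sesq A.b₀ A.b₁ (A.gram 0) := by
  rw [Shat, if_neg (coe_ne_infty 0), sig_zero, e₀, e₁, zBasis_of_eq_one _ _ zunit_zero,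
    zBasis_of_eq_one _ _ zunit_infty, zc_coe]

lemma Shat_infty : A.Shat ∞ = sesq A.b₁ A.b₀ (A.gram 0).conjTranspose := if_pos rfl

lemma Shat_symm x (a b : D.V) : A.Shat x a b = Cj (A.Shat (sig x) b a) := by
  rcases cases_P1 x with rfl | rfl | hx
  · rw [sig_zero, Shat_zero, Shat_infty, sesq_conj, Matrix.conjTranspose_conjTranspose]
  · rw [sig_infty, Shat_zero, Shat_infty, sesq_conj]
  · rw [A.Shat_of_mem hx, A.Shat_of_mem (Twistor.sig_mem_Cstar hx), D.hForm_conj_symm]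

lemma Shat_nondeg_left x {a : D.V} (h : ∀ b, A.Shat x a b = 0) : a = 0 := by
  rcases cases_P1 x with rfl | rfl | hx
  · rw [Shat_zero] at h; exact sesq_nondeg_left A.det_gram_zero_ne_zero h
  · refine sesq_nondeg_right A.det_gram_zero_ne_zero (b := A.b₀) (b' := A.b₁) fun b => ?_
    have := h b
    rw [A.Shat_symm, sig_infty, Shat_zero] at this; simpa using this
  · rw [A.Shat_of_mem hx] at h; exact D.hForm_nondeg_left h

lemma Shat_hol_aux {a b : P1 → D.V} {x : P1} (hx : x ≠ ∞) (ha : A.E.HolAt a x)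
    (hb : A.E.HolAt b (sig x)) : HolFun (fun y => A.Shat y (a y) (b (sig y))) x := by
  have hx' : sig x ≠ 𝟘 := fun h => hx (by rw [← sig_sig x, h, sig_zero])
  have h1 := (A.frame₀ a x hx).1 ha
  have h2 := fun j => HolFun.conj_sig ((A.frame₁ b _ hx').1 hb j)
  have h3 : ∀ i j, HolFun (fun y => A.gram (zc y) i j) x := fun i j => by
    obtain ⟨z, rfl⟩ := ne_infty_iff_exists.1 hx
    rw [holFun_coe_iff]
    exact (analyticAt_const.mul (analyticAt_id.pow _)).mul analyticAt_const
  refine (HolFun.sum (s := univ) fun i _ => HolFun.sum (s := univ) fun j _ =>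
    ((h1 i).mul (h2 j)).mul (h3 i j)).congr ?_
  filter_upwards [compl_singleton_mem_nhds hx] with y hy
  rw [Shat, if_neg (by simpa using hy)]; rfl

lemma Shat_hol {a b : P1 → D.V} {x : P1} (ha : A.E.HolAt a x) (hb : A.E.HolAt b (sig x)) :
    HolFun (fun y => A.Shat y (a y) (b (sig y))) x := by
  by_cases hx : x = ∞
  · subst hx
    have h1 := A.Shat_hol_aux (a := b) (b := a) (x := 𝟘) (coe_ne_infty 0) hb
      (by rwa [sig_zero])
    refine (HolFun.conj_sig (x := ∞) h1).congr (.of_forall fun y => ?_)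
    rw [A.Shat_symm y, sig_sig]
  · exact A.Shat_hol_aux hx ha hb

end AdaptedFrame

namespace HodgeTuple

variable {w : ℤ} (D : HodgeTuple.{u} w)

lemma conj_expB_int (n : ℤ) (v : D.V) : D.conj (expB D.M n v) = expB D.M n (D.conj v) := by
  refine strip_ind D.M_bij (by simp +contextual) (fun α hα x hx => ?_) v
  rw [conj_expB D.M_bij D.conj_conj D.M_real _ hα hx, map_intCast]
  have h1 := Complex.exp_int_mul_two_pi_mul_I (-(stripN α * n))
  push_cast at h1
  rw [show (-(ϖ * stripN α * n) : ℂ) = -(stripN α * n) * ϖ by ring, h1, one_smul]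

/-- The complex conjugation of the flat real structure in the trivialization in which the flat
sections are `e^{-2πiBζ}A`. -/
def conjAt (x : P1) : D.V →ₛₗ[Cj] D.V :=
  (expB D.M (-(log (zc x) / ϖ))).comp (D.conj.comp (expB D.M (log (zc x) / ϖ)))

lemma conjAt_expP (ζ : ℂ) (v : D.V) :
    D.conjAt (expP ζ) (expB D.M (-ζ) v) = expB D.M (-ζ) (D.conj v) := by
  have h1 : ∃ n : ℤ, log (zc (expP ζ)) / ϖ = ζ + n := by
    refine expP_eq_iff.1 ?_
    rw [expP, mul_div_cancel₀ _ two_pi_I_ne, zc_expP, Complex.exp_log (ez_ne_zero ζ)]; rfl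
  obtain ⟨n, hn⟩ := h1
  rw [conjAt, hn]
  change expB D.M (-(ζ + n)) (D.conj (expB D.M (ζ + n) (expB D.M (-ζ) v))) = _
  rw [← expB_add_apply D.M_bij, show ζ + n + -ζ = ((n : ℤ) : ℂ) by ring, conj_expB_int,
    ← expB_add_apply D.M_bij]
  congr 2
  ring

end HodgeTuple

namespace AdaptedFrame

variable {w : ℤ} {D : HodgeTuple.{u} w} {W : Fil(D.V)} (A : AdaptedFrame D W)

/-- The twistor of a tuple. -/
def twistor : Twistor.{u} where
  E := A.E
  rank := finrank ℂ D.V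
  bundle := twoFrame_bundle
  nabla := A.nabla
  conn := A.isMerConnection
  conj := D.conjAt
  conj_conj x hx v := by
    obtain ⟨ζ, rfl⟩ := exists_expP hx
    have h1 : v = expB D.M (-ζ) (expB D.M ζ v) := (expB_neg_apply D.M_bij ζ v).symm
    have h2 : D.conjAt (expP ζ) (D.conjAt (expP ζ) v) = v := by
      rw [h1, D.conjAt_expP, D.conjAt_expP, D.conj_conj]
    exact h2
  conj_flat s x hx hs := by
    obtain ⟨ζ, rfl⟩ := exists_expP hx
    obtain ⟨v, hv⟩ := (A.isTriv.flatAt_iff D.M_bij).1 hs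
    refine (A.isTriv.flatAt_iff D.M_bij).2 ⟨D.conj v, ?_⟩
    filter_upwards [hv] with ξ hξ
    rw [← D.conjAt_expP, ← hξ]; rfl
  What k _ := W k
  Nhat _ := D.N
  Shat := A.Shat
  Shat_hol _ _ _ ha hb := A.Shat_hol ha hb
  Shat_nondeg_left x _ h := A.Shat_nondeg_left x h
  Shat_nondeg_right x b h := by
    refine A.Shat_nondeg_left (sig x) fun a => ?_
    have h1 := h a
    rw [A.Shat_symm] at h1; simpa using h1
  Shat_symm a b x := by
    rw [sig_sig]; exact A.Shat_symm x _ _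
  Shat_flat a b x hx ha hb := by
    obtain ⟨ζ, rfl⟩ := exists_expP hx
    rw [sig_expP] at hb
    obtain ⟨u, hu⟩ := (A.isTriv.flatAt_iff D.M_bij).1 ha
    obtain ⟨v, hv⟩ := (A.isTriv.flatAt_iff D.M_bij).1 hb
    have hc : Tendsto (fun ξ : ℂ => Cj ξ + 1 / 2) (𝓝 ζ) (𝓝 (Cj ζ + 1 / 2)) :=
      (Complex.continuous_conj.add continuous_const).tendsto ζ
    have h1 : ∀ᶠ ξ in 𝓝 ζ, A.Shat (expP ξ) (a (expP ξ)) (b (sig (expP ξ))) =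
        D.hForm u (expB D.M (-1 / 2) v) := by
      filter_upwards [hu, hc.eventually hv] with ξ h1 h2
      rw [A.Shat_of_mem (expP_mem ξ), sig_expP, ← D.hForm_expB_expB ξ u v, ← h1, ← h2]; rfl
    rw [eventually_nhds_expP]
    filter_upwards [h1] with ξ h2
    rw [h2, h1.self_of_nhds]

lemma isModel : IsModel D W A.twistor fun _ => LinearEquiv.refl ℂ D.V where
  weight := A.isData.weight
  triv := A.isTriv
  ext_zero _ := A.extHolAt_zero
  ext_infty _ := A.extHolAt_infty
  conj ζ v := D.conjAt_expP ζ v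
  What _ _ _ _ := Iff.rfl
  Nhat _ _ _ := rfl
  Shat _ hx a b := by
    exact congrArg (fun f : D.V →ₗ[ℂ] D.V →ₛₗ[Cj] ℂ => f a b) (A.Shat_of_mem hx)

end AdaptedFrame

/-! ### The weight filtration of the constructed twistor -/

section Gr

variable {E : HolFam.{u}} {W : ℤ → ∀ x, Submodule ℂ (E.Fib x)} {r : ℕ} {U : Set P1}
  {e : ∀ y, Basis (Fin r) ℂ (E.Fib y)} {κ : Fin r → ℤ}

lemma HolFam.gr_holAt_iff (he : E.IsFrameOn U e)
    (hW : ∀ k y v, v ∈ W k y ↔ ∀ j, (e y).repr v j ≠ 0 → κ j ≤ k) {k : ℤ} {x : P1} (hx : x ∈ U)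
    (o : ∀ y, W k y) : (E.Gr W k).HolAt (fun y => qmk (o y)) x ↔
      ∀ j, κ j = k → HolFun (fun y => (e y).repr (o y) j) x := by
  constructor
  · rintro ⟨t, ht, hts⟩ j hj
    refine ((he _ x hx).1 ht j).congr (hts.mono fun y hy => ?_)
    have h1 := (hW _ _ _).1 (Submodule.mem_comap.1 ((Submodule.Quotient.eq _).1 hy)) j
    rw [map_sub, map_sub, Finsupp.sub_apply, sub_ne_zero] at h1
    by_contra h2
    have := h1 h2
    omega
  · intro h
    let c : P1 → Fin r → ℂ := fun y j => if κ j = k then (e y).repr (o y) j else 0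
    have hr : ∀ y j, (e y).repr (∑ i, c y i • e y i) j = c y j := fun y j => by
      simp [Finsupp.single_apply]
    refine ⟨fun y => ⟨∑ i, c y i • e y i, (hW _ _ _).2 fun j hj => ?_⟩,
      (he _ x hx).2 fun j => ?_, .of_forall fun y => ?_⟩
    · rw [hr] at hj
      by_contra h1
      exact hj (if_neg (by omega))
    · simp only [hr, c]
      by_cases hj : κ j = k
      · simpa only [if_pos hj] using h j hj
      · simpa only [if_neg hj] using HolFam.holFun_const 0 x
    · refine (Submodule.Quotient.eq _).2 (Submodule.mem_comap.2 ((hW _ _ _).2 fun j hj => ?_))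
      rw [map_sub, map_sub, Finsupp.sub_apply] at hj
      change (e y).repr (∑ i, c y i • e y i) j - _ ≠ 0 at hj
      rw [hr] at hj
      by_cases hjk : κ j = k
      · exact absurd (by simp only [c, if_pos hjk]; exact sub_self _) hj
      · simp only [c, if_neg hjk, zero_sub, neg_ne_zero] at hj
        have := (hW k y _).1 (o y).2 j hj
        omega

end Gr

lemma zBasis_repr_ne_zero {V : Type u} [AddCommGroup V] [Module ℂ V] {r : ℕ}
    {b : Basis (Fin r) ℂ V} {n : Fin r → ℤ} {y : P1} {v : V} {j : Fin r} :
    (zBasis b n y).repr v j ≠ 0 ↔ b.repr v j ≠ 0 := by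
  rw [zBasis_repr, mul_ne_zero_iff, and_iff_right (zpow_ne_zero _ (zunit y).ne_zero)]

lemma zBasis_mem_iff {V : Type u} [AddCommGroup V] [Module ℂ V] {r : ℕ}
    {b : Basis (Fin r) ℂ V} {n : Fin r → ℤ} {W : Fil(V)} {κ : Fin r → ℤ}
    (hW : Monotone W) (hb : ∀ j, b j ∈ W (κ j)) (hr : ∀ k, ∀ v ∈ W k, ∀ j, b.repr v j ≠ 0 → κ j ≤ k)
    {k : ℤ} {y : P1} {v : V} : v ∈ W k ↔ ∀ j, (zBasis b n y).repr v j ≠ 0 → κ j ≤ k := by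
  simp only [zBasis_repr_ne_zero]
  refine ⟨hr k v, fun h => ?_⟩
  rw [← b.sum_repr v]
  refine sum_mem fun j _ => ?_
  by_cases hj : b.repr v j = 0
  · simp [hj]
  · exact (W k).smul_mem _ (hW (h j hj) (hb j))

lemma eq_const_of_tendsto_inv {f g : ℂ → ℂ} (hf : Differentiable ℂ f) (hg : ContinuousAt g 0)
    (h : ∀ᶠ u in 𝓝[≠] 0, f u⁻¹ = g u) (z : ℂ) : f z = f 0 := by
  have h1 : Tendsto (fun u : ℂ => f u⁻¹) (𝓝[≠] 0) (𝓝 (g 0)) :=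
    (hg.tendsto.mono_left nhdsWithin_le_nhds).congr' (h.mono fun u hu => hu.symm)
  have h2 : Tendsto f (cocompact ℂ) (𝓝 (g 0)) := by
    rw [← Metric.cobounded_eq_cocompact]
    exact (h1.comp (tendsto_inv₀_cobounded' (α := ℂ))).congr fun u => by simp
  rw [hf.eq_const_of_tendsto_cocompact h2]; rfl

/-- The coefficients of a Laurent polynomial with values in a subspace are in this subspace. -/
lemma mem_of_sum_zpow_mem {V : Type u} [AddCommGroup V] [Module ℂ V] {U : Submodule ℂ V}
    {S : Finset ℤ} {v : ℤ → V} (h : ∀ z : ℂ, z ≠ 0 → ∑ n ∈ S, z ^ n • v n ∈ U) {n : ℤ}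
    (hn : n ∈ S) : v n ∈ U := by
  by_contra hv
  obtain ⟨ℓ, hℓ, hU⟩ := U.exists_le_ker_of_notMem hv
  let f : ℤ → ℂˣ →* ℂ := fun n => (Units.coeHom ℂ).comp (zpowGroupHom n)
  have hf : Injective f := fun m n hmn => by
    have h2 : (2 : ℝ) ^ m = 2 ^ n := by
      have := DFunLike.congr_fun hmn (Units.mk0 (2 : ℂ) two_ne_zero)
      simp only [f, MonoidHom.comp_apply, zpowGroupHom_apply, Units.coeHom_apply,
        Units.val_zpow_eq_zpow_val, Units.val_mk0] at this
      simpa using congrArg norm this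
    exact zpow_right_injective₀ two_pos (by norm_num) h2
  refine hℓ (linearIndependent_iff'.1 ((linearIndependent_monoidHom ℂˣ ℂ).comp f hf) S
    (fun n => ℓ (v n)) (funext fun z => ?_) n hn)
  have h1 := hU (h z z.ne_zero)
  rw [LinearMap.mem_ker, map_sum] at h1
  rw [Finset.sum_apply, Pi.zero_apply, ← h1]; simp [mul_comm, f]

namespace AdaptedFrame

variable {w : ℤ} {D : HodgeTuple.{u} w} {W : Fil(D.V)} (A : AdaptedFrame D W)

lemma mem_iff₀ (k : ℤ) y (v : D.V) : v ∈ W k ↔ ∀ j, (A.e₀ y).repr v j ≠ 0 → A.κ j ≤ k := by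
  obtain ⟨p, hp⟩ := D.F_fil.1.2.1
  exact zBasis_mem_iff A.isData.weight.mono (fun j => (A.mem₀ j).2)
    fun k v hv j hj => (A.repr₀ k p v ⟨by rw [hp]; trivial, hv⟩ j hj).1

lemma mem_iff₁ (k : ℤ) y (v : D.V) : v ∈ W k ↔ ∀ j, (A.e₁ y).repr v j ≠ 0 → A.κ j ≤ k := by
  obtain ⟨p, hp⟩ := D.Fb_fil.1.2.1
  exact zBasis_mem_iff A.isData.weight.mono (fun j => (A.mem₁ j).2)
    fun k v hv j hj => (A.repr₁ k p v ⟨by rw [hp]; trivial, hv⟩ j hj).1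

/-- The two bases induce the same basis of `Gr_k`. -/
lemma repr_eq {k : ℤ} {v : D.V} (hv : v ∈ W k) {j : Fin (finrank ℂ D.V)}
    (hj : A.κ j = k) : A.b₁.repr v j = A.b₀.repr v j := by
  have h1 : v - ∑ i, A.b₀.repr v i • A.b₁ i ∈ W (k - 1) := by
    rw [show v - ∑ i, A.b₀.repr v i • A.b₁ i = ∑ i, A.b₀.repr v i • (A.b₀ i - A.b₁ i) by
      simp only [smul_sub, sum_sub_distrib, A.b₀.sum_repr]]
    refine sum_mem fun i _ => ?_
    by_cases hi : A.b₀.repr v i = 0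
    · simp [hi]
    · have := (A.mem_iff₀ k 𝟘 v).1 hv i (zBasis_repr_ne_zero.2 hi)
      exact (W _).smul_mem _ (A.isData.weight.mono (by omega) (A.sub_mem i))
  by_contra h2
  have h3 := (A.mem_iff₁ _ 𝟘 _).1 h1 j (zBasis_repr_ne_zero.2 (by
    simpa [Finsupp.single_apply, sub_eq_zero] using h2))
  omega

lemma coord_infty {k : ℤ} {v : D.V} (hv : v ∈ W k) {j : Fin (finrank ℂ D.V)}
    (hj : A.κ j = k) {u : ℂ} (hu : u ≠ 0) :
    (A.e₁ (atInf u)).repr v j = u ^ k * (A.e₀ (atInf u)).repr v j := by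
  rw [zBasis_repr, zBasis_repr, A.repr_eq hv hj, zunit_of_mem (atInf_mem_Cstar hu), zc_atInf,
    inv_zpow', inv_zpow', neg_neg, neg_neg, zpow_add₀ hu, hj, mul_assoc]

lemma isSubbundle (k : ℤ) : A.E.IsSubbundle fun _ => W k := by
  have key : ∀ b : Basis (Fin (finrank ℂ D.V)) ℂ D.V,
      (∀ v, v ∈ W k ↔ ∀ j, b.repr v j ≠ 0 → A.κ j ≤ k) →
      W k = span ℂ (b '' {j | A.κ j ≤ k}) := fun b hb => by
    ext v
    rw [hb, Basis.mem_span_image]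
    exact ⟨fun h j hj => h j (Finsupp.mem_support_iff.1 hj),
      fun h j hj => h (Finsupp.mem_support_iff.2 hj)⟩
  intro x
  by_cases hx : x = ∞
  · refine ⟨_, isOpen_compl_singleton, ?_, _, A.e₁, _, A.frame₁, fun y _ => key _ (A.mem_iff₁ k y)⟩
    rw [hx]; exact (coe_ne_infty 0).symm
  · exact ⟨_, isOpen_compl_singleton, hx, _, A.e₀, _, A.frame₀, fun y _ => key _ (A.mem_iff₀ k y)⟩

lemma isPure (k : ℤ) : (A.E.Gr (fun k _ => W k) k).IsPure k := by
  classical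
  let idx := (Fintype.equivFin {j // A.κ j = k}).symm
  let ε : P1 → Basis (Fin (finrank ℂ D.V)) ℂ D.V := fun y => if y = ∞ then A.e₁ y else A.e₀ y
  have hε : ∀ k y v, v ∈ W k ↔ ∀ j, (ε y).repr v j ≠ 0 → A.κ j ≤ k := fun k y v => by
    by_cases hy : y = ∞
    · simpa only [ε, if_pos hy] using A.mem_iff₁ k y v
    · simpa only [ε, if_neg hy] using A.mem_iff₀ k y v
  let f : P1 → W k →ₗ[ℂ] (Fin (Fintype.card {j // A.κ j = k}) → ℂ) := fun y =>
    LinearMap.pi fun i => ((ε y).coord (idx i)).comp (W k).subtype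
  have hker : ∀ y, (W (k - 1)).comap (W k).subtype = LinearMap.ker (f y) := fun y => by
    ext v
    rw [Submodule.mem_comap, LinearMap.mem_ker, hε (k - 1) y]
    constructor
    · intro h
      refine funext fun i => ?_
      by_contra h1
      have := h _ h1
      have := (idx i).2
      omega
    · intro h j hj
      have h1 := (hε k y v).1 v.2 j hj
      by_contra h2
      have h3 := congrFun h (idx.symm ⟨j, by omega⟩)
      simp only [f, LinearMap.pi_apply, Equiv.apply_symm_apply] at h3; exact hj h3
  have hsurj : ∀ y, LinearMap.range (f y) = ⊤ := fun y => by
    refine LinearMap.range_eq_top.2 fun c => ⟨⟨∑ i, c i • ε y (idx i), ?_⟩, funext fun i => ?_⟩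
    · refine sum_mem fun i _ => (W k).smul_mem _ ((hε k y _).2 fun j hj => ?_)
      rw [Basis.repr_self, Finsupp.single_apply] at hj
      have h1 : ((idx i : _) : Fin _) = j := by
        by_contra h
        exact hj (if_neg h)
      exact (h1 ▸ (idx i).2).le
    · change (ε y).repr (∑ i, c i • ε y (idx i)) (idx i) = c i
      simp [Finsupp.single_apply, Subtype.coe_inj]
  let Φ : ∀ y, (W k ⧸ (W (k - 1)).comap (W k).subtype) ≃ₗ[ℂ]
      (Fin (Fintype.card {j // A.κ j = k}) → ℂ) := fun y =>
    (Submodule.quotEquivOfEq _ _ (hker y)).trans ((f y).quotKerEquivOfSurjective (LinearMap.range_eq_top.1 (hsurj y)))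
  refine ⟨_, ⟨⟨Φ, fun s x => ?_⟩⟩⟩
  choose o ho using fun y => Submodule.Quotient.mk_surjective _ (s y)
  obtain rfl : (fun y => qmk (o y)) = s := funext ho
  have hidx : ∀ P : Fin (finrank ℂ D.V) → Prop, (∀ i, P (idx i)) ↔ ∀ j, A.κ j = k → P j :=
    fun P => ⟨fun h j hj => by simpa using h (idx.symm ⟨j, hj⟩), fun h i => h _ (idx i).2⟩
  have h1 : ∀ y i, Φ y (qmk (o y)) i = (ε y).repr (o y) (idx i) := fun _ _ => rfl
  by_cases hx : x = ∞
  · subst hx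
    refine Iff.trans ?_ (HolFam.gr_holAt_iff A.frame₁ A.mem_iff₁ (coe_ne_infty 0).symm o).symm
    rw [← hidx]
    have h2 : ∀ i, (fun u : ℂ => if u = 0 then Φ ∞ (qmk (o ∞)) i
        else u ^ k * Φ (atInf u) (qmk (o (atInf u))) i) =
        fun u : ℂ => (A.e₁ (atInf u)).repr (o (atInf u)) (idx i) := fun i => funext fun u => by
      split_ifs with hu
      · rw [h1, hu, atInf_zero]
        simp only [ε, if_true]
      · simp [A.coord_infty (o _).2 (idx i).2 hu, h1, ε, if_neg (atInf_mem_Cstar hu).1]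
    exact ⟨fun h i => holFun_infty_iff.2 (h2 i ▸ h.2 rfl i),
      fun h => ⟨fun z hz => absurd hz.symm (coe_ne_infty z),
        fun _ i => (h2 i).symm ▸ holFun_infty_iff.1 (h i)⟩⟩
  · obtain ⟨z, rfl⟩ := ne_infty_iff_exists.1 hx
    refine Iff.trans ?_ (HolFam.gr_holAt_iff A.frame₀ A.mem_iff₀ hx o).symm
    rw [← hidx]
    have h2 : ∀ i, (fun u : ℂ => Φ u (qmk (o u)) i) =
        fun u : ℂ => (A.e₀ u).repr (o u) (idx i) := fun i => funext fun u => by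
      simp only [h1, ε, if_neg (coe_ne_infty u)]
    refine ⟨fun h i => holFun_coe_iff.2 (h2 i ▸ h.1 z rfl i), fun h => ⟨fun z' hz' i => ?_,
      fun h3 => absurd h3 hx⟩⟩
    rw [← OnePoint.coe_injective hz']; exact (h2 i).symm ▸ holFun_coe_iff.1 (h i)

/-- The coefficients with respect to `e₀` of a global section of `Gr_k ⊗ 𝒪(-k)` are entire functions
with a limit at `∞`. -/
lemma exists_const {k : ℤ} (o : P1 → W k)
    (h₀ : ∀ z : ℂ, (A.E.Gr (fun k _ => W k) k).HolAt (fun y => qmk (o y)) z)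
    (h₁ : (A.E.Gr (fun k _ => W k) k).ExtHolAt (fun y => zc y ^ k • qmk (o y))
      ∞) (j : Fin (finrank ℂ D.V)) (hj : A.κ j = k) (z : ℂ) :
    (A.e₀ z).repr (o z) j = A.b₀.repr (o 𝟘) j := by
  obtain ⟨t, ht, hts⟩ := h₁
  choose o' ho' using fun y => Submodule.Quotient.mk_surjective _ (t y)
  obtain rfl : (fun y => qmk (o' y)) = t := funext ho'
  have h2 := (HolFam.gr_holAt_iff A.frame₁ A.mem_iff₁ (coe_ne_infty 0).symm o').1 ht j hj
  have h3 := eq_const_of_tendsto_inv (f := fun z : ℂ => (A.e₀ z).repr (o z) j)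
    (fun z => (holFun_coe_iff.1 ((HolFam.gr_holAt_iff A.frame₀ A.mem_iff₀
      (coe_ne_infty z) o).1 (h₀ z) j hj)).differentiableAt)
    (holFun_infty_iff.1 h2).continuousAt (by
      filter_upwards [eventually_nhdsNE_infty.1 hts, self_mem_nhdsWithin] with u hu (hu0 : u ≠ 0)
      have h4 := Submodule.mem_comap.1 ((Submodule.Quotient.eq _).1
        (hu.trans (Submodule.Quotient.mk_smul _ _ _).symm))
      have h5 := (A.mem_iff₁ _ (atInf u) _).1 h4 j
      rw [map_sub, map_sub, Finsupp.sub_apply, sub_ne_zero] at h5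
      have h6 : (A.e₁ (atInf u)).repr (o' (atInf u)) j = (A.e₁ (atInf u)).repr
          (zc (atInf u) ^ k • (o (atInf u) : D.V)) j := by
        by_contra h6
        have := h5 h6
        omega
      rw [h6, LinearEquiv.map_smul, Finsupp.smul_apply, smul_eq_mul, A.coord_infty (o _).2 hj hu0, zc_atInf,
        ← mul_assoc, ← mul_zpow, inv_mul_cancel₀ hu0, one_zpow, one_mul, atInf_of_ne hu0]) z
  refine h3.trans ?_
  rw [e₀, zBasis_of_eq_one _ _ zunit_zero]

/-- A primitive section is `∑ z^n a_n` modulo `W_{k-1}`. The vectors `a_n` are primitive, they are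
of Hodge type with respect to `F` and `Fb`, and pairwise orthogonal, so that the pairing is a sum
of values of the polarizations. -/
lemma pos (k : ℕ) (o : P1 → W k)
    (hN : ∀ x ∈ Cstar, (D.N ^ (k + 1)) (o x : D.V) ∈ W (-(k : ℤ) - 3))
    (h₀ : ∀ z : ℂ, (A.E.Gr (fun k _ => W k) k).HolAt (fun y => qmk (o y)) z)
    (h₁ : (A.E.Gr (fun k _ => W k) k).ExtHolAt
      (fun y => zc y ^ (k : ℤ) • qmk (o y)) ∞)
    (hne : ∃ z : ℂ, (o z : D.V) ∉ W (k - 1)) {x : P1} (hx : x ∈ Cstar) :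
    ∃ r : ℝ, 0 < r ∧ I ^ (-(k : ℤ)) * D.hForm ((D.N ^ k) (o x : D.V)) (o (sig x) : D.V) = r := by
  have hW := A.isData.weight
  set c : Fin (finrank ℂ D.V) → ℂ := fun j =>
    if A.κ j = k then A.b₀.repr (o 𝟘) j else 0 with hc
  have hc' : ∀ (z : ℂ) j, A.κ j = k → (A.e₀ z).repr (o z) j = c j := fun z j hj => by
    rw [hc]
    simp only [if_pos hj]; exact A.exists_const o h₀ h₁ j hj z
  set S : Finset ℤ := univ.image A.n
  have hnS : ∀ j, A.n j ∈ S := fun j => Finset.mem_image_of_mem _ (mem_univ j)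
  let a : ℤ → D.V := fun n => ∑ j, (if A.n j = n then c j else 0) • A.b₀ j
  let a' : ℤ → D.V := fun n => ∑ j, (if A.n j = n then c j else 0) • A.b₁ j
  have hmem : ∀ (n : ℤ) (U : Submodule ℂ D.V) (f : Fin (finrank ℂ D.V) → D.V),
      (∀ j, A.n j = n → A.κ j = k → f j ∈ U) →
      ∑ j, (if A.n j = n then c j else 0) • f j ∈ U := fun n U f hf => by
    refine sum_mem fun j _ => ?_
    by_cases h1 : A.n j = n
    · by_cases h2 : A.κ j = k
      · exact U.smul_mem _ (hf j h1 h2)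
      · simp [hc, h2]
    · simp [h1]
  have ha : ∀ n, a n ∈ D.F (w - 1 - n) ⊓ W k := fun n => hmem _ _ _ fun j h1 h2 => by
    have := A.mem₀ j
    rwa [h1, h2] at this
  have ha' : ∀ n, a' n ∈ D.Fb (k + n) ⊓ W k := fun n => hmem _ _ _ fun j h1 h2 => by
    have := A.mem₁ j
    rwa [h1, h2] at this
  have haa : ∀ n, a n - a' n ∈ W (k - 1) := fun n => by
    rw [← sum_sub_distrib]
    simp only [← smul_sub]; exact hmem _ _ _ fun j _ h2 => h2 ▸ A.sub_mem j
  have hrepr : ∀ n j, A.b₀.repr (a n) j = if A.n j = n then c j else 0 := fun n j =>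
    congrFun (A.b₀.repr_sum_self _) j
  have ho : ∀ z : ℂ, z ≠ 0 → (o z : D.V) - ∑ n ∈ S, z ^ n • a n ∈ W (k - 1) := fun z hz => by
    refine (A.mem_iff₀ _ z _).2 fun j hj => ?_
    by_contra h
    have h1 := (A.mem_iff₀ k z _).1 (Submodule.sub_mem _ (o z).2 (Submodule.sum_mem _
      fun n _ => (W k).smul_mem _ (ha n).2)) j hj
    apply hj
    have h2 : A.b₀.repr (∑ n ∈ S, z ^ n • a n) j = z ^ A.n j * c j := by simp [hrepr, hnS j]
    rw [map_sub, Finsupp.sub_apply, hc' z j (by omega), zBasis_repr, h2,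
      zunit_of_mem (mem_Cstar_coe.2 hz), zc_coe, ← mul_assoc, ← zpow_add₀ hz, neg_add_cancel,
      zpow_zero, one_mul, sub_self]
  have haN : ∀ n ∈ S, (D.N ^ (k + 1)) (a n) ∈ W (-(k : ℤ) - 3) := fun n hn => by
    refine mem_of_sum_zpow_mem (S := S) (v := fun n => (D.N ^ (k + 1)) (a n)) (fun z hz => ?_) hn
    have h1 := hW.pow_mem_of_le (m := -(k : ℤ) - 3) (ho z hz) (k + 1) (by push_cast; omega)
    have h2 := Submodule.sub_mem _ (hN _ (mem_Cstar_coe.2 hz)) h1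
    rw [← map_sub, sub_sub_cancel, map_sum] at h2
    simpa only [LinearMap.map_smul] using h2
  have hcong : ∀ {p p' q q' : D.V}, p' ∈ W k → p - p' ∈ W (k - 1) → q ∈ W k →
      q - q' ∈ W (k - 1) → D.hForm ((D.N ^ k) p) q = D.hForm ((D.N ^ k) p') q' := by
    intro p p' q q' hp' hpp hq hqq
    have h1 := D.hForm_weight hW (by omega)
      (hW.pow_mem_of_le (m := -(k : ℤ) - 1) hpp k (by omega)) hq
    have h2 := D.hForm_weight hW (by omega) (hW.pow_mem_of_le (m := -(k : ℤ)) hp' k (by omega)) hqq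
    rw [map_sub, map_sub, LinearMap.sub_apply, sub_eq_zero] at h1
    rw [map_sub, sub_eq_zero] at h2; exact h1.trans h2
  have hlt : ∀ n m, n < m → D.hForm ((D.N ^ k) (a n)) (a m) = 0 := fun n m hnm => by
    rw [hcong (ha n).2 (by simp) (ha m).2 (haa m)]
    have h1 : ∀ i : ℕ, (D.N ^ i) (a n) ∈ D.F (w - 1 - n - i) := fun i => by
      induction i with
      | zero => simpa using (ha n).1
      | succ i ih =>
        rw [pow_succ', Nat.cast_succ, ← sub_sub]; exact D.F_fil.2.2 _ (mem_map_of_mem ih)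
    exact A.isData.hForm_eq_zero (by omega) (h1 k) (ha' m).1
  have horth : ∀ n m, n ≠ m → D.hForm ((D.N ^ k) (a n)) (a m) = 0 := fun n m hnm => by
    rcases lt_or_gt_of_ne hnm with h | h
    · exact hlt n m h
    · rw [D.hForm_N_pow, ← D.hForm_conj_symm, hlt m n h, map_zero, mul_zero]
  have hterm : ∀ n ∈ S, ∃ r : ℝ, 0 ≤ r ∧ (a n ∉ W (k - 1) → 0 < r) ∧
      I ^ (-(k : ℤ)) * (-1) ^ n * D.hForm ((D.N ^ k) (a n)) (a n) = r := fun n hn => by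
    by_cases h : a n ∈ W (k - 1)
    · refine ⟨0, le_rfl, fun h1 => absurd h h1, ?_⟩
      rw [hcong (p := a n) (p' := 0) (q' := a n) (zero_mem _) (by simpa using h) (ha n).2 (by simp)]
      simp
    · obtain ⟨r, hr, h1⟩ := A.isData.hForm_pos k (p := w - 1 - n) (ha n).2 h (haN n hn) (ha n)
        (y := a' n) (by
          rw [show (k : ℤ) + w - 1 - (w - 1 - n) = k + n by ring]
          exact ha' n) (by simp) (haa n)
      rw [sub_sub_cancel] at h1; exact ⟨r, hr.le, fun _ => hr, h1⟩
  choose! r hr using hterm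
  obtain ⟨z, rfl⟩ := ne_infty_iff_exists.1 hx.1
  have hz := mem_Cstar_coe.1 hx
  have hz' : (-Cj z)⁻¹ ≠ 0 := inv_ne_zero (by simpa using hz)
  refine ⟨∑ n ∈ S, r n, Finset.sum_pos' (fun n hn => (hr n hn).1) ?_, ?_⟩
  · by_contra h
    push Not at h
    obtain ⟨z, hz⟩ := hne
    apply hz
    refine (A.mem_iff₀ _ z _).2 fun j hj => ?_
    have h1 := (A.mem_iff₀ _ z _).1 (o z).2 j hj
    by_contra h2
    have h3 : a (A.n j) ∈ W (k - 1) := by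
      by_contra h3
      exact absurd ((hr _ (hnS j)).2.1 h3) (not_lt.2 (h _ (hnS j)))
    refine h2 ((A.mem_iff₀ _ 𝟘 _).1 h3 j (zBasis_repr_ne_zero.2 ?_))
    rwa [hrepr, if_pos rfl, ← hc' z j (by omega)]
  · rw [sig_coe hz, hcong (sum_mem fun n _ => (W k).smul_mem _ (ha n).2) (ho z hz)
      (o _).2 (ho _ hz'), map_sum (D.N ^ k), map_sum D.hForm, LinearMap.sum_apply, Finset.mul_sum, Complex.ofReal_sum]
    refine sum_congr rfl fun n hn => ?_
    rw [map_sum, sum_eq_single n]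
    · rw [← (hr n hn).2.2, LinearMap.map_smul, LinearMap.map_smul, LinearMap.smul_apply,
        LinearMap.map_smulₛₗ, smul_eq_mul, smul_eq_mul, map_zpow₀, map_inv₀, map_neg,
        conj_conj, ← mul_assoc (z ^ n), ← mul_zpow, inv_neg, mul_neg, mul_inv_cancel₀ hz,
        mul_assoc]
    · intro m _ hm
      simp [LinearMap.map_smulₛₗ, horth n m hm.symm]
    · exact fun h => absurd hn h

end AdaptedFrame

/-! ### The twistor of a tuple is a polarized mixed twistor structure -/

namespace HodgeTuple

variable {w : ℤ} (D : HodgeTuple.{u} w)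

lemma hForm_conj_expB (a b : D.V) : D.hForm (D.conj a) (expB D.M (-1 / 2) (D.conj b)) =
    (-1) ^ w * Cj (D.hForm a (expB D.M (-1 / 2) b)) := by
  refine strip_ind D.M_bij (by simp +contextual [mul_add]) (fun α hα a ha => ?_) a
  refine strip_ind D.M_bij (by simp +contextual [mul_add]) (fun β hβ b hb => ?_) b
  have h1 := conj_expB D.M_bij D.conj_conj D.M_real (-1 / 2) hβ hb
  have h3 : Cj (-1 / 2 : ℂ) = -1 / 2 := by rw [map_div₀, map_neg, map_one, map_ofNat]
  have h2 : exp (-(ϖ * stripN β * Cj (-1 / 2))) = (-1) ^ stripN β := by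
    have h4 := Complex.exp_int_mul (Real.pi * I) (stripN β)
    rw [Complex.exp_pi_mul_I] at h4
    rw [h3, ← h4]
    congr 1; ring
  have h4 := D.hForm_conj_conj hα ha (expB D.M (-1 / 2) b)
  rw [h1, h2, h3, LinearMap.map_smulₛₗ, neg_one_zpow_conj, smul_eq_mul] at h4
  by_cases h : β = Cj α
  · rw [h, stripN_conj, zpow_add₀ (by norm_num), mul_comm ((-1 : ℂ) ^ w), mul_assoc] at h4
    exact mul_left_cancel₀ (zpow_ne_zero _ (by norm_num)) h4
  · have h5 : D.hForm a (expB D.M (-1 / 2) b) = 0 :=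
      D.hForm_eq_zero hα hβ h ha (fc_mem_genEig D.M_bij _ hβ hb)
    rw [h5, map_zero, mul_zero] at h4 ⊢
    exact (mul_eq_zero.1 h4).resolve_left (zpow_ne_zero _ (by norm_num))

end HodgeTuple

lemma IsMonodromyFiltration.comap_equiv {V V' : Type u} [AddCommGroup V] [Module ℂ V]
    [AddCommGroup V'] [Module ℂ V'] [FiniteDimensional ℂ V] [FiniteDimensional ℂ V']
    {M : End ℂ V} {M' : End ℂ V'} {φ : V ≃ₗ[ℂ] V'} (hφ : ∀ a, φ (M a) = M' (φ a))
    (hM : Bijective M) (hM' : Bijective M') {F : Fil(V')}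
    (hF : IsMonodromyFiltration M' F) :
    IsMonodromyFiltration M fun p => (F p).comap φ.toLinearMap := by
  refine ⟨⟨fun p q h => Submodule.comap_mono (hF.1.1 h), ?_, ?_⟩, ?_, ?_⟩
  · obtain ⟨p, hp⟩ := hF.1.2.1
    refine ⟨p, ?_⟩
    simp only [hp, Submodule.comap_top]
  · obtain ⟨p, hp⟩ := hF.1.2.2
    refine ⟨p, ?_⟩
    simp only [hp]; exact LinearEquiv.ker φ
  · rintro p _ ⟨a, ha, rfl⟩
    refine Submodule.mem_comap.2 ?_
    rw [coe_coe, equiv_semisimplePart hφ hM hM']; exact hF.2.1 p (mem_map_of_mem ha)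
  · rintro p _ ⟨a, ha, rfl⟩
    refine Submodule.mem_comap.2 ?_
    rw [coe_coe, equiv_nPart hφ hM hM']; exact hF.2.2 p (mem_map_of_mem ha)

section Model

variable {w : ℤ} {D : HodgeTuple.{u} w} {W : Fil(D.V)} {T : Twistor.{u}}
  {τ : ∀ x, T.E.Fib x ≃ₗ[ℂ] D.V}

lemma IsModel.isInduced (h : IsModel D W T τ) : T.IsInduced := by
  obtain ⟨φ, hτ, hφ, -⟩ := h.exists_equiv
  have : FiniteDimensional ℂ T.Hinf := Module.Finite.equiv φ
  have hM := mono_bijective_of_equiv hφ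
  have hN : ∀ a, φ (D.N a) = T.N (φ a) := equiv_nPart hφ D.M_bij hM
  refine ⟨⟨_, h.weight.comap_equiv φ.symm fun a => ?_, fun k ζ => ?_⟩, fun ζ A => ?_⟩
  · rw [LinearEquiv.symm_apply_eq, hN, φ.apply_symm_apply]
  · ext v
    rw [h.What k _ (expP_mem ζ)]
    constructor
    · intro hv
      refine ⟨φ (expB D.M ζ (τ _ v)), Submodule.mem_comap.2 ?_, (τ (expP ζ)).injective ?_⟩
      · rw [coe_coe, φ.symm_apply_apply]; exact (D.expB_mem_weight h.weight k ζ).2 hv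
      · rw [hτ, expB_neg_apply D.M_bij]
    · rintro ⟨A, hA, rfl⟩
      rw [← φ.apply_symm_apply A, hτ]; exact (D.expB_mem_weight h.weight k _).2 hA
  · apply (τ (expP ζ)).injective
    rw [← φ.apply_symm_apply A, h.Nhat _ (expP_mem ζ), hτ, ← hN, hτ]
    exact (congrArg (fun f : End ℂ D.V => f (φ.symm A))
      (fc_commute_nPart D.M_bij _).eq).symm

lemma Corresponds.isGenByElementary (h : Corresponds D T) : T.IsGenByElementary w := by
  obtain ⟨φ, -, hφ, hg, -⟩ := h
  have : FiniteDimensional ℂ T.Hinf := Module.Finite.equiv φ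
  refine ⟨_, D.F_fil.comap_equiv (φ := φ.symm) (fun a => ?_) (mono_bijective_of_equiv hφ) D.M_bij, hg⟩
  rw [LinearEquiv.symm_apply_eq, hφ, φ.apply_symm_apply]

end Model

namespace AdaptedFrame

variable {w : ℤ} {D : HodgeTuple.{u} w} {W : Fil(D.V)} (A : AdaptedFrame D W)

lemma isReal : A.twistor.IsReal w := fun x hx a b ha hb => by
  obtain ⟨ζ, rfl⟩ := exists_expP hx
  have h1 : ∀ (ξ : ℂ) (v : D.V), D.conjAt (expP ξ) v = v →
      v = expB D.M (-ξ) (expB D.M ξ v) ∧ D.conj (expB D.M ξ v) = expB D.M ξ v := fun ξ v hv => by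
    have h2 := (expB_neg_apply D.M_bij ξ v).symm
    refine ⟨h2, ?_⟩
    have h3 := D.conjAt_expP ξ (expB D.M ξ v)
    rw [← h2, hv] at h3
    conv_rhs => rw [h3, expB_apply_neg D.M_bij]
  have hb' : D.conjAt (expP (Cj ζ + 1 / 2)) b = b := sig_expP ζ ▸ hb
  obtain ⟨ha1, ha2⟩ := h1 ζ a ha
  obtain ⟨hb1, hb2⟩ := h1 _ b hb'
  have hS : A.twistor.Shat (expP ζ) a b = D.hForm a b :=
    congrArg (fun f : D.V →ₗ[ℂ] D.V →ₛₗ[Cj] ℂ => f a b) (A.Shat_of_mem hx)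
  rw [hS, ha1, hb1, D.hForm_expB_expB]
  have h3 := D.hForm_conj_expB (expB D.M ζ a) (expB D.M (Cj ζ + 1 / 2) b)
  rw [ha2, hb2] at h3
  generalize D.hForm _ _ = q at h3 ⊢
  have hI : Cj (I ^ (-w)) = (-1) ^ w * I ^ (-w) := by
    rw [map_zpow₀, conj_I, ← neg_one_mul, mul_zpow, neg_one_zpow_neg]
  obtain ⟨r, hr⟩ := Complex.conj_eq_iff_real.1 (show Cj (I ^ (-w) * q) = _ by
    rw [map_mul, hI]
    conv_rhs => rw [h3]
    ring)
  exact ⟨r, by rw [← hr, ← mul_assoc, ← zpow_add₀ Complex.I_ne_zero, add_neg_cancel, zpow_zero,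
    one_mul]⟩

lemma isMixedTwistor : A.twistor.IsMixedTwistor := by
  have hW := A.isData.weight
  refine ⟨⟨fun _ _ h _ => hW.mono h, ?_, ?_, A.isSubbundle, A.isPure⟩, ?_, ?_, ?_,
    fun k _ _ => hW.map_le k⟩
  · obtain ⟨l, hl⟩ := hW.exists_bot
    exact ⟨l, fun _ => hl⟩
  · obtain ⟨l, hl⟩ := hW.exists_top
    exact ⟨l, fun _ => hl⟩
  · intro s x hx hs
    obtain ⟨z, rfl⟩ := ne_infty_iff_exists.1 hx.1
    have hz := mem_Cstar_coe.1 hx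
    exact (twoFrame_holAt hz).2 fun ℓ => (twoFrame_holAt hz).1 hs (ℓ.comp D.N)
  · intro s hs
    refine A.extHolAt_zero.2 (((A.extHolAt_zero.1 (HolFam.HolAt.ext hs)).map
      (Ψ := fun n => D.F (w - 1 - n)) D.N 1 fun n x hx => ?_).congr
      (.of_forall fun u => ?_))
    · rw [show w - 1 - (n + 1) = w - 1 - n - 1 by ring]; exact D.F_fil.2.2 _ (mem_map_of_mem hx)
    · rw [zpow_one]; rfl
  · intro s hs
    refine A.extHolAt_infty.2 (((A.extHolAt_infty.1 (HolFam.HolAt.ext hs)).map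
      (Ψ := fun n => D.Fb (-n)) D.N 1 fun n x hx => ?_).congr
      (.of_forall fun u => ?_))
    · rw [show -(n + 1) = -n - 1 by ring]; exact D.Fb_fil.2.2 _ (mem_map_of_mem hx)
    · rw [zpow_one, zc_atInf, inv_inv]; rfl

lemma Shat_weight {k l : ℤ} (hkl : k + l < 0) x {a b : D.V} (ha : a ∈ W k) (hb : b ∈ W l) :
    A.Shat x a b = 0 := by
  have h0 : ∀ {k l : ℤ}, k + l < 0 → ∀ {a b : D.V}, a ∈ W k → b ∈ W l →
      A.Shat 𝟘 a b = 0 := by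
    intro k l hkl a b ha hb
    rw [Shat_zero, sesq_apply]
    refine sum_eq_zero fun i _ => sum_eq_zero fun j _ => ?_
    by_contra h
    rw [← Ne, mul_ne_zero_iff, mul_ne_zero_iff, gram, mul_ne_zero_iff] at h
    have h1 := (A.mem_iff₀ k 𝟘 a).1 ha i (zBasis_repr_ne_zero.2 h.1.1)
    have h2 := (A.mem_iff₁ l 𝟘 b).1 hb j
      (zBasis_repr_ne_zero.2 fun h2 => h.1.2 (by rw [h2, map_zero]))
    exact h.2.2 (D.hForm_weight A.isData.weight (by omega) (A.mem₀ i).2 (A.mem₁ j).2)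
  rcases cases_P1 x with rfl | rfl | hx
  · exact h0 hkl ha hb
  · rw [A.Shat_symm, sig_infty, h0 (by omega) hb ha, map_zero]
  · rw [A.Shat_of_mem hx, D.hForm_weight A.isData.weight hkl ha hb]

lemma isPMTS : A.twistor.IsPMTS w where
  real := A.isReal
  induced := A.isModel.isInduced
  mixed := A.isMixedTwistor
  polarized := by
    refine ⟨fun k l hkl x a ha b hb => A.Shat_weight hkl x ha hb, fun x hx a b => ?_,
      fun k a ha hne x hx => ?_⟩
    · have h1 : ∀ a b : D.V, A.Shat x (D.N a) b + A.Shat x a (D.N b) = 0 := fun a b => by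
        rw [A.Shat_of_mem hx, D.hForm_N, neg_add_cancel]
      exact h1 a b
    · obtain ⟨r, hr, h1⟩ := A.pos k a ha.1 ha.2.1 (by
        simp only [zpow_natCast]
        exact ha.2.2) (by
        obtain ⟨z, hz⟩ := hne
        exact ⟨z, fun h => hz ((Submodule.Quotient.mk_eq_zero _).2 h)⟩) hx
      rw [← A.Shat_of_mem hx] at h1; exact ⟨r, hr, h1⟩
  elementary := A.isModel.corresponds.isGenByElementary

end AdaptedFrame

/-- Every tuple inducing polarized mixed Hodge structures has a twistor. -/
lemma HodgeTuple.InducesPMHS.exists_twistor {w : ℤ} {D : HodgeTuple.{u} w}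
    (hD : D.InducesPMHS) : ∃ T : Twistor.{u}, T.IsPMTS w ∧ Corresponds D T := by
  obtain ⟨W, hW⟩ := (HodgeTuple.inducesPMHS_iff D).1 hD
  obtain ⟨A⟩ := AdaptedFrame.nonempty hW
  exact ⟨A.twistor, A.isPMTS, A.isModel.corresponds⟩

/-! ### Uniqueness of the twistor and of the tuple -/

namespace HolFam

variable {E E' : HolFam.{u}} {r r' : ℕ}

lemma IsFrameOn.exists_section (hE : E.IsBundle r') {U : Set P1}
    {e : ∀ y, Basis (Fin r) ℂ (E.Fib y)} (he : E.IsFrameOn U e) {x : P1} (hx : x ∈ U)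
    (v : E.Fib x) : ∃ s, E.HolAt s x ∧ s x = v ∧ ∀ y, s y = ∑ j, (e x).repr v j • e y j := by
  refine ⟨_, hE.holAt_sum fun j _ => hE.holAt_smul_fun (holFun_const _ _) ?_, (e x).sum_repr v,
    fun _ => rfl⟩
  refine (he _ x hx).2 fun i => ?_
  simpa [Finsupp.single_apply] using holFun_const _ x

lemma IsBundle.exists_section (hE : E.IsBundle r) {x : P1} (v : E.Fib x) :
    ∃ s, E.HolAt s x ∧ s x = v := by
  obtain ⟨U, -, hx, e, he⟩ := hE x
  obtain ⟨s, h1, h2, -⟩ := he.exists_section hE hx v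
  exact ⟨s, h1, h2⟩

/-- A family of linear maps on a punctured neighbourhood of `x` which maps holomorphic sections to
sections with a holomorphic extension has a limit at `x`. -/
lemma exists_limit_hom (hE : E.IsBundle r) (hE' : E'.IsBundle r')
    (g : ∀ y, E.Fib y →ₗ[ℂ] E'.Fib y) {x : P1}
    (hg : ∀ s, E.HolAt s x → E'.ExtHolAt (fun y => g y (s y)) x) :
    ∃ G : E.Fib x →ₗ[ℂ] E'.Fib x, ∀ s t, E.HolAt s x → E'.HolAt t x →
      (∀ᶠ y in 𝓝[≠] x, t y = g y (s y)) → t x = G (s x) := by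
  obtain ⟨U, -, hx, e, he⟩ := hE x
  have h1 : ∀ j, E.HolAt (fun y => e y j) x := fun j => (he _ x hx).2 fun i => by
    simpa [Finsupp.single_apply] using holFun_const _ x
  choose t ht hts using fun j => hg _ (h1 j)
  refine ⟨(e x).constr ℂ fun j => t j x, fun s t' hs ht' h => ?_⟩
  rw [Basis.constr_apply_fintype]
  refine hE'.holAt_eq (t := fun y => ∑ j, (e y).equivFun (s y) j • t j y) ht'
    (hE'.holAt_sum fun j _ => hE'.holAt_smul_fun ((he _ x hx).1 hs j) (ht j)) ?_
  filter_upwards [h, eventually_all.2 hts] with y hy hy'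
  rw [hy]
  conv_lhs => rw [← (e y).sum_equivFun (s y), map_sum]
  exact sum_congr rfl fun j _ => by rw [hy', LinearMap.map_smul]

lemma exists_limit_equiv (hE : E.IsBundle r) (hE' : E'.IsBundle r')
    (g : ∀ y, E.Fib y ≃ₗ[ℂ] E'.Fib y) {x : P1}
    (hg : ∀ s, E.HolAt s x → E'.ExtHolAt (fun y => g y (s y)) x)
    (hg' : ∀ s, E'.HolAt s x → E.ExtHolAt (fun y => (g y).symm (s y)) x) :
    ∃ G : E.Fib x ≃ₗ[ℂ] E'.Fib x, ∀ s t, E.HolAt s x → E'.HolAt t x →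
      (∀ᶠ y in 𝓝[≠] x, t y = g y (s y)) → t x = G (s x) := by
  obtain ⟨G, hG⟩ := exists_limit_hom hE hE' (fun y => (g y).toLinearMap) hg
  obtain ⟨G', hG'⟩ := exists_limit_hom hE' hE (fun y => (g y).symm.toLinearMap) hg'
  refine ⟨LinearEquiv.ofLinearMap G G' (LinearMap.ext fun v => ?_) (LinearMap.ext fun v => ?_), hG⟩
  · obtain ⟨s, hs, rfl⟩ := hE'.exists_section v
    obtain ⟨t, ht, hts⟩ := hg' s hs
    rw [LinearMap.comp_apply, ← hG' s t hs ht hts]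
    exact (hG t s ht hs (hts.mono fun y hy => by simp [hy])).symm
  · obtain ⟨s, hs, rfl⟩ := hE.exists_section v
    obtain ⟨t, ht, hts⟩ := hg s hs
    rw [LinearMap.comp_apply, ← hG s t hs ht hts]
    exact (hG' t s ht hs (hts.mono fun y hy => by simp [hy])).symm

/-- A section with values in a subbundle outside of `x` has its value at `x` in the subbundle, and
all elements of the subbundle are values of such sections. -/
lemma IsSubbundle.mem_iff (hE : E.IsBundle r) {W : ∀ x, Submodule ℂ (E.Fib x)}
    (hW : E.IsSubbundle W) {x : P1} {v : E.Fib x} :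
    v ∈ W x ↔ ∃ s, E.HolAt s x ∧ s x = v ∧ ∀ᶠ y in 𝓝[≠] x, s y ∈ W y := by
  constructor
  · intro hv
    obtain ⟨U, hU, hx, r, e, J, he, hJ⟩ := hW x
    obtain ⟨s, hs, h1, h2⟩ := he.exists_section hE hx v
    refine ⟨s, hs, h1, ?_⟩
    filter_upwards [nhdsWithin_le_nhds (hU.mem_nhds hx)] with y hy
    rw [hJ x hx, Basis.mem_span_image] at hv
    rw [hJ y hy, h2]
    refine sum_mem fun j _ => ?_
    by_cases hj : (e x).repr v j = 0
    · simp [hj]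
    · exact smul_mem _ _ (Submodule.subset_span ⟨j, hv (Finsupp.mem_support_iff.2 hj), rfl⟩)
  · rintro ⟨s, hs, rfl, h⟩
    obtain ⟨t, -, ht⟩ := hW.exists_section hE hs h
    rw [← ht.self_of_nhds]; exact (t x).2

end HolFam

section Uniqueness

variable {w : ℤ} {D D' : HodgeTuple.{u} w} {W W' : Fil(D.V)} {T T' : Twistor.{u}}
  {τ : ∀ x, T.E.Fib x ≃ₗ[ℂ] D.V} {τ' : ∀ x, T'.E.Fib x ≃ₗ[ℂ] D.V}

lemma IsModel.extHolAt (h : IsModel D W T τ) (h' : IsModel D W' T' τ') {s : ∀ x, T.E.Fib x}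
    {x : P1} (hs : T.E.HolAt s x) : T'.E.ExtHolAt (fun y => (τ' y).symm (τ y (s y))) x := by
  rcases cases_P1 x with rfl | rfl | hx
  · refine (h'.ext_zero _).2 ?_
    simp only [apply_symm_apply]; exact (h.ext_zero s).1 (HolFam.HolAt.ext hs)
  · refine (h'.ext_infty _).2 ?_
    simp only [apply_symm_apply]; exact (h.ext_infty s).1 (HolFam.HolAt.ext hs)
  · obtain ⟨z, rfl⟩ := ne_infty_iff_exists.1 hx.1
    have hz := mem_Cstar_coe.1 hx
    refine HolFam.HolAt.ext ((h'.triv.hol _ z hz).2 ?_)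
    simp only [apply_symm_apply]; exact (h.triv.hol s z hz).1 hs

/-- Twistor structures with models on the same space are isomorphic: the isomorphism of the models
extends to `0` and `∞`. -/
lemma IsModel.nonempty_iso (h : IsModel D W T τ) (h' : IsModel D W' T' τ') (hT : T.IsPMTS w)
    (hT' : T'.IsPMTS w) : Nonempty (Twistor.Iso T T') := by
  obtain rfl : W = W' := h.weight.unique h'.weight
  let g : ∀ y, T.E.Fib y ≃ₗ[ℂ] T'.E.Fib y := fun y => (τ y).trans (τ' y).symm
  have hg : ∀ x s, T.E.HolAt s x → T'.E.ExtHolAt (fun y => g y (s y)) x := fun _ _ => h.extHolAt h'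
  have hg' : ∀ x s, T'.E.HolAt s x → T.E.ExtHolAt (fun y => (g y).symm (s y)) x :=
    fun _ _ => h'.extHolAt h
  choose e he using fun x => HolFam.exists_limit_equiv T.bundle T'.bundle g (hg x) (hg' x)
  have heg : ∀ x ∈ Cstar, ∀ v, τ' x (e x v) = τ x v := fun x hx v => by
    obtain ⟨s, hs, rfl⟩ := T.bundle.exists_section v
    obtain ⟨z, rfl⟩ := ne_infty_iff_exists.1 hx.1
    have h1 : T'.E.HolAt (fun y => g y (s y)) z := by
      refine (h'.triv.hol _ z (mem_Cstar_coe.1 hx)).2 ?_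
      simpa only [g, trans_apply, apply_symm_apply] using (h.triv.hol s z (mem_Cstar_coe.1 hx)).1 hs
    rw [← he _ s _ hs h1 (.of_forall fun _ => rfl)]; exact (τ' z).apply_symm_apply _
  have heg' : ∀ x ∈ Cstar, ∀ v, e x v = g x v := fun x hx v =>
    (τ' x).injective ((heg x hx v).trans ((τ' x).apply_symm_apply _).symm)
  have hol : ∀ s x, T.E.HolAt s x → T'.E.HolAt (fun y => e y (s y)) x := fun s x hs => by
    obtain ⟨t, ht, hts⟩ := hg x s hs
    refine T'.bundle.holAt_congr ht ?_
    rw [← nhdsNE_sup_pure, eventually_sup]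
    refine ⟨?_, he x s t hs ht hts⟩
    filter_upwards [hts, eventually_mem_Cstar x] with y hy hyC
    rw [hy, heg' y hyC]
  have hol' : ∀ s x, T'.E.HolAt (fun y => e y (s y)) x → T.E.HolAt s x := fun s x hs => by
    obtain ⟨t, ht, hts⟩ := hg' x _ hs
    have h1 : ∀ᶠ y in 𝓝[≠] x, t y = s y := by
      filter_upwards [hts, eventually_mem_Cstar x] with y hy hyC
      rw [hy, heg' y hyC, symm_apply_apply]
    refine T.bundle.holAt_congr ht ?_
    rw [← nhdsNE_sup_pure, eventually_sup]
    refine ⟨h1, (e x).injective (he x t _ ht hs ?_).symm⟩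
    filter_upwards [h1, eventually_mem_Cstar x] with y hy hyC
    rw [hy, heg' y hyC]
  refine ⟨⟨e, fun s x => ⟨hol' s x, hol s x⟩, fun s x hx hs => ?_, fun x hx v => ?_, fun k x v => ?_,
    fun x hx v => ?_, fun x a b => ?_⟩⟩
  · obtain ⟨z, rfl⟩ := ne_infty_iff_exists.1 hx.1
    have hz := mem_Cstar_coe.1 hx
    apply (τ' z).injective
    refine sub_eq_zero.1 ((forall_dual_apply_eq_zero_iff ℂ _).1 fun ℓ => ?_)
    rw [heg _ hx, map_sub, h'.triv.nabla _ z hz (hol s _ hs), h.triv.nabla s z hz hs, heg _ hx,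
      EventuallyEq.deriv_eq (f := fun u : ℂ => ℓ (τ u (s u))), sub_self]
    filter_upwards [compl_singleton_mem_nhds hz] with u hu
    rw [heg _ (mem_Cstar_coe.2 hu)]
  · obtain ⟨ζ, rfl⟩ := exists_expP hx
    apply (τ' (expP ζ)).injective
    have h1 : ∀ v, v = (τ (expP ζ)).symm (expB D.M (-ζ) (expB D.M ζ (τ (expP ζ) v))) := fun v => by
      rw [expB_neg_apply D.M_bij, symm_apply_apply]
    have h2 : e (expP ζ) v = (τ' (expP ζ)).symm (expB D.M (-ζ) (expB D.M ζ (τ (expP ζ) v))) := by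
      rw [expB_neg_apply D.M_bij, LinearEquiv.eq_symm_apply, heg _ hx]
    rw [heg _ hx, h2, h'.conj]
    conv_lhs => rw [h1 v, h.conj]
  · have key : ∀ (k : ℤ) (s : ∀ x, T.E.Fib x) x,
        (∀ᶠ y in 𝓝[≠] x, e y (s y) ∈ T'.What k y) ↔ ∀ᶠ y in 𝓝[≠] x, s y ∈ T.What k y := fun k s x => by
      refine eventually_congr ?_
      filter_upwards [eventually_mem_Cstar x] with y hy
      rw [h'.What k y hy, heg y hy, h.What k y hy]
    rw [(hT'.mixed.mixed.subbundle k).mem_iff T'.bundle, (hT.mixed.mixed.subbundle k).mem_iff T.bundle]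
    constructor
    · rintro ⟨s, hs, h1, h2⟩
      refine ⟨fun y => (e y).symm (s y), hol' _ _ (by simpa using hs), ?_, (key k _ x).1 (by simpa)⟩
      simp only [h1, symm_apply_apply]
    · rintro ⟨s, hs, rfl, h2⟩; exact ⟨_, hol s x hs, rfl, (key k s x).2 h2⟩
  · apply (τ' x).injective; simp [heg x hx, h'.Nhat x hx, h.Nhat x hx]
  · obtain ⟨s, hs, rfl⟩ := T.bundle.exists_section a
    obtain ⟨t, ht, rfl⟩ := T.bundle.exists_section b
    refine (T'.Shat_hol _ _ x (hol s x hs) (hol t _ ht)).eq_of_eventually (T.Shat_hol s t x hs ht) ?_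
    filter_upwards [eventually_mem_Cstar x] with y hy
    have hy' := Twistor.sig_mem_Cstar hy
    rw [h'.Shat y hy, h.Shat y hy, heg y hy, heg _ hy']

lemma IsModel.of_iso (h : IsModel D W T τ) (f : Twistor.Iso T T') :
    IsModel D W T' fun x => (f.e x).symm.trans (τ x) := by
  have hext : ∀ s x, T'.E.ExtHolAt s x ↔ T.E.ExtHolAt (fun y => (f.e y).symm (s y)) x := fun s x => by
    constructor
    · rintro ⟨t, ht, h1⟩
      exact ⟨_, (f.symm.hol t x).2 ht, h1.mono fun y hy => congrArg (f.e y).symm hy⟩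
    · rintro ⟨t, ht, h1⟩
      exact ⟨_, (f.hol t x).2 ht, h1.mono fun y hy => by rw [hy, apply_symm_apply]⟩
  refine ⟨h.weight, ⟨fun s z hz => ?_, fun s z hz hs ℓ => ?_⟩, fun s => ?_, fun s => ?_, fun ζ v => ?_,
    fun k x hx v => ?_, fun x hx v => ?_, fun x hx a b => ?_⟩
  · exact (f.symm.hol s z).symm.trans (h.triv.hol _ z hz)
  · have h1 := h.triv.nabla _ z hz ((f.symm.hol s z).2 hs) ℓ
    rwa [f.symm.nabla s z (mem_Cstar_coe.2 hz) hs] at h1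
  · exact (hext s _).trans (h.ext_zero _)
  · exact (hext s _).trans (h.ext_infty _)
  · have h1 := f.symm.conj _ (expP_mem ζ) (f.e _ ((τ (expP ζ)).symm (expB D.M (-ζ) v)))
    refine (congrArg (τ (expP ζ)) h1).trans ((congrArg (fun u => τ (expP ζ) (T.conj (expP ζ) u))
      ((f.e (expP ζ)).symm_apply_apply _)).trans (h.conj ζ v))
  · exact (f.symm.What k x v).symm.trans (h.What k x hx _)
  · exact (congrArg (τ x) (f.symm.Nhat x hx v)).trans (h.Nhat x hx _)
  · exact (f.symm.Shat x a b).symm.trans (h.Shat x hx _ _)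

lemma Corresponds.of_twistorIso (h : Corresponds D T) (hT : T.IsPMTS w) (f : Twistor.Iso T T') :
    Corresponds D T' := by
  obtain ⟨W, τ, h1⟩ := h.exists_isModel hT
  exact (h1.of_iso f).corresponds

lemma Corresponds.of_tupleIso (h : Corresponds D T) (f : HodgeTuple.Iso D' D) :
    Corresponds D' T := by
  obtain ⟨φ, hc, hφ, hg, htop⟩ := h
  refine ⟨f.e.trans φ, fun a => ?_, fun a => ?_, ?_, ?_⟩
  · rw [trans_apply, f.conj, hc]; rfl
  · rw [trans_apply, f.M, hφ]; rfl
  · have h1 : ∀ p, (D'.F p).comap (f.e.trans φ).symm.toLinearMap =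
        (D.F p).comap φ.symm.toLinearMap := fun p => by
      ext v
      exact f.symm.F p _
    simp only [h1]; exact hg
  · have h1 : ∀ a b, D'.S ((f.e.trans φ).symm a) ((f.e.trans φ).symm b) =
        D.S (φ.symm a) (φ.symm b) := fun a b => f.symm.S _ _
    simp only [h1]; exact htop

lemma Lat.mem_of_single {V : Type u} [AddCommGroup V] [Module ℂ V] {Φ : Fil(V)}
    (hΦ : Monotone Φ) {n : ℤ} {A : V} (h : Lat Φ fun u => u ^ n • A) : A ∈ Φ n := by
  by_contra hA
  obtain ⟨ℓ, hℓ, hU⟩ := (Φ n).exists_le_ker_of_notMem hA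
  obtain ⟨f, hf, h1⟩ := h.functional (ℓ := ℓ) fun j hj B hB => hU (hΦ hj hB)
  have h2 : ∀ᶠ u in 𝓝[≠] (0 : ℂ), f u * u = ℓ A := by
    filter_upwards [h1, self_mem_nhdsWithin] with u hu (hu0 : u ≠ 0)
    rw [map_smul, smul_eq_mul, zpow_add_one₀ hu0, mul_left_comm] at hu
    exact (mul_left_cancel₀ (zpow_ne_zero n hu0) hu).symm
  have h3 : Tendsto (fun u => f u * u) (𝓝[≠] 0) (𝓝 (f 0 * 0)) :=
    (hf.continuousAt.mul continuousAt_id).tendsto.mono_left nhdsWithin_le_nhds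
  rw [mul_zero] at h3
  exact hℓ (tendsto_nhds_unique (tendsto_const_nhds.congr' (h2.mono fun u hu => hu.symm)) h3)

/-- The tuple is determined by the twistor: `F` by the germs of the bundle at `0`, and `S` by the
pairing. -/
lemma Corresponds.nonempty_iso (h : Corresponds D T) (h' : Corresponds D' T) :
    Nonempty (HodgeTuple.Iso D D') := by
  obtain ⟨φ, hc, hφ, hg, htop⟩ := h
  obtain ⟨φ', hc', hφ', hg', htop'⟩ := h'
  let e : D.V ≃ₗ[ℂ] D'.V := φ.trans φ'.symm
  have hφe : ∀ a, φ' (e a) = φ a := fun a => φ'.apply_symm_apply _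
  have hM : ∀ a, e (D.M a) = D'.M (e a) := fun a => φ'.injective (by rw [hφe, hφ', hφe, hφ])
  have hconj : ∀ a, e (D.conj a) = D'.conj (e a) := fun a => φ'.injective (by
    rw [hφe, hc', hφe, hc])
  have hE : ∀ ζ a, e (expB D.M ζ a) = expB D'.M ζ (e a) := fun ζ a =>
    equiv_fc hM D.M_bij D'.M_bij _ a
  obtain ⟨τ, hτ⟩ := exists_triv hφ (Twistor.ev_bijective hg.1 hg.2)
  have hτ' : ∀ ζ A, ((τ (expP ζ)).trans e) (T.ev ζ (φ' A)) = expB D'.M (-ζ) A := fun ζ A => by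
    rw [← e.apply_symm_apply A, hφe, trans_apply, hτ, hE]
  have h1 := (generatedAt_zero_iff hφ hτ).1 hg.1
  have h2 := (generatedAt_zero_iff (τ := fun x => (τ x).trans e) hφ' hτ').1 hg'.1
  have hlat : ∀ (n : ℤ) A, (Lat (fun n => D.F (w - 1 - n)) fun u => u ^ n • A) ↔
      Lat (fun n => D'.F (w - 1 - n)) fun u => u ^ n • e A := fun n A => by
    have h3 := (h1 fun y => (τ y).symm (zc y ^ n • A)).symm.trans (h2 _)
    simpa [zc_coe] using h3
  have hmem : ∀ (D : HodgeTuple.{u} w) p a,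
      (Lat (fun n => D.F (w - 1 - n)) fun u => u ^ (w - 1 - p) • a) ↔ a ∈ D.F p := fun D p a => by
    conv_rhs => rw [← sub_sub_cancel (w - 1) p]
    exact ⟨Lat.mem_of_single (Φ := fun n => D.F (w - 1 - n)) fun m n h => D.F_fil.1.1 (by omega),
      fun h => Lat.gen_one (Φ := fun n => D.F (w - 1 - n)) h⟩
  refine ⟨⟨e, hconj, hM, fun p a => ?_, fun a b => ?_⟩⟩
  · rw [← hmem, ← hmem, hlat]
  · have h3 := (T.isTopPolarization_iff_pr hc hφ).1 htop 0 a
      (expB D.M (1 / 2) (D.conj (D.psiInv b)))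
    have h4 := (T.isTopPolarization_iff_pr hc' hφ').1 htop' 0 (e a)
      (e (expB D.M (1 / 2) (D.conj (D.psiInv b))))
    have h5 : ∀ x, e (D.psi x) = D'.psi (e x) := fun x => equiv_fc hM D.M_bij D'.M_bij _ x
    rw [hφe, hφe, h3, ← hE, neg_div, expB_neg_apply D.M_bij, HodgeTuple.hForm_apply,
      HodgeTuple.hForm_apply, ← hconj, D.conj_conj, ← h5, ← End.mul_apply,
      D.psi_mul_psiInv] at h4
    exact h4.symm

end Uniqueness

end PMTS

end

theorem mainTheorem5 (w : ℤ) :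
    (∃ e : Quotient (PMTS.pmhsSetoid.{u} w) ≃ Quotient (PMTS.pmtsSetoid.{u} w),
      ∀ (D : PMTS.PMHSTuple.{u} w) (T : PMTS.PMTSTwistor.{u} w),
        e (Quotient.mk (PMTS.pmhsSetoid w) D) = Quotient.mk (PMTS.pmtsSetoid w) T ↔
          PMTS.Corresponds D.1 T.1) ∧
    (∀ (D : PMTS.PMHSTuple.{u} w) (μ : ℂ), Module.End.HasEigenvalue D.1.M μ → ‖μ‖ = 1) ∧
    (∀ (T : PMTS.PMTSTwistor.{u} w) (μ : ℂ),
      Module.End.HasEigenvalue T.1.mono μ → ‖μ‖ = 1) := by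
  classical
  -- `PMTS.Corresponds` relates the isomorphism classes bijectively.
  have h1 : ∀ D : PMTS.PMHSTuple.{u} w, ∃ T : PMTS.PMTSTwistor.{u} w, PMTS.Corresponds D.1 T.1 :=
    fun D => by
      obtain ⟨T, hT, h⟩ := D.2.exists_twistor
      exact ⟨⟨T, hT⟩, h⟩
  have h2 : ∀ T : PMTS.PMTSTwistor.{u} w, ∃ D : PMTS.PMHSTuple.{u} w, PMTS.Corresponds D.1 T.1 :=
    fun T => by
      obtain ⟨D, h⟩ := PMTS.Twistor.exists_tuple T.2
      obtain ⟨W, τ, hm⟩ := h.exists_isModel T.2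
      exact ⟨⟨D, (PMTS.HodgeTuple.inducesPMHS_iff D).2 ⟨W, hm.isData T.2⟩⟩, h⟩
  have h3 : ∀ {D : PMTS.PMHSTuple.{u} w} {T T' : PMTS.PMTSTwistor.{u} w},
      PMTS.Corresponds D.1 T.1 → PMTS.Corresponds D.1 T'.1 →
      Nonempty (PMTS.Twistor.Iso T.1 T'.1) := fun {D T T'} h h' => by
    obtain ⟨W, τ, hm⟩ := h.exists_isModel T.2
    obtain ⟨W', τ', hm'⟩ := h'.exists_isModel T'.2
    exact hm.nonempty_iso hm' T.2 T'.2
  have hD : ∀ (D : PMTS.PMHSTuple.{u} w) (μ : ℂ),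
      Module.End.HasEigenvalue D.1.M μ → ‖μ‖ = 1 := fun D μ hμ => by
    obtain ⟨W, hW⟩ := (PMTS.HodgeTuple.inducesPMHS_iff D.1).1 D.2
    exact hW.norm_eq_one hμ
  choose t ht using h1
  refine ⟨?_, hD, fun T μ hμ => ?_⟩
  · let f : Quotient (PMTS.pmhsSetoid.{u} w) → Quotient (PMTS.pmtsSetoid.{u} w) :=
      Quotient.lift (fun D => Quotient.mk (PMTS.pmtsSetoid w) (t D)) fun D D' h => by
        obtain ⟨g⟩ : Nonempty (PMTS.HodgeTuple.Iso D.1 D'.1) := h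
        exact Quotient.sound (h3 ((ht D).of_tupleIso g.symm) (ht D'))
    have hf : ∀ (D : PMTS.PMHSTuple.{u} w) (T : PMTS.PMTSTwistor.{u} w),
        f (Quotient.mk (PMTS.pmhsSetoid w) D) = Quotient.mk (PMTS.pmtsSetoid w) T ↔
          PMTS.Corresponds D.1 T.1 := fun D T => by
      constructor
      · intro h
        obtain ⟨g⟩ : Nonempty (PMTS.Twistor.Iso (t D).1 T.1) := Quotient.exact h
        exact (ht D).of_twistorIso (t D).2 g
      · exact fun h => Quotient.sound (h3 (ht D) h)
    refine ⟨Equiv.ofBijective f ⟨?_, ?_⟩, hf⟩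
    · rintro ⟨D⟩ ⟨D'⟩ h; exact Quotient.sound (((hf D (t D')).1 h).nonempty_iso (ht D'))
    · rintro ⟨T⟩
      obtain ⟨D, h⟩ := h2 T
      exact ⟨Quotient.mk _ D, (hf D T).2 h⟩
  · obtain ⟨D, φ, -, hφ, -⟩ := h2 T
    obtain ⟨v, hv⟩ := hμ.exists_hasEigenvector
    refine hD D μ (Module.End.hasEigenvalue_of_hasEigenvector (x := φ.symm v)
      ⟨Module.End.mem_eigenspace_iff.2 (φ.injective ?_), by simpa using hv.2⟩)
    rw [hφ, φ.apply_symm_apply, hv.apply_eq_smul, map_smul, φ.apply_symm_apply]
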